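/- **Setting.** $\lambda$ is the security parameter. Algorithms act on bit strings; PPT means classical probabilistic polynomial time, and QPT adversaries are uniform quantum machines that, on input $1^\lambda$, make at most polynomially many (in $\lambda$) steps whatever their oracle answers. All oracles below are queried classically. A *private-key encryption scheme* $\mathsf{ENC}$ consists of PPT algorithms $\mathsf{keygen}$, $\mathsf{encrypt}$, $\mathsf{decrypt}$ ($\mathsf{decrypt}$ deterministic) with $\mathsf{decrypt}_k(\mathsf{encrypt}_k(m))=m$ for all $\lambda$, all keys $k$ output by $\mathsf{keygen}(1^\lambda)$ and all $m\in\{0,1\}^*$. It is *PQ-IND-CPA* if every QPT distinguisher with oracle access to $\mathsf{encrypt}_k(\cdot)$, which at one moment submits $m_0,m_1$ of equal length and receives $\mathsf{encrypt}_k(m_b)$ for a uniform bit $b$, outputs $b$ with probability at most $\tfrac12+\mathrm{negl}(\lambda)$. A *MAC* consists of PPT algorithms $\mathsf{keygen}$, $\mathsf{mac}$, $\mathsf{verify}$ with $\mathsf{verify}_k(m,\mathsf{mac}_k(m))=1$ always. It is *PQ-EU-CMA* if every QPT forger with oracle access to $\mathsf{mac}_k(\cdot)$ and $\mathsf{verify}_k(\cdot)$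 outputs, with at most negligible probability, a pair $(m,t)$ with $\mathsf{verify}_k(m,t)=1$ such that $m$ was not queried to $\mathsf{mac}_k$. An *interactive (memoryless) private quantum money scheme* $\$$ consists of a PPT algorithm $\mathsf{keygen}$ and two-party QPT protocols $\mathsf{mint}$ and $\mathsf{verify}$ between a user and a bank. In each run the bank starts from the key alone; the result of $\mathsf{mint}$ for the user is a banknote, with which it enters $\mathsf{verify}$; the bank ends $\mathsf{verify}$ with a bit saying whether the money is valid. The scheme is *correct* if an honestly minted banknote is accepted with probability at least $1-\mathrm{negl}(\lambda)$, and it has *classical minting and verification* if the bank is classical in both protocols. In the *counterfeiting game* a key $k\leftarrow\mathsf{keygen}(1^\lambda)$ is chosen and a counterfeiter, playing the user arbitrarily, runs $\mathsf{mint}_k$ and $\mathsf{verify}_k$ with the bank as often as it likes and interleaved as it likes, learning the outcomes. Let $\ell$ be the number of runs of $\mathsf{mint}$ and $w$ the number of successful runs of $\mathsf{verify}$. The scheme is (*fully*) *secure* if every QPT counterfeiter achieves $w>\ell$ with at most negligible probability; it is a *mini-scheme* if every QPT counterfeiter achieves $w>\ell$ and $\ell=1$ with at most negligible probability. A secure scheme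 with classical minting and verification is called *semi-quantum*. **Construction.** Given a scheme $\$$, a MAC and $\mathsf{ENC}$, let $\hat\$$ be the following scheme. - $\hat\$.\mathsf{keygen}(1^\lambda)$ outputs $(k_m,k_e)$ with $k_m\leftarrow \mathsf{MAC.keygen}(1^\lambda)$, $k_e\leftarrow\mathsf{ENC.keygen}(1^\lambda)$. - $\hat\$.\mathsf{mint}_{(k_m,k_e)}$: the bank computes $k_\$\leftarrow\$.\mathsf{keygen}(1^\lambda)$, $c\leftarrow\mathsf{ENC.encrypt}_{k_e}(k_\$)$, $t\leftarrow\mathsf{MAC.mac}_{k_m}(c)$; the parties run $\$.\mathsf{mint}_{k_\$}$, giving the user a banknote $|\$\rangle$; then the bank sends $(c,t)$. The new banknote is $(c,t,|\$\rangle)$. - $\hat\$.\mathsf{verify}_{(k_m,k_e)}(c,t,|\$\rangle)$: the user sends $(c,t)$. If $\mathsf{MAC.verify}_{k_m}(c,t)=0$, the bank outputs $0$. Otherwise it computes $k_\$=\mathsf{ENC.decrypt}_{k_e}(c)$, the parties run $\$.\mathsf{verify}_{k_\$}(|\$\rangle)$, and the bank outputs the result. **Theorem.** Let $\$$ be an interactive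 private quantum money mini-scheme, $\mathsf{MAC}$ a PQ-EU-CMA MAC and $\mathsf{ENC}$ a PQ-IND-CPA private-key encryption scheme. Then $\hat\$$ is a secure interactive private quantum money scheme, and it is correct if $\$$ is. Moreover, if $\$$ has classical minting and verification, so has $\hat\$$; that is, $\hat\$$ is then semi-quantum. -/

import Mathlib

open Filter
open scoped NNReal ENNReal

/-! ## Bit strings -/

/-- Classical data: finite bit strings. -/
abbrev Str := List Bool

/-- Self-delimiting pairing of bit strings: the bits of the first string are doubled, then comes
the delimiter `01`, then the second string. -/
def Str.pair : Str → Str → Str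
  | [], y => false :: true :: y
  | b :: x, y => b :: b :: Str.pair x y

/-- Decoding of `Str.pair` (malformed strings decode to something harmless). -/
def Str.unpair : Str → Str × Str
  | b :: c :: w => if b = c then (b :: (Str.unpair w).1, (Str.unpair w).2) else ([], w)
  | _ => ([], [])

def Str.fst (w : Str) : Str := (Str.unpair w).1

def Str.snd (w : Str) : Str := (Str.unpair w).2

theorem Str.unpair_pair (x y : Str) : Str.unpair (Str.pair x y) = (x, y) := by
  induction x with
  | nil => simp [Str.pair, Str.unpair]
  | cons b x ih => simp [Str.pair, Str.unpair, ih]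

/-- The unary string `1ⁿ`. -/
def Str.unary (n : ℕ) : Str := List.replicate n true

/-! ## Quantum memory -/

/-- Names of qubits. `msg a` are the cells of the quantum message register, which all parties of an
interaction can access; `priv o a` is the private cell with address `a` of party number `o`. -/
inductive Cell where
  | msg (a : Str)
  | priv (o : ℕ) (a : Str)
  deriving DecidableEq

/-- State vectors of the quantum memory. The basis vector `x : Finset Cell` has exactly the qubits
of `x` in state `1`. Vectors are not normalised: a nonzero vector stands for the pure state of its
ray (collapsed vectors are not rescaled). -/
abbrev QState := Finset Cell →₀ ℂ

noncomputable section

/-- All qubits are in state `0`. -/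
def QState.zero : QState := Finsupp.single ∅ 1

/-- The squared norm. -/
def QState.weight (ψ : QState) : ℝ≥0 := ψ.sum fun _ a => ‖a‖₊ ^ 2

/-- The linear extension of an action on basis vectors. -/
def QState.lift (f : Finset Cell → QState) (ψ : QState) : QState :=
  Finsupp.linearCombination ℂ f ψ

/-- The Hadamard gate on the qubit `c`. -/
def QState.hadamard (c : Cell) : QState → QState :=
  QState.lift fun x =>
    Finsupp.single (x.erase c) ((Real.sqrt 2 : ℂ)⁻¹) +
      Finsupp.single (insert c x) ((if c ∈ x then -1 else 1) * (Real.sqrt 2 : ℂ)⁻¹)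

/-- The gate `T = diag(1, exp(iπ/4))` on the qubit `c`. -/
def QState.tGate (c : Cell) : QState → QState :=
  QState.lift fun x =>
    Finsupp.single x (if c ∈ x then Complex.exp (Complex.I * (Real.pi : ℂ) / 4) else 1)

/-- The controlled-NOT gate with control `c` and target `d` (the identity if `c = d`). -/
def QState.cnot (c d : Cell) : QState → QState :=
  QState.lift fun x => Finsupp.single (if c ∈ x ∧ c ≠ d then symmDiff x {d} else x) 1

/-- The component of the state on which the qubit `c` has the value `b`. -/
def QState.project (c : Cell) (b : Bool) (ψ : QState) : QState :=
  ψ.filter fun x => decide (c ∈ x) = b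

/-- The probability (Born rule) that a measurement of the qubit `c` yields `1`. -/
def QState.prob (c : Cell) (ψ : QState) : ℝ≥0 :=
  (ψ.project c true).weight / ((ψ.project c true).weight + (ψ.project c false).weight)

theorem QState.prob_le_one (c : Cell) (ψ : QState) : ψ.prob c ≤ 1 :=
  div_le_one_of_le₀ (by simp) (by simp)

/-- Measurement of the qubit `c` in the computational basis: the outcome together with the
collapsed state. -/
def QState.measure (c : Cell) (ψ : QState) : PMF (Bool × QState) :=
  (PMF.ofFintype (fun b : Bool => ((if b then ψ.prob c else 1 - ψ.prob c : ℝ≥0) : ℝ≥0∞)) (by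
    rw [Fintype.sum_bool, ← ENNReal.coe_add]
    simp [add_tsub_cancel_of_le (ψ.prob_le_one c)])).map fun b => (b, ψ.project c b)

/-! ## Programs: a machine model with step count -/

/-- Programs of a quantum computer with classical control. A program computes a bit string from a
list of bit strings (its environment); on the way it can toss coins, act on its private qubits and
on the message register, and query an oracle. Every loop is bounded by the length of a string, so that
programs always halt (a machine with a polynomial running time is simulated by looping over a
polynomially long string); the running time is counted by `Prog.eval`.

* `arg i`: the `i`-th string of the environment; `lit w`: a constant;
* `append`, `tail`, `pair`, `fst`, `snd`, `eq`: string operations; `eq` yields `1` or `0`;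
* `ite p q r`: `q` if the value of `p` begins with `1`, otherwise `r`;
* `letIn p q`: `q` in the environment extended (at index `0`) by the value of `p`;
* `call f p`: the program `f` on the value of `p` as its only argument;
* `loop n a f`: start with the value of `a` and replace it `|n|` times by the value of `f` in the
  environment extended by the current value;
* `flip`: a uniform bit;
* `had`, `tGate`, `cnot`, `meas`: gates and measurement of the cells with the computed addresses,
  in the message register if the flag is `true` and in the private memory otherwise;
* `base p q`: `q` with all its private cells relocated below the address given by `p`;
* `oracle i p q`: query port `i` of the oracle with the value of `p` and read the first `|q|` bits
  of the reply;
* `simulate f h a`: `f`, whose oracle queries are answered by the program `h`. The program `h` keeps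
  a state, initially the value of `a`; it is run on (state, (port in unary, query)) and yields
  (new state, reply). Its own oracle queries go to the oracle. The result is (value of `f`, final
  state). -/
inductive Prog where
  | arg (i : ℕ)
  | lit (w : Str)
  | append (p q : Prog)
  | tail (p : Prog)
  | pair (p q : Prog)
  | fst (p : Prog)
  | snd (p : Prog)
  | eq (p q : Prog)
  | ite (p q r : Prog)
  | letIn (p q : Prog)
  | call (f p : Prog)
  | loop (n a f : Prog)
  | flip
  | had (shared : Bool) (p : Prog)
  | tGate (shared : Bool) (p : Prog)
  | cnot (shared₁ : Bool) (p : Prog) (shared₂ : Bool) (q : Prog)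
  | meas (shared : Bool) (p : Prog)
  | base (p q : Prog)
  | oracle (port : ℕ) (p q : Prog)
  | simulate (f h a : Prog)

/-- An oracle with internal state in `σ`: from port, query, its state and the state of the quantum
memory it produces a reply and new states. -/
abbrev Oracle (σ : Type) := ℕ → Str → σ → QState → PMF (Str × σ × QState)

/-- The oracle that always replies with the empty string; used for programs without oracle. -/
def noOracle : Oracle Unit := fun _ _ s ψ => PMF.pure ([], s, ψ)

/-- What a computation acts on: the state of the oracle, the quantum memory, and the number of
steps so far. -/
structure World (σ : Type) where
  ora : σ
  q : QState
  cost : ℕ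

/-- Randomised computations on the world. -/
abbrev Comp (σ : Type) := StateT (World σ) PMF

def Comp.tick {σ : Type} (n : ℕ) : Comp σ Unit := modify fun w => { w with cost := w.cost + n }

def Comp.gate {σ : Type} (g : QState → QState) : Comp σ Unit := modify fun w => { w with q := g w.q }

def Comp.iterate {σ : Type} (f : Str → Comp σ Str) : ℕ → Str → Comp σ Str
  | 0, v => pure v
  | n + 1, v => do
    let v' ← f v
    Comp.iterate f n v'

/-- The oracle, with state (state of the handler, (state of the outer oracle, steps of the
handler)), that answers queries by a handler. -/
def Oracle.ofHandler {σ : Type} (h : Str → Comp σ Str) : Oracle (Str × σ × ℕ) :=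
  fun port m s ψ => do
    let input := Str.pair s.1 (Str.pair (Str.unary port) m)
    let (v, w) ← (h input).run ⟨s.2.1, ψ, s.2.2 + 1 + input.length⟩
    return (v.snd, (v.fst, w.ora, w.cost + 1 + v.length), w.q)

/-- The cell with address `a`, in the message register or in private memory; `loc` places private
addresses. -/
def cellAt (loc : Str → Cell) (shared : Bool) (a : Str) : Cell :=
  if shared then Cell.msg a else loc a

/-- Execution of a program, with oracle `O`, private memory placed by `loc`, and environment `env`.
Each instruction costs one step plus the length of the strings that it reads. -/
def Prog.eval : Prog → {σ : Type} → Oracle σ → (Str → Cell) → List Str → Comp σ Str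
  | .arg i, _, _, _, env => do
    let v := env.getD i []
    Comp.tick (1 + v.length)
    return v
  | .lit w, _, _, _, _ => do
    Comp.tick (1 + w.length)
    return w
  | .append p q, _, O, loc, env => do
    let v ← p.eval O loc env
    let w ← q.eval O loc env
    Comp.tick (1 + v.length + w.length)
    return v ++ w
  | .tail p, _, O, loc, env => do
    let v ← p.eval O loc env
    Comp.tick (1 + v.length)
    return v.tail
  | .pair p q, _, O, loc, env => do
    let v ← p.eval O loc env
    let w ← q.eval O loc env
    Comp.tick (1 + v.length + w.length)
    return Str.pair v w
  | .fst p, _, O, loc, env => do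
    let v ← p.eval O loc env
    Comp.tick (1 + v.length)
    return v.fst
  | .snd p, _, O, loc, env => do
    let v ← p.eval O loc env
    Comp.tick (1 + v.length)
    return v.snd
  | .eq p q, _, O, loc, env => do
    let v ← p.eval O loc env
    let w ← q.eval O loc env
    Comp.tick (1 + v.length + w.length)
    return [decide (v = w)]
  | .ite p q r, _, O, loc, env => do
    let v ← p.eval O loc env
    Comp.tick 1
    if v.head? = some true then q.eval O loc env else r.eval O loc env
  | .letIn p q, _, O, loc, env => do
    let v ← p.eval O loc env
    Comp.tick 1
    q.eval O loc (v :: env)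
  | .call f p, _, O, loc, env => do
    let v ← p.eval O loc env
    Comp.tick 1
    f.eval O loc [v]
  | .loop n a f, _, O, loc, env => do
    let k ← n.eval O loc env
    let v ← a.eval O loc env
    Comp.tick (1 + k.length)
    Comp.iterate (fun u => f.eval O loc (u :: env)) k.length v
  | .flip, _, _, _, _ => do
    Comp.tick 1
    let b ← (StateT.lift (PMF.uniformOfFintype Bool) : Comp _ Bool)
    return [b]
  | .had s p, _, O, loc, env => do
    let v ← p.eval O loc env
    Comp.tick (1 + v.length)
    Comp.gate (QState.hadamard (cellAt loc s v))
    return []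
  | .tGate s p, _, O, loc, env => do
    let v ← p.eval O loc env
    Comp.tick (1 + v.length)
    Comp.gate (QState.tGate (cellAt loc s v))
    return []
  | .cnot s p s' q, _, O, loc, env => do
    let v ← p.eval O loc env
    let w ← q.eval O loc env
    Comp.tick (1 + v.length + w.length)
    Comp.gate (QState.cnot (cellAt loc s v) (cellAt loc s' w))
    return []
  | .meas s p, _, O, loc, env => do
    let v ← p.eval O loc env
    Comp.tick (1 + v.length)
    let w ← get
    let (b, ψ) ← (StateT.lift (QState.measure (cellAt loc s v) w.q) : Comp _ (Bool × QState))
    Comp.gate fun _ => ψ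
    return [b]
  | .base p q, _, O, loc, env => do
    let v ← p.eval O loc env
    Comp.tick (1 + v.length)
    q.eval O (fun a => loc (Str.pair v a)) env
  | .oracle port p q, _, O, loc, env => do
    let m ← p.eval O loc env
    let k ← q.eval O loc env
    Comp.tick (1 + m.length + k.length)
    let w ← get
    let (r, s, ψ) ← (StateT.lift (O port m w.ora w.q) : Comp _ (Str × _ × QState))
    set (⟨s, ψ, w.cost⟩ : World _)
    return r.take k.length
  | .simulate f h a, _, O, loc, env => do
    let s ← a.eval O loc env
    let w ← get
    let (v, w') ← (StateT.lift
      ((f.eval (Oracle.ofHandler fun input => h.eval O loc [input]) loc env).run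
        ⟨(s, w.ora, 0), w.q, w.cost⟩) : Comp _ (Str × World (Str × _ × ℕ)))
    set (⟨w'.ora.2.1, w'.q, w'.cost + w'.ora.2.2⟩ : World _)
    Comp.tick (1 + v.length + w'.ora.1.length)
    return Str.pair v w'.ora.1

/-- The program is classical: it contains no instruction that touches the quantum memory. -/
def Prog.Classical : Prog → Prop
  | .arg _ | .lit _ | .flip => True
  | .tail p | .fst p | .snd p => p.Classical
  | .append p q | .pair p q | .eq p q | .letIn p q | .call p q | .base p q | .oracle _ p q =>
    p.Classical ∧ q.Classical
  | .ite p q r | .loop p q r | .simulate p q r => p.Classical ∧ q.Classical ∧ r.Classical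
  | .had _ _ | .tGate _ _ | .cnot _ _ _ _ | .meas _ _ => False

/-- The output distribution of a program (without oracle, on fresh quantum memory). -/
def Prog.run (P : Prog) (x : Str) : PMF Str :=
  Prod.fst <$> (P.eval noOracle (Cell.priv 0) [x]).run ⟨(), QState.zero, 0⟩

/-- An admissible placement of private memory: distinct addresses are distinct cells, none of them
in the message register. -/
def IsPlacement (loc : Str → Cell) : Prop :=
  Function.Injective loc ∧ ∀ a b, loc a ≠ Cell.msg b

/-- Classical probabilistic polynomial-time algorithms. -/
def Prog.PPT (P : Prog) : Prop :=
  P.Classical ∧ ∃ p : Polynomial ℕ, ∀ (x : Str) (loc : Str → Cell) (ψ : QState), IsPlacement loc →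
    ∀ o ∈ ((P.eval noOracle loc [x]).run ⟨(), ψ, 0⟩).support, o.2.cost ≤ p.eval x.length

/-- QPT adversaries: on input `1ⁿ`, and whatever the oracle does, the number of steps is bounded by
a polynomial in `n`. -/
def Prog.QPTAdversary (A : Prog) : Prop :=
  ∃ p : Polynomial ℕ, ∀ (n : ℕ) (loc : Str → Cell), IsPlacement loc →
    ∀ (σ : Type) (O : Oracle σ) (s : σ) (ψ : QState),
      ∀ o ∈ ((A.eval O loc [Str.unary n]).run ⟨s, ψ, 0⟩).support, o.2.cost ≤ p.eval n

/-- The value and final oracle state when an adversary is run on `1ⁿ` with an oracle. -/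
def Prog.runWith {σ : Type} (A : Prog) (n : ℕ) (O : Oracle σ) (s : σ) : PMF (Str × σ) :=
  (fun o => (o.1, o.2.ora)) <$> (A.eval O (Cell.priv 0) [Str.unary n]).run ⟨s, QState.zero, 0⟩

/-- Negligible functions. -/
def Negligible (ν : ℕ → ℝ) : Prop :=
  Asymptotics.SuperpolynomialDecay atTop (fun n : ℕ => (n : ℝ)) ν

/-- The first bit of an output string is `1`. -/
def Accepts (w : Str) : Prop := w.head? = some true

instance (w : Str) : Decidable (Accepts w) := inferInstanceAs (Decidable (_ = _))

/-! ## Private-key encryption -/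

/-- Inputs: `1ⁿ` for `keygen`, (key, message) for `encrypt`, (key, ciphertext) for `decrypt`. -/
structure EncScheme where
  keygen : Prog
  encrypt : Prog
  decrypt : Prog

/-- Private-key encryption schemes: PPT algorithms, deterministic decryption, and perfect
completeness. -/
structure EncScheme.IsScheme (E : EncScheme) : Prop where
  keygen_ppt : E.keygen.PPT
  encrypt_ppt : E.encrypt.PPT
  decrypt_ppt : E.decrypt.PPT
  decrypt_det : ∀ x, ∃ y, E.decrypt.run x = PMF.pure y
  complete : ∀ n, ∀ k ∈ (E.keygen.run (Str.unary n)).support, ∀ m,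
    ∀ c ∈ (E.encrypt.run (Str.pair k m)).support, E.decrypt.run (Str.pair k c) = PMF.pure m

/-- The oracle of the chosen-plaintext game with key `k` and hidden bit `b`. Port `0` encrypts the
query. Port `1` takes a pair of messages of equal length and encrypts the `b`-th of them; it works
only once, which its state records. -/
def EncScheme.cpaOracle (E : EncScheme) (k : Str) (b : Bool) : Oracle Bool
  | 0, m, used, ψ => do
    let c ← E.encrypt.run (Str.pair k m)
    return (c, used, ψ)
  | 1, m, used, ψ =>
    if used = false ∧ m.fst.length = m.snd.length then do
      let c ← E.encrypt.run (Str.pair k (if b then m.snd else m.fst))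
      return (c, true, ψ)
    else return ([], used, ψ)
  | _ + 2, _, used, ψ => return ([], used, ψ)

/-- The chosen-plaintext indistinguishability game: did the distinguisher guess the bit? -/
def EncScheme.cpaGame (E : EncScheme) (D : Prog) (n : ℕ) : PMF Bool := do
  let k ← E.keygen.run (Str.unary n)
  let b ← PMF.uniformOfFintype Bool
  let (v, _) ← D.runWith n (E.cpaOracle k b) false
  return (decide (Accepts v) == b)

/-- Post-quantum indistinguishability under chosen-plaintext attack. -/
def EncScheme.PQIndCPA (E : EncScheme) : Prop :=
  ∀ D : Prog, D.QPTAdversary → ∃ ν : ℕ → ℝ, Negligible ν ∧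
    ∀ n, (E.cpaGame D n true).toReal ≤ 1 / 2 + ν n

/-! ## Message authentication codes -/

/-- Inputs: `1ⁿ` for `keygen`, (key, message) for `mac`, (key, (message, tag)) for `verify`. -/
structure MACScheme where
  keygen : Prog
  mac : Prog
  verify : Prog

/-- Message authentication codes: PPT algorithms and perfect completeness. -/
structure MACScheme.IsScheme (M : MACScheme) : Prop where
  keygen_ppt : M.keygen.PPT
  mac_ppt : M.mac.PPT
  verify_ppt : M.verify.PPT
  complete : ∀ n, ∀ k ∈ (M.keygen.run (Str.unary n)).support, ∀ m,
    ∀ t ∈ (M.mac.run (Str.pair k m)).support,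
      ∀ r ∈ (M.verify.run (Str.pair k (Str.pair m t))).support, Accepts r

/-- The oracle of the chosen-message game with key `k`: port `0` signs, port `1` verifies a
(message, tag) pair. The state is the list of all messages signed so far. -/
def MACScheme.cmaOracle (M : MACScheme) (k : Str) : Oracle (List Str)
  | 0, m, Q, ψ => do
    let t ← M.mac.run (Str.pair k m)
    return (t, m :: Q, ψ)
  | 1, m, Q, ψ => do
    let r ← M.verify.run (Str.pair k (Str.pair m.fst m.snd))
    return ([decide (Accepts r)], Q, ψ)
  | _ + 2, _, Q, ψ => return ([], Q, ψ)

/-- The forgery game: is the output of the forger a valid pair (message, tag) whose message was not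
signed by the oracle? -/
def MACScheme.forgeGame (M : MACScheme) (F : Prog) (n : ℕ) : PMF Bool := do
  let k ← M.keygen.run (Str.unary n)
  let (v, Q) ← F.runWith n (M.cmaOracle k) []
  let r ← M.verify.run (Str.pair k (Str.pair v.fst v.snd))
  return decide (Accepts r ∧ v.fst ∉ Q)

/-- Post-quantum existential unforgeability under adaptive chosen-message attack. -/
def MACScheme.PQEUCMA (M : MACScheme) : Prop :=
  ∀ F : Prog, F.QPTAdversary → ∃ ν : ℕ → ℝ, Negligible ν ∧
    ∀ n, (M.forgeGame F n true).toReal ≤ ν n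

/-! ## Interactive protocols -/

/-- The local situation of a party in one run of a protocol: its classical state, and its output
bit once it has halted. -/
structure Party where
  st : Str
  out : Option Bool

def Party.init : Party := ⟨[], none⟩

/-- A party is given by a program that is run on every incoming message. Its input is
(`1ⁿ`, (input of the party, (state, message))). -/
def partyInput (n : ℕ) (x st m : Str) : Str :=
  Str.pair (Str.unary n) (Str.pair x (Str.pair st m))

/-- The output of the program is (status, (new state, outgoing message)). The party goes on if the
status is empty, and otherwise halts with the first bit of the status as its output bit. -/
def partyNext (v : Str) : Party := ⟨v.snd.fst, v.fst.head?⟩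

/-- The outgoing message in the output of the program. -/
def partyReply (v : Str) : Str := v.snd.snd

/-- A party with program `P` receives the message `m`: its reply, its new situation, and the new
state of the quantum memory. A party that has halted does nothing. -/
def activate (P : Prog) (loc : Str → Cell) (n : ℕ) (x : Str) (s : Party) (m : Str) (ψ : QState) :
    PMF (Str × Party × QState) :=
  if s.out.isSome then return ([], s, ψ)
  else do
    let (v, w) ← (P.eval noOracle loc [partyInput n x s.st m]).run ⟨(), ψ, 0⟩
    return (partyReply v, partyNext v, w.q)

/-- `Reachable P loc n x s len c`: in some run with an arbitrary environment, the party with input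
`x` gets into the situation `s` after having received messages of total length `len` (counting one
more for each message) and having made `c` steps altogether. -/
inductive Reachable (P : Prog) (loc : Str → Cell) (n : ℕ) (x : Str) : Party → ℕ → ℕ → Prop
  | init : Reachable P loc n x Party.init 0 0
  | step {s : Party} {len c : ℕ} (h : Reachable P loc n x s len c) (hs : s.out = none)
      (m : Str) (ψ : QState) (o : Str × World Unit)
      (ho : o ∈ ((P.eval noOracle loc [partyInput n x s.st m]).run ⟨(), ψ, 0⟩).support) :
      Reachable P loc n x (partyNext o.1) (len + (m.length + 1)) (c + o.2.cost)

/-- Interactive QPT parties: in every run the total number of steps is bounded by a polynomial in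
the security parameter, the length of the input and the length of the received messages. -/
def Prog.InteractiveQPT (P : Prog) : Prop :=
  ∃ p : Polynomial ℕ, ∀ (n : ℕ) (x : Str) (loc : Str → Cell), IsPlacement loc →
    ∀ (s : Party) (len c : ℕ), Reachable P loc n x s len c → c ≤ p.eval (n + x.length + len)

/-! ## Private quantum money -/

/-- The algorithms of an interactive memoryless private quantum money scheme. The input of `keygen`
is `1ⁿ`. In each run of `mint` and of `verify` the bank starts from the key and no other memory. The
user has no input in `mint`; its final memory (classical state and qubits) is the banknote, with
which it enters `verify`. The output bit of the bank in `verify` says whether the money is valid. -/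
structure MoneyScheme where
  keygen : Prog
  mintBank : Prog
  mintUser : Prog
  verifyBank : Prog
  verifyUser : Prog

/-- Interactive private quantum money schemes: key generation is classical PPT and the parties of
the two protocols are interactive QPT machines. -/
structure MoneyScheme.IsScheme (S : MoneyScheme) : Prop where
  keygen_ppt : S.keygen.PPT
  mintBank_qpt : S.mintBank.InteractiveQPT
  mintUser_qpt : S.mintUser.InteractiveQPT
  verifyBank_qpt : S.verifyBank.InteractiveQPT
  verifyUser_qpt : S.verifyUser.InteractiveQPT

/-- The bank is classical in `mint` and in `verify`. -/
def MoneyScheme.SemiQuantum (S : MoneyScheme) : Prop :=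
  S.mintBank.Classical ∧ S.verifyBank.Classical

/-- Some rounds of the interaction between a user and a bank. In each round the user reacts to the
last message of the bank (at first the empty one) and the bank reacts to the message of the user.
The bank is party number `o`, the user party number `0`. -/
def interact (user bank : Prog) (o n : ℕ) (xU xB : Str) :
    ℕ → Party → Party → Str → QState → PMF (Party × Party × QState)
  | 0, u, b, _, ψ => return (u, b, ψ)
  | r + 1, u, b, m, ψ => do
    let (m₁, u₁, ψ₁) ← activate user (Cell.priv 0) n xU u m ψ
    let (m₂, b₁, ψ₂) ← activate bank (Cell.priv o) n xB b m₁ ψ₁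
    interact user bank o n xU xB r u₁ b₁ m₂ ψ₂

/-- Honest minting followed by honest verification, each for `r` rounds: is minting finished, and
the banknote accepted? -/
def MoneyScheme.honestRun (S : MoneyScheme) (n r : ℕ) : PMF Bool := do
  let k ← S.keygen.run (Str.unary n)
  let (u, b, ψ) ← interact S.mintUser S.mintBank 1 n [] k r Party.init Party.init [] QState.zero
  let (_, b', _) ← interact S.verifyUser S.verifyBank 2 n u.st k r Party.init Party.init [] ψ
  return (u.out.isSome && b.out.isSome && b'.out == some true)

/-- Correctness: an honestly minted banknote is accepted, within polynomially many rounds and up to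
a negligible probability. -/
def MoneyScheme.Correct (S : MoneyScheme) : Prop :=
  ∃ (p : Polynomial ℕ) (ν : ℕ → ℝ), Negligible ν ∧
    ∀ n, 1 - ν n ≤ (S.honestRun n (p.eval n) true).toReal

/-- A run of `verify` or of `mint` in which the counterfeiter takes the part of the user. -/
structure Session where
  isVerify : Bool
  party : Party

/-- The bank with key `k` in the counterfeiting game. Port `0` starts a run of `mint` and port `1` a
run of `verify`; port `2`, queried with (number of a run in unary, message), sends the message to
the bank in that run and returns (status, reply), where the status tells whether the bank has halted
and with which output bit. Runs may be interleaved arbitrarily. The bank of each run has its own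
private quantum memory; quantum messages are exchanged in the message register. -/
def MoneyScheme.bankOracle (S : MoneyScheme) (n : ℕ) (k : Str) : Oracle (List Session)
  | 0, _, runs, ψ => return ([], runs ++ [⟨false, Party.init⟩], ψ)
  | 1, _, runs, ψ => return ([], runs ++ [⟨true, Party.init⟩], ψ)
  | 2, m, runs, ψ =>
    let i := m.fst.length
    match runs[i]? with
    | none => return ([], runs, ψ)
    | some s => do
      let (r, s', ψ') ← activate (if s.isVerify then S.verifyBank else S.mintBank)
        (Cell.priv (i + 1)) n k s.party m.snd ψ
      return (Str.pair s'.out.toList r, runs.set i ⟨s.isVerify, s'⟩, ψ')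
  | _ + 3, _, runs, ψ => return ([], runs, ψ)

/-- The counterfeiting game. The result is `(w, ℓ, v)`: the numbers of successful verifications, of
calls of `mint`, and of calls of `verify`. -/
def MoneyScheme.counterfeit (S : MoneyScheme) (A : Prog) (n : ℕ) : PMF (ℕ × ℕ × ℕ) := do
  let k ← S.keygen.run (Str.unary n)
  let (_, runs) ← A.runWith n (S.bankOracle n k) []
  return (runs.countP fun s => s.isVerify && s.party.out == some true,
    runs.countP fun s => !s.isVerify, runs.countP fun s => s.isVerify)

/-- Full security: no QPT counterfeiter wins, that is, achieves `w > ℓ`, with more than negligible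
probability. -/
def MoneyScheme.FullSecure (S : MoneyScheme) : Prop :=
  ∀ A : Prog, A.QPTAdversary → ∃ ν : ℕ → ℝ, Negligible ν ∧
    ∀ n, ((S.counterfeit A n).toOuterMeasure {g | g.1 > g.2.1}).toReal ≤ ν n

/-- Mini-scheme security: a counterfeiter wins if `w > ℓ` and `ℓ = 1`. -/
def MoneyScheme.MiniSecure (S : MoneyScheme) : Prop :=
  ∀ A : Prog, A.QPTAdversary → ∃ ν : ℕ → ℝ, Negligible ν ∧
    ∀ n, ((S.counterfeit A n).toOuterMeasure {g | g.1 > g.2.1 ∧ g.2.1 = 1}).toReal ≤ ν n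

end

/-! ## The construction -/

namespace Prog

/-- The value is the empty string. -/
def isNil (p : Prog) : Prog := .eq p (.lit [])

/-- The security parameter, input, state and message, if `a` is the input of a party. -/
def secOf (a : Prog) : Prog := .fst a

def inpOf (a : Prog) : Prog := .fst (.snd a)

def stOf (a : Prog) : Prog := .fst (.snd (.snd a))

def msgOf (a : Prog) : Prog := .snd (.snd (.snd a))

/-- The input of a party. -/
def partyIn (sec inp st msg : Prog) : Prog := .pair sec (.pair inp (.pair st msg))

/-- The output (status, (state, message)) of a party. -/
def partyOut (status st msg : Prog) : Prog := .pair status (.pair st msg)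

end Prog

namespace FullScheme

open Prog

variable (S : MoneyScheme) (M : MACScheme) (E : EncScheme)

/-- Input `1ⁿ`; the key is `(k_m, k_e)`. -/
def keygen : Prog := .pair (.call M.keygen (.arg 0)) (.call E.keygen (.arg 0))

/-- The first step of the bank in `mint`: it generates a mini-scheme key `k`, encrypts it, signs the
ciphertext, and gets the state `((k, (c, t)), state of the mini-scheme bank)`. The environment holds
the input of the party. -/
def mintStart : Prog :=
  .letIn (.call S.keygen (secOf (.arg 0)))
    (.letIn (.call E.encrypt (.pair (.snd (inpOf (.arg 1))) (.arg 0)))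
      (.letIn (.call M.mac (.pair (.fst (inpOf (.arg 2))) (.arg 0)))
        (.pair (.pair (.arg 2) (.pair (.arg 1) (.arg 0))) (.lit []))))

/-- The bank in `mint` runs the minting protocol of the mini-scheme with the key `k`, and together
with the last message of that protocol sends `(c, t)`. Messages are pairs of a message of the
mini-scheme and either nothing or `(c, t)`. -/
def mintBank : Prog :=
  .letIn (.ite (isNil (stOf (.arg 0))) (mintStart S M E) (stOf (.arg 0)))
    (.letIn (.call S.mintBank
        (partyIn (secOf (.arg 1)) (.fst (.fst (.arg 0))) (.snd (.arg 0)) (msgOf (.arg 1))))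
      (partyOut (.fst (.arg 0))
        (.pair (.fst (.arg 1)) (.fst (.snd (.arg 0))))
        (.pair (.snd (.snd (.arg 0)))
          (.ite (isNil (.fst (.arg 0))) (.lit []) (.snd (.fst (.arg 1)))))))

/-- The user in `mint` runs the user of the mini-scheme and keeps `(c, t)`. It halts when the user
of the mini-scheme has halted and `(c, t)` has arrived. Its state is
`((status of the mini-scheme user, (c, t)), state of the mini-scheme user)`. -/
def mintUser : Prog :=
  .letIn (.ite (isNil (.fst (.fst (stOf (.arg 0)))))
      (.call S.mintUser
        (partyIn (secOf (.arg 0)) (inpOf (.arg 0)) (.snd (stOf (.arg 0))) (.fst (msgOf (.arg 0)))))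
      (partyOut (.fst (.fst (stOf (.arg 0)))) (.snd (stOf (.arg 0))) (.lit [])))
    (.letIn (.ite (isNil (.snd (msgOf (.arg 1))))
        (.snd (.fst (stOf (.arg 1)))) (.snd (msgOf (.arg 1))))
      (partyOut (.ite (isNil (.arg 0)) (.lit []) (.fst (.arg 1)))
        (.pair (.pair (.fst (.arg 1)) (.arg 0)) (.fst (.snd (.arg 1))))
        (.snd (.snd (.arg 1)))))

/-- The bank in `verify` first receives `(c, t)`. If the tag is not valid, it rejects; otherwise it
decrypts the mini-scheme key `k` and runs the verification of the mini-scheme with this key. Its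
state is `(k, state of the mini-scheme bank)`. -/
def verifyBank : Prog :=
  .ite (isNil (stOf (.arg 0)))
    (.ite (.call M.verify (.pair (.fst (inpOf (.arg 0)))
        (.pair (.fst (msgOf (.arg 0))) (.snd (msgOf (.arg 0))))))
      (partyOut (.lit [])
        (.pair (.call E.decrypt (.pair (.snd (inpOf (.arg 0))) (.fst (msgOf (.arg 0))))) (.lit []))
        (.lit []))
      (partyOut (.lit [false]) (.lit []) (.lit [])))
    (.letIn (.call S.verifyBank
        (partyIn (secOf (.arg 0)) (.fst (stOf (.arg 0))) (.snd (stOf (.arg 0))) (msgOf (.arg 0))))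
      (partyOut (.fst (.arg 0))
        (.pair (.fst (stOf (.arg 1))) (.fst (.snd (.arg 0))))
        (.snd (.snd (.arg 0)))))

/-- The user in `verify`, whose input is the final state of `mintUser`, first sends `(c, t)` and
then runs the user of the mini-scheme. Its state is `(0, state of the mini-scheme user)`. -/
def verifyUser : Prog :=
  .ite (isNil (stOf (.arg 0)))
    (partyOut (.lit []) (.pair (.lit []) (.lit [])) (.snd (.fst (inpOf (.arg 0)))))
    (.letIn (.call S.verifyUser
        (partyIn (secOf (.arg 0)) (.snd (inpOf (.arg 0))) (.snd (stOf (.arg 0))) (msgOf (.arg 0))))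
      (partyOut (.fst (.arg 0))
        (.pair (.lit []) (.fst (.snd (.arg 0))))
        (.snd (.snd (.arg 0)))))

end FullScheme

/-- The scheme that mints banknotes of the mini-scheme `S` under fresh keys and attaches to each the
encrypted and authenticated key. -/
def fullScheme (S : MoneyScheme) (M : MACScheme) (E : EncScheme) : MoneyScheme where
  keygen := FullScheme.keygen M E
  mintBank := FullScheme.mintBank S M E
  mintUser := FullScheme.mintUser S
  verifyBank := FullScheme.verifyBank S M E
  verifyUser := FullScheme.verifyUser S

set_option linter.all false
set_option linter.unusedSimpArgs false


noncomputable section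

/-! Security is a hybrid argument over games. The bank of the full scheme is compared with a bank
that keeps a ledger. The latter remembers which run of `mint` made which ciphertext and with which
key of the mini-scheme; it uses the remembered key instead of decrypting, and it rejects every
ciphertext that is not in its table. Since decryption inverts encryption, the two banks agree until
an unknown ciphertext arrives with a valid tag (`full_sim`). In the ledger game every accepted
banknote has an owner, namely the run of `mint` that made its ciphertext. If there are more
acceptances than runs of `mint`, two of them share an owner by the pigeonhole principle
(`FullRel.exists_count`). Hence, if `B` bounds the steps of the counterfeiter, its success
probability is at most a sum over the run numbers below `B` of the probabilities of two events: an
unknown ciphertext with a valid tag in run `g`, and two acceptances with owner `j` (`full_le`).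

The first event is bounded by a forger against the MAC that guesses `g`, simulates the bank, and
outputs the pair submitted in run `g` (`exists_forger`). For the second event, the key encrypted in
run `j` is replaced by a string of ones of the same length; the change is bounded by a distinguisher
against the encryption (`exists_distinguisher`). After the replacement, the key of run `j` is used
only by the bank of the mini-scheme, apart from its length. A counterfeiter of the mini-scheme can
therefore take run `j` and all verifications owned by `j` from its own bank and play everything else
by itself; two acceptances with owner `j` are two successful verifications of a single minted
banknote (`exists_counterfeiter`). The guessed numbers cost polynomial factors, which
`fullScheme_fullSecure` collects.

Much of the proof shows that these reductions are programs of the machine model. A program is turned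
into a tree of effects, which depends neither on the oracle nor on the place of its memory
(`eval_run`). Two executions of one tree are compared by a one-sided simulation principle
(`Sim.ev_run_le`); qubits are renamed because a simulated bank has its memory elsewhere. The three
reductions share one program for the ledger, `handlerP`, and differ only in its elementary
operations. `run_handlerP` shows that this program implements the ledger, `Link.sim` reduces the
comparison of game and reduction to conditions on the single operations, and `exists_play_bound`
gives the running time. The last point needs bounds for the ledger that do not grow from query to
query; they come from the fact that the state of an interactive bank is bounded in terms of the
messages it has received.

Correctness is a coupling of the honest runs of the two schemes, with one additional round
(`honestRun_le`). That the parties of the new scheme are interactive QPT machines follows from an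
invariant containing a reachable situation of the inner party (`interactiveQPT_of_invariant`).
Classicality is inherited because everything else that the new bank calls is a PPT algorithm, hence
classical. -/

theorem PMF.do_bind_eq {α β : Type} (p : PMF α) (f : α → PMF β) : (p >>= f) = p.bind f := rfl

/-! ## Effect trees -/

/-- Unitary gates on abstract addresses. -/
inductive Gate where
  | had (s : Bool) (a : Str)
  | tg (s : Bool) (a : Str)
  | cnot (s : Bool) (a : Str) (s' : Bool) (a' : Str)

/-- The address `a` moved below `v` unless it is shared. -/
def shiftAddr (v : Str) (s : Bool) (a : Str) : Str := if s then a else Str.pair v a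

theorem cellAt_shiftAddr (loc : Str → Cell) (v : Str) (s : Bool) (a : Str) :
    cellAt loc s (shiftAddr v s a) = cellAt (fun a => loc (Str.pair v a)) s a := by
  cases s <;> simp [cellAt, shiftAddr]

def Gate.act (loc : Str → Cell) : Gate → QState → QState
  | .had s a => QState.hadamard (cellAt loc s a)
  | .tg s a => QState.tGate (cellAt loc s a)
  | .cnot s a s' a' => QState.cnot (cellAt loc s a) (cellAt loc s' a')

def Gate.relocate (v : Str) : Gate → Gate
  | .had s a => .had s (shiftAddr v s a)
  | .tg s a => .tg s (shiftAddr v s a)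
  | .cnot s a s' a' => .cnot s (shiftAddr v s a) s' (shiftAddr v s' a')

theorem Gate.act_relocate (loc : Str → Cell) (v : Str) (g : Gate) :
    (g.relocate v).act loc = g.act (fun a => loc (Str.pair v a)) := by
  cases g <;> simp [Gate.relocate, Gate.act, cellAt_shiftAddr]

/-- The tree of possible effects of a computation. -/
inductive Eff (α : Type) : Type where
  | ret (a : α)
  | tick (n : ℕ) (t : Eff α)
  | flip (k : Bool → Eff α)
  | gate (g : Gate) (t : Eff α)
  | meas (s : Bool) (a : Str) (k : Bool → Eff α)
  | query (port : ℕ) (m : Str) (l : ℕ) (k : Str → Eff α)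

namespace Eff

variable {α β γ : Type} {σ : Type}

def bind : Eff α → (α → Eff β) → Eff β
  | ret a, f => f a
  | tick n t, f => tick n (t.bind f)
  | flip k, f => flip fun b => (k b).bind f
  | gate g t, f => gate g (t.bind f)
  | meas s a k, f => meas s a fun b => (k b).bind f
  | query p m l k, f => query p m l fun r => (k r).bind f

def relocate (v : Str) : Eff α → Eff α
  | ret a => ret a
  | tick n t => tick n (t.relocate v)
  | flip k => flip fun b => (k b).relocate v
  | gate g t => gate (g.relocate v) (t.relocate v)
  | meas s a k => meas s (shiftAddr v s a) fun b => (k b).relocate v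
  | query p m l k => query p m l fun r => (k r).relocate v

/-- The input of a handler. -/
def handlerInput (s : Str) (port : ℕ) (m : Str) : Str := Str.pair s (Str.pair (Str.unary port) m)

/-- Replace the queries by a handler with state. -/
def handle (h : Str → Eff Str) : Eff α → Str → Eff (α × Str)
  | ret a, s => ret (a, s)
  | tick n t, s => tick n (t.handle h s)
  | flip k, s => flip fun b => (k b).handle h s
  | gate g t, s => gate g (t.handle h s)
  | meas c a k, s => meas c a fun b => (k b).handle h s
  | query p m l k, s =>
    -- The price of the query itself, and on top of it the price of starting the handler that
    -- `Oracle.ofHandler` books on its separate counter.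
    tick ((1 + m.length + l) + (1 + (handlerInput s p m).length))
      ((h (handlerInput s p m)).bind fun v => tick (1 + v.length) ((k (v.snd.take l)).handle h v.fst))

def iterate (f : Str → Eff Str) : ℕ → Str → Eff Str
  | 0, v => ret v
  | n + 1, v => (f v).bind (iterate f n)

/-- Execution with step count. -/
def interp (O : Oracle σ) (loc : Str → Cell) : Eff α → World σ → PMF (α × World σ)
  | ret a, w => PMF.pure (a, w)
  | tick n t, w => t.interp O loc ⟨w.ora, w.q, w.cost + n⟩
  | flip k, w => (PMF.uniformOfFintype Bool).bind fun b => (k b).interp O loc w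
  | gate g t, w => t.interp O loc ⟨w.ora, g.act loc w.q, w.cost⟩
  | meas s a k, w => (QState.measure (cellAt loc s a) w.q).bind fun x =>
      (k x.1).interp O loc ⟨w.ora, x.2, w.cost⟩
  | query p m l k, w => (O p m w.ora w.q).bind fun x =>
      (k (x.1.take l)).interp O loc ⟨x.2.1, x.2.2, w.cost + (1 + m.length + l)⟩

/-- Execution without step count. -/
def run (O : Oracle σ) (loc : Str → Cell) : Eff α → σ × QState → PMF (α × σ × QState)
  | ret a, w => PMF.pure (a, w)
  | tick _ t, w => t.run O loc w
  | flip k, w => (PMF.uniformOfFintype Bool).bind fun b => (k b).run O loc w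
  | gate g t, w => t.run O loc (w.1, g.act loc w.2)
  | meas s a k, w => (QState.measure (cellAt loc s a) w.2).bind fun x =>
      (k x.1).run O loc (w.1, x.2)
  | query p m l k, w => (O p m w.1 w.2).bind fun x => (k (x.1.take l)).run O loc x.2

theorem interp_bind (O : Oracle σ) (loc : Str → Cell) (t : Eff α) (f : α → Eff β) (w : World σ) :
    (t.bind f).interp O loc w = (t.interp O loc w).bind fun o => (f o.1).interp O loc o.2 := by
  induction t generalizing w with
  | ret a => simp [bind, interp]
  | tick n t ih => simp [bind, interp, ih]
  | flip k ih => simp [bind, interp, ih]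
  | gate g t ih => simp [bind, interp, ih]
  | meas s a k ih => simp [bind, interp, ih]
  | query p m l k ih => simp [bind, interp, ih]

theorem run_bind (O : Oracle σ) (loc : Str → Cell) (t : Eff α) (f : α → Eff β) (w : σ × QState) :
    (t.bind f).run O loc w = (t.run O loc w).bind fun o => (f o.1).run O loc o.2 := by
  induction t generalizing w with
  | ret a => simp [bind, run]
  | tick n t ih => simp [bind, run, ih]
  | flip k ih => simp [bind, run, ih]
  | gate g t ih => simp [bind, run, ih]
  | meas s a k ih => simp [bind, run, ih]
  | query p m l k ih => simp [bind, run, ih]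

theorem interp_relocate (O : Oracle σ) (loc : Str → Cell) (v : Str) (t : Eff α) (w : World σ) :
    (t.relocate v).interp O loc w = t.interp O (fun a => loc (Str.pair v a)) w := by
  induction t generalizing w with
  | ret a => simp [relocate, interp]
  | tick n t ih => simp [relocate, interp, ih]
  | flip k ih => simp [relocate, interp, ih]
  | gate g t ih => simp [relocate, interp, ih, Gate.act_relocate]
  | meas s a k ih => simp [relocate, interp, ih, cellAt_shiftAddr]
  | query p m l k ih => simp [relocate, interp, ih]

theorem run_relocate (O : Oracle σ) (loc : Str → Cell) (v : Str) (t : Eff α) (w : σ × QState) :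
    (t.relocate v).run O loc w = t.run O (fun a => loc (Str.pair v a)) w := by
  induction t generalizing w with
  | ret a => simp [relocate, run]
  | tick n t ih => simp [relocate, run, ih]
  | flip k ih => simp [relocate, run, ih]
  | gate g t ih => simp [relocate, run, ih, Gate.act_relocate]
  | meas s a k ih => simp [relocate, run, ih, cellAt_shiftAddr]
  | query p m l k ih => simp [relocate, run, ih]

/-- The step counter is only increased and never read, so an initial amount can be added afterwards.
-/
theorem interp_shift (O : Oracle σ) (loc : Str → Cell) (t : Eff α) (s : σ) (ψ : QState) (c d : ℕ) :
    t.interp O loc ⟨s, ψ, c + d⟩ =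
      (t.interp O loc ⟨s, ψ, c⟩).map fun o => (o.1, ⟨o.2.ora, o.2.q, o.2.cost + d⟩) := by
  induction t generalizing s ψ c with
  | ret a => simp [interp, PMF.pure_map]
  | tick n t ih => simp only [interp]; rw [← ih]; congr 2; omega
  | flip k ih => simp [interp, ih, PMF.map_bind]
  | gate g t ih => simp [interp, ih]
  | meas s a k ih => simp [interp, ih, PMF.map_bind]
  | query p m l k ih =>
    simp only [interp, PMF.map_bind]
    congr 1; funext x; rw [← ih]; congr 2; omega

theorem run_eq_map_interp (O : Oracle σ) (loc : Str → Cell) (t : Eff α) (w : World σ) :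
    t.run O loc (w.ora, w.q) = (t.interp O loc w).map fun o => (o.1, o.2.ora, o.2.q) := by
  induction t generalizing w with
  | ret a => simp [interp, run, PMF.pure_map]
  | tick n t ih => simp only [interp, run]; rw [← ih]
  | flip k ih => simp [interp, run, ih, PMF.map_bind]
  | gate g t ih => simp only [interp, run]; rw [← ih]
  | meas s a k ih => simp only [interp, run, PMF.map_bind]; congr 1; funext x; rw [← ih]
  | query p m l k ih => simp only [interp, run, PMF.map_bind]; congr 1; funext x; rw [← ih]

/-- Replacing queries in the tree agrees with running against the handler as an oracle. -/
theorem interp_handle (O : Oracle σ) (loc : Str → Cell) (h : Str → Eff Str) (H : Str → Comp σ Str)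
    (hH : ∀ x w, (H x).run w = (h x).interp O loc w) (t : Eff α) (s : Str) (so : σ) (ψ : QState)
    (c d : ℕ) :
    (t.handle h s).interp O loc ⟨so, ψ, c + d⟩ =
      (t.interp (Oracle.ofHandler H) loc ⟨(s, so, d), ψ, c⟩).map fun o =>
        ((o.1, o.2.ora.1), ⟨o.2.ora.2.1, o.2.q, o.2.cost + o.2.ora.2.2⟩) := by
  induction t generalizing s so ψ c d with
  | ret a => simp [interp, handle, PMF.pure_map]
  | tick n t ih => simp only [interp, handle]; rw [← ih]; congr 2; omega
  | flip k ih => simp [interp, handle, ih, PMF.map_bind]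
  | gate g t ih => simp [interp, handle, ih]
  | meas s a k ih => simp [interp, handle, ih, PMF.map_bind]
  | query p m l k ih =>
    simp only [interp, handle, PMF.map_bind, interp_bind, Oracle.ofHandler]
    -- The cost is split into the account of the handler, from which `h` starts, and the account of
    -- the main program, which `interp_shift` adds at the end.
    have e : c + d + ((1 + m.length + l) + (1 + (handlerInput s p m).length)) =
      (d + 1 + (handlerInput s p m).length) + (c + (1 + m.length + l)) := by omega
    rw [e, interp_shift]
    simp only [PMF.bind_map, Function.comp_def]
    change _ = PMF.bind (PMF.bind ((H _).run _) _) _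
    rw [hH, PMF.bind_bind]
    refine congrArg _ (funext fun x => ?_)
    change _ = PMF.bind (PMF.pure _) _
    rw [PMF.pure_bind]
    simp only
    rw [← ih]
    congr 2
    omega

/-- The oracle given by a handler, without step count. -/
def handlerOracle (h : Str → Eff Str) (O : Oracle σ) (loc : Str → Cell) : Oracle (Str × σ) :=
  fun p m s ψ => ((h (handlerInput s.1 p m)).run O loc (s.2, ψ)).map fun o =>
    (o.1.snd, (o.1.fst, o.2.1), o.2.2)

theorem run_handle (O : Oracle σ) (loc : Str → Cell) (h : Str → Eff Str) (t : Eff α) (s : Str)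
    (so : σ) (ψ : QState) :
    (t.handle h s).run O loc (so, ψ) = (t.run (handlerOracle h O loc) loc ((s, so), ψ)).map fun o =>
        ((o.1, o.2.1.1), o.2.1.2, o.2.2) := by
  induction t generalizing s so ψ with
  | ret a => simp [run, handle, PMF.pure_map]
  | tick n t ih => simp only [run, handle]; rw [← ih]
  | flip k ih => simp [run, handle, ih, PMF.map_bind]
  | gate g t ih => simp [run, handle, ih]
  | meas s a k ih => simp [run, handle, ih, PMF.map_bind]
  | query p m l k ih =>
    simp only [run, handle, PMF.map_bind, run_bind, handlerOracle, PMF.bind_map, Function.comp_def]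
    refine congrArg _ (funext fun x => ?_)
    rw [← ih]

end Eff

namespace Prog

/-- The effect tree of a program. -/
def tree : Prog → List Str → Eff Str
  | arg i, env => .tick (1 + (env.getD i []).length) (.ret (env.getD i []))
  | lit w, _ => .tick (1 + w.length) (.ret w)
  | append p q, env => (p.tree env).bind fun v => (q.tree env).bind fun w =>
      .tick (1 + v.length + w.length) (.ret (v ++ w))
  | tail p, env => (p.tree env).bind fun v => .tick (1 + v.length) (.ret v.tail)
  | pair p q, env => (p.tree env).bind fun v => (q.tree env).bind fun w =>
      .tick (1 + v.length + w.length) (.ret (Str.pair v w))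
  | fst p, env => (p.tree env).bind fun v => .tick (1 + v.length) (.ret v.fst)
  | snd p, env => (p.tree env).bind fun v => .tick (1 + v.length) (.ret v.snd)
  | eq p q, env => (p.tree env).bind fun v => (q.tree env).bind fun w =>
      .tick (1 + v.length + w.length) (.ret [decide (v = w)])
  | ite p q r, env => (p.tree env).bind fun v =>
      .tick 1 (if v.head? = some true then q.tree env else r.tree env)
  | letIn p q, env => (p.tree env).bind fun v => .tick 1 (q.tree (v :: env))
  | call f p, env => (p.tree env).bind fun v => .tick 1 (f.tree [v])
  | loop n a f, env => (n.tree env).bind fun k => (a.tree env).bind fun v =>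
      .tick (1 + k.length) (Eff.iterate (fun u => f.tree (u :: env)) k.length v)
  | flip, _ => .tick 1 (.flip fun b => .ret [b])
  | had s p, env => (p.tree env).bind fun v => .tick (1 + v.length) (.gate (.had s v) (.ret []))
  | tGate s p, env => (p.tree env).bind fun v => .tick (1 + v.length) (.gate (.tg s v) (.ret []))
  | cnot s p s' q, env => (p.tree env).bind fun v => (q.tree env).bind fun w =>
      .tick (1 + v.length + w.length) (.gate (.cnot s v s' w) (.ret []))
  | meas s p, env => (p.tree env).bind fun v => .tick (1 + v.length) (.meas s v fun b => .ret [b])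
  | base p q, env => (p.tree env).bind fun v => .tick (1 + v.length) ((q.tree env).relocate v)
  | oracle port p q, env => (p.tree env).bind fun m => (q.tree env).bind fun k =>
      .query port m k.length fun r => .ret r
  | simulate f h a, env => (a.tree env).bind fun s =>
      ((f.tree env).handle (fun x => h.tree [x]) s).bind fun o =>
        .tick (1 + o.1.length + o.2.length) (.ret (Str.pair o.1 o.2))

theorem iterate_run {σ : Type} (O : Oracle σ) (loc : Str → Cell) (F : Str → Comp σ Str)
    (f : Str → Eff Str) (h : ∀ x w, (F x).run w = (f x).interp O loc w) (n : ℕ) (v : Str)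
    (w : World σ) :
    (Comp.iterate F n v).run w = (Eff.iterate f n v).interp O loc w := by
  induction n generalizing v w with
  | zero => rfl
  | succ n ih =>
    simp only [Comp.iterate, Eff.iterate, Eff.interp_bind, StateT.run_bind, h, PMF.do_bind_eq, ih]

theorem tick_run {σ : Type} (n : ℕ) (w : World σ) :
    (Comp.tick n).run w = PMF.pure ((), ⟨w.ora, w.q, w.cost + n⟩) := rfl

theorem gate_run {σ : Type} (g : QState → QState) (w : World σ) :
    (Comp.gate g).run w = PMF.pure ((), ⟨w.ora, g w.q, w.cost⟩) := rfl

theorem pure_run {σ α : Type} (a : α) (w : World σ) :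
    (pure a : Comp σ α).run w = PMF.pure (a, w) := rfl

theorem lift_run {σ α : Type} (p : PMF α) (w : World σ) :
    (StateT.lift p : Comp σ α).run w = p.bind fun a => PMF.pure (a, w) := rfl

theorem get_run {σ : Type} (w : World σ) : (get : Comp σ (World σ)).run w = PMF.pure (w, w) := rfl

theorem set_run {σ : Type} (w w' : World σ) :
    (set w' : Comp σ PUnit).run w = PMF.pure (⟨⟩, w') := rfl

/-- This is the bridge from the machine model to effect trees. Inside `simulate` the oracle has
another type of states, so the induction is over all oracles at once; there the evaluation against
the handler becomes the substitution `handle`. -/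
theorem eval_run (P : Prog) {σ : Type} (O : Oracle σ) (loc : Str → Cell) (env : List Str)
    (w : World σ) : (P.eval O loc env).run w = (P.tree env).interp O loc w := by
  induction P generalizing σ loc env w with
  | simulate f h a ihf ihh iha =>
    simp only [eval, tree, StateT.run_bind, PMF.do_bind_eq, iha, Eff.interp_bind, lift_run,
      get_run, set_run, tick_run, pure_run, PMF.pure_bind, PMF.bind_bind]
    refine congrArg _ (funext fun x => ?_)
    -- At the start of a simulation the handler has made no steps: this is `interp_handle` with `d =
    -- 0`.
    have e : x.2 = ⟨x.2.ora, x.2.q, x.2.cost + 0⟩ := rfl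
    conv_rhs => rw [e]
    rw [Eff.interp_handle O loc (fun x => h.tree [x]) (fun input => h.eval O loc [input])
      (fun y w => ihh O loc [y] w), PMF.bind_map]
    rw [ihf]
    rfl
  | loop n a f ihn iha ihf =>
    simp only [eval, tree, StateT.run_bind, PMF.do_bind_eq, ihn, iha, Eff.interp_bind,
      tick_run, PMF.pure_bind, Eff.interp]
    refine congrArg _ (funext fun x => congrArg _ (funext fun y => ?_))
    exact iterate_run O loc _ _ (fun u w => ihf O loc (u :: env) w) _ _ _
  | ite p q r ihp ihq ihr =>
    simp only [eval, tree, StateT.run_bind, PMF.do_bind_eq, ihp, Eff.interp_bind,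
      tick_run, PMF.pure_bind, Eff.interp]
    refine congrArg _ (funext fun x => ?_)
    split_ifs <;> simp [ihq, ihr]
  | _ =>
    simp only [eval, tree, StateT.run_bind, PMF.do_bind_eq, Eff.interp_bind, Eff.interp,
      tick_run, gate_run, pure_run, lift_run, get_run, set_run, PMF.pure_bind,
      PMF.bind_bind, Gate.act, Eff.interp_relocate, *]

end Prog

end


noncomputable section

/-! ## Lengths of strings -/

namespace Str

theorem fst_pair (x y : Str) : (pair x y).fst = x := by simp [fst, unpair_pair]

theorem snd_pair (x y : Str) : (pair x y).snd = y := by simp [snd, unpair_pair]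

theorem fst_nil : fst [] = [] := by simp [fst, unpair]

theorem snd_nil : snd [] = [] := by simp [snd, unpair]

theorem length_pair (x y : Str) : (pair x y).length = 2 * x.length + 2 + y.length := by
  induction x with
  | nil => simp [pair]; omega
  | cons b x ih => simp [pair, ih]; omega

theorem pair_ne_nil (x y : Str) : pair x y ≠ [] := by
  cases x <;> simp [pair]

theorem pair_injective_right (x : Str) : Function.Injective (pair x) := fun a b h => by
  simpa [snd_pair] using congrArg snd h

/-- Each decoded bit of the first component consumes two bits of the string. The factor 2 is what
makes repeated application of `fst` a halving. -/
theorem length_fst_add_snd (w : Str) : 2 * w.fst.length + w.snd.length ≤ w.length := by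
  unfold fst snd
  fun_induction unpair w with
  | case1 b w ih => simp; omega
  | case2 b c w h => simp; omega
  | case3 w h => simp

theorem length_fst_le (w : Str) : w.fst.length ≤ w.length := by
  have := length_fst_add_snd w; omega

theorem length_snd_le (w : Str) : w.snd.length ≤ w.length := by
  have := length_fst_add_snd w; omega

theorem length_unary (n : ℕ) : (unary n).length = n := by simp [unary]

theorem unary_injective : Function.Injective unary := fun a b h => by
  simpa [length_unary] using congrArg List.length h

end Str

theorem Polynomial.eval_mono_nat (p : Polynomial ℕ) {m n : ℕ} (h : m ≤ n) :
    p.eval m ≤ p.eval n := by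
  simp only [Polynomial.eval_eq_sum, Polynomial.sum]
  exact Finset.sum_le_sum fun i _ => Nat.mul_le_mul_left _ (Nat.pow_le_pow_left h i)

/-! ## Support-based reasoning about effect trees -/

namespace Eff

variable {α β γ : Type} {σ : Type}

/-- Every outcome of the computation, with its number of steps, satisfies the property. -/
def Ensures (O : Oracle σ) (loc : Str → Cell) (t : Eff α) (Q : α → ℕ → Prop) : Prop :=
  ∀ (s : σ) (ψ : QState) (c : ℕ), ∀ o ∈ (t.interp O loc ⟨s, ψ, c⟩).support,
    ∃ d, o.2.cost = c + d ∧ Q o.1 d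

variable {O : Oracle σ} {loc : Str → Cell}

theorem Ensures.mono {t : Eff α} {Q Q' : α → ℕ → Prop} (h : Ensures O loc t Q)
    (hQ : ∀ a d, Q a d → Q' a d) : Ensures O loc t Q' := fun s ψ c o ho => by
  obtain ⟨d, hd, hq⟩ := h s ψ c o ho
  exact ⟨d, hd, hQ _ _ hq⟩

theorem Ensures.and {t : Eff α} {Q Q' : α → ℕ → Prop} (h : Ensures O loc t Q)
    (h' : Ensures O loc t Q') : Ensures O loc t fun a d => Q a d ∧ Q' a d := fun s ψ c o ho => by
  obtain ⟨d, hd, hq⟩ := h s ψ c o ho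
  obtain ⟨d', hd', hq'⟩ := h' s ψ c o ho
  obtain rfl : d = d' := by omega
  exact ⟨d, hd, hq, hq'⟩

theorem ensures_ret {a : α} {Q : α → ℕ → Prop} (h : Q a 0) : Ensures O loc (.ret a) Q := by
  intro s ψ c o ho
  simp only [interp, PMF.support_pure, Set.mem_singleton_iff] at ho
  subst ho
  exact ⟨0, rfl, h⟩

theorem ensures_tick {t : Eff α} {n : ℕ} {Q : α → ℕ → Prop}
    (h : Ensures O loc t fun a d => Q a (n + d)) : Ensures O loc (.tick n t) Q := by
  intro s ψ c o ho
  obtain ⟨d, hd, hq⟩ := h s ψ (c + n) o ho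
  exact ⟨n + d, by omega, hq⟩

theorem ensures_flip {k : Bool → Eff α} {Q : α → ℕ → Prop} (h : ∀ b, Ensures O loc (k b) Q) :
    Ensures O loc (.flip k) Q := by
  intro s ψ c o ho
  simp only [interp, PMF.mem_support_bind_iff] at ho
  obtain ⟨b, -, hb⟩ := ho
  exact h b s ψ c o hb

theorem ensures_gate {g : Gate} {t : Eff α} {Q : α → ℕ → Prop} (h : Ensures O loc t Q) :
    Ensures O loc (.gate g t) Q := by
  intro s ψ c o ho
  exact h s _ c o ho

theorem ensures_meas {x : Bool} {a : Str} {k : Bool → Eff α} {Q : α → ℕ → Prop}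
    (h : ∀ b, Ensures O loc (k b) Q) : Ensures O loc (.meas x a k) Q := by
  intro s ψ c o ho
  simp only [interp, PMF.mem_support_bind_iff] at ho
  obtain ⟨b, -, hb⟩ := ho
  exact h b.1 s _ c o hb

theorem ensures_query {p : ℕ} {m : Str} {l : ℕ} {k : Str → Eff α} {Q : α → ℕ → Prop}
    (h : ∀ r : Str, r.length ≤ l → Ensures O loc (k r) fun a d => Q a (1 + m.length + l + d)) :
    Ensures O loc (.query p m l k) Q := by
  intro s ψ c o ho
  simp only [interp, PMF.mem_support_bind_iff] at ho
  obtain ⟨b, -, hb⟩ := ho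
  obtain ⟨d, hd, hq⟩ := h (b.1.take l) (by simp) _ _ _ o hb
  exact ⟨_, by omega, hq⟩

theorem Ensures.bind {t : Eff α} {f : α → Eff β} {Q : α → ℕ → Prop} {Q' : β → ℕ → Prop}
    (h : Ensures O loc t Q)
    (h' : ∀ a d, Q a d → Ensures O loc (f a) fun b e => Q' b (d + e)) :
    Ensures O loc (t.bind f) Q' := by
  intro s ψ c o ho
  rw [interp_bind, PMF.mem_support_bind_iff] at ho
  obtain ⟨x, hx, hb⟩ := ho
  obtain ⟨d, hd, hq⟩ := h s ψ c x hx
  obtain ⟨e, he, hq'⟩ := h' _ _ hq x.2.ora x.2.q x.2.cost o hb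
  exact ⟨d + e, by omega, hq'⟩

theorem ensures_relocate {t : Eff α} {v : Str} {Q : α → ℕ → Prop}
    (h : Ensures O (fun a => loc (Str.pair v a)) t Q) : Ensures O loc (t.relocate v) Q := by
  intro s ψ c o ho
  rw [interp_relocate] at ho
  exact h s ψ c o ho

theorem ensures_true (t : Eff α) : Ensures O loc t fun _ _ => True := by
  induction t with
  | ret a => exact ensures_ret trivial
  | tick n t ih => exact ensures_tick ih
  | flip k ih => exact ensures_flip ih
  | gate g t ih => exact ensures_gate ih
  | meas s a k ih => exact ensures_meas ih
  | query p m l k ih => exact ensures_query fun r _ => ih r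

/-- Properties of the value follow from the execution without step count. -/
theorem ensures_of_run {t : Eff α} {Q : α → Prop}
    (h : ∀ s ψ, ∀ o ∈ (t.run O loc (s, ψ)).support, Q o.1) : Ensures O loc t fun a _ => Q a := by
  intro s ψ c o ho
  obtain ⟨d, hd, -⟩ := ensures_true t s ψ c o ho
  refine ⟨d, hd, h s ψ (o.1, o.2.ora, o.2.q) ?_⟩
  have := run_eq_map_interp O loc t ⟨s, ψ, c⟩
  simp only at this
  rw [this, PMF.mem_support_map_iff]
  exact ⟨o, ho, rfl⟩

/-- The invariant may depend on the number of passes made so far, so it can describe values that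
grow from pass to pass. -/
theorem ensures_iterate {f : Str → Eff Str} {Inv : ℕ → Str → Prop} {D : ℕ} {n : ℕ}
    (h : ∀ i u, i < n → Inv i u → Ensures O loc (f u) fun v d => Inv (i + 1) v ∧ d ≤ D) {u : Str}
    (hu : Inv 0 u) : Ensures O loc (iterate f n u) fun v d => Inv n v ∧ d ≤ n * D := by
  induction n generalizing u Inv with
  | zero => exact ensures_ret ⟨hu, by simp⟩
  | succ n ih =>
    refine (h 0 u (by omega) hu).bind fun v d hv => ?_
    refine (ih (Inv := fun i => Inv (i + 1)) (fun i u hi hu => h (i + 1) u (by omega) hu) hv.1).mono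
      fun a e ha => ⟨ha.1, ?_⟩
    have := ha.2
    have := hv.2
    rw [Nat.succ_mul]; omega

/-- All queries of the tree go to ports up to `K`, and only if `g` holds the tree touches the quantum
memory. -/
def Fits (g : Prop) (K : ℕ) : Eff α → Prop
  | ret _ => True
  | tick _ t => t.Fits g K
  | flip k => ∀ b, (k b).Fits g K
  | gate _ t => g ∧ t.Fits g K
  | meas _ _ k => g ∧ ∀ b, (k b).Fits g K
  | query p _ _ k => p ≤ K ∧ ∀ r, (k r).Fits g K

variable {g : Prop}

theorem Fits.mono {K L : ℕ} (h : K ≤ L) {t : Eff α} (ht : t.Fits g K) : t.Fits g L := by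
  induction t with
  | ret a => trivial
  | tick n t ih => exact ih ht
  | flip k ih => exact fun b => ih b (ht b)
  | gate _ t ih => exact ⟨ht.1, ih ht.2⟩
  | meas s a k ih => exact ⟨ht.1, fun b => ih b (ht.2 b)⟩
  | query p m l k ih => exact ⟨ht.1.trans h, fun r => ih r (ht.2 r)⟩

theorem Fits.bind {K : ℕ} {t : Eff α} {f : α → Eff β} (ht : t.Fits g K)
    (hf : ∀ a, (f a).Fits g K) : (t.bind f).Fits g K := by
  induction t with
  | ret a => exact hf a
  | tick n t ih => exact ih ht
  | flip k ih => exact fun b => ih b (ht b)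
  | gate _ t ih => exact ⟨ht.1, ih ht.2⟩
  | meas _ _ k ih | query _ _ _ k ih => exact ⟨ht.1, fun r => ih r (ht.2 r)⟩

theorem Fits.relocate {K : ℕ} {t : Eff α} {v : Str} (ht : t.Fits g K) : (t.relocate v).Fits g K := by
  induction t with
  | ret a => trivial
  | tick n t ih => exact ih ht
  | flip k ih => exact fun b => ih b (ht b)
  | gate _ t ih => exact ⟨ht.1, ih ht.2⟩
  | meas _ _ k ih | query _ _ _ k ih => exact ⟨ht.1, fun r => ih r (ht.2 r)⟩

theorem Fits.handle {K L : ℕ} {h : Str → Eff Str} (hh : ∀ x, (h x).Fits g K) {t : Eff α}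
    (ht : t.Fits g L) (s : Str) : (t.handle h s).Fits g K := by
  induction t generalizing s with
  | ret a => trivial
  | tick n t ih => exact ih ht s
  | flip k ih => exact fun b => ih b (ht b) s
  | gate _ t ih => exact ⟨ht.1, ih ht.2 s⟩
  | meas c a k ih => exact ⟨ht.1, fun b => ih b (ht.2 b) s⟩
  | query p m l k ih => exact (hh _).bind fun v => ih _ (ht.2 _) _

theorem fits_iterate {K : ℕ} {f : Str → Eff Str} (hf : ∀ x, (f x).Fits g K) (n : ℕ) (v : Str) :
    (iterate f n v).Fits g K := by
  induction n generalizing v with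
  | zero => trivial
  | succ n ih => exact (hf v).bind fun a => ih a

/-- Invariants of the oracle state that depend on the number of steps. -/
theorem interp_invariant {K : ℕ} {I : ℕ → σ → Prop} (hmono : ∀ c c' s, c ≤ c' → I c s → I c' s)
    (hI : ∀ c s p m ψ, p ≤ K → I c s → ∀ o ∈ (O p m s ψ).support, I (c + 1 + m.length) o.2.1)
    {t : Eff α} (ht : t.Fits g K) (w : World σ) (hw : I w.cost w.ora) :
    ∀ o ∈ (t.interp O loc w).support, I o.2.cost o.2.ora := by
  induction t generalizing w with
  | ret a =>
    intro o ho
    simp only [interp, PMF.support_pure, Set.mem_singleton_iff] at ho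
    subst ho; exact hw
  | tick n t ih => exact ih ht _ (hmono _ _ _ (by simp) hw)
  | flip k ih =>
    intro o ho
    simp only [interp, PMF.mem_support_bind_iff] at ho
    obtain ⟨b, -, hb⟩ := ho
    exact ih b (ht b) w hw o hb
  | gate _ t ih => exact ih ht.2 _ hw
  | meas s a k ih =>
    intro o ho
    simp only [interp, PMF.mem_support_bind_iff] at ho
    obtain ⟨b, -, hb⟩ := ho
    exact ih b.1 (ht.2 b.1) _ (by exact hw) o hb
  | query p m l k ih =>
    intro o ho
    simp only [interp, PMF.mem_support_bind_iff] at ho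
    obtain ⟨b, hb, hb'⟩ := ho
    exact ih _ (ht.2 _) _ (hmono _ _ _ (by simp only; omega) (hI _ _ _ _ _ ht.1 hw b hb)) o hb'

/-! ### Silent handlers -/

/-- The program `lit []` returns the empty string, which decodes to an empty state and an empty
reply. So the simulated program sees exactly `noOracle`, and the outer oracle is never asked. -/
theorem run_handle_silent (t : Eff α) (O : Oracle σ) (loc : Str → Cell) (s : σ) (ψ : QState) :
    (t.handle (fun x => (Prog.lit []).tree [x]) []).run O loc (s, ψ) =
      (t.run noOracle loc ((), ψ)).map fun o => ((o.1, []), s, o.2.2) := by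
  induction t generalizing ψ with
  | ret a => simp [run, handle, PMF.pure_map]
  | tick n t ih => simp [run, handle, ih]
  | flip k ih => simp [run, handle, ih, PMF.map_bind]
  | gate g t ih => simp [run, handle, ih]
  | meas c a k ih => simp [run, handle, ih, PMF.map_bind]
  | query p m l k ih =>
    simp only [run, handle, Prog.tree, Str.fst_nil, Str.snd_nil, noOracle, bind,
      PMF.pure_bind, List.take_nil]
    exact ih [] ψ

/-- A query to port `p` that used to cost `1 + |m| + l` now costs `8 + 2p + 2|m| + l`, because the
handler reads the port in unary. With `p ≤ K` the factor `2K + 10` suffices; it depends on the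
program only. -/
theorem interp_handle_silent {K : ℕ} {t : Eff α} (ht : t.Fits g K) (O : Oracle σ)
    (loc : Str → Cell) (s : σ) (ψ : QState) (c c' : ℕ) :
    ∀ o ∈ ((t.handle (fun x => (Prog.lit []).tree [x]) []).interp O loc ⟨s, ψ, c⟩).support,
      o.1.2 = [] ∧ ∃ o' ∈ (t.interp noOracle loc ⟨(), ψ, c'⟩).support, o'.1 = o.1.1 ∧
        o.2.cost + (2 * K + 10) * c' ≤ c + (2 * K + 10) * o'.2.cost := by
  induction t generalizing ψ c c' with
  | ret a => intro o ho; simp_all [interp, handle]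
  | tick n t ih =>
    intro o ho
    obtain ⟨h, o', h1, h2, h3⟩ := ih ht ψ (c + n) (c' + n) o ho
    refine ⟨h, o', h1, h2, ?_⟩
    nlinarith
  | flip k ih =>
    intro o ho
    simp only [interp, handle, PMF.mem_support_bind_iff] at ho ⊢
    obtain ⟨b, hb, hb'⟩ := ho
    obtain ⟨h, o', h1, h2, h3⟩ := ih b (ht b) ψ c c' o hb'
    exact ⟨h, o', ⟨b, hb, h1⟩, h2, h3⟩
  | gate _ t ih => exact ih ht.2 _ c c'
  | meas x a k ih =>
    intro o ho
    simp only [interp, handle, PMF.mem_support_bind_iff] at ho ⊢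
    obtain ⟨b, hb, hb'⟩ := ho
    obtain ⟨h, o', h1, h2, h3⟩ := ih b.1 (ht.2 b.1) b.2 c c' o hb'
    exact ⟨h, o', ⟨b, hb, h1⟩, h2, h3⟩
  | query p m l k ih =>
    intro o ho
    simp only [interp, handle, interp_bind, Prog.tree, PMF.pure_bind, Str.fst_nil, Str.snd_nil,
      noOracle, List.take_nil, List.length_nil] at ho ⊢
    obtain ⟨h, o', h1, h2, h3⟩ := ih [] (ht.2 []) ψ _ (c' + (1 + m.length + l)) o ho
    refine ⟨h, o', h1, h2, ?_⟩
    have hp := ht.1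
    simp only [handlerInput, Str.length_pair, Str.length_unary, List.length_nil] at h3
    nlinarith [Nat.zero_le (K * m.length), Nat.zero_le (K * l)]

/-- Without gates and measurements the memory is passed through unchanged, and nothing that happens
can depend on it or on its placement. -/
theorem Fits.run_eq {K : ℕ} {t : Eff α} (ht : t.Fits False K) (loc loc' : Str → Cell)
    (ψ ψ' : QState) : t.run noOracle loc ((), ψ) =
      ((t.run noOracle loc' ((), ψ')).map Prod.fst).map fun a => (a, (), ψ) := by
  induction t with
  | ret a => simp [run, PMF.pure_map]
  | tick n t ih => simpa [run] using ih ht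
  | flip k ih =>
    simp only [run, PMF.map_bind]
    exact congrArg _ (funext fun b => ih b (ht b))
  | gate _ t ih | meas _ _ t ih => exact ht.1.elim
  | query p m l k ih => simpa [run, noOracle] using ih [] (ht.2 _)

end Eff

namespace Prog

/-- Ports are constants in the program text, so only finitely many occur. The disjunction serves two
uses at once: `g = True` yields a bound on the ports of any program, and `g = False` says that a
classical program never touches the quantum memory. -/
theorem exists_fits (P : Prog) : ∃ K, ∀ g : Prop, (g ∨ P.Classical) → ∀ env, (P.tree env).Fits g K := by
  induction P with
  | arg _ | lit _ | flip => exact ⟨0, fun _ _ _ => by simp [tree, Eff.Fits]⟩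
  | tail p ihp | fst p ihp | snd p ihp =>
    exact ihp.imp fun K hK g h env => (hK g h env).bind fun v => trivial
  | had s p ihp | tGate s p ihp =>
    exact ihp.imp fun K hK g h env => (hK g (h.imp_right False.elim) env).bind fun v =>
      ⟨h.resolve_right id, trivial⟩
  | meas s p ihp =>
    exact ihp.imp fun K hK g h env => (hK g (h.imp_right False.elim) env).bind fun v =>
      ⟨h.resolve_right id, fun _ => trivial⟩
  | append p q ihp ihq | pair p q ihp ihq | eq p q ihp ihq =>
    obtain ⟨K, hK⟩ := ihp
    obtain ⟨L, hL⟩ := ihq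
    exact ⟨max K L, fun g h env => ((hK g (h.imp_right And.left) env).mono (by simp)).bind fun v =>
      ((hL g (h.imp_right And.right) env).mono (by simp)).bind fun w => trivial⟩
  | cnot s p s' q ihp ihq =>
    obtain ⟨K, hK⟩ := ihp
    obtain ⟨L, hL⟩ := ihq
    exact ⟨max K L, fun g h env =>
      ((hK g (h.imp_right False.elim) env).mono (by simp)).bind fun v =>
        ((hL g (h.imp_right False.elim) env).mono (by simp)).bind fun w =>
          ⟨h.resolve_right id, trivial⟩⟩
  | letIn p q ihp ihq =>
    obtain ⟨K, hK⟩ := ihp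
    obtain ⟨L, hL⟩ := ihq
    exact ⟨max K L, fun g h env => ((hK g (h.imp_right And.left) env).mono (by simp)).bind fun v =>
      (hL g (h.imp_right And.right) _).mono (by simp)⟩
  | base p q ihp ihq =>
    obtain ⟨K, hK⟩ := ihp
    obtain ⟨L, hL⟩ := ihq
    exact ⟨max K L, fun g h env => ((hK g (h.imp_right And.left) env).mono (by simp)).bind fun v =>
      ((hL g (h.imp_right And.right) _).mono (by simp)).relocate⟩
  | call f p ihf ihp =>
    obtain ⟨K, hK⟩ := ihp
    obtain ⟨L, hL⟩ := ihf
    exact ⟨max K L, fun g h env => ((hK g (h.imp_right And.right) env).mono (by simp)).bind fun v =>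
      (hL g (h.imp_right And.left) _).mono (by simp)⟩
  | oracle port p q ihp ihq =>
    obtain ⟨K, hK⟩ := ihp
    obtain ⟨L, hL⟩ := ihq
    exact ⟨max port (max K L), fun g h env =>
      ((hK g (h.imp_right And.left) env).mono (by simp)).bind fun v =>
        ((hL g (h.imp_right And.right) _).mono (by simp)).bind fun w => ⟨by simp, fun r => trivial⟩⟩
  | ite p q r ihp ihq ihr =>
    obtain ⟨K, hK⟩ := ihp
    obtain ⟨L, hL⟩ := ihq
    obtain ⟨M, hM⟩ := ihr
    refine ⟨max M (max K L), fun g h env =>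
      ((hK g (h.imp_right And.left) env).mono (by simp)).bind fun v => ?_⟩
    simp only [Eff.Fits]
    split_ifs
    · exact (hL g (h.imp_right fun h => h.2.1) _).mono (by simp)
    · exact (hM g (h.imp_right fun h => h.2.2) _).mono (by simp)
  | loop n a f ihn iha ihf =>
    obtain ⟨K, hK⟩ := ihn
    obtain ⟨L, hL⟩ := iha
    obtain ⟨M, hM⟩ := ihf
    exact ⟨max M (max K L), fun g h env =>
      ((hK g (h.imp_right And.left) env).mono (by simp)).bind fun v =>
        ((hL g (h.imp_right fun h => h.2.1) _).mono (by simp)).bind fun w =>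
          Eff.fits_iterate (fun x => (hM g (h.imp_right fun h => h.2.2) _).mono (by simp)) _ _⟩
  | simulate f h a ihf ihh iha =>
    obtain ⟨K, hK⟩ := iha
    obtain ⟨L, hL⟩ := ihh
    obtain ⟨M, hM⟩ := ihf
    exact ⟨max K L, fun g h env =>
      ((hK g (h.imp_right fun h => h.2.2) env).mono (by simp)).bind fun v =>
        (Eff.Fits.handle (fun x => (hL g (h.imp_right fun h => h.2.1) _).mono (by simp))
          (hM g (h.imp_right And.left) _) _).bind fun o => trivial⟩

theorem run_eq_tree (P : Prog) (x : Str) :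
    P.run x = ((P.tree [x]).run noOracle (Cell.priv 0) ((), QState.zero)).map Prod.fst := by
  have := Eff.run_eq_map_interp noOracle (Cell.priv 0) (P.tree [x]) ⟨(), QState.zero, 0⟩
  simp only at this
  rw [this, Prog.run, eval_run, PMF.monad_map_eq_map, PMF.map_comp]
  rfl

theorem Classical.run_eq {P : Prog} (h : P.Classical) (x : Str) (loc : Str → Cell) (ψ : QState) :
    (P.tree [x]).run noOracle loc ((), ψ) = (P.run x).map fun v => (v, (), ψ) := by
  obtain ⟨K, hK⟩ := P.exists_fits
  rw [run_eq_tree, (hK False (Or.inr h) [x]).run_eq loc (Cell.priv 0) ψ QState.zero]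

/-- The length of the value is bounded by the number of steps. -/
theorem ensures_length (P : Prog) {σ : Type} (O : Oracle σ) (loc : Str → Cell) (env : List Str) :
    Eff.Ensures O loc (P.tree env) fun v d => v.length ≤ 2 * d := by
  induction P generalizing σ loc env with
  | arg i => exact Eff.ensures_tick (Eff.ensures_ret (by omega))
  | lit w => exact Eff.ensures_tick (Eff.ensures_ret (by omega))
  | flip => exact Eff.ensures_tick (Eff.ensures_flip fun b => Eff.ensures_ret (by simp))
  | tail p ihp | fst p ihp | snd p ihp =>
    refine (ihp _ _ _).bind fun v d h => Eff.ensures_tick (Eff.ensures_ret ?_)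
    have := v.length_fst_le
    have := v.length_snd_le
    have := v.length_tail
    omega
  | had s p ihp | tGate s p ihp =>
    exact (ihp _ _ _).bind fun v d h =>
      Eff.ensures_tick (Eff.ensures_gate (Eff.ensures_ret (by simp)))
  | meas s p ihp =>
    exact (ihp _ _ _).bind fun v d h =>
      Eff.ensures_tick (Eff.ensures_meas fun b => Eff.ensures_ret (by simp; omega))
  | cnot s p s' q ihp ihq =>
    exact (ihp _ _ _).bind fun v d h => (ihq _ _ _).bind fun v d h =>
      Eff.ensures_tick (Eff.ensures_gate (Eff.ensures_ret (by simp)))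
  | append p q ihp ihq | pair p q ihp ihq | eq p q ihp ihq =>
    exact (ihp _ _ _).bind fun v d h => (ihq _ _ _).bind fun v d h =>
      -- The factor 2 in the bound is due to `pair`, which doubles the bits of its first string but
      -- pays for them once.
      Eff.ensures_tick (Eff.ensures_ret (by simp [Str.length_pair]; omega))
  | letIn p q ihp ihq | call q p ihq ihp =>
    exact (ihp _ _ _).bind fun v d h => Eff.ensures_tick ((ihq _ _ _).mono fun _ _ _ => by omega)
  | base p q ihp ihq =>
    exact (ihp _ _ _).bind fun v d h =>
      Eff.ensures_tick (Eff.ensures_relocate ((ihq _ _ _).mono fun _ _ _ => by omega))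
  | oracle port p q ihp ihq =>
    exact (ihp _ _ _).bind fun v d h => (ihq _ _ _).bind fun v d h =>
      Eff.ensures_query fun r hr => Eff.ensures_ret (by omega)
  | ite p q r ihp ihq ihr =>
    refine (ihp _ _ _).bind fun v d h => Eff.ensures_tick ?_
    split_ifs
    · exact (ihq _ _ _).mono fun _ _ _ => by omega
    · exact (ihr _ _ _).mono fun _ _ _ => by omega
  | loop n a f ihn iha ihf =>
    refine (ihn _ _ _).bind fun v d h => (iha _ _ _).bind fun w e h' => Eff.ensures_tick ?_
    generalize v.length = k
    have : ∀ k (w : Str) e, w.length ≤ 2 * e →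
        Eff.Ensures O loc (Eff.iterate (fun u => f.tree (u :: env)) k w)
          fun a e' => a.length ≤ 2 * (e + e') := by
      intro k
      induction k with
      | zero => exact fun w e he => Eff.ensures_ret he
      | succ k ih =>
        intro w e he
        refine (ihf O loc (w :: env)).bind fun x e' hx => ?_
        exact (ih x e' hx).mono fun a e'' ha => by omega
    exact (this k w e h').mono fun a e' ha => by omega
  | simulate f h a ihf ihh iha =>
    refine (iha _ _ _).bind fun v d hv => (Eff.ensures_true _).bind fun o e _ => ?_
    exact Eff.ensures_tick (Eff.ensures_ret (by rw [Str.length_pair]; omega))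

end Prog

end


noncomputable section

/-! ## Expectations -/

/-- The expected value of a nonnegative function. -/
def PMF.ev {α : Type} (p : PMF α) (f : α → ℝ≥0∞) : ℝ≥0∞ := ∑' a, p a * f a

namespace PMF

variable {α β : Type}

theorem ev_pure (a : α) (f : α → ℝ≥0∞) : (PMF.pure a).ev f = f a := by
  rw [ev, tsum_eq_single a]
  · simp
  · intro b hb; simp [PMF.pure_apply, hb]

theorem ev_bind (p : PMF α) (q : α → PMF β) (f : β → ℝ≥0∞) :
    (p.bind q).ev f = p.ev fun a => (q a).ev f := by
  simp only [ev, PMF.bind_apply, ← ENNReal.tsum_mul_right, ← ENNReal.tsum_mul_left]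
  rw [ENNReal.tsum_comm]
  simp only [mul_assoc]

theorem ev_map (p : PMF α) (h : α → β) (f : β → ℝ≥0∞) : (p.map h).ev f = p.ev fun a => f (h a) := by
  rw [PMF.map, ev_bind]
  simp [ev_pure]

theorem ev_mono {p : PMF α} {f g : α → ℝ≥0∞} (h : ∀ a ∈ p.support, f a ≤ g a) : p.ev f ≤ p.ev g := by
  refine ENNReal.tsum_le_tsum fun a => ?_
  by_cases ha : p a = 0
  · simp [ha]
  · exact mul_le_mul_right (h a ((PMF.mem_support_iff _ _).2 ha)) _

theorem ev_congr {p : PMF α} {f g : α → ℝ≥0∞} (h : ∀ a ∈ p.support, f a = g a) : p.ev f = p.ev g :=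
  le_antisymm (ev_mono fun a ha => (h a ha).le) (ev_mono fun a ha => (h a ha).ge)

theorem ev_const (p : PMF α) (c : ℝ≥0∞) : (p.ev fun _ => c) = c := by
  rw [ev, ENNReal.tsum_mul_right, p.tsum_coe, one_mul]

theorem ev_le_of_le {p : PMF α} {f : α → ℝ≥0∞} {c : ℝ≥0∞} (h : ∀ a ∈ p.support, f a ≤ c) :
    p.ev f ≤ c := (ev_mono h).trans (ev_const p c).le

theorem le_ev_of_le {p : PMF α} {f : α → ℝ≥0∞} {c : ℝ≥0∞} (h : ∀ a ∈ p.support, c ≤ f a) :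
    c ≤ p.ev f := (ev_const p c).ge.trans (ev_mono h)

theorem ev_mul_left (p : PMF α) (c : ℝ≥0∞) (f : α → ℝ≥0∞) :
    (p.ev fun a => c * f a) = c * p.ev f := by
  simp only [ev, ← ENNReal.tsum_mul_left]
  exact tsum_congr fun a => by ring

theorem ev_add (p : PMF α) (f g : α → ℝ≥0∞) : (p.ev fun a => f a + g a) = p.ev f + p.ev g := by
  simp only [ev, mul_add]
  exact ENNReal.tsum_add

theorem ev_sum {ι : Type} (s : Finset ι) (p : PMF α) (f : ι → α → ℝ≥0∞) :
    (p.ev fun a => ∑ i ∈ s, f i a) = ∑ i ∈ s, p.ev (f i) := by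
  classical
  induction s using Finset.induction_on with
  | empty => simp [ev]
  | insert i s hi ih => simp only [Finset.sum_insert hi, ev_add, ih]

theorem ev_comm (p : PMF α) (q : PMF β) (f : α → β → ℝ≥0∞) :
    (p.ev fun a => q.ev fun b => f a b) = q.ev fun b => p.ev fun a => f a b := by
  simp only [ev, ← ENNReal.tsum_mul_left]
  rw [ENNReal.tsum_comm]
  exact tsum_congr fun a => tsum_congr fun b => by ring

theorem mul_le_ev (p : PMF α) (f : α → ℝ≥0∞) (a : α) : p a * f a ≤ p.ev f := ENNReal.le_tsum a

theorem toOuterMeasure_eq_ev (p : PMF α) (s : Set α) :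
    p.toOuterMeasure s = p.ev (s.indicator 1) := by
  rw [toOuterMeasure_apply, ev]
  refine tsum_congr fun a => ?_
  by_cases h : a ∈ s <;> simp [h]

theorem apply_true_eq_ev (p : PMF Bool) : p true = p.ev fun b => if b = true then 1 else 0 := by
  rw [ev, tsum_bool]; simp

end PMF

/-! ## Simulations -/

namespace Eff

variable {α : Type} {σ σ' : Type}

/-- Pairs of test functions compatible with a relation and with bounds on the two sides. -/
structure Tests (Rel : σ × QState → PMF (σ' × QState) → Prop) (U : σ → ℝ≥0∞) (V : σ' → ℝ≥0∞)
    (f : α → σ × QState → ℝ≥0∞) (g : α → σ' × QState → ℝ≥0∞) : Prop where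
  rel : ∀ a w ν, Rel w ν → f a w ≤ ν.ev (g a)
  left : ∀ a w, f a w ≤ U w.1
  right : ∀ a w, V w.1 ≤ g a w

theorem Tests.rel_pure {Rel : σ × QState → PMF (σ' × QState) → Prop} {U : σ → ℝ≥0∞} {V : σ' → ℝ≥0∞}
    {f : α → σ × QState → ℝ≥0∞} {g : α → σ' × QState → ℝ≥0∞} (h : Tests Rel U V f g) {a : α}
    {w : σ × QState} {w' : σ' × QState} (hw : Rel w (PMF.pure w')) : f a w ≤ g a w' :=
  (h.rel _ _ _ hw).trans_eq (PMF.ev_pure _ _)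

/-- A relation between states and distributions of states that is respected by gates, measurements
and queries; `U` bounds the left test functions from above, `V` the right ones from below. -/
structure Sim (Rel : σ × QState → PMF (σ' × QState) → Prop) (U : σ → ℝ≥0∞) (V : σ' → ℝ≥0∞)
    (O : Oracle σ) (loc : Str → Cell) (O' : Oracle σ') (loc' : Str → Cell) : Prop where
  gate : ∀ g w ν, Rel w ν → Rel (w.1, g.act loc w.2) (ν.map fun w' => (w'.1, Gate.act loc' g w'.2))
  meas : ∀ s a w ν, Rel w ν → ∀ f g, Tests Rel U V f g →
    (QState.measure (cellAt loc s a) w.2).ev (fun x => f x.1 (w.1, x.2)) ≤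
      ν.ev fun w' => (QState.measure (cellAt loc' s a) w'.2).ev fun x => g x.1 (w'.1, x.2)
  query : ∀ p m w ν, Rel w ν → ∀ f g, Tests Rel U V f g → (O p m w.1 w.2).ev (fun x => f x.1 x.2) ≤
      ν.ev fun w' => (O' p m w'.1 w'.2).ev fun x => g x.1 x.2
  monoU : ∀ p m s ψ, ∀ o ∈ (O p m s ψ).support, U o.2.1 ≤ U s
  monoV : ∀ p m s ψ, ∀ o ∈ (O' p m s ψ).support, V s ≤ V o.2.1

theorem ev_run_le {U : σ → ℝ≥0∞} {O : Oracle σ} {loc : Str → Cell}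
    (h : ∀ p m s ψ, ∀ o ∈ (O p m s ψ).support, U o.2.1 ≤ U s) (t : Eff α)
    {f : α → σ × QState → ℝ≥0∞} (hf : ∀ a w, f a w ≤ U w.1) (w : σ × QState) :
    (t.run O loc w).ev (fun x => f x.1 x.2) ≤ U w.1 := by
  induction t generalizing w with
  | ret a => simpa [run, PMF.ev_pure] using hf a w
  | tick n t ih => exact ih w
  | flip k ih =>
    simp only [run, PMF.ev_bind]
    exact PMF.ev_le_of_le fun b _ => ih b w
  | gate g t ih => exact ih _
  | meas s a k ih =>
    simp only [run, PMF.ev_bind]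
    exact PMF.ev_le_of_le fun b _ => ih _ _
  | query p m l k ih =>
    simp only [run, PMF.ev_bind]
    exact PMF.ev_le_of_le fun b hb => (ih _ _).trans (h _ _ _ _ b hb)

theorem le_ev_run {V : σ → ℝ≥0∞} {O : Oracle σ} {loc : Str → Cell}
    (h : ∀ p m s ψ, ∀ o ∈ (O p m s ψ).support, V s ≤ V o.2.1) (t : Eff α)
    {f : α → σ × QState → ℝ≥0∞} (hf : ∀ a w, V w.1 ≤ f a w) (w : σ × QState) :
    V w.1 ≤ (t.run O loc w).ev (fun x => f x.1 x.2) := by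
  induction t generalizing w with
  | ret a => simpa [run, PMF.ev_pure] using hf a w
  | tick n t ih => exact ih w
  | flip k ih =>
    simp only [run, PMF.ev_bind]
    exact PMF.le_ev_of_le fun b _ => ih b w
  | gate g t ih => exact ih (w.1, _)
  | meas s a k ih =>
    simp only [run, PMF.ev_bind]
    exact PMF.le_ev_of_le fun b _ => ih _ (w.1, _)
  | query p m l k ih =>
    simp only [run, PMF.ev_bind]
    exact PMF.le_ev_of_le fun b hb => (h _ _ _ _ b hb).trans (ih _ _)

/-- Both sides execute the same tree, hence the induction over the tree. The right side is a
distribution of states, which allows it to have drawn randomness that the left side draws later. The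
bounds `U` and `V` dispense with the relation where it breaks: if `U` is at most `V` there, or `U`
vanishes, the inequality holds whatever happens afterwards. -/
theorem Sim.ev_run_le {Rel : σ × QState → PMF (σ' × QState) → Prop} {U : σ → ℝ≥0∞}
    {V : σ' → ℝ≥0∞} {O : Oracle σ} {loc : Str → Cell} {O' : Oracle σ'} {loc' : Str → Cell}
    (h : Sim Rel U V O loc O' loc') (t : Eff α) {w : σ × QState} {ν : PMF (σ' × QState)}
    (hw : Rel w ν) {f : α → σ × QState → ℝ≥0∞} {g : α → σ' × QState → ℝ≥0∞}
    (hfg : Tests Rel U V f g) :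
    (t.run O loc w).ev (fun x => f x.1 x.2) ≤
      ν.ev fun w' => (t.run O' loc' w').ev fun x => g x.1 x.2 := by
  induction t generalizing w ν with
  | ret a => simpa [run, PMF.ev_pure] using hfg.rel a w ν hw
  | tick n t ih => exact ih hw
  | flip k ih =>
    simp only [run, PMF.ev_bind]
    rw [PMF.ev_comm]
    exact PMF.ev_mono fun b _ => ih b hw
  | gate x t ih =>
    have := ih (h.gate x w ν hw)
    rwa [PMF.ev_map] at this
  | meas s a k ih =>
    simp only [run, PMF.ev_bind]
    exact h.meas s a w ν hw
      (fun b w => ((k b).run O loc w).ev fun x => f x.1 x.2)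
      (fun b w => ((k b).run O' loc' w).ev fun x => g x.1 x.2)
      -- The expectations over the rest of the computation are test functions again: related states
      -- are covered by the induction, and the bounds persist because `U` never increases and `V`
      -- never decreases.
      ⟨fun b w ν hw => ih b hw, fun b w => Eff.ev_run_le h.monoU _ hfg.left w,
        fun b w => le_ev_run h.monoV _ hfg.right w⟩
  | query p m l k ih =>
    simp only [run, PMF.ev_bind]
    exact h.query p m w ν hw
      (fun r w => ((k (r.take l)).run O loc w).ev fun x => f x.1 x.2)
      (fun r w => ((k (r.take l)).run O' loc' w).ev fun x => g x.1 x.2)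
      ⟨fun b w ν hw => ih _ hw, fun b w => Eff.ev_run_le h.monoU _ hfg.left w,
        fun b w => le_ev_run h.monoV _ hfg.right w⟩

end Eff

/-! ## Relocation of the quantum memory -/

namespace QState

/-- Renaming of the cells. -/
def rename (ρ : Cell ↪ Cell) (ψ : QState) : QState := Finsupp.mapDomain (fun x => x.map ρ) ψ

theorem rename_zero (ρ : Cell ↪ Cell) : rename ρ zero = zero := by
  simp [rename, zero, Finsupp.mapDomain_single]

/-- Gates are linear, so it suffices to check compatibility with the renaming on basis vectors. -/
theorem rename_lift (ρ : Cell ↪ Cell) {f g : Finset Cell → QState}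
    (h : ∀ x, rename ρ (f x) = g (x.map ρ)) (ψ : QState) :
    rename ρ (lift f ψ) = lift g (rename ρ ψ) := by
  have h1 : rename ρ (lift f ψ) =
      Finsupp.lmapDomain ℂ ℂ (fun x : Finset Cell => x.map ρ) (lift f ψ) := rfl
  rw [h1, lift, Finsupp.apply_linearCombination, lift, rename, Finsupp.linearCombination_mapDomain]
  congr 2
  funext x
  exact h x

theorem rename_hadamard (ρ : Cell ↪ Cell) (c : Cell) (ψ : QState) :
    rename ρ (hadamard c ψ) = hadamard (ρ c) (rename ρ ψ) := by
  refine rename_lift ρ (fun x => ?_) ψ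
  simp [rename, Finsupp.mapDomain_add, Finsupp.mapDomain_single, Finset.map_erase, Finset.map_insert]

theorem rename_tGate (ρ : Cell ↪ Cell) (c : Cell) (ψ : QState) :
    rename ρ (tGate c ψ) = tGate (ρ c) (rename ρ ψ) := by
  refine rename_lift ρ (fun x => ?_) ψ
  simp [rename, Finsupp.mapDomain_single]

theorem rename_cnot (ρ : Cell ↪ Cell) (c d : Cell) (ψ : QState) :
    rename ρ (cnot c d ψ) = cnot (ρ c) (ρ d) (rename ρ ψ) := by
  refine rename_lift ρ (fun x => ?_) ψ
  simp only [rename, Finsupp.mapDomain_single, Finset.mem_map', ne_eq, EmbeddingLike.apply_eq_iff_eq]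
  congr 1
  split_ifs
  · ext y
    simp only [Finset.mem_map, Finset.mem_symmDiff, Finset.mem_singleton]
    constructor
    · rintro ⟨a, h | h, rfl⟩
      · exact Or.inl ⟨⟨a, h.1, rfl⟩, by simpa using h.2⟩
      · exact Or.inr ⟨by rw [h.1], by rintro ⟨b, hb, hb'⟩; exact h.2 (ρ.injective hb' ▸ hb)⟩
    · rintro (⟨⟨a, ha, rfl⟩, h⟩ | ⟨rfl, h⟩)
      · exact ⟨a, Or.inl ⟨ha, by simpa using h⟩, rfl⟩
      · exact ⟨d, Or.inr ⟨rfl, fun hd => h ⟨d, hd, rfl⟩⟩, rfl⟩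
  · rfl

theorem rename_project (ρ : Cell ↪ Cell) (c : Cell) (b : Bool) (ψ : QState) :
    rename ρ (project c b ψ) = project (ρ c) b (rename ρ ψ) := by
  unfold project rename
  induction ψ using Finsupp.induction_linear with
  | zero =>
    rw [Finsupp.filter_zero, Finsupp.mapDomain_zero, Finsupp.filter_zero]
  | add x y hx hy => simp only [Finsupp.filter_add, Finsupp.mapDomain_add, hx, hy]
  | single x a =>
    simp only [Finsupp.mapDomain_single]
    by_cases h : decide (c ∈ x) = b
    · rw [Finsupp.filter_single_of_pos (p := fun y => decide (c ∈ y) = b) h,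
        Finsupp.filter_single_of_pos (p := fun y => decide (ρ c ∈ y) = b) (by simpa using h),
        Finsupp.mapDomain_single]
    · rw [Finsupp.filter_single_of_neg (p := fun y => decide (c ∈ y) = b) h,
        Finsupp.filter_single_of_neg (p := fun y => decide (ρ c ∈ y) = b) (by simpa using h),
        Finsupp.mapDomain_zero]

theorem weight_rename (ρ : Cell ↪ Cell) (ψ : QState) : (rename ρ ψ).weight = ψ.weight := by
  unfold weight rename
  rw [Finsupp.sum_mapDomain_index_inj (Finset.map_injective ρ)]

theorem prob_rename (ρ : Cell ↪ Cell) (c : Cell) (ψ : QState) :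
    (rename ρ ψ).prob (ρ c) = ψ.prob c := by
  simp only [prob, ← rename_project, weight_rename]

theorem measure_rename (ρ : Cell ↪ Cell) (c : Cell) (ψ : QState) :
    measure (ρ c) (rename ρ ψ) = (measure c ψ).map fun x => (x.1, rename ρ x.2) := by
  unfold measure
  simp only [prob_rename, PMF.map_comp]
  congr 1
  funext b
  simp [rename_project]

/-- The state `ψ'` is the image of `ψ` under each of the renamings. -/
def Renamed (R : Set (Cell ↪ Cell)) (ψ ψ' : QState) : Prop := ∀ ρ ∈ R, ψ' = rename ρ ψ

theorem Renamed.mono {R R' : Set (Cell ↪ Cell)} {ψ ψ' : QState} (h : Renamed R ψ ψ')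
    (hR : R' ⊆ R) : Renamed R' ψ ψ' := fun ρ hρ => h ρ (hR hρ)

theorem Renamed.gate {R : Set (Cell ↪ Cell)} {ψ ψ' : QState} (h : Renamed R ψ ψ')
    {loc loc' : Str → Cell} (hl : ∀ ρ ∈ R, ∀ s a, ρ (cellAt loc s a) = cellAt loc' s a) (g : Gate) :
    Renamed R (g.act loc ψ) (g.act loc' ψ') := by
  intro ρ hρ
  rw [h ρ hρ]
  cases g with
  | had s a => simp only [Gate.act, rename_hadamard, hl ρ hρ]
  | tg s a => simp only [Gate.act, rename_tGate, hl ρ hρ]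
  | cnot s a s' a' => simp only [Gate.act, rename_cnot, hl ρ hρ]

/-- One renaming in `R` identifies the two distributions of outcomes, since renaming preserves
weights. The collapsed states stay related under all of `R` because every renaming in `R` sends the
measured cell to the same cell. -/
theorem Renamed.ev_measure_le {R : Set (Cell ↪ Cell)} (hne : R.Nonempty) {ψ ψ' : QState}
    (h : Renamed R ψ ψ') {c c' : Cell} (hc : ∀ ρ ∈ R, ρ c = c') {f g : Bool × QState → ℝ≥0∞}
    (hfg : ∀ b φ φ', Renamed R φ φ' → f (b, φ) ≤ g (b, φ')) :
    (measure c ψ).ev f ≤ (measure c' ψ').ev g := by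
  obtain ⟨ρ, hρ⟩ := hne
  rw [h ρ hρ, ← hc ρ hρ, measure_rename, PMF.ev_map]
  refine PMF.ev_mono fun x hx => ?_
  rw [measure, PMF.mem_support_map_iff] at hx
  obtain ⟨b, -, rfl⟩ := hx
  refine hfg _ _ _ fun ρ' hρ' => ?_
  simp only [rename_project]
  rw [← h ρ hρ, h ρ' hρ', hc ρ hρ, hc ρ' hρ']

end QState

/-- This permits a program to be executed with its private memory at another place. It is applied to
the bank of the mini-scheme, whose qubits lie elsewhere in a reduction than in the game. -/
theorem Eff.ev_run_le_of_renamed {α : Type} {R : Set (Cell ↪ Cell)} (hne : R.Nonempty)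
    {loc loc' : Str → Cell} (hl : ∀ ρ ∈ R, ∀ s a, ρ (cellAt loc s a) = cellAt loc' s a)
    (t : Eff α) {ψ ψ' : QState} (h : QState.Renamed R ψ ψ') {f g : α → QState → ℝ≥0∞}
    (hfg : ∀ a φ φ', QState.Renamed R φ φ' → f a φ ≤ g a φ') :
    (t.run noOracle loc ((), ψ)).ev (fun x => f x.1 x.2.2) ≤
      (t.run noOracle loc' ((), ψ')).ev fun x => g x.1 x.2.2 := by
  have hs : Eff.Sim (fun w ν => ∃ φ', ν = PMF.pure ((), φ') ∧ QState.Renamed R w.2 φ')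
      (fun _ => ⊤) (fun _ => 0) noOracle loc noOracle loc' := by
    refine ⟨?_, ?_, ?_, fun _ _ _ _ _ _ => le_top, fun _ _ _ _ _ _ => zero_le⟩
    · rintro g w ν ⟨φ, rfl, hφ⟩
      exact ⟨_, PMF.pure_map _ _, hφ.gate hl g⟩
    · rintro s a w ν ⟨φ, rfl, hφ⟩ f g hfg
      rw [PMF.ev_pure]
      refine hφ.ev_measure_le hne (fun ρ hρ => hl ρ hρ s a) fun b φ₁ φ₂ h12 =>
        hfg.rel_pure ⟨φ₂, rfl, h12⟩
    · rintro p m w ν ⟨φ, rfl, hφ⟩ f g hfg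
      simp only [noOracle, PMF.ev_pure]
      exact hfg.rel_pure ⟨φ, rfl, hφ⟩
  have := hs.ev_run_le t (w := ((), ψ)) ⟨ψ', rfl, h⟩ (f := fun a w => f a w.2)
    (g := fun a w => g a w.2)
    ⟨?_, fun _ _ => le_top, fun _ _ => zero_le⟩
  · rwa [PMF.ev_pure] at this
  · rintro a w ν ⟨φ, rfl, hφ⟩
    rw [PMF.ev_pure]
    exact hfg a _ _ hφ

end


noncomputable section

open Polynomial

namespace Prog

/-! ## Deterministic programs without side effects -/

/-- Programs without coins, gates, measurements and queries. -/
def Pure : Prog → Prop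
  | arg _ | lit _ => True
  | tail p | fst p | snd p => p.Pure
  | append p q | pair p q | eq p q | letIn p q | call p q => p.Pure ∧ q.Pure
  | ite p q r | loop p q r => p.Pure ∧ q.Pure ∧ r.Pure
  | flip | had _ _ | tGate _ _ | cnot _ _ _ _ | meas _ _ | base _ _ | oracle _ _ _
  | simulate _ _ _ => False

/-- The value of a pure program. -/
def val : Prog → List Str → Str
  | arg i, env => env.getD i []
  | lit w, _ => w
  | append p q, env => p.val env ++ q.val env
  | tail p, env => (p.val env).tail
  | pair p q, env => Str.pair (p.val env) (q.val env)
  | fst p, env => (p.val env).fst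
  | snd p, env => (p.val env).snd
  | eq p q, env => [decide (p.val env = q.val env)]
  | ite p q r, env => if (p.val env).head? = some true then q.val env else r.val env
  | letIn p q, env => q.val (p.val env :: env)
  | call f p, env => f.val [p.val env]
  | loop n a f, env => (fun u => f.val (u :: env))^[(n.val env).length] (a.val env)
  | _, _ => []

theorem Pure.run {P : Prog} (h : P.Pure) {σ : Type} (O : Oracle σ) (loc : Str → Cell)
    (env : List Str) (w : σ × QState) : (P.tree env).run O loc w = PMF.pure (P.val env, w) := by
  induction P generalizing env w with
  | arg i | lit v => rfl
  | tail p ihp | fst p ihp | snd p ihp =>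
    simp only [tree, Eff.run_bind, ihp h, PMF.pure_bind, Eff.run, val]
  | append p q ihp ihq | pair p q ihp ihq | eq p q ihp ihq | letIn p q ihp ihq | call p q ihp ihq =>
    simp only [tree, Eff.run_bind, ihp h.1, ihq h.2, PMF.pure_bind, Eff.run, val]
  | ite p q r ihp ihq ihr =>
    simp only [tree, Eff.run_bind, ihp h.1, PMF.pure_bind, Eff.run, val]
    split_ifs
    · exact ihq h.2.1 _ _
    · exact ihr h.2.2 _ _
  | loop n a f ihn iha ihf =>
    simp only [tree, Eff.run_bind, ihn h.1, iha h.2.1, PMF.pure_bind, Eff.run, val]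
    generalize a.val env = v
    induction (n.val env).length generalizing v with
    | zero => rfl
    | succ k ih =>
      simp only [Eff.iterate, Eff.run_bind, ihf h.2.2, PMF.pure_bind, ih, Function.iterate_succ_apply]
  | _ => exact h.elim

theorem Pure.ensures {P : Prog} (h : P.Pure) {σ : Type} (O : Oracle σ) (loc : Str → Cell)
    (env : List Str) : Eff.Ensures O loc (P.tree env) fun v _ => v = P.val env :=
  Eff.ensures_of_run fun s ψ o ho => by
    rw [h.run] at ho
    simp only [PMF.support_pure, Set.mem_singleton_iff] at ho
    rw [ho]

/-! ## Programs with polynomial running time -/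

def envSize (env : List Str) : ℕ := (env.map fun v => v.length + 1).sum

theorem envSize_cons (v : Str) (env : List Str) : envSize (v :: env) = v.length + 1 + envSize env :=
  by simp [envSize]

theorem envSize_singleton (v : Str) : envSize [v] = v.length + 1 := by simp [envSize]

theorem length_getD_le (env : List Str) (i : ℕ) : (env.getD i []).length ≤ envSize env := by
  induction env generalizing i with
  | nil => simp
  | cons v env ih =>
    cases i with
    | zero => simp [envSize_cons]; omega
    | succ i => have := ih i; simp [envSize_cons] at *; omega

/-- Polynomially many steps in the length of the environment, for all oracles of a class. -/
def PolyTime (C : ∀ σ : Type, Oracle σ → Prop) (P : Prog) : Prop :=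
  ∃ p : Polynomial ℕ, ∀ (σ : Type) (O : Oracle σ), C σ O → ∀ loc, IsPlacement loc → ∀ env,
    Eff.Ensures O loc (P.tree env) fun _ d => d ≤ p.eval (envSize env)

/-- The class of all oracles. -/
def AnyOracle : ∀ σ : Type, Oracle σ → Prop := fun _ _ => True

/-- The class of the oracles that always reply with the empty string and do nothing. -/
def SilentOracle : ∀ σ : Type, Oracle σ → Prop := fun _ O =>
  ∀ p m s ψ, O p m s ψ = PMF.pure ([], s, ψ)

variable {C : ∀ σ : Type, Oracle σ → Prop}

theorem PolyTime.exists_bound {P : Prog} (h : PolyTime C P) : ∃ p : Polynomial ℕ,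
    ∀ (σ : Type) (O : Oracle σ), C σ O → ∀ loc, IsPlacement loc → ∀ env,
      Eff.Ensures O loc (P.tree env) fun v d =>
        d ≤ p.eval (envSize env) ∧ v.length ≤ 2 * p.eval (envSize env) := by
  obtain ⟨p, hp⟩ := h
  refine ⟨p, fun σ O hO loc hl env => ?_⟩
  refine ((hp σ O hO loc hl env).and (ensures_length P O loc env)).mono fun v d hd => ?_
  exact ⟨hd.1, hd.2.trans (Nat.mul_le_mul_left _ hd.1)⟩

theorem polyTime_arg (i : ℕ) : PolyTime C (arg i) := by
  refine ⟨Polynomial.X + 1, fun σ O hO loc hl env => Eff.ensures_tick (Eff.ensures_ret ?_)⟩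
  have := length_getD_le env i
  simp only [eval_add, eval_X, eval_one]
  omega

theorem polyTime_lit (w : Str) : PolyTime C (lit w) := by
  refine ⟨Polynomial.C (1 + w.length), fun σ O hO loc hl env =>
    Eff.ensures_tick (Eff.ensures_ret ?_)⟩
  simp

theorem polyTime_flip : PolyTime C flip :=
  ⟨1, fun σ O hO loc hl env => Eff.ensures_tick (Eff.ensures_flip fun b =>
    Eff.ensures_ret (by simp))⟩

theorem PolyTime.of_tree {P F : Prog} (h : PolyTime C P) {φ : Str → Str} (hF : ∀ env, F.tree env =
    (P.tree env).bind fun v => .tick (1 + v.length) (.ret (φ v))) : PolyTime C F := by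
  obtain ⟨p, hp⟩ := h.exists_bound
  refine ⟨3 * p + 1, fun σ O hO loc hl env => hF env ▸ (hp σ O hO loc hl env).bind fun v d hv =>
    Eff.ensures_tick (Eff.ensures_ret ?_)⟩
  simp; omega

theorem PolyTime.of_tree₂ {P Q F : Prog} (h : PolyTime C P) (h' : PolyTime C Q)
    {φ : Str → Str → Str} (hF : ∀ env, F.tree env = (P.tree env).bind fun v => (Q.tree env).bind
      fun w => .tick (1 + v.length + w.length) (.ret (φ v w))) : PolyTime C F := by
  obtain ⟨p, hp⟩ := h.exists_bound
  obtain ⟨q, hq⟩ := h'.exists_bound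
  refine ⟨3 * p + 3 * q + 1, fun σ O hO loc hl env => hF env ▸ (hp σ O hO loc hl env).bind
    fun v d hv => (hq σ O hO loc hl env).bind fun w e hw => Eff.ensures_tick (Eff.ensures_ret ?_)⟩
  simp; omega

theorem PolyTime.tail {P : Prog} (h : PolyTime C P) : PolyTime C (tail P) := h.of_tree fun _ => rfl

theorem PolyTime.fst {P : Prog} (h : PolyTime C P) : PolyTime C (fst P) := h.of_tree fun _ => rfl

theorem PolyTime.snd {P : Prog} (h : PolyTime C P) : PolyTime C (snd P) := h.of_tree fun _ => rfl

theorem PolyTime.append {P Q : Prog} (h : PolyTime C P) (h' : PolyTime C Q) :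
    PolyTime C (append P Q) := h.of_tree₂ h' fun _ => rfl

theorem PolyTime.pair {P Q : Prog} (h : PolyTime C P) (h' : PolyTime C Q) :
    PolyTime C (pair P Q) := h.of_tree₂ h' fun _ => rfl

theorem PolyTime.eq {P Q : Prog} (h : PolyTime C P) (h' : PolyTime C Q) :
    PolyTime C (eq P Q) := h.of_tree₂ h' fun _ => rfl

theorem PolyTime.oracle {P Q : Prog} (port : ℕ) (h : PolyTime C P) (h' : PolyTime C Q) :
    PolyTime C (oracle port P Q) := by
  obtain ⟨p, hp⟩ := h.exists_bound
  obtain ⟨q, hq⟩ := h'.exists_bound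
  refine ⟨3 * p + 3 * q + 1, fun σ O hO loc hl env => (hp σ O hO loc hl env).bind fun v d hv =>
    (hq σ O hO loc hl env).bind fun w e hw => Eff.ensures_query fun r hr => Eff.ensures_ret ?_⟩
  simp; omega

theorem PolyTime.ite {P Q R : Prog} (h : PolyTime C P) (h' : PolyTime C Q) (h'' : PolyTime C R) :
    PolyTime C (ite P Q R) := by
  obtain ⟨p, hp⟩ := h.exists_bound
  obtain ⟨q, hq⟩ := h'
  obtain ⟨r, hr⟩ := h''
  refine ⟨p + q + r + 1, fun σ O hO loc hl env => (hp σ O hO loc hl env).bind fun v d hv =>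
    Eff.ensures_tick ?_⟩
  split_ifs
  · exact (hq σ O hO loc hl env).mono fun a e he => by simp; omega
  · exact (hr σ O hO loc hl env).mono fun a e he => by simp; omega

theorem PolyTime.letIn {P Q : Prog} (h : PolyTime C P) (h' : PolyTime C Q) :
    PolyTime C (letIn P Q) := by
  obtain ⟨p, hp⟩ := h.exists_bound
  obtain ⟨q, hq⟩ := h'
  refine ⟨p + 1 + q.comp (Polynomial.X + 2 * p + 1), fun σ O hO loc hl env =>
    (hp σ O hO loc hl env).bind fun v d hv =>
    Eff.ensures_tick ((hq σ O hO loc hl _).mono fun a e he => ?_)⟩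
  have := q.eval_mono_nat (m := envSize (v :: env)) (n := envSize env + 2 * p.eval (envSize env) + 1)
    (by rw [envSize_cons]; omega)
  simp [eval_comp] at *
  omega

theorem PolyTime.call {P Q : Prog} (h : PolyTime C P) (h' : PolyTime C Q) :
    PolyTime C (call P Q) := by
  obtain ⟨p, hp⟩ := h'.exists_bound
  obtain ⟨q, hq⟩ := h
  refine ⟨p + 1 + q.comp (2 * p + 1), fun σ O hO loc hl env =>
    (hp σ O hO loc hl env).bind fun v d hv =>
    Eff.ensures_tick ((hq σ O hO loc hl _).mono fun a e he => ?_)⟩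
  have := q.eval_mono_nat (m := envSize [v]) (n := 2 * p.eval (envSize env) + 1)
    (by rw [envSize_singleton]; omega)
  simp [eval_comp] at *
  omega

theorem isPlacement_pair {loc : Str → Cell} (h : IsPlacement loc) (v : Str) :
    IsPlacement fun a => loc (Str.pair v a) :=
  ⟨h.1.comp (Str.pair_injective_right v), fun a b => h.2 _ b⟩

/-- Polynomial time of the body is not enough, since a value might double in each pass. The
invariant has to bound the carried value in terms of the environment outside the loop. -/
theorem PolyTime.loop {n a f : Prog} (hn : PolyTime C n) (ha : PolyTime C a) (hf : PolyTime C f)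
    (Inv : List Str → Str → Prop) (q : Polynomial ℕ)
    (h0 : ∀ (σ : Type) (O : Oracle σ) loc env, Eff.Ensures O loc (a.tree env) fun v _ => Inv env v)
    (h1 : ∀ (σ : Type) (O : Oracle σ) loc env u, Inv env u →
      Eff.Ensures O loc (f.tree (u :: env)) fun v _ => Inv env v)
    (hq : ∀ env u, Inv env u → u.length ≤ q.eval (envSize env)) : PolyTime C (loop n a f) := by
  obtain ⟨p₁, hp₁⟩ := hn.exists_bound
  obtain ⟨p₂, hp₂⟩ := ha
  obtain ⟨p₃, hp₃⟩ := hf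
  refine ⟨3 * p₁ + p₂ + 1 + 2 * p₁ * p₃.comp (Polynomial.X + q + 1), fun σ O hO loc hl env =>
    (hp₁ σ O hO loc hl env).bind fun k d hk =>
    ((hp₂ σ O hO loc hl env).and (h0 σ O loc env)).bind fun v e hv => Eff.ensures_tick ?_⟩
  refine (Eff.ensures_iterate (Inv := fun _ => Inv env)
    (D := (p₃.comp (Polynomial.X + q + 1)).eval (envSize env))
    (fun i u hi hu => ((h1 σ O loc env u hu).and (hp₃ σ O hO loc hl (u :: env))).mono
      fun w e hw => ⟨hw.1, hw.2.trans ?_⟩) hv.2).mono fun w e' hw => ?_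
  · rw [eval_comp]
    apply eval_mono_nat
    have := hq env u hu
    simp [envSize_cons]; omega
  · have h4 : k.length * (p₃.comp (Polynomial.X + q + 1)).eval (envSize env) ≤
      2 * p₁.eval (envSize env) * (p₃.comp (Polynomial.X + q + 1)).eval (envSize env) :=
      Nat.mul_le_mul_right _ hk.2
    simp only [eval_add, eval_mul, eval_ofNat, eval_one]
    omega

theorem interp_silent {σ α : Type} {O : Oracle σ} (hO : SilentOracle σ O) (loc : Str → Cell)
    (t : Eff α) (s : σ) (ψ : QState) (c : ℕ) :
    t.interp O loc ⟨s, ψ, c⟩ =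
      (t.interp noOracle loc ⟨(), ψ, c⟩).map fun o => (o.1, ⟨s, o.2.q, o.2.cost⟩) := by
  induction t generalizing ψ c with
  | ret a => simp [Eff.interp, PMF.pure_map]
  | tick n t ih => simp [Eff.interp, ih]
  | flip k ih => simp [Eff.interp, ih, PMF.map_bind]
  | gate g t ih => simp [Eff.interp, ih]
  | meas x a k ih => simp [Eff.interp, ih, PMF.map_bind]
  | query p m l k ih => simp [Eff.interp, hO p m s ψ, noOracle, ih]

theorem ensures_silent {σ α : Type} {O : Oracle σ} (hO : SilentOracle σ O) {loc : Str → Cell}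
    {t : Eff α} {Q : α → ℕ → Prop} (h : Eff.Ensures noOracle loc t Q) : Eff.Ensures O loc t Q := by
  intro s ψ c o ho
  rw [interp_silent hO, PMF.mem_support_map_iff] at ho
  obtain ⟨o, ho, rfl⟩ := ho
  exact h () ψ c o ho

theorem silentOracle_noOracle : SilentOracle Unit noOracle := fun _ _ _ _ => rfl

theorem PPT.exists_bound {P : Prog} (h : P.PPT) : ∃ p : Polynomial ℕ, ∀ x loc, IsPlacement loc →
    Eff.Ensures noOracle loc (P.tree [x]) fun _ d => d ≤ p.eval x.length := by
  obtain ⟨-, p, hp⟩ := h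
  refine ⟨p, fun x loc hl s ψ c o ho => ?_⟩
  have e := Eff.interp_shift noOracle loc (P.tree [x]) s ψ 0 c
  rw [Nat.zero_add] at e
  rw [e, PMF.mem_support_map_iff] at ho
  obtain ⟨o, ho, rfl⟩ := ho
  refine ⟨o.2.cost, Nat.add_comm _ _, hp x loc ψ hl o ?_⟩
  rw [eval_run]; exact ho

/-- PPT only speaks of executions with `noOracle`, so a direct call is under control only if the
oracle is silent; for other oracles there is `sandbox`. -/
theorem PPT.polyTime_call {P Q : Prog} (h : P.PPT) (h' : PolyTime SilentOracle Q) :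
    PolyTime SilentOracle (.call P Q) := by
  obtain ⟨p, hp⟩ := h.exists_bound
  obtain ⟨q, hq⟩ := h'.exists_bound
  refine ⟨q + 1 + p.comp (2 * q), fun σ O hO loc hl env =>
    (hq σ O hO loc hl env).bind fun v d hv =>
    Eff.ensures_tick ((ensures_silent hO (hp v loc hl)).mono fun a e he => ?_)⟩
  have := p.eval_mono_nat hv.2
  simp [eval_comp] at *
  omega

/-! ### Calls that cannot reach the oracle -/

/-- Call a program, with its oracle queries answered by the empty string. -/
def sandbox (P p : Prog) : Prog := .fst (.simulate (.call P p) (.lit []) (.lit []))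

theorem run_sandbox (P : Prog) {p : Prog} (hp : p.Pure) {σ : Type} (O : Oracle σ)
    (loc : Str → Cell) (env : List Str) (w : σ × QState) :
    ((sandbox P p).tree env).run O loc w =
      ((P.tree [p.val env]).run noOracle loc ((), w.2)).map fun o => (o.1, w.1, o.2.2) := by
  have h1 : ((call P p).tree env).run noOracle loc ((), w.2) =
      (P.tree [p.val env]).run noOracle loc ((), w.2) := by
    simp only [tree, Eff.run_bind, hp.run, PMF.pure_bind, Eff.run]
  have h2 : ((lit []).tree env).run O loc w = PMF.pure ([], w) := rfl
  have h3 := Eff.run_handle_silent ((call P p).tree env) O loc w.1 w.2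
  rw [h1] at h3
  rw [sandbox, tree, Eff.run_bind, tree, Eff.run_bind, h2, PMF.pure_bind, Eff.run_bind]
  simp only
  rw [h3]
  simp only [PMF.bind_map, PMF.bind_bind, Function.comp_def, Eff.run, PMF.pure_bind, Str.fst_pair]
  rfl

theorem run_sandbox_classical {P : Prog} (hP : P.Classical) {p : Prog} (hp : p.Pure) {σ : Type}
    (O : Oracle σ) (loc : Str → Cell) (env : List Str) (w : σ × QState) :
    ((sandbox P p).tree env).run O loc w = (P.run (p.val env)).map fun v => (v, w) := by
  rw [run_sandbox P hp, hP.run_eq, PMF.map_comp]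
  rfl

/-- The constant `K` comes from the ports occurring in `P` and `p`, so it is the same for all
arguments and oracles. The postcondition `Q` speaks of the steps `e` of the program itself, which
lets any time bound of it be carried over. -/
theorem ensures_sandbox (P : Prog) {p : Prog} (hp : p.Pure) : ∃ K : ℕ,
    ∀ (σ : Type) (O : Oracle σ) loc env (Q : Str → ℕ → Prop) (d₀ : ℕ),
      Eff.Ensures noOracle loc (p.tree env) (fun _ d => d ≤ d₀) →
      Eff.Ensures noOracle loc (P.tree [p.val env]) Q →
      Eff.Ensures O loc ((sandbox P p).tree env) fun v d => ∃ e, Q v e ∧ d ≤ K * (e + d₀ + 1) := by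
  obtain ⟨K, hK⟩ := exists_fits (call P p)
  refine ⟨2 * K + 30, fun σ O loc env Q d₀ h0 hQ => ?_⟩
  have h1 : Eff.Ensures noOracle loc ((call P p).tree env)
      fun v d => ∃ e, Q v e ∧ d ≤ e + d₀ + 1 ∧ v.length ≤ 2 * (e + d₀ + 1) := by
    refine ((h0.and (hp.ensures noOracle loc env)).bind (Q' := fun v d =>
      ∃ e, Q v e ∧ d ≤ e + d₀ + 1) fun v d hv => ?_).and (ensures_length (call P p) _ _ _)
      |>.mono fun v d hd => ?_
    · obtain ⟨hv, rfl⟩ := hv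
      exact Eff.ensures_tick (hQ.mono fun a e he => ⟨e, he, by omega⟩)
    · obtain ⟨⟨e, he, he'⟩, h⟩ := hd
      exact ⟨e, he, he', by omega⟩
  have h2 : Eff.Ensures O loc (((call P p).tree env).handle (fun x => (lit []).tree [x]) [])
      fun o d => o.2 = [] ∧ ∃ e, Q o.1 e ∧ d ≤ (2 * K + 10) * (e + d₀ + 1) ∧
        o.1.length ≤ 2 * (e + d₀ + 1) := by
    intro s ψ c o ho
    obtain ⟨d, hd, -⟩ := Eff.ensures_true (((call P p).tree env).handle
      (fun x => (lit []).tree [x]) []) s ψ c o ho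
    obtain ⟨hn, o', ho', hv, hc⟩ := Eff.interp_handle_silent (hK True (Or.inl trivial) env) O loc s ψ c 0 o ho
    obtain ⟨d', hd', e, he, he', he''⟩ := h1 () ψ 0 o' ho'
    refine ⟨d, hd, hn, e, hv ▸ he, ?_, hv ▸ he''⟩
    have : (2 * K + 10) * o'.2.cost ≤ (2 * K + 10) * (e + d₀ + 1) :=
      Nat.mul_le_mul_left _ (by omega)
    omega
  have h3 : Eff.Ensures O loc ((lit []).tree env) fun v d => v = [] ∧ d ≤ 1 :=
    Eff.ensures_tick (Eff.ensures_ret (by simp))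
  rw [sandbox, tree, tree]
  refine (h3.bind (Q' := fun v d => ∃ o e, v = Str.pair o [] ∧ Q o e ∧
    d ≤ (2 * K + 10) * (e + d₀ + 1) + 2 + 2 * (e + d₀ + 1) ∧ o.length ≤ 2 * (e + d₀ + 1))
    fun v d hv => ?_).bind fun v d hv => Eff.ensures_tick (Eff.ensures_ret ?_)
  · obtain ⟨rfl, hd⟩ := hv
    refine h2.bind fun o d ho => Eff.ensures_tick (Eff.ensures_ret ?_)
    obtain ⟨h, e, he, he', hl⟩ := ho
    exact ⟨o.1, e, by rw [h], he, by rw [h]; simp; omega, hl⟩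
  · obtain ⟨o, e, rfl, he, hd, hl⟩ := hv
    refine ⟨e, by rwa [Str.fst_pair], ?_⟩
    rw [Str.length_pair, List.length_nil]
    have : (2 * K + 30) * (e + d₀ + 1) = (2 * K + 10) * (e + d₀ + 1) + 20 * (e + d₀ + 1) := by ring
    omega

/-- This makes the algorithms of the given schemes available to reductions that do have an oracle.
-/
theorem PPT.polyTime_sandbox {P p : Prog} (h : P.PPT) (hp : p.Pure)
    (h' : PolyTime SilentOracle p) : PolyTime AnyOracle (sandbox P p) := by
  obtain ⟨p₁, hp₁⟩ := h.exists_bound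
  obtain ⟨q, hq⟩ := h'.exists_bound
  obtain ⟨K, hK⟩ := ensures_sandbox P hp
  refine ⟨Polynomial.C K * (p₁.comp (2 * q) + q + 1), fun σ O _ loc hl env => ?_⟩
  have h1 := hq Unit noOracle silentOracle_noOracle loc hl env
  -- A pure program has a single value, so its length can be read off from any outcome; the support
  -- is nonempty.
  have hlen : (p.val env).length ≤ 2 * q.eval (envSize env) := by
    obtain ⟨o, ho⟩ := (Eff.interp noOracle loc (p.tree env) ⟨(), QState.zero, 0⟩).support_nonempty
    obtain ⟨d, -, h2⟩ := (h1.and (hp.ensures noOracle loc env)) () QState.zero 0 o ho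
    rw [← h2.2]
    exact h2.1.2
  refine (hK σ O loc env _ _ (h1.mono fun v d hd => hd.1) (hp₁ _ loc hl)).mono
    fun v d ⟨e, he, hd⟩ => hd.trans ?_
  simp only [eval_mul, eval_C, eval_add, eval_comp, eval_one, eval_ofNat]
  have := p₁.eval_mono_nat hlen
  exact Nat.mul_le_mul_left _ (by omega)

end Prog

end


noncomputable section

theorem length_partyInput (n : ℕ) (x st m : Str) :
    (partyInput n x st m).length = 2 * n + 2 * x.length + 2 * st.length + m.length + 6 := by
  simp only [partyInput, Str.length_pair, Str.length_unary]; omega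

/-! ### Loop-free programs, and composition of explicit time bounds. -/

namespace Prog

/-- Pure programs without loops. -/
def Simple : Prog → Prop
  | arg _ | lit _ => True
  | tail p | fst p | snd p => p.Simple
  | append p q | pair p q | eq p q | letIn p q | call p q => p.Simple ∧ q.Simple
  | ite p q r => p.Simple ∧ q.Simple ∧ r.Simple
  | _ => False

theorem Simple.pure {P : Prog} (h : P.Simple) : P.Pure := by
  induction P with
  | arg i | lit v => trivial
  | tail p ihp | fst p ihp | snd p ihp => exact ihp h
  | append p q ihp ihq | pair p q ihp ihq | eq p q ihp ihq | letIn p q ihp ihq | call p q ihp ihq =>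
    exact ⟨ihp h.1, ihq h.2⟩
  | ite p q r ihp ihq ihr => exact ⟨ihp h.1, ihq h.2.1, ihr h.2.2⟩
  | _ => exact h.elim

theorem Simple.polyTime {P : Prog} (h : P.Simple) {C : ∀ σ : Type, Oracle σ → Prop} :
    PolyTime C P := by
  induction P with
  | arg i => exact polyTime_arg i
  | lit v => exact polyTime_lit v
  | tail p ihp => exact (ihp h).tail
  | fst p ihp => exact (ihp h).fst
  | snd p ihp => exact (ihp h).snd
  | append p q ihp ihq => exact (ihp h.1).append (ihq h.2)
  | pair p q ihp ihq => exact (ihp h.1).pair (ihq h.2)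
  | eq p q ihp ihq => exact (ihp h.1).eq (ihq h.2)
  | letIn p q ihp ihq => exact (ihp h.1).letIn (ihq h.2)
  | call p q ihp ihq => exact (ihp h.1).call (ihq h.2)
  | ite p q r ihp ihq ihr => exact (ihp h.1).ite (ihq h.2.1) (ihr h.2.2)
  | _ => exact h.elim

theorem val_isNil (p : Prog) (env : List Str) : (isNil p).val env = [decide (p.val env = [])] := rfl

theorem ppt_of_polyTime {P : Prog} (hc : P.Classical) (h : PolyTime SilentOracle P) : P.PPT := by
  obtain ⟨p, hp⟩ := h
  refine ⟨hc, p.comp (Polynomial.X + 1), fun x loc ψ hl o ho => ?_⟩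
  rw [eval_run] at ho
  obtain ⟨d, hd, hd'⟩ := hp Unit noOracle silentOracle_noOracle loc hl [x] () ψ 0 o ho
  rw [envSize_singleton] at hd'
  simp only [Polynomial.eval_comp, Polynomial.eval_add, Polynomial.eval_X, Polynomial.eval_one]
  omega

/-- Composition of an initial and a final part of a program. -/
theorem ensures_letIn {σ : Type} {O : Oracle σ} {loc : Str → Cell} {p q : Prog} {env : List Str}
    {A B : Str → Prop} {a b : ℕ} (hp : Eff.Ensures O loc (p.tree env) fun v d => A v ∧ d ≤ a)
    (hq : ∀ v, A v → v.length ≤ 2 * a →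
      Eff.Ensures O loc (q.tree (v :: env)) fun v d => B v ∧ d ≤ b) :
    Eff.Ensures O loc ((letIn p q).tree env) fun v d => B v ∧ d ≤ a + 1 + b :=
  (hp.and (ensures_length p O loc env)).bind fun v d hv =>
    Eff.ensures_tick ((hq v hv.1.1 (by omega)).mono fun w e hw => ⟨hw.1, by omega⟩)

theorem ensures_call {σ : Type} {O : Oracle σ} {loc : Str → Cell} {f p : Prog} {env : List Str}
    (hp : p.Pure) {B : Str → Prop} {a b : ℕ}
    (ha : Eff.Ensures O loc (p.tree env) fun v d => d ≤ a)
    (hf : Eff.Ensures O loc (f.tree [p.val env]) fun v d => B v ∧ d ≤ b) :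
    Eff.Ensures O loc ((call f p).tree env) fun v d => B v ∧ d ≤ a + 1 + b :=
  (ha.and (hp.ensures O loc env)).bind fun v d hv =>
    Eff.ensures_tick (hv.2 ▸ hf.mono fun w e hw => ⟨hw.1, by omega⟩)

theorem ensures_ite {σ : Type} {O : Oracle σ} {loc : Str → Cell} {p q r : Prog} {env : List Str}
    (hp : p.Pure) {Q : Str → Prop} {a b : ℕ}
    (ha : Eff.Ensures O loc (p.tree env) fun v d => d ≤ a)
    (hf : Eff.Ensures O loc (if (p.val env).head? = some true then q.tree env else r.tree env)
      fun v d => Q v ∧ d ≤ b) :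
    Eff.Ensures O loc ((ite p q r).tree env) fun v d => Q v ∧ d ≤ a + 1 + b :=
  (ha.and (hp.ensures O loc env)).bind fun v d hv =>
    Eff.ensures_tick (hv.2 ▸ hf.mono fun w e hw => ⟨hw.1, by omega⟩)

end Prog

open Prog Polynomial

/-! ## Running time of parties -/

theorem Reachable.ensures {P : Prog} {loc : Str → Cell} {n : ℕ} {x : Str} {s : Party} {len c : ℕ}
    (h : Reachable P loc n x s len c) (hs : s.out = none) (m : Str) :
    Eff.Ensures noOracle loc (P.tree [partyInput n x s.st m]) fun v d =>
      Reachable P loc n x (partyNext v) (len + (m.length + 1)) (c + d) := by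
  intro s' ψ c' o ho
  have e := Eff.interp_shift noOracle loc (P.tree [partyInput n x s.st m]) s' ψ 0 c'
  rw [Nat.zero_add] at e
  rw [e, PMF.mem_support_map_iff] at ho
  obtain ⟨o, ho, rfl⟩ := ho
  exact ⟨o.2.cost, Nat.add_comm _ _, .step h hs m ψ o (by rw [eval_run]; exact ho)⟩

/-- The state is part of the output of the last activation, and the length of an output is bounded
by the steps of that activation. -/
theorem Reachable.length_le {P : Prog} {loc : Str → Cell} {n : ℕ} {x : Str} {s : Party} {len c : ℕ}
    (h : Reachable P loc n x s len c) : s.st.length ≤ 2 * c := by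
  induction h with
  | init => simp [Party.init]
  | @step s len c h hs m ψ o ho ih =>
    rw [eval_run] at ho
    obtain ⟨d, hd, hl⟩ := P.ensures_length noOracle loc _ () ψ 0 o ho
    have h1 := o.1.snd.length_fst_le
    have h2 := o.1.length_snd_le
    simp only [partyNext]
    omega

/-- The bound for calling a party in a reachable situation. -/
theorem Prog.InteractiveQPT.exists_bound {P : Prog} (h : P.InteractiveQPT) : ∃ p : Polynomial ℕ,
    (∀ n x loc, IsPlacement loc → ∀ s len c, Reachable P loc n x s len c →
      c ≤ p.eval (n + x.length + len)) ∧
    ∀ n x loc, IsPlacement loc → ∀ s len c, Reachable P loc n x s len c → s.out = none →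
      ∀ (m : Str) (N : ℕ), n + x.length + (len + (m.length + 1)) ≤ N →
      Eff.Ensures noOracle loc (P.tree [partyInput n x s.st m]) fun v d =>
        ((∃ c', Reachable P loc n x (partyNext v) (len + (m.length + 1)) c') ∧
          v.length ≤ 2 * p.eval N) ∧ d ≤ p.eval N := by
  obtain ⟨p, hp⟩ := h
  refine ⟨p, hp, fun n x loc hl s len c h hs m N hN => ?_⟩
  refine ((h.ensures hs m).and (P.ensures_length _ _ _)).mono fun v d hv => ?_
  have h1 := hp n x loc hl _ _ _ hv.1
  have h2 := p.eval_mono_nat hN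
  exact ⟨⟨⟨_, hv.1⟩, by omega⟩, by omega⟩

/-! ## Families of executions in polynomial time -/

namespace Prog

/-- The program runs in polynomial time in all environments of the family and its value has the
property `Q`. The parameter `μ` is counted in addition to the size of the environment. -/
def Quick {ι : Type} (loc : ι → Str → Cell) (μ : ι → ℕ) (env : ι → List Str) (P : Prog)
    (Q : ι → Str → Prop) : Prop :=
  ∃ p : Polynomial ℕ, ∀ i, Eff.Ensures noOracle (loc i) (P.tree (env i)) fun v d =>
    Q i v ∧ d ≤ p.eval (μ i + envSize (env i))

variable {ι : Type} {loc : ι → Str → Cell} {μ : ι → ℕ} {env : ι → List Str} {Q R : ι → Str → Prop}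

theorem Quick.mono {P : Prog} (h : Quick loc μ env P Q) (hQ : ∀ i v, Q i v → R i v) :
    Quick loc μ env P R :=
  h.imp fun _ hp i => (hp i).mono fun _ _ hv => ⟨hQ _ _ hv.1, hv.2⟩

theorem PolyTime.quick {P : Prog} (h : PolyTime SilentOracle P) (hl : ∀ i, IsPlacement (loc i))
    (hQ : ∀ i, Eff.Ensures noOracle (loc i) (P.tree (env i)) fun v _ => Q i v) :
    Quick loc μ env P Q :=
  h.imp fun p hp i => ((hp _ _ silentOracle_noOracle _ (hl i) _).and (hQ i)).mono fun _ _ hv =>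
    ⟨hv.2, hv.1.trans (p.eval_mono_nat (Nat.le_add_left _ _))⟩

theorem Simple.quick {P : Prog} (h : P.Simple) (hl : ∀ i, IsPlacement (loc i))
    (hQ : ∀ i, Q i (P.val (env i))) : Quick loc μ env P Q :=
  h.polyTime.quick hl fun i => (h.pure.ensures _ _ _).mono fun _ _ hv => hv ▸ hQ i

theorem Quick.letIn {P P' : Prog} (h : Quick loc μ env P Q)
    (h' : Quick (ι := {j : ι × Str // Q j.1 j.2}) (fun j => loc j.1.1) (fun j => μ j.1.1)
      (fun j => j.1.2 :: env j.1.1) P' fun j => R j.1.1) : Quick loc μ env (letIn P P') R := by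
  obtain ⟨p, hp⟩ := h
  obtain ⟨q, hq⟩ := h'
  refine ⟨p + 1 + q.comp (Polynomial.X + 2 * p + 1), fun i => (ensures_letIn (B := R i)
    (b := q.eval (μ i + envSize (env i) + 2 * p.eval (μ i + envSize (env i)) + 1)) (hp i)
    fun v hv hl => (hq ⟨(i, v), hv⟩).mono fun w d hw => ⟨hw.1, hw.2.trans (q.eval_mono_nat ?_)⟩).mono
      fun w d hw => ⟨hw.1, hw.2.trans (by simp [eval_comp])⟩⟩
  simp only [envSize_cons]
  omega

theorem Quick.call {P a : Prog} (ha : a.Simple) (hl : ∀ i, IsPlacement (loc i))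
    (h : Quick loc μ (fun i => [a.val (env i)]) P Q) : Quick loc μ env (call P a) Q := by
  obtain ⟨p, hp⟩ := ha.quick (loc := loc) (μ := μ) (env := env) (Q := fun i v => v = a.val (env i)) hl
    fun _ => rfl
  obtain ⟨q, hq⟩ := h
  refine ⟨p + 1 + q.comp (Polynomial.X + 2 * p + 1), fun i => ((hp i).and (ensures_length _ _ _ _)).bind
    fun v d hv => Eff.ensures_tick ?_⟩
  obtain ⟨⟨rfl, hd⟩, hl⟩ := hv
  refine (hq i).mono fun w e hw => ⟨hw.1, ?_⟩
  have := hw.2.trans (q.eval_mono_nat (n := μ i + envSize (env i) +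
    2 * p.eval (μ i + envSize (env i)) + 1) (by simp only [envSize_singleton]; omega))
  simp [eval_comp] at *
  omega

theorem Quick.ite {c P P' : Prog} (hc : c.Simple) (hl : ∀ i, IsPlacement (loc i))
    (h : Quick (ι := {i // Accepts (c.val (env i))}) (fun i => loc i.1) (fun i => μ i.1)
      (fun i => env i.1) P fun i => Q i.1)
    (h' : Quick (ι := {i // ¬ Accepts (c.val (env i))}) (fun i => loc i.1) (fun i => μ i.1)
      (fun i => env i.1) P' fun i => Q i.1) : Quick loc μ env (ite c P P') Q := by
  obtain ⟨r, hr⟩ := hc.quick (loc := loc) (μ := μ) (env := env) (Q := fun _ _ => True) hl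
    fun _ => trivial
  obtain ⟨p, hp⟩ := h
  obtain ⟨q, hq⟩ := h'
  refine ⟨r + 1 + (p + q), fun i => (ensures_ite (Q := Q i)
    (b := (p + q).eval (μ i + envSize (env i))) hc.pure ((hr i).mono fun _ _ h => h.2) ?_).mono
    fun w d hw => ⟨hw.1, hw.2.trans (by simp)⟩⟩
  split_ifs with h
  · exact (hp ⟨i, h⟩).mono fun v d hv => ⟨hv.1, hv.2.trans (by simp)⟩
  · exact (hq ⟨i, h⟩).mono fun v d hv => ⟨hv.1, hv.2.trans (by simp)⟩

/-- The total time bound of the party also bounds the next activation. The postcondition may use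
that the new situation is again reachable, which is what keeps an invariant about an inner party
alive. -/
theorem InteractiveQPT.quick {P : Prog} (h : P.InteractiveQPT) (hl : ∀ i, IsPlacement (loc i))
    (hi : ∀ i, ∃ n k si m li c, env i = [partyInput n k si m] ∧ li ≤ μ i ∧
      Reachable P (loc i) n k ⟨si, none⟩ li c ∧ ∀ w c', w.length ≤ 2 * c' →
        Reachable P (loc i) n k (partyNext w) (li + (m.length + 1)) c' → Q i w) :
    Quick loc μ env P Q := by
  obtain ⟨p, hp⟩ := h
  refine ⟨p, fun i => ?_⟩
  obtain ⟨n, k, si, m, li, c, he, hli, hR, hQ⟩ := hi i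
  rw [he]
  refine ((hR.ensures rfl m).and (P.ensures_length _ _ _)).mono fun v d hv => ?_
  have h1 := hp _ _ _ (hl i) _ _ _ hv.1
  have h2 := p.eval_mono_nat (m := n + k.length + (li + (m.length + 1)))
    (n := μ i + envSize [partyInput n k si m]) (by rw [envSize_singleton, length_partyInput]; omega)
  exact ⟨hQ _ _ (hv.2.trans (by omega)) hv.1, by omega⟩

end Prog

/-- A step of a party in a situation that satisfies the invariant `J`. -/
structure Turn (J : ℕ → Str → (Str → Cell) → Party → ℕ → Prop) where
  n : ℕ
  x : Str
  loc : Str → Cell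
  st : Str
  len : ℕ
  m : Str
  placement : IsPlacement loc
  inv : J n x loc ⟨st, none⟩ len

/-- The environment of the program of the party. -/
def Turn.env {J : ℕ → Str → (Str → Cell) → Party → ℕ → Prop} (i : Turn J) : List Str :=
  [partyInput i.n i.x i.st i.m]

/-- The running time of a party that maintains an invariant. -/
theorem interactiveQPT_of_invariant {P : Prog} (J : ℕ → Str → (Str → Cell) → Party → ℕ → Prop)
    (B : Polynomial ℕ) (h0 : ∀ n x loc, J n x loc Party.init 0)
    (hB : ∀ n x loc, IsPlacement loc → ∀ s len, J n x loc s len →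
      s.st.length ≤ B.eval (n + x.length + len))
    (hstep : Quick (Turn.loc (J := J)) Turn.len Turn.env P fun i v =>
      J i.n i.x i.loc (partyNext v) (i.len + (i.m.length + 1))) : P.InteractiveQPT := by
  obtain ⟨p, hp⟩ := hstep
  -- The argument bounds the counted length `len` plus the size of the input of an activation; `B`
  -- accounts for the state, which is doubled by `pair`.
  let q := p.comp (3 * Polynomial.X + 2 * B + 7)
  refine ⟨Polynomial.X * q, fun n x loc hl s len c h => ?_⟩
  -- Each message contributes at least one to `len`, so there are at most `len` activations, each of
  -- cost at most `q`.
  have : J n x loc s len ∧ c ≤ len * q.eval (n + x.length + len) := by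
    induction h with
    | init => exact ⟨h0 n x loc, by simp⟩
    | @step s len c h hs m ψ o ho ih =>
      obtain ⟨st, out⟩ := s
      subst hs
      rw [eval_run] at ho
      obtain ⟨d, hd, hJ, hq⟩ := hp ⟨n, x, loc, st, len, m, hl, ih.1⟩ () ψ 0 o ho
      refine ⟨hJ, ?_⟩
      have h1 := q.eval_mono_nat (m := n + x.length + len)
        (n := n + x.length + (len + (m.length + 1))) (by omega)
      have h2 := ih.2.trans (Nat.mul_le_mul_left _ h1)
      have h3 := (hB n x loc hl _ _ ih.1).trans (B.eval_mono_nat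
        (n := n + x.length + (len + (m.length + 1))) (by omega))
      have h4 := hq.trans (p.eval_mono_nat (n := 3 * (n + x.length + (len + (m.length + 1))) +
        2 * B.eval (n + x.length + (len + (m.length + 1))) + 7) (by
          simp only [Turn.env, envSize_singleton, length_partyInput]
          dsimp only at h3
          omega))
      have h5 : q.eval (n + x.length + (len + (m.length + 1))) ≤
          (m.length + 1) * q.eval (n + x.length + (len + (m.length + 1))) :=
        Nat.le_mul_of_pos_left _ (by omega)
      rw [Nat.add_mul]
      simp only [hd]
      simp only [q, eval_comp, eval_add, eval_mul, eval_ofNat, eval_X] at *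
      omega
  refine this.2.trans ?_
  rw [eval_mul, eval_X]
  exact Nat.mul_le_mul_right _ (by omega)

attribute [local simp] val isNil stOf inpOf msgOf secOf partyIn partyOut partyInput partyNext Simple
  Accepts Str.fst_pair Str.snd_pair Str.fst_nil Str.snd_nil Str.pair_ne_nil Turn.env

/-! ### Running time of the parties of the full scheme. -/

namespace FullScheme

variable {S : MoneyScheme} {M : MACScheme} {E : EncScheme}

theorem keygen_ppt (hM : M.keygen.PPT) (hE : E.keygen.PPT) : (keygen M E).PPT :=
  ppt_of_polyTime ⟨⟨hM.1, trivial⟩, hE.1, trivial⟩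
    ((hM.polyTime_call (polyTime_arg 0)).pair (hE.polyTime_call (polyTime_arg 0)))

/-- Apart from the first activation, each one is an activation of the inner user, so its situation
is reachable. The first message is not passed on, which is why the inner length `li` is only at most
`len`. -/
theorem verifyUser_qpt (hS : S.verifyUser.InteractiveQPT) : (verifyUser S).InteractiveQPT := by
  obtain ⟨p, hp⟩ := id hS
  refine interactiveQPT_of_invariant (fun n x loc s len => (s.st = [] ∧ s.out = none) ∨
    ∃ si li c, s.st = Str.pair [] si ∧ li ≤ len ∧ Reachable S.verifyUser loc n x.snd ⟨si, s.out⟩ li c)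
    (2 + 2 * p) (fun n x loc => Or.inl ⟨rfl, rfl⟩) ?_ ?_
  · rintro n x loc hl ⟨st, out⟩ len (⟨rfl, -⟩ | ⟨si, li, c, rfl, hli, hR⟩)
    · simp
    · have h2 := hR.length_le
      have h3 := hp n x.snd loc hl _ _ _ hR
      have h4 := x.length_snd_le
      have h5 := p.eval_mono_nat (m := n + x.snd.length + li) (n := n + x.length + len) (by omega)
      simp [Str.length_pair] at *
      omega
  · refine Quick.ite (by simp) (fun i => i.placement) (Simple.quick (by simp) (fun i => i.1.placement)
      fun i => Or.inr ⟨[], 0, 0, by simp, by omega, by simpa using .init⟩) (Quick.letIn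
      (Q := fun i w => ∃ li c, li ≤ i.1.len + (i.1.m.length + 1) ∧
        Reachable S.verifyUser i.1.loc i.1.n i.1.x.snd (partyNext w) li c)
      (Quick.call (by simp) (fun i => i.1.placement) (hS.quick (fun i => i.1.placement) ?_))
      (Simple.quick (by simp) (fun i => i.1.1.1.placement) ?_))
    · rintro ⟨i, hi⟩
      obtain ⟨h, -⟩ | ⟨si, li, c, hst, hli, hR⟩ := i.inv
      · simp at h; simp [h] at hi
      · exact ⟨i.n, i.x.snd, si, i.m, li, c, by simp at hst; simp [hst], hli, hR,
          fun w c' _ h => ⟨_, c', by dsimp only; omega, h⟩⟩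
    · rintro ⟨⟨i, w⟩, li, c, hli, hR⟩
      exact Or.inr ⟨w.snd.fst, li, c, by simp, hli, by simpa using hR⟩

/-- The decrypted key need not be a key of the mini-scheme, since any tagged string might be
submitted. Only its length is bounded, by the running time of the first activation; the time bound
of the inner bank holds for every input string and needs no more. -/
theorem verifyBank_qpt (hS : S.verifyBank.InteractiveQPT) (hM : M.verify.PPT) (hE : E.decrypt.PPT) :
    (verifyBank S M E).InteractiveQPT := by
  obtain ⟨p, hp⟩ := id hS
  let b0 : Prog := .ite (.call M.verify (.pair (.fst (inpOf (.arg 0)))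
      (.pair (.fst (msgOf (.arg 0))) (.snd (msgOf (.arg 0))))))
    (partyOut (.lit []) (.pair (.call E.decrypt (.pair (.snd (inpOf (.arg 0)))
      (.fst (msgOf (.arg 0))))) (.lit [])) (.lit [])) (partyOut (.lit [false]) (.lit []) (.lit []))
  have tb0 : PolyTime SilentOracle b0 :=
    (hM.polyTime_call (Simple.polyTime (by simp))).ite ((polyTime_lit _).pair (((hE.polyTime_call
      (Simple.polyTime (by simp))).pair (polyTime_lit _)).pair (polyTime_lit _)))
      (Simple.polyTime (by simp))
  have vb0 : ∀ (env : List Str) (loc : Str → Cell), Eff.Ensures noOracle loc (b0.tree env) fun v _ =>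
      v = Str.pair [false] (Str.pair [] []) ∨ ∃ k, v = Str.pair [] (Str.pair (Str.pair k []) []) := by
    intro env loc
    refine (Eff.ensures_true _).bind fun w d _ => Eff.ensures_tick ?_
    split_ifs
    · refine Eff.ensures_of_run fun s ψ o ho => ?_
      simp only [partyOut, tree, Eff.run_bind, Eff.run, PMF.pure_bind,
        PMF.mem_support_bind_iff, PMF.support_pure, Set.mem_singleton_iff] at ho
      obtain ⟨x, ⟨y, ⟨z, -, rfl⟩, rfl⟩, rfl⟩ := ho
      exact Or.inr ⟨z.1, rfl⟩
    · exact (Pure.ensures (by simp [Prog.Pure]) _ _ _).mono fun v d hv => Or.inl (by rw [hv]; rfl)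
  obtain ⟨q, hq⟩ := tb0.exists_bound
  -- At the first message the state is empty, and `2 * X + 7` bounds the size of the environment. So
  -- `K` bounds the running time of that activation, and `2 * K` the length of the key.
  let K : Polynomial ℕ := q.comp (2 * Polynomial.X + 7)
  refine interactiveQPT_of_invariant (fun n x loc s len => s.st = [] ∨ ∃ k si li c,
    s.st = Str.pair k si ∧ li ≤ len ∧ k.length ≤ 2 * K.eval (n + x.length + len) ∧
      Reachable S.verifyBank loc n k ⟨si, s.out⟩ li c)
    (4 * K + 2 + 2 * p.comp (Polynomial.X + 2 * K)) (fun n x loc => Or.inl rfl) ?_ ?_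
  · rintro n x loc hl ⟨st, out⟩ len (rfl | ⟨k, si, li, c, rfl, hli, hk, hR⟩)
    · simp
    · have h2 := hR.length_le
      have h3 := hp n k loc hl _ _ _ hR
      have h5 := p.eval_mono_nat (m := n + k.length + li) (n := n + x.length + len +
        2 * K.eval (n + x.length + len)) (by omega)
      simp only [Str.length_pair, eval_add, eval_mul, eval_comp, eval_ofNat, eval_X] at *
      omega
  · refine Quick.ite (by simp) (fun i => i.placement) (tb0.quick (fun i => i.1.placement) ?_)
      (Quick.letIn (Q := fun i w => ∃ k li c, i.1.st.fst = k ∧ li ≤ i.1.len + (i.1.m.length + 1) ∧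
        k.length ≤ 2 * K.eval (i.1.n + i.1.x.length + (i.1.len + (i.1.m.length + 1))) ∧
        Reachable S.verifyBank i.1.loc i.1.n k (partyNext w) li c)
      (Quick.call (by simp) (fun i => i.1.placement) (hS.quick (fun i => i.1.placement) ?_))
      (Simple.quick (by simp) (fun i => i.1.1.1.placement) ?_))
    · rintro ⟨i, hi⟩
      refine ((hq _ _ silentOracle_noOracle _ i.placement _).and (vb0 _ _)).mono fun v d hv => ?_
      rcases hv with ⟨⟨-, hv⟩, rfl | ⟨k, rfl⟩⟩
      · exact Or.inl (by simp)
      · refine Or.inr ⟨k, [], 0, 0, by simp, by omega, ?_, by simpa using .init⟩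
        have h1 : i.st = [] := by simpa using hi
        have h2 := q.eval_mono_nat (m := envSize i.env)
          (n := 2 * (i.n + i.x.length + (i.len + (i.m.length + 1))) + 7) (by
            rw [Turn.env, envSize_singleton, length_partyInput, h1]; simp; omega)
        simp only [Str.length_pair, K, eval_comp, eval_add, eval_mul, eval_ofNat, eval_X] at *
        omega
    · rintro ⟨i, hi⟩
      obtain h | ⟨k, si, li, c, hst, hli, hk, hR⟩ := i.inv
      · simp at h; simp [h] at hi
      · exact ⟨i.n, k, si, i.m, li, c, by simp at hst; simp [hst], hli, hR,
          fun w c' _ h => ⟨k, _, c', by simp at hst; simp [hst], by dsimp only; omega,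
            hk.trans (Nat.mul_le_mul_left _ (K.eval_mono_nat (by dsimp only; omega))), h⟩⟩
    · rintro ⟨⟨i, w⟩, k, li, c, rfl, hli, hk, hR⟩
      exact Or.inr ⟨_, w.snd.fst, li, c, by simp, hli, hk, by simpa using hR⟩

theorem mintStart_value (env : List Str) (loc : Str → Cell) :
    Eff.Ensures noOracle loc ((mintStart S M E).tree env) fun v _ => ∃ y, v = Str.pair y [] := by
  refine Eff.ensures_of_run fun s ψ o ho => ?_
  simp only [mintStart, tree, Eff.run_bind, Eff.run, PMF.pure_bind, PMF.mem_support_bind_iff,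
    PMF.support_pure, Set.mem_singleton_iff] at ho
  obtain ⟨_, _, _, _, _, _, rfl⟩ := ho
  exact ⟨_, rfl⟩

theorem mintStart_polyTime (hS : S.keygen.PPT) (hE : E.encrypt.PPT) (hM : M.mac.PPT) :
    PolyTime SilentOracle (mintStart S M E) := by
  refine (hS.polyTime_call (Simple.polyTime ?_)).letIn ((hE.polyTime_call (Simple.polyTime ?_)).letIn
    ((hM.polyTime_call (Simple.polyTime ?_)).letIn (Simple.polyTime ?_))) <;>
  simp [secOf, inpOf, Simple]

theorem mintBank_qpt (hS : S.mintBank.InteractiveQPT) (hk : S.keygen.PPT) (hE : E.encrypt.PPT)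
    (hM : M.mac.PPT) : (mintBank S M E).InteractiveQPT := by
  obtain ⟨p, hp⟩ := id hS
  have tb0 := mintStart_polyTime hk hE hM
  obtain ⟨q, hq⟩ := tb0.exists_bound
  let K : Polynomial ℕ := q.comp (2 * Polynomial.X + 7)
  refine interactiveQPT_of_invariant (fun n x loc s len => (s.st = [] ∧ s.out = none) ∨
    ∃ y si li c, s.st = Str.pair y si ∧ li ≤ len ∧ y.length ≤ 2 * K.eval (n + x.length + len) ∧
      Reachable S.mintBank loc n y.fst ⟨si, s.out⟩ li c)
    (4 * K + 2 + 2 * p.comp (Polynomial.X + 2 * K)) (fun n x loc => Or.inl ⟨rfl, rfl⟩) ?_ ?_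
  · rintro n x loc hl ⟨st, out⟩ len (⟨rfl, -⟩ | ⟨y, si, li, c, rfl, hli, hk, hR⟩)
    · simp
    · have h2 := hR.length_le
      have h3 := hp n y.fst loc hl _ _ _ hR
      have h4 := y.length_fst_le
      have h5 := p.eval_mono_nat (m := n + y.fst.length + li) (n := n + x.length + len +
        2 * K.eval (n + x.length + len)) (by omega)
      simp only [Str.length_pair, eval_add, eval_mul, eval_comp, eval_ofNat, eval_X] at *
      omega
  · refine Quick.letIn (Q := fun i v => ∃ y si li c, v = Str.pair y si ∧ li ≤ i.len ∧
        y.length ≤ 2 * K.eval (i.n + i.x.length + (i.len + (i.m.length + 1))) ∧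
        Reachable S.mintBank i.loc i.n y.fst ⟨si, none⟩ li c)
      (Quick.ite (by simp) (fun i => i.placement) (tb0.quick (fun i => i.1.placement) ?_)
        (Simple.quick (by simp) (fun i => i.1.placement) ?_))
      (Quick.letIn (Q := fun j w => ∃ y li c, j.1.2.fst = y ∧ li ≤ j.1.1.len + (j.1.1.m.length + 1) ∧
        y.length ≤ 2 * K.eval (j.1.1.n + j.1.1.x.length + (j.1.1.len + (j.1.1.m.length + 1))) ∧
        Reachable S.mintBank j.1.1.loc j.1.1.n y.fst (partyNext w) li c)
      (Quick.call (by simp) (fun i => i.1.1.placement) (hS.quick (fun i => i.1.1.placement) ?_))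
      (Simple.quick (by simp) (fun i => i.1.1.1.1.placement) ?_))
    · rintro ⟨i, hi⟩
      refine ((hq _ _ silentOracle_noOracle _ i.placement _).and (mintStart_value _ _)).mono
        fun v d hv => ?_
      obtain ⟨⟨-, hv⟩, y, rfl⟩ := hv
      refine ⟨y, [], 0, 0, rfl, by omega, ?_, .init⟩
      have h1 : i.st = [] := by simpa using hi
      have h2 := q.eval_mono_nat (m := envSize i.env)
        (n := 2 * (i.n + i.x.length + (i.len + (i.m.length + 1))) + 7) (by
          rw [Turn.env, envSize_singleton, length_partyInput, h1]; simp; omega)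
      simp only [Str.length_pair, K, eval_comp, eval_add, eval_mul, eval_ofNat, eval_X] at *
      omega
    · rintro ⟨i, hi⟩
      obtain ⟨h, -⟩ | ⟨y, si, li, c, hst, hli, hk, hR⟩ := i.inv
      · simp at h; simp [h] at hi
      · exact ⟨y, si, li, c, by simpa using hst, hli,
          hk.trans (Nat.mul_le_mul_left _ (K.eval_mono_nat (by dsimp only; omega))), hR⟩
    · rintro ⟨⟨i, v⟩, y, si, li, c, hv, hli, hk, hR⟩
      dsimp only at hv hli
      exact ⟨i.n, y.fst, si, i.m, li, c, by simp [hv], hli, hR,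
        fun w c' _ h => ⟨y, _, c', by simp [hv], by dsimp only; omega, hk, h⟩⟩
    · rintro ⟨⟨⟨⟨i, v⟩, hv⟩, w⟩, y, li, c, rfl, hli, hk, hR⟩
      exact Or.inr ⟨_, w.snd.fst, li, c, by simp, hli, hk, by simpa using hR⟩

/-- The invariant is stated for the decoded components of the state. The empty initial state decodes
to empty components, so it needs no separate case. The last inequality is the length of a twofold
`pair`. -/
theorem mintUser_qpt (hS : S.mintUser.InteractiveQPT) : (mintUser S).InteractiveQPT := by
  obtain ⟨p, hp⟩ := id hS
  refine interactiveQPT_of_invariant (fun n x loc s len => ∃ li c, li ≤ len ∧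
      Reachable S.mintUser loc n x ⟨s.st.snd, s.st.fst.fst.head?⟩ li c ∧
      s.st.fst.fst.length ≤ 2 * c ∧ s.st.fst.snd.length ≤ len ∧
      s.st.length ≤ 4 * s.st.fst.fst.length + 2 * s.st.fst.snd.length + s.st.snd.length + 6)
    (10 * p + 2 * Polynomial.X + 6) (fun n x loc => ⟨0, 0, le_rfl, by
      simpa [Party.init] using .init, by simp [Party.init]⟩) ?_ ?_
  · rintro n x loc hl ⟨st, out⟩ len ⟨li, c, hli, hR, h1, h2, h3⟩
    have h4 := hR.length_le
    have h5 := hp n x loc hl _ _ _ hR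
    have h6 := p.eval_mono_nat (m := n + x.length + li) (n := n + x.length + len) (by omega)
    simp only [eval_add, eval_mul, eval_ofNat, eval_X] at *
    omega
  · refine Quick.letIn (Q := fun i w => ∃ li c, li ≤ i.len + (i.m.length + 1) ∧
        Reachable S.mintUser i.loc i.n i.x (partyNext w) li c ∧ w.fst.length ≤ 2 * c)
      (Quick.ite (by simp) (fun i => i.placement)
        (Quick.call (by simp) (fun i => i.1.placement) (hS.quick (fun i => i.1.placement) ?_))
        (Simple.quick (by simp) (fun i => i.1.placement) ?_))
      (Simple.quick (by simp) (fun i => i.1.1.placement) ?_)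
    · rintro ⟨i, hi⟩
      obtain ⟨li, c, hli, hR, h1, h2, h3⟩ := i.inv
      have h0 : i.st.fst.fst = [] := by simpa using hi
      have h5 := i.m.length_fst_le
      simp only [h0] at hR
      exact ⟨i.n, i.x, i.st.snd, i.m.fst, li, c, by simp, hli, hR, fun w c' hw h =>
        ⟨_, c', by dsimp only; omega, h, w.length_fst_le.trans hw⟩⟩
    · rintro ⟨i, hi⟩
      obtain ⟨li, c, hli, hR, h1, h2, h3⟩ := i.inv
      exact ⟨li, c, by dsimp only; omega, by simpa using hR, by simpa using h1⟩
    · rintro ⟨⟨i, w⟩, li, c, hli, hR, hw⟩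
      obtain ⟨-, -, -, -, -, h2, -⟩ := i.inv
      have h5 := i.m.length_snd_le
      refine ⟨li, c, hli, by simpa using hR, by simpa using hw, ?_, ?_⟩
      · dsimp only at h2
        simp
        split_ifs <;> omega
      · simp [Str.length_pair]
        omega

end FullScheme

theorem fullScheme_isScheme {S : MoneyScheme} {M : MACScheme} {E : EncScheme} (hS : S.IsScheme)
    (hM : M.IsScheme) (hE : E.IsScheme) : (fullScheme S M E).IsScheme where
  keygen_ppt := FullScheme.keygen_ppt hM.keygen_ppt hE.keygen_ppt
  mintBank_qpt := FullScheme.mintBank_qpt hS.mintBank_qpt hS.keygen_ppt hE.encrypt_ppt hM.mac_ppt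
  mintUser_qpt := FullScheme.mintUser_qpt hS.mintUser_qpt
  verifyBank_qpt := FullScheme.verifyBank_qpt hS.verifyBank_qpt hM.verify_ppt hE.decrypt_ppt
  verifyUser_qpt := FullScheme.verifyUser_qpt hS.verifyUser_qpt

theorem fullScheme_semiQuantum {S : MoneyScheme} {M : MACScheme} {E : EncScheme} (hS : S.IsScheme)
    (hM : M.IsScheme) (hE : E.IsScheme) (h : S.SemiQuantum) : (fullScheme S M E).SemiQuantum := by
  have h1 := hS.keygen_ppt.1
  have h2 := hE.encrypt_ppt.1
  have h3 := hM.mac_ppt.1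
  have h4 := hM.verify_ppt.1
  have h5 := hE.decrypt_ppt.1
  have h6 := h.1
  have h7 := h.2
  constructor <;>
  simp [fullScheme, FullScheme.mintBank, FullScheme.verifyBank, FullScheme.mintStart, partyOut,
    partyIn, secOf, inpOf, stOf, msgOf, isNil, Prog.Classical, *]

end


noncomputable section

/-! ## A bank that keeps a ledger -/

namespace Eff

variable {α : Type} {σ σ' : Type}

/-- Oracles related by a map of their states. -/
theorem run_map_state {O : Oracle σ} {O' : Oracle σ'} (e : σ → σ')
    (h : ∀ p m s ψ, O' p m (e s) ψ = (O p m s ψ).map fun o => (o.1, e o.2.1, o.2.2))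
    (loc : Str → Cell) (t : Eff α) (w : σ × QState) :
    t.run O' loc (e w.1, w.2) = (t.run O loc w).map fun o => (o.1, e o.2.1, o.2.2) := by
  induction t generalizing w with
  | ret a => simp [run, PMF.pure_map]
  | tick n t ih => simp [run, ih]
  | flip k ih => simp [run, ih, PMF.map_bind]
  | gate g t ih => simp only [run]; exact ih (w.1, g.act loc w.2)
  | meas s a k ih =>
    simp only [run, PMF.map_bind]
    exact congrArg _ (funext fun x => ih x.1 (w.1, x.2))
  | query p m l k ih =>
    simp only [run, PMF.map_bind, h, PMF.bind_map]
    exact congrArg _ (funext fun x => ih _ x.2)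

/-- An outcome without step count comes from an outcome with step count. -/
theorem exists_interp_of_run {O : Oracle σ} {loc : Str → Cell} {t : Eff α} {s : σ} {ψ : QState}
    {o : α × σ × QState} (h : o ∈ (t.run O loc (s, ψ)).support) (c : ℕ) :
    ∃ o' ∈ (t.interp O loc ⟨s, ψ, c⟩).support, o = (o'.1, o'.2.ora, o'.2.q) := by
  have := run_eq_map_interp O loc t ⟨s, ψ, c⟩
  simp only at this
  rw [this, PMF.mem_support_map_iff] at h
  obtain ⟨o', ho', rfl⟩ := h
  exact ⟨o', ho', rfl⟩

theorem Ensures.of_run {O : Oracle σ} {loc : Str → Cell} {t : Eff α} {Q : α → ℕ → Prop}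
    (h : Ensures O loc t Q) {s : σ} {ψ : QState} {o : α × σ × QState}
    (ho : o ∈ (t.run O loc (s, ψ)).support) : ∃ d, Q o.1 d := by
  obtain ⟨o', ho', rfl⟩ := exists_interp_of_run ho 0
  obtain ⟨d, -, hd⟩ := h _ _ _ _ ho'
  exact ⟨d, hd⟩

theorem mem_ret {O : Oracle σ} {loc : Str → Cell} {a : α} {w : σ × QState}
    {x : α × σ × QState} : x ∈ ((ret a).run O loc w).support ↔ x = (a, w) := by
  simp [run]

theorem mem_bind {β : Type} {O : Oracle σ} {loc : Str → Cell} {t : Eff α} {k : α → Eff β}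
    {w : σ × QState} {x : β × σ × QState} : x ∈ ((t.bind k).run O loc w).support ↔
      ∃ y ∈ (t.run O loc w).support, x ∈ ((k y.1).run O loc y.2).support := by
  rw [run_bind, PMF.mem_support_bind_iff]

end Eff

/-- A run of `mint` or `verify` of the full scheme: kind, whether the key of the mini-scheme is
fixed, the run of `mint` which this key comes from, the key, the pair of ciphertext and tag (for
`mint`), and the situation of the bank of the mini-scheme. -/
structure Entry where
  ver : Bool
  started : Bool
  own : ℕ
  key : Str
  ct : Str
  party : Party

/-- The state of a bank that remembers which key belongs to which ciphertext: number of runs, runs,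
table of ciphertexts, owners of accepted banknotes, results of the verifications of unknown
ciphertexts, a recorded forgery, and total length of the queries. -/
structure Ledger where
  N : ℕ
  log : List (ℕ × Entry)
  tbl : List (Str × ℕ × Str)
  wins : List ℕ
  fresh : List (ℕ × Bool)
  dead : Str
  fuel : ℕ

namespace Ledger

def init : Ledger := ⟨0, [], [], [], [], [], 0⟩

def look (a : Ledger) (i : ℕ) : Option Entry := (a.log.find? fun x => x.1 == i).map Prod.snd

def find (a : Ledger) (c : Str) : Option (ℕ × Str) := (a.tbl.find? fun x => x.1 == c).map Prod.snd

def push (a : Ledger) (ver : Bool) : Ledger :=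
  { a with N := a.N + 1, log := (a.N, ⟨ver, false, 0, [], [], Party.init⟩) :: a.log }

def set (a : Ledger) (i : ℕ) (r : Entry) : Ledger := { a with log := (i, r) :: a.log }

/-- How the bank performs its elementary operations. -/
structure Ops where
  opn : Eff Str
  gen : ℕ → Eff Str
  enc : ℕ → Str → Eff Str
  sign : Str → Eff Str
  vtag : Str → Str → Eff Str
  bank : Bool → ℕ → ℕ → Str → Str → Str → Eff Str
  target : Str

/-- The answer to a query, or the information needed for the next step of the mini-scheme bank. -/
abbrev Prep := (Str × Ledger) ⊕ (Ledger × ℕ × Entry × Str)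

def reject (a : Ledger) (i : ℕ) (r : Entry) : Str × Ledger :=
  (Str.pair [false] [], a.set i { r with party := ⟨[], some false⟩ })

def accept (a : Ledger) (i : ℕ) (r : Entry) (y : ℕ × Str) : Str × Ledger :=
  (Str.pair [] [], a.set i { r with started := true, own := y.1, key := y.2, party := Party.init })

/-- The first message in a run of `verify`. -/
def verStart (o : Ops) (a : Ledger) (i : ℕ) (r : Entry) (c t : Str) : Eff Prep :=
  match a.find c with
  | none =>
    if Str.unary i = o.target then .ret (.inl ([], { a with dead := Str.pair c t }))
    else (o.vtag c t).bind fun v =>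
      .ret (.inl (reject { a with fresh := a.fresh ++ [(i, decide (Accepts v))] } i r))
  | some y => (o.vtag c t).bind fun v =>
      .ret (.inl (if Accepts v then accept a i r y else reject a i r))

/-- The entry of a run of `mint` after its key has been chosen. -/
def minted (a : Ledger) (i : ℕ) (r : Entry) (k c t x : Str) : Ledger × ℕ × Entry × Str :=
  ({ a with tbl := (c, i, k) :: a.tbl }, i,
    { r with started := true, own := i, key := k, ct := Str.pair c t, party := Party.init }, x)

/-- The first message in a run of `mint`. -/
def mintStart (o : Ops) (a : Ledger) (i : ℕ) (r : Entry) (x : Str) : Eff Prep :=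
  (o.gen i).bind fun k => (o.enc i k).bind fun c => (o.sign c).bind fun t =>
    .ret (.inr (minted a i r k c t x))

def message (o : Ops) (a : Ledger) (i : ℕ) (x : Str) : Eff Prep :=
  match a.look i with
  | none => .ret (.inl ([], a))
  | some r =>
    if r.party.out.isSome then .ret (.inl (Str.pair r.party.out.toList [], a))
    else if r.started then .ret (.inr (a, i, r, x))
    else if r.ver then verStart o a i r x.fst x.snd
    else mintStart o a i r x

def live (o : Ops) (a : Ledger) (m : Str) : ℕ → Eff Prep
  | 0 => o.opn.bind fun _ => .ret (.inl ([], a.push false))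
  | 1 => o.opn.bind fun _ => .ret (.inl ([], a.push true))
  | 2 => message o a m.fst.length m.snd
  | _ + 3 => .ret (.inl ([], a))

def spend (a : Ledger) (m : Str) : Ledger := { a with fuel := a.fuel + 1 + m.length }

def prep (o : Ops) (a : Ledger) (p : ℕ) (m : Str) : Eff Prep :=
  if a.dead = [] then live o (a.spend m) m p else .ret (.inl ([], a.spend m))

/-- The effect of the output `v` of the bank of the mini-scheme. -/
def bankDone (a : Ledger) (i : ℕ) (r : Entry) (v : Str) : Str × Ledger :=
  (Str.pair (partyNext v).out.toList
      (if r.ver then partyReply v else Str.pair (partyReply v) (if v.fst = [] then [] else r.ct)),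
    { a.set i { r with party := partyNext v } with
      wins := if r.ver ∧ (partyNext v).out = some true then r.own :: a.wins else a.wins })

def bankStep (o : Ops) (y : Ledger × ℕ × Entry × Str) : Eff (Str × Ledger) :=
  (o.bank y.2.2.1.ver y.2.1 y.2.2.1.own y.2.2.1.key y.2.2.1.party.st y.2.2.2).bind fun v =>
    .ret (bankDone y.1 y.2.1 y.2.2.1 v)

def finish (o : Ops) : Prep → Eff (Str × Ledger)
  | .inl x => .ret x
  | .inr y => bankStep o y

def step (o : Ops) (a : Ledger) (p : ℕ) (m : Str) : Eff (Str × Ledger) :=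
  (prep o a p m).bind (finish o)

/-- The ledger as an oracle whose operations can query another oracle. -/
def oracle {σ : Type} (o : Ops) (O : Oracle σ) (loc : Str → Cell) : Oracle (Ledger × σ) :=
  fun p m s ψ => ((step o s.1 p m).run O loc (s.2, ψ)).map fun x =>
    (x.1.1, (x.1.2, x.2.1), x.2.2)

variable {σ : Type}

/-! ### Elementary properties -/

theorem look_set (a : Ledger) (i j : ℕ) (r : Entry) :
    (a.set i r).look j = if i = j then some r else a.look j := by
  simp only [look, set, List.find?_cons]
  by_cases h : i = j
  · simp [h]
  · simp [h, beq_eq_false_iff_ne.2 h]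

theorem look_push (a : Ledger) (v : Bool) (j : ℕ) : (a.push v).look j =
      if a.N = j then some ⟨v, false, 0, [], [], Party.init⟩ else a.look j := by
  simp only [look, push, List.find?_cons]
  by_cases h : a.N = j
  · simp [h]
  · simp [h, beq_eq_false_iff_ne.2 h]

theorem look_set_cases {a : Ledger} {i j : ℕ} {r r' : Entry} (h : (a.set i r).look j = some r') :
    (i = j ∧ r = r') ∨ a.look j = some r' := by
  rw [look_set] at h
  split_ifs at h with hi
  exacts [.inl ⟨hi, Option.some.inj h⟩, .inr h]

theorem exists_look_set {a : Ledger} {i j : ℕ} {r r₀ : Entry} {q : Entry → Prop}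
    (hr₀ : a.look i = some r₀) (hq : q r₀ → q r) : (∃ r', a.look j = some r' ∧ q r') →
      ∃ r', (a.set i r).look j = some r' ∧ q r' := by
  rintro ⟨r', hr', h⟩
  rw [look_set]
  split_ifs with hi
  · subst hi
    exact ⟨r, rfl, hq (Option.some.inj (hr₀.symm.trans hr') ▸ h)⟩
  · exact ⟨r', hr', h⟩

theorem look_of_look_push {a : Ledger} {v : Bool} {i : ℕ} {r : Entry}
    (hr : (a.push v).look i = some r) (hs : r.started = true) : a.look i = some r := by
  rw [look_push] at hr
  split_ifs at hr
  · obtain rfl := Option.some.inj hr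
    cases hs
  · exact hr

theorem find_cons (a : Ledger) (c : Str) (y : ℕ × Str) (c' : Str) :
    find { a with tbl := (c, y) :: a.tbl } c' = if c = c' then some y else a.find c' := by
  simp only [find, List.find?_cons]
  by_cases h : c = c'
  · simp [h]
  · simp [h, beq_eq_false_iff_ne.2 h]

theorem look_spend (a : Ledger) (m : Str) (i : ℕ) : (a.spend m).look i = a.look i := rfl

/-- Relations between ledgers before and after an operation that hold for all operations. -/
theorem step_invariant {J : Ledger → Prop} (o : Ops) (O : Oracle σ) (loc : Str → Cell)
    (h1 : ∀ a v, J a → J (a.push v)) (h2 : ∀ a i r r₀, a.look i = some r₀ →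
      (r₀.started = true → r.started = true) → J a → J (a.set i r))
    (h3 : ∀ a x, J a → J { a with fresh := a.fresh ++ [x] })
    (h4 : ∀ a x, J a → J { a with dead := x })
    (h5 : ∀ a x, J a → J { a with tbl := x :: a.tbl })
    (h6 : ∀ a x, J a → J { a with wins := x :: a.wins })
    (a : Ledger) (p : ℕ) (m : Str) (ha : J (a.spend m)) (s : σ) (ψ : QState) :
    ∀ x ∈ ((step o a p m).run O loc (s, ψ)).support, J x.1.2 := by
  have hp : ∀ x ∈ ((prep o a p m).run O loc (s, ψ)).support,
      Sum.elim (fun y => J y.2) (fun y => J y.1 ∧ ∃ r₀, y.1.look y.2.1 = some r₀ ∧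
        (r₀.started = true → y.2.2.1.started = true)) x.1 := by
    intro x hx
    unfold prep live message at hx
    split_ifs at hx with hd
    swap; · rw [Eff.mem_ret.1 hx]; exact ha
    split at hx
    pick_goal 4; · rw [Eff.mem_ret.1 hx]; exact ha
    pick_goal 3
    · split at hx
      · rw [Eff.mem_ret.1 hx]; exact ha
      rename_i r hr
      split_ifs at hx with _ _ hs
      · rw [Eff.mem_ret.1 hx]; exact ha
      · rw [Eff.mem_ret.1 hx]; exact ⟨ha, _, hr, id⟩
      · unfold verStart at hx
        split at hx
        · split_ifs at hx
          · rw [Eff.mem_ret.1 hx]; exact h4 _ _ ha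
          · simp only [Eff.mem_bind, Eff.mem_ret] at hx
            obtain ⟨_, _, rfl⟩ := hx
            exact h2 _ _ _ _ hr id (h3 _ _ ha)
        · simp only [Eff.mem_bind, Eff.mem_ret] at hx
          obtain ⟨_, _, rfl⟩ := hx
          simp only [Sum.elim_inl]
          split_ifs
          exacts [h2 _ _ _ _ hr (fun _ => rfl) ha, h2 _ _ _ _ hr id ha]
      · simp only [mintStart, Eff.mem_bind, Eff.mem_ret] at hx
        obtain ⟨_, _, _, _, _, _, rfl⟩ := hx
        exact ⟨h5 _ _ ha, _, hr, fun _ => rfl⟩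
    all_goals
      simp only [Eff.mem_bind, Eff.mem_ret] at hx
      obtain ⟨_, _, rfl⟩ := hx
      exact h1 _ _ ha
  intro x hx
  obtain ⟨⟨y | y, w⟩, hy, hx⟩ := Eff.mem_bind.1 hx
  · rw [Eff.mem_ret.1 hx]; exact hp _ hy
  · simp only [finish, bankStep, Eff.mem_bind, Eff.mem_ret] at hx
    obtain ⟨_, _, rfl⟩ := hx
    obtain ⟨hJ, r₀, hr, hs⟩ := hp _ hy
    simp only [bankDone]
    split_ifs
    exacts [h6 _ _ (h2 _ _ _ _ hr hs hJ), h2 _ _ _ _ hr hs hJ]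

theorem step_fuel (o : Ops) (O : Oracle σ) (loc : Str → Cell) (a : Ledger) (p : ℕ) (m : Str)
    (s : σ) (ψ : QState) :
    ∀ x ∈ ((step o a p m).run O loc (s, ψ)).support, x.1.2.fuel = a.fuel + 1 + m.length :=
  step_invariant o O loc (J := fun b => b.fuel = a.fuel + 1 + m.length) (fun _ _ h => h)
    (fun _ _ _ _ _ _ h => h) (fun _ _ h => h) (fun _ _ h => h) (fun _ _ h => h) (fun _ _ h => h) a p m rfl
    s ψ

theorem step_fresh (o : Ops) (O : Oracle σ) (loc : Str → Cell) (a : Ledger) (p : ℕ) (m : Str)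
    (s : σ) (ψ : QState) :
    ∀ x ∈ ((step o a p m).run O loc (s, ψ)).support, a.fresh <+: x.1.2.fresh :=
  step_invariant o O loc (J := fun b => a.fresh <+: b.fresh) (fun _ _ h => h)
    (fun _ _ _ _ _ _ h => h) (fun _ _ h => h.trans (List.prefix_append _ _)) (fun _ _ h => h)
    (fun _ _ h => h) (fun _ _ h => h) a p m (List.prefix_refl _) s ψ

/-- The first verification of an unknown ciphertext in the run `g` had a positive result. -/
def Bad (a : Ledger) (g : ℕ) : Prop := a.fresh.find? (fun x => x.1 == g) = some (g, true)

theorem find?_prefix {α : Type} {l l' : List α} (h : l <+: l') {q : α → Bool} {x : α}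
    (hx : l.find? q = some x) : l'.find? q = some x := by
  obtain ⟨t, rfl⟩ := h
  rw [List.find?_append, hx]; rfl

end Ledger

end


noncomputable section

namespace Prog

/-! ## Execution of composite programs -/

variable {σ : Type} {O : Oracle σ} {loc : Str → Cell} {env : List Str} {w : σ × QState}

theorem run_call (f : Prog) {p : Prog} (hp : p.Pure) :
    ((call f p).tree env).run O loc w = (f.tree [p.val env]).run O loc w := by
  simp only [tree, Eff.run_bind, hp.run, PMF.pure_bind, Eff.run]

theorem run_call_of_val {f p : Prog} {v : Str} (hp : p.Pure := by simp)
    (hv : p.val env = v := by simp) :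
    ((call f p).tree env).run O loc w = (f.tree [v]).run O loc w := hv ▸ run_call f hp

theorem run_of_val {p : Prog} {v : Str} (hp : p.Pure := by simp)
    (hv : p.val env = v := by simp) :
    (p.tree env).run O loc w = PMF.pure (v, w) := hv ▸ hp.run O loc env w

theorem run_lit (v : Str) : ((lit v).tree env).run O loc w = PMF.pure (v, w) := rfl

theorem run_letIn (p q : Prog) : ((letIn p q).tree env).run O loc w =
      ((p.tree env).run O loc w).bind fun o => (q.tree (o.1 :: env)).run O loc o.2 := by
  simp only [tree, Eff.run_bind, Eff.run]

theorem run_ite (p q r : Prog) : ((ite p q r).tree env).run O loc w =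
      ((p.tree env).run O loc w).bind fun o =>
        if Accepts o.1 then (q.tree env).run O loc o.2 else (r.tree env).run O loc o.2 := by
  simp only [tree, Eff.run_bind, Eff.run]
  refine congrArg _ (funext fun o => ?_)
  by_cases h : Accepts o.1
  · rw [if_pos h, if_pos (show o.1.head? = some true from h)]
  · rw [if_neg h, if_neg (show ¬ o.1.head? = some true from h)]

theorem run_ite_pure {p : Prog} (hp : p.Pure) (q r : Prog) : ((ite p q r).tree env).run O loc w =
      if Accepts (p.val env) then (q.tree env).run O loc w
      else (r.tree env).run O loc w := by
  rw [run_ite, hp.run, PMF.pure_bind]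

theorem run_ite_pos {p q r : Prog} (hp : p.Pure := by simp) (h : Accepts (p.val env) := by simp) :
    ((ite p q r).tree env).run O loc w = (q.tree env).run O loc w := by
  rw [run_ite_pure hp, if_pos h]

theorem run_ite_neg {p q r : Prog} (hp : p.Pure := by simp) (h : ¬ Accepts (p.val env) := by simp) :
    ((ite p q r).tree env).run O loc w = (r.tree env).run O loc w := by
  rw [run_ite_pure hp, if_neg h]

theorem run_pair (p q : Prog) : ((pair p q).tree env).run O loc w =
      ((p.tree env).run O loc w).bind fun o => ((q.tree env).run O loc o.2).bind fun o' =>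
        PMF.pure (Str.pair o.1 o'.1, o'.2) := by
  simp only [tree, Eff.run_bind, Eff.run]

end Prog

open Prog

/-- The reaction of a party to a message, and the new state of the quantum memory. -/
def partyRun (P : Prog) (loc : Str → Cell) (n : ℕ) (x st m : Str) (ψ : QState) :
    PMF (Str × QState) :=
  ((P.tree [partyInput n x st m]).run noOracle loc ((), ψ)).map fun o => (o.1, o.2.2)

theorem activate_none (P : Prog) (loc : Str → Cell) (n : ℕ) (x st m : Str) (ψ : QState) :
    activate P loc n x ⟨st, none⟩ m ψ =
      (partyRun P loc n x st m ψ).map fun o => (partyReply o.1, partyNext o.1, o.2) := by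
  have := Eff.run_eq_map_interp noOracle loc (P.tree [partyInput n x st m]) ⟨(), ψ, 0⟩
  simp only at this
  rw [partyRun, this, PMF.map_comp, PMF.map_comp]
  simp only [activate, eval_run]
  rfl

theorem activate_some (P : Prog) (loc : Str → Cell) (n : ℕ) (x st m : Str) (b : Bool) (ψ : QState) :
    activate P loc n x ⟨st, some b⟩ m ψ = PMF.pure ([], ⟨st, some b⟩, ψ) := rfl

theorem run_tree_eq_partyRun (P : Prog) (loc : Str → Cell) (n : ℕ) (x st m : Str) (ψ : QState) :
    (P.tree [partyInput n x st m]).run noOracle loc ((), ψ) =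
      (partyRun P loc n x st m ψ).map fun o => (o.1, (), o.2) := by
  rw [partyRun, PMF.map_comp]
  exact (PMF.map_id _).symm

/-! ### Activations of the full scheme expressed through those of the mini-scheme. -/

namespace FullScheme

attribute [local simp] Accepts val isNil stOf inpOf msgOf secOf partyIn partyOut partyInput Prog.Pure
  Str.fst_pair Str.snd_pair Str.pair_ne_nil

variable {S : MoneyScheme} {M : MACScheme} {E : EncScheme} {loc : Str → Cell} {n : ℕ}
  {km ke : Str} {ψ : QState}

theorem partyRun_verifyBank_start (hM : M.verify.Classical) (hE : E.decrypt.Classical) (m : Str) :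
    partyRun (verifyBank S M E) loc n (Str.pair km ke) [] m ψ =
      (M.verify.run (Str.pair km (Str.pair m.fst m.snd))).bind fun r =>
        if Accepts r then (E.decrypt.run (Str.pair ke m.fst)).map fun k =>
          (Str.pair [] (Str.pair (Str.pair k []) []), ψ)
        else PMF.pure (Str.pair [false] (Str.pair [] []), ψ) := by
  rw [partyRun, verifyBank, run_ite_pos, run_ite,
    run_call_of_val (v := Str.pair km (Str.pair m.fst m.snd)), hM.run_eq,
    PMF.bind_map, PMF.map_bind]
  refine congrArg _ (funext fun r => ?_)
  rw [Function.comp_apply]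
  dsimp only
  split_ifs
  · simp only [partyOut, run_pair, run_lit, run_call_of_val (v := Str.pair ke m.fst) (f := E.decrypt)
      (env := [partyInput n (Str.pair km ke) [] m])
      (p := .pair (.snd (inpOf (.arg 0))) (.fst (msgOf (.arg 0)))), hE.run_eq,
      PMF.bind_map, PMF.bind_bind, PMF.map_bind, PMF.pure_bind, PMF.pure_map, Function.comp_def]
    rfl
  · rw [Prog.Pure.run (by simp), PMF.pure_map]
    rfl

theorem partyRun_verifyBank (k st m : Str) :
    partyRun (verifyBank S M E) loc n (Str.pair km ke) (Str.pair k st) m ψ =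
      (partyRun S.verifyBank loc n k st m ψ).map fun o =>
        (Str.pair o.1.fst (Str.pair (Str.pair k o.1.snd.fst) o.1.snd.snd), o.2) := by
  rw [partyRun, verifyBank, run_ite_neg, run_letIn,
    run_call_of_val (v := partyInput n k st m), run_tree_eq_partyRun,
    PMF.bind_map, PMF.map_bind]
  refine congrArg _ (funext fun o => ?_)
  rw [Function.comp_apply, Prog.Pure.run (by simp), PMF.pure_map]
  simp

/-- What the bank in `mint` makes of the output `v` of the bank of the mini-scheme. -/
def mintWrap (k ct v : Str) : Str := Str.pair v.fst (Str.pair (Str.pair (Str.pair k ct) v.snd.fst)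
    (Str.pair v.snd.snd (if v.fst = [] then [] else ct)))

theorem run_mintBank_rest (k ct st m x st₀ : Str) : ((letIn (call S.mintBank
        (partyIn (secOf (.arg 1)) (.fst (.fst (.arg 0))) (.snd (.arg 0)) (msgOf (.arg 1))))
      (partyOut (.fst (.arg 0)) (.pair (.fst (.arg 1)) (.fst (.snd (.arg 0))))
        (.pair (.snd (.snd (.arg 0)))
          (.ite (isNil (.fst (.arg 0))) (.lit []) (.snd (.fst (.arg 1))))))).tree
        [Str.pair (Str.pair k ct) st, partyInput n x st₀ m]).run noOracle loc ((), ψ) =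
      (partyRun S.mintBank loc n k st m ψ).map fun o => (mintWrap k ct o.1, (), o.2) := by
  rw [run_letIn, run_call_of_val (v := partyInput n k st m), run_tree_eq_partyRun, PMF.bind_map]
  refine congrArg _ (funext fun o => ?_)
  rw [Function.comp_apply, Prog.Pure.run (by simp)]
  simp [mintWrap]

theorem partyRun_mintBank (k ct st m x : Str) :
    partyRun (mintBank S M E) loc n x (Str.pair (Str.pair k ct) st) m ψ =
      (partyRun S.mintBank loc n k st m ψ).map fun o => (mintWrap k ct o.1, o.2) := by
  rw [partyRun, mintBank, run_letIn, run_ite_neg,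
    Prog.Pure.run (by simp), PMF.pure_bind,
    show (stOf (.arg 0)).val [partyInput n x (Str.pair (Str.pair k ct) st) m] =
      Str.pair (Str.pair k ct) st by simp, run_mintBank_rest, PMF.map_comp]
  rfl

theorem run_mintStart (hS : S.keygen.Classical) (hE : E.encrypt.Classical) (hM : M.mac.Classical)
    (m st₀ : Str) :
    ((mintStart S M E).tree [partyInput n (Str.pair km ke) st₀ m]).run noOracle loc ((), ψ) =
      (S.keygen.run (Str.unary n)).bind fun k => (E.encrypt.run (Str.pair ke k)).bind fun c =>
        (M.mac.run (Str.pair km c)).map fun t =>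
          (Str.pair (Str.pair k (Str.pair c t)) [], (), ψ) := by
  rw [mintStart, run_letIn, run_call_of_val (v := Str.unary n), hS.run_eq, PMF.bind_map]
  refine congrArg _ (funext fun k => ?_)
  rw [Function.comp_apply, run_letIn, run_call_of_val (v := Str.pair ke k), hE.run_eq, PMF.bind_map]
  refine congrArg _ (funext fun c => ?_)
  rw [Function.comp_apply, run_letIn, run_call_of_val (v := Str.pair km c), hM.run_eq, PMF.bind_map]
  refine congrArg _ (funext fun t => ?_)
  rw [Function.comp_apply, Prog.Pure.run (by simp)]
  rfl

theorem partyRun_mintBank_start (hS : S.keygen.Classical) (hE : E.encrypt.Classical)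
    (hM : M.mac.Classical) (m : Str) :
    partyRun (mintBank S M E) loc n (Str.pair km ke) [] m ψ =
      (S.keygen.run (Str.unary n)).bind fun k => (E.encrypt.run (Str.pair ke k)).bind fun c =>
        (M.mac.run (Str.pair km c)).bind fun t =>
          (partyRun S.mintBank loc n k [] m ψ).map fun o => (mintWrap k (Str.pair c t) o.1, o.2) := by
  rw [partyRun, mintBank, run_letIn, run_ite_pure (by simp), if_pos,
    run_mintStart hS hE hM]
  · simp only [PMF.bind_bind, PMF.bind_map, Function.comp_def, PMF.map_bind]
    refine congrArg _ (funext fun k => congrArg _ (funext fun c => congrArg _ (funext fun t => ?_)))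
    rw [run_mintBank_rest, PMF.map_comp]
    rfl
  · simp [Accepts, val, isNil, stOf, partyInput, Str.fst_pair, Str.snd_pair]

end FullScheme

end


noncomputable section

/-! ## The counterfeiting game of the full scheme in terms of the ledger -/

/-- Converts a count of list entries into the cardinality of a set of indices; owners are indices of
runs, and the pigeonhole argument compares the two. -/
theorem List.card_filter_range_eq_countP {α : Type} (l : List α) (q : α → Bool) :
    ((Finset.range l.length).filter fun i => l[i]?.any q).card =
      l.countP q := by
  induction l using List.reverseRecOn with
  | nil => simp
  | append_singleton l x ih =>
    have h1 : (Finset.range l.length).filter (fun i => (l ++ [x])[i]?.any q) =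
        (Finset.range l.length).filter fun i => l[i]?.any q := by
      refine Finset.filter_congr fun i hi => ?_
      rw [List.getElem?_append_left (Finset.mem_range.1 hi)]
    rw [List.length_append, List.length_singleton, Finset.range_add_one, Finset.filter_insert, h1,
      List.countP_append, List.countP_singleton, ← ih]
    by_cases hx : q x = true
    · rw [if_pos (by simp [hx]), Finset.card_insert_of_notMem (by simp), if_pos hx]
    · rw [if_neg (by simpa using hx), if_neg hx, Nat.add_zero]

namespace Ledger

variable (S : MoneyScheme) (M : MACScheme) (E : EncScheme) (n : ℕ) (km ke : Str)

/-- The program of the bank in a run. -/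
def bankProg (ver : Bool) : Prog := if ver then S.verifyBank else S.mintBank

/-- The operations with known keys. In run `j` a string of ones is encrypted if `b` is false. The
key in run `j` is given by `kst`, if any. -/
def gameOps (j : ℕ) (b : Bool) (kst : Option Str) : Ops where
  opn := .ret []
  gen i := if i = j ∧ kst.isSome then .ret (kst.getD []) else S.keygen.tree [Str.unary n]
  enc i k := E.encrypt.tree
    [Str.pair ke (if i = j ∧ b = false then Str.unary k.length else k)]
  sign c := M.mac.tree [Str.pair km c]
  vtag c t := M.verify.tree [Str.pair km (Str.pair c t)]
  bank ver i _ key st x :=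
    ((bankProg S ver).tree [partyInput n key st x]).relocate (Str.unary (i + 1))
  -- Not a unary string, so no run of the game is ever stopped to record a forgery.
  target := [false]

/-- The placement that puts the memory below the address `pair v a` of length-`i` strings `v` into
the private memory of party `i`. -/
def spread (a : Str) : Cell := Cell.priv a.fst.length a.snd

theorem spread_pair_unary (i : ℕ) : (fun a => spread (Str.pair (Str.unary i) a)) = Cell.priv i := by
  funext a; simp [spread, Str.fst_pair, Str.snd_pair, Str.length_unary]

/-- The run of the full scheme corresponding to an entry. -/
def _root_.Entry.session (r : Entry) : Session :=
  ⟨r.ver, ⟨if r.started then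
    (if r.ver then Str.pair r.key r.party.st else Str.pair (Str.pair r.key r.ct) r.party.st)
    else [], r.party.out⟩⟩

def success (s : Session) : Bool := s.isVerify && s.party.out == some true

/-- Correspondence of the runs of the full scheme and the ledger. -/
structure FullRel (runs : List Session) (a : Ledger) : Prop where
  dead : a.dead = []
  len : runs.length = a.N
  some : ∀ i, i < a.N → ∃ r, a.look i = some r ∧ runs[i]? = Option.some r.session
  none : ∀ i, a.N ≤ i → a.look i = Option.none
  tbl : ∀ c j k, a.find c = Option.some (j, k) → c ∈ (E.encrypt.run (Str.pair ke k)).support ∧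
    ∃ r, a.look j = Option.some r ∧ r.ver = false
  own : ∀ i r, a.look i = Option.some r → r.started = true →
    ∃ r', a.look r.own = Option.some r' ∧ r'.ver = false
  wins : ∀ j ∈ a.wins, ∃ r, a.look j = Option.some r ∧ r.ver = false
  count : a.wins.length = runs.countP success
  fresh : ∀ x ∈ a.fresh, x.2 = false ∧ ∃ r, a.look x.1 = Option.some r ∧ r.party.out.isSome = true
  fuel : a.N ≤ a.fuel

variable {E ke} {runs : List Session} {a : Ledger}

theorem FullRel.spend (h : FullRel E ke runs a) (m : Str) : FullRel E ke runs (a.spend m) :=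
  ⟨h.dead, h.len, h.some, h.none, h.tbl, h.own, h.wins, h.count, h.fresh,
    h.fuel.trans (by simp only [Ledger.spend]; omega)⟩

theorem fullRel_init : FullRel E ke [] init := by
  refine ⟨rfl, rfl, ?_, ?_, ?_, ?_, ?_, rfl, ?_, le_refl _⟩ <;> simp [init, look, find]

theorem FullRel.lt (h : FullRel E ke runs a) {i : ℕ} {r : Entry} (hr : a.look i = Option.some r) :
    i < a.N := by
  by_contra hi
  rw [h.none i (not_lt.1 hi)] at hr
  simp at hr

theorem FullRel.get (h : FullRel E ke runs a) {i : ℕ} {r : Entry} (hr : a.look i = Option.some r) :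
    runs[i]? = Option.some r.session := by
  obtain ⟨r', h1, h2⟩ := h.some i (h.lt hr)
  rw [hr] at h1
  obtain rfl := Option.some.inj h1
  exact h2

theorem FullRel.push (h : FullRel E ke runs a) (hf : a.N < a.fuel) (v : Bool) :
    FullRel E ke (runs ++ [⟨v, Party.init⟩]) (a.push v) := by
  have hl : ∀ {i r}, a.look i = Option.some r → (a.push v).look i = Option.some r := by
    intro i r hr
    rw [look_push, if_neg (h.lt hr).ne', hr]
  have hl' : ∀ {q : Entry → Prop} {i}, (∃ r, a.look i = Option.some r ∧ q r) →
      ∃ r, (a.push v).look i = Option.some r ∧ q r := fun ⟨r, hr, hq⟩ => ⟨r, hl hr, hq⟩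
  refine ⟨h.dead, ?_, fun i hi => ?_, fun i hi => ?_, fun c j k hc => ?_, fun i r hr hs => ?_,
    fun j hj => hl' (h.wins j hj), ?_, fun x hx => ⟨(h.fresh x hx).1, hl' (h.fresh x hx).2⟩, hf⟩
  · simp [Ledger.push, h.len]
  · rcases Nat.lt_succ_iff_lt_or_eq.1 hi with hi | rfl
    · obtain ⟨r, h1, h2⟩ := h.some i hi
      exact ⟨r, hl h1, by rw [List.getElem?_append_left (by rw [h.len]; exact hi), h2]⟩
    · refine ⟨_, by rw [look_push, if_pos rfl], ?_⟩
      rw [← h.len, List.getElem?_append_right (le_refl _)]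
      simp [Entry.session, Party.init]
  · have hi' : a.N < i := hi
    rw [look_push, if_neg hi'.ne, h.none i hi'.le]
  · obtain ⟨h1, h2⟩ := h.tbl c j k hc
    exact ⟨h1, hl' h2⟩
  · exact hl' (h.own i r (look_of_look_push hr hs) hs)
  · simp only [Ledger.push, List.countP_append, h.count]
    simp [success, Party.init]

/-- Updating a run that has not ended. -/
theorem FullRel.set (h : FullRel E ke runs a) {i : ℕ} {r₀ r : Entry}
    (hr₀ : a.look i = Option.some r₀) (hout : r₀.party.out = Option.none) (hver : r.ver = r₀.ver)
    (hown : r.started = true → ∃ r', a.look r.own = Option.some r' ∧ r'.ver = false)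
    (hst : r.started = true ∨ r.party.out ≠ Option.some true) :
    FullRel E ke (runs.set i r.session) { a.set i r with
      wins := if r.ver ∧ r.party.out = Option.some true then r.own :: a.wins else a.wins } := by
  set a' : Ledger := { a.set i r with
      wins := if r.ver ∧ r.party.out = Option.some true then r.own :: a.wins else a.wins } with ha'
  have hlook : ∀ j, a'.look j = if i = j then Option.some r else a.look j := fun j => look_set a i j r
  have hi := h.lt hr₀
  have hl' : ∀ {j}, (∃ r', a.look j = Option.some r' ∧ r'.ver = false) →
      ∃ r', a'.look j = Option.some r' ∧ r'.ver = false := exists_look_set hr₀ hver.trans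
  refine ⟨h.dead, ?_, fun j hj => ?_, fun j hj => ?_, fun c j k hc => ?_, fun j r' hr' hs => ?_,
    fun j hj => ?_, ?_, fun x hx => ?_, h.fuel⟩
  · rw [List.length_set]; exact h.len
  · by_cases hij : i = j
    · subst hij
      exact ⟨r, by rw [hlook, if_pos rfl], by
        rw [List.getElem?_set_self (by rw [h.len]; exact hi)]⟩
    · obtain ⟨r', h1, h2⟩ := h.some j hj
      exact ⟨r', by rw [hlook, if_neg hij, h1], by rw [List.getElem?_set_ne hij, h2]⟩
  · have hj' : a.N ≤ j := hj
    rw [hlook, if_neg (by omega), h.none j hj']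
  · obtain ⟨h1, h2⟩ := h.tbl c j k hc
    exact ⟨h1, hl' h2⟩
  · rcases look_set_cases hr' with ⟨-, rfl⟩ | hr'
    exacts [hl' (hown hs), hl' (h.own j r' hr' hs)]
  · simp only [ha'] at hj
    split_ifs at hj with hw
    · rcases List.mem_cons.1 hj with rfl | hj
      · exact hl' (hown (hst.resolve_right fun h => h hw.2))
      · exact hl' (h.wins j hj)
    · exact hl' (h.wins j hj)
  · have hlt : i < runs.length := by rw [h.len]; exact hi
    have hg : runs[i] = r₀.session := by
      have := h.get hr₀
      rw [List.getElem?_eq_getElem hlt] at this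
      exact Option.some.inj this
    have e1 : success runs[i] = false := by
      rw [hg]; simp [success, Entry.session, hout]
    have e2 : success r.session = true ↔ (r.ver ∧ r.party.out = Option.some true) := by
      simp [success, Entry.session]
    simp only [ha']
    rw [List.countP_set hlt, e1]
    by_cases hw : r.ver ∧ r.party.out = Option.some true
    · rw [if_pos hw, if_pos (e2.2 hw)]
      simp [h.count]
    · rw [if_neg hw, if_neg (fun hh => hw (e2.1 hh))]
      simp [h.count]
  · obtain ⟨h1, r', h2, h3⟩ := h.fresh x hx
    refine ⟨h1, r', ?_, h3⟩
    rw [hlook, if_neg, h2]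
    rintro rfl
    rw [hr₀] at h2
    obtain rfl := Option.some.inj h2
    simp [hout] at h3

theorem FullRel.insert (h : FullRel E ke runs a) {i : ℕ} {r : Entry} {c k : Str}
    (hr : a.look i = Option.some r) (hv : r.ver = false)
    (hc : c ∈ (E.encrypt.run (Str.pair ke k)).support) :
    FullRel E ke runs { a with tbl := (c, i, k) :: a.tbl } := by
  refine ⟨h.dead, h.len, h.some, h.none, fun c' j k' hc' => ?_, h.own, h.wins, h.count, h.fresh,
    h.fuel⟩
  rw [find_cons] at hc'
  split_ifs at hc' with hcc
  · subst hcc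
    obtain ⟨rfl, rfl⟩ := Prod.mk.inj (Option.some.inj hc')
    exact ⟨hc, r, hr, hv⟩
  · exact h.tbl c' j k' hc'

/-- The counterfeiter wins only if some verification of an unknown ciphertext succeeded or some
banknote was accepted twice. -/
theorem FullRel.exists_count (h : FullRel E ke runs a)
    (hw : runs.countP (fun s => !s.isVerify) < runs.countP success) :
    ∃ j < a.fuel, 2 ≤ a.wins.count j := by
  by_contra hc
  push Not at hc
  have hN : ∀ j ∈ a.wins, j < a.N := fun j hj => by
    obtain ⟨r, hr, -⟩ := h.wins j hj
    exact h.lt hr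
  -- If no owner occurs twice, the list of owners is a set of runs of `mint`, and there would be at
  -- most as many acceptances as runs of `mint`.
  have hnd : a.wins.Nodup := List.nodup_iff_count_le_one.2 fun j => by
    by_cases hj : j ∈ a.wins
    · have := hc j ((hN j hj).trans_le h.fuel); omega
    · rw [List.count_eq_zero_of_not_mem hj]; omega
  have h1 : a.wins.toFinset ⊆ (Finset.range runs.length).filter fun i =>
      runs[i]?.any fun x => !x.isVerify := by
    intro j hj
    have hj' := List.mem_toFinset.1 hj
    obtain ⟨r, hr, hv⟩ := h.wins j hj'
    rw [Finset.mem_filter, Finset.mem_range, h.len]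
    exact ⟨hN j hj', by simp [h.get hr, Entry.session, hv]⟩
  have h2 := Finset.card_le_card h1
  rw [List.card_filter_range_eq_countP, List.toFinset_card_of_nodup hnd, h.count] at h2
  omega

end Ledger

end


noncomputable section

/-! ### Simulation of the full scheme by the ledger, up to forgeries. -/

theorem MoneyScheme.bankOracle_none (S : MoneyScheme) (n : ℕ) (k m : Str) {runs : List Session}
    (ψ : QState) (h : runs[m.fst.length]? = none) :
    S.bankOracle n k 2 m runs ψ = PMF.pure ([], runs, ψ) := by
  simp only [bankOracle, h]; rfl

theorem MoneyScheme.bankOracle_some (S : MoneyScheme) (n : ℕ) (k m : Str) {runs : List Session}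
    (ψ : QState) {s : Session} (h : runs[m.fst.length]? = some s) :
    S.bankOracle n k 2 m runs ψ =
      (activate (if s.isVerify then S.verifyBank else S.mintBank) (Cell.priv (m.fst.length + 1)) n k
        s.party m.snd ψ).map fun o =>
          (Str.pair o.2.1.out.toList o.1, runs.set m.fst.length ⟨s.isVerify, o.2.1⟩, o.2.2) := by
  simp only [bankOracle, h]; rfl

namespace Ledger

variable {S : MoneyScheme} {M : MACScheme} {E : EncScheme} {n : ℕ} {km ke : Str} {j : ℕ} {b : Bool}
  {kst : Option Str}

theorem run_bankStep (a : Ledger) (i : ℕ) (r : Entry) (x : Str) (ψ : QState) :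
    (bankStep (gameOps S M E n km ke j b kst) (a, i, r, x)).run noOracle spread ((), ψ) =
      (partyRun (bankProg S r.ver) (Cell.priv (i + 1)) n r.key r.party.st x ψ).map fun v =>
        (bankDone a i r v.1, (), v.2) := by
  simp only [bankStep, gameOps, Eff.run_bind, Eff.run_relocate, spread_pair_unary, Eff.run,
    run_tree_eq_partyRun, PMF.bind_map, Function.comp_def]
  rfl

/-- The distribution of the keys. -/
def keyDist (S : MoneyScheme) (n j : ℕ) (kst : Option Str) (i : ℕ) : PMF Str :=
  if i = j ∧ kst.isSome then PMF.pure (kst.getD []) else S.keygen.run (Str.unary n)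

/-- The distribution of the ciphertexts. -/
def encDist (E : EncScheme) (ke : Str) (j : ℕ) (b : Bool) (i : ℕ) (k : Str) : PMF Str :=
  E.encrypt.run (Str.pair ke (if i = j ∧ b = false then Str.unary k.length else k))

theorem run_mintStart (hS : S.keygen.Classical) (hE : E.encrypt.Classical) (hM : M.mac.Classical)
    (a : Ledger) (i : ℕ) (r : Entry) (x : Str) (ψ : QState) :
    (mintStart (gameOps S M E n km ke j b kst) a i r x).run noOracle spread ((), ψ) =
      (keyDist S n j kst i).bind fun k => (encDist E ke j b i k).bind fun c =>
        (M.mac.run (Str.pair km c)).map fun t => (.inr (minted a i r k c t x), (), ψ) := by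
  have h1 : ((gameOps S M E n km ke j b kst).gen i).run noOracle spread ((), ψ) =
      (keyDist S n j kst i).map fun k => (k, (), ψ) := by
    simp only [gameOps, keyDist]
    split_ifs
    · rw [PMF.pure_map]; rfl
    · exact hS.run_eq _ _ _
  rw [mintStart, Eff.run_bind, h1, PMF.bind_map]
  refine congrArg _ (funext fun k => ?_)
  simp only [Function.comp_apply, gameOps, Eff.run_bind, hE.run_eq, hM.run_eq, PMF.bind_map,
    Function.comp_def, Eff.run]
  rfl

theorem run_vtag (hM : M.verify.Classical) (c t : Str) (ψ : QState) :
    ((gameOps S M E n km ke j b kst).vtag c t).run noOracle spread ((), ψ) =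
      (M.verify.run (Str.pair km (Str.pair c t))).map fun v => (v, (), ψ) :=
  hM.run_eq _ _ _

theorem run_step {σ : Type} (o : Ops) (O : Oracle σ) (loc : Str → Cell) (a : Ledger) (p : ℕ)
    (m : Str) (w : σ × QState) :
    (step o a p m).run O loc w =
      ((prep o a p m).run O loc w).bind fun x => (finish o x.1).run O loc x.2 := by
  rw [step, Eff.run_bind]

theorem partyNext_verWrap (k v : Str) :
    partyNext (Str.pair v.fst (Str.pair (Str.pair k v.snd.fst) v.snd.snd)) =
      ⟨Str.pair k (partyNext v).st, (partyNext v).out⟩ := by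
  simp [partyNext, Str.fst_pair, Str.snd_pair]

theorem partyNext_mintWrap (k ct v : Str) : partyNext (FullScheme.mintWrap k ct v) =
      ⟨Str.pair (Str.pair k ct) (partyNext v).st, (partyNext v).out⟩ := by
  simp [partyNext, FullScheme.mintWrap, Str.fst_pair, Str.snd_pair]

theorem session_done (r : Entry) (v : Str) (hs : r.started = true) :
    ({ r with party := partyNext v } : Entry).session =
      ⟨r.ver, ⟨if r.ver then Str.pair r.key (partyNext v).st
        else Str.pair (Str.pair r.key r.ct) (partyNext v).st, (partyNext v).out⟩⟩ := by
  simp [Entry.session, hs]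

theorem unary_ne_false (i : ℕ) : Str.unary i ≠ [false] := by
  cases i <;> simp [Str.unary, List.replicate_succ]

variable (S M E n km ke)

/-- The bank of the full scheme in a started run. -/
theorem activate_session {r : Entry} (hs : r.started = true) (hout : r.party.out = none) (i : ℕ)
    (x : Str) (ψ : QState) :
    activate (if r.ver then (fullScheme S M E).verifyBank else (fullScheme S M E).mintBank)
        (Cell.priv (i + 1)) n (Str.pair km ke) r.session.party x ψ =
      (partyRun (bankProg S r.ver) (Cell.priv (i + 1)) n r.key r.party.st x ψ).map fun v =>
        (if r.ver then partyReply v.1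
          else Str.pair (partyReply v.1) (if v.1.fst = [] then [] else r.ct),
          ({ r with party := partyNext v.1 } : Entry).session.party, v.2) := by
  obtain ⟨ver, started, own, key, ct, ⟨st, out⟩⟩ := r
  simp only at hs hout
  subst hs hout
  cases ver
  · simp only [Entry.session, Bool.false_eq_true, if_false, if_true, fullScheme, activate_none,
      FullScheme.partyRun_mintBank, PMF.map_comp, bankProg]
    congr 1
    funext v
    simp only [Function.comp_apply, partyNext_mintWrap]
    simp [FullScheme.mintWrap, partyReply, Str.snd_pair]
  · simp only [Entry.session, if_true, fullScheme, activate_none,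
      FullScheme.partyRun_verifyBank, PMF.map_comp, bankProg]
    congr 1
    funext v
    simp [partyNext_verWrap, partyReply, Str.snd_pair]

variable {S M E n km ke}

theorem Bad.mono {a a' : Ledger} (h : a.fresh <+: a'.fresh) {g : ℕ} (hg : a.Bad g) : a'.Bad g :=
  find?_prefix h hg

/-- Some verification of an unknown ciphertext succeeded. -/
def SomeBad (a : Ledger) : Prop := ∃ g < a.fuel, a.Bad g

-- The relation `FullRel` is kept only as long as no unknown ciphertext has been accepted. When it
-- breaks, the test function on the left is at most 1, while the one on the right is at least 1 from
-- then on because `SomeBad` is permanent. Up to that moment the quantum states of both sides are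
-- equal, and the private cells of the banks are the same.
open Classical in
theorem full_sim (hS : S.keygen.PPT) (hM : M.IsScheme) (hE : E.IsScheme)
    (hke : ke ∈ (E.keygen.run (Str.unary n)).support) (j : ℕ) :
    Eff.Sim
      (fun (w : List Session × QState) (ν : PMF ((Ledger × Unit) × QState)) =>
        ∃ a, ν = PMF.pure ((a, ()), w.2) ∧ FullRel E ke w.1 a)
      (fun _ => 1) (fun s => if SomeBad s.1 then 1 else 0)
      ((fullScheme S M E).bankOracle n (Str.pair km ke)) (Cell.priv 0)
      (oracle (gameOps S M E n km ke j true none) noOracle spread) (Cell.priv 0) := by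
  have hrev : ∀ p m (s : Ledger × Unit) ψ, ∀ o ∈ (oracle (gameOps S M E n km ke j true none) noOracle
      spread p m s ψ).support, SomeBad s.1 → SomeBad o.2.1.1 := by
    rintro p m ⟨a, ⟨⟩⟩ ψ o ho ⟨g, hg, hbad⟩
    rw [oracle, PMF.mem_support_map_iff] at ho
    obtain ⟨x, hx, rfl⟩ := ho
    exact ⟨g, hg.trans_le (le_of_le_of_eq (by simp only [spend]; omega)
      (step_fuel _ _ _ _ _ _ _ _ x hx).symm), hbad.mono (step_fresh _ _ _ _ _ _ _ _ x hx)⟩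
  refine ⟨?_, ?_, ?_, fun _ _ _ _ _ _ => le_refl _, fun p m s ψ o ho => ?_⟩
  · rintro g w ν ⟨a, rfl, h⟩
    exact ⟨a, PMF.pure_map _ _, h⟩
  · rintro s c w ν ⟨a, rfl, h⟩ f g hfg
    rw [PMF.ev_pure]
    exact PMF.ev_mono fun x _ => hfg.rel_pure ⟨a, rfl, h⟩
  · rintro p m ⟨runs, ψ⟩ ν ⟨a₀, rfl, h₀⟩ f g hfg
    have hpt : ∀ r runs a ψ, FullRel E ke runs a → f r (runs, ψ) ≤ g r ((a, ()), ψ) :=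
      fun r runs a ψ h => hfg.rel_pure ⟨a, rfl, h⟩
    -- The way out of the relation: once the ledger is bad, the bounds `U = 1` and `V = 1` settle
    -- the comparison.
    have hbad : ∀ r w r' a ψ, SomeBad a → f r w ≤ g r' ((a, ()), ψ) := fun r w r' a ψ h =>
      (hfg.left r w).trans ((if_pos h).ge.trans (hfg.right r' ((a, ()), ψ)))
    rw [PMF.ev_pure, oracle, PMF.ev_map, run_step, prep, if_pos h₀.dead, PMF.ev_bind]
    have h := h₀.spend m
    have hf : (a₀.spend m).N < (a₀.spend m).fuel := by
      have := h₀.fuel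
      simp only [spend]; omega
    generalize a₀.spend m = a at h hf
    simp only
    match p with
    | 0 =>
      simp only [MoneyScheme.bankOracle, live, gameOps, Eff.bind, Eff.run, PMF.ev_pure, finish]
      exact (PMF.ev_pure _ _).le.trans (hpt _ _ _ _ (h.push hf false))
    | 1 =>
      simp only [MoneyScheme.bankOracle, live, gameOps, Eff.bind, Eff.run, PMF.ev_pure, finish]
      exact (PMF.ev_pure _ _).le.trans (hpt _ _ _ _ (h.push hf true))
    | p + 3 =>
      simp only [MoneyScheme.bankOracle, live, gameOps, Eff.run, PMF.ev_pure, finish]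
      exact (PMF.ev_pure _ _).le.trans (hpt _ _ _ _ h)
    | 2 =>
      simp only [live, message]
      set i := m.fst.length with hi
      rcases hl : a.look i with _ | r
      · have hn : runs[i]? = none := by
          rw [List.getElem?_eq_none_iff, h.len]
          by_contra hc
          obtain ⟨r, hr, -⟩ := h.some i (not_le.1 hc)
          simp [hl] at hr
        rw [MoneyScheme.bankOracle_none _ _ _ _ _ hn]
        simp only [PMF.ev_pure, Eff.run, finish]
        exact hpt _ _ _ _ h
      · have hg := h.get hl
        rw [MoneyScheme.bankOracle_some _ _ _ _ _ hg, PMF.ev_map]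
        simp only
        have hver : r.session.isVerify = r.ver := rfl
        rw [hver]
        rcases hout : r.party.out with _ | bo
        swap
        · have e : r.session.party = ⟨r.session.party.st, some bo⟩ := by simp [Entry.session, hout]
          rw [e, activate_some, PMF.ev_pure]
          simp only [Option.isSome_some, if_true, PMF.ev_pure, Eff.run, finish]
          refine hpt _ _ _ _ ?_
          rw [show (⟨r.ver, ⟨r.session.party.st, some bo⟩⟩ : Session) = r.session by rw [← e]; rfl]
          rw [List.getElem?_eq_getElem ((h.lt hl).trans_eq h.len.symm)] at hg
          rw [← Option.some.inj hg, List.set_getElem_self]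
          exact h
        · simp only [Option.isSome_none, Bool.false_eq_true, if_false]
          have hbank : ∀ (a' : Ledger) (r' : Entry), FullRel E ke runs a' → a'.look i = some r →
              r'.party.out = none → r'.ver = r.ver → r'.started = true →
              (∃ r'', a'.look r'.own = some r'' ∧ r''.ver = false) →
              (activate (if r.ver then (fullScheme S M E).verifyBank
                else (fullScheme S M E).mintBank) (Cell.priv (i + 1)) n (Str.pair km ke)
                r'.session.party m.snd ψ).ev (fun o => f (Str.pair o.2.1.out.toList o.1)
                  (runs.set i ⟨r.ver, o.2.1⟩, o.2.2)) ≤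
              ((bankStep (gameOps S M E n km ke j true none) (a', i, r', m.snd)).run noOracle spread
                ((), ψ)).ev fun x => g x.1.1 ((x.1.2, x.2.1), x.2.2) := by
            intro a' r' h' hl' hout' hver' hst' hown'
            rw [← hver', activate_session S M E n km ke hst' hout', run_bankStep, PMF.ev_map, PMF.ev_map]
            refine PMF.ev_mono fun v _ => ?_
            have h3 := h'.set (r := { r' with party := partyNext v.1 }) hl' hout hver'
              (fun _ => hown') (Or.inl hst')
            refine le_of_eq_of_le ?_ (hpt (bankDone a' i r' v.1).1 _ _ v.2 h3)
            simp only [session_done r' v.1 hst', bankDone]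
          by_cases hst : r.started = true
          · simp only [hst, if_true, Eff.run, PMF.ev_pure, finish]
            exact hbank a r h hl hout rfl hst (h.own i r hl hst)
          · simp only [hst, Bool.false_eq_true, if_false]
            have hsp : r.session.party = ⟨[], none⟩ := by simp [Entry.session, hst, hout]
            by_cases hv : r.ver = true
            · -- start of `verify`
              simp only [hv, if_true, fullScheme, hsp, activate_none,
                FullScheme.partyRun_verifyBank_start hM.verify_ppt.1 hE.decrypt_ppt.1]
              have hrej : ∀ (φ : QState),
                  f (Str.pair [false] []) (runs.set i ⟨true, ⟨[], some false⟩⟩, φ) ≤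
                    g (reject a i r).1 (((reject a i r).2, ()), φ) := by
                intro φ
                have h3 := h.set (r := { r with party := ⟨[], some false⟩ }) hl hout rfl
                  (fun hh => absurd hh hst) (Or.inr (by simp))
                rw [if_neg (by simp)] at h3
                refine le_of_eq_of_le ?_ (hpt (Str.pair [false] []) _ _ φ h3)
                simp [Entry.session, hst, hv]
              rw [PMF.ev_map, PMF.ev_bind, verStart]
              rcases hfind : a.find m.snd.fst with _ | y
              · dsimp only
                rw [if_neg (show ¬ Str.unary i = (gameOps S M E n km ke j true none).target from
                  unary_ne_false i)]
                simp only [Eff.run_bind, Eff.run, run_vtag hM.verify_ppt.1, PMF.bind_map,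
                  PMF.ev_bind, Function.comp_def, PMF.ev_pure, finish]
                refine PMF.ev_mono fun v _ => ?_
                by_cases hacc : Accepts v
                · rw [if_pos hacc, PMF.ev_map]
                  refine PMF.ev_le_of_le fun k _ => hbad _ _ _ _ _ ⟨i, ?_, ?_⟩
                  · exact (h.lt hl).trans hf
                  -- A recorded result belongs to a run that has halted, but run `i` has not. So the
                  -- new result is the first one of run `i`, as `Bad` demands.
                  · have : a.fresh.find? (fun x => x.1 == i) = none := by
                      rw [List.find?_eq_none]
                      intro x hx hxi
                      obtain ⟨-, r', hr', ho⟩ := h.fresh x hx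
                      rw [beq_iff_eq.1 hxi, hl] at hr'
                      obtain rfl := Option.some.inj hr'
                      simp [hout] at ho
                    simp [Bad, reject, Ledger.set, List.find?_append, this, hacc]
                · rw [if_neg hacc, PMF.ev_pure]
                  simp only [partyNext, partyReply, Str.fst_pair, Str.snd_pair, List.head?_cons,
                    Option.toList_some, decide_eq_false hacc]
                  have h3 := h.set (r := { r with party := ⟨[], some false⟩ }) hl hout rfl
                    (fun hh => absurd hh hst) (Or.inr (by simp))
                  rw [if_neg (by simp)] at h3
                  have h4 : FullRel E ke (runs.set i ⟨true, ⟨[], some false⟩⟩)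
                      (reject { a with fresh := a.fresh ++ [(i, false)] } i r).2 := by
                    have e : ({ r with party := ⟨[], some false⟩ } : Entry).session =
                        ⟨true, ⟨[], some false⟩⟩ := by simp [Entry.session, hst, hv]
                    rw [e] at h3
                    refine ⟨h3.dead, h3.len, h3.some, h3.none, h3.tbl, h3.own, h3.wins, h3.count,
                      fun x hx => ?_, h3.fuel⟩
                    obtain hx | hx := List.mem_append.1 hx
                    · exact h3.fresh x hx
                    · rw [List.mem_singleton.1 hx]
                      exact ⟨rfl, _, (look_set a i i _).trans (if_pos rfl), rfl⟩
                  exact hpt _ _ _ _ h4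
              · obtain ⟨j', k⟩ := y
                obtain ⟨hc, hown⟩ := h.tbl _ _ _ hfind
                simp only [Eff.run_bind, Eff.run, run_vtag hM.verify_ppt.1, PMF.bind_map,
                  PMF.ev_bind, Function.comp_def, PMF.ev_pure, finish]
                refine PMF.ev_mono fun v _ => ?_
                by_cases hacc : Accepts v
                · simp only [if_pos hacc]
                  -- The ciphertext in the table is an encryption of the recorded key, so decryption
                  -- by the real bank returns the very key that the ledger uses.
                  rw [hE.complete n ke hke k _ hc, PMF.pure_map, PMF.ev_pure]
                  simp only [partyNext, partyReply, Str.fst_pair, Str.snd_pair, List.head?_nil,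
                    Option.toList_none]
                  have h3 := h.set (r := { r with
                    started := true, own := j', key := k, party := Party.init }) hl hout rfl (fun _ => hown) (Or.inl rfl)
                  rw [if_neg (by simp [Party.init])] at h3
                  refine le_of_eq_of_le ?_ (hpt (Str.pair [] []) _ _ ψ h3)
                  simp [Entry.session, hv, Party.init]
                  rfl
                · simp only [if_neg hacc]
                  rw [PMF.ev_pure]
                  simp only [partyNext, partyReply, Str.fst_pair, Str.snd_pair, List.head?_cons,
                    Option.toList_some]
                  exact hrej ψ
            · -- start of `mint`
              have hv' : r.ver = false := by simpa using hv
              simp only [hv', Bool.false_eq_true, if_false, fullScheme, hsp, activate_none,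
                FullScheme.partyRun_mintBank_start hS.1 hE.encrypt_ppt.1 hM.mac_ppt.1]
              rw [run_mintStart hS.1 hE.encrypt_ppt.1 hM.mac_ppt.1]
              simp only [PMF.map_bind, PMF.ev_bind, keyDist, encDist, Option.isSome_none, and_false,
                Bool.false_eq_true, Bool.true_eq_false, if_false, PMF.ev_map, finish]
              refine PMF.ev_mono fun k _ => PMF.ev_mono fun c hc => PMF.ev_mono fun t _ => ?_
              refine le_of_eq_of_le ?_ (hbank { a with tbl := (c, i, k) :: a.tbl }
                { r with
                  started := true, own := i, key := k, ct := Str.pair c t, party := Party.init }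
                (h.insert hl hv' hc) hl rfl rfl rfl ⟨r, hl, hv'⟩)
              simp only [hv', Bool.false_eq_true, if_false, fullScheme, Entry.session, if_true,
                Party.init, activate_none, FullScheme.partyRun_mintBank, PMF.ev_map]
              rfl
  · by_cases hs : SomeBad s.1
    · rw [if_pos hs, if_pos (hrev p m s ψ o ho hs)]
    · rw [if_neg hs]; exact zero_le

end Ledger

end


noncomputable section

namespace Ledger

/-! ## Reductions: replacing the operations of the ledger -/

/-- The placement of the memory of a program below the address `[]`. -/
def inner (a : Str) : Cell := Cell.priv 0 (Str.pair [] a)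

/-- From the memory layout of the game to the layout of a reduction: the memory of the bank in run
`i` is either below the address `unary (i + 1)` or, if the run is forwarded, it belongs to a bank of
the outer game. -/
def moveCell (j : ℕ) (fwd : ℕ → Bool) : Cell → Cell
  | .msg a => .msg a
  | .priv 0 a => inner a
  | .priv (i + 1) a =>
    if fwd i then (if i = j then .priv 1 a else .priv (i + 2) a)
    else .priv 0 (Str.pair (Str.unary (i + 1)) a)

theorem pair_injective {x y x' y' : Str} (h : Str.pair x y = Str.pair x' y') : x = x' ∧ y = y' :=
  ⟨by simpa [Str.fst_pair] using congrArg Str.fst h, by simpa [Str.snd_pair] using congrArg Str.snd h⟩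

theorem moveCell_injective (j : ℕ) (fwd : ℕ → Bool) : Function.Injective (moveCell j fwd) := by
  have hu : ∀ i, Str.unary (i + 1) ≠ [] := fun i h => by simpa [Str.unary] using h
  have hp : ∀ {x y x' y' : Str}, Cell.priv 0 (Str.pair x y) = Cell.priv 0 (Str.pair x' y') →
      x = x' ∧ y = y' := fun h => pair_injective (Cell.priv.inj h).2
  rintro (a | ⟨_ | i, a⟩) (b | ⟨_ | i', b⟩) h <;> simp only [moveCell, inner] at h
  · exact h
  · cases h
  · split_ifs at h
  · cases h
  · rw [(hp h).2]
  · split_ifs at h with h1 h2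
    · exact absurd (Cell.priv.inj h).1 (by omega)
    · exact absurd (Cell.priv.inj h).1 (by omega)
    · exact absurd (hp h).1.symm (hu _)
  · split_ifs at h
  · split_ifs at h with h1 h2
    · exact absurd (Cell.priv.inj h).1 (by omega)
    · exact absurd (Cell.priv.inj h).1 (by omega)
    · exact absurd (hp h).1 (hu _)
  · by_cases h1 : fwd i = true <;> by_cases h2 : fwd i' = true <;> by_cases h3 : i = j <;>
      by_cases h4 : i' = j <;>
      simp only [h1, h2, if_true, if_false, Bool.false_eq_true] at h <;>
      (try simp only [h3, h4, if_true, if_false] at h) <;>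
      first
        | (have h5 := (Cell.priv.inj h).1
           have h6 := (Cell.priv.inj h).2
           first | (exfalso; omega) | (obtain rfl : i = i' := by omega
                                       rw [h6]))
        | (have h5 := Str.unary_injective (hp h).1
           have h6 := (hp h).2
           obtain rfl : i = i' := by omega
           rw [h6])

def move (j : ℕ) (fwd : ℕ → Bool) : Cell ↪ Cell := ⟨moveCell j fwd, moveCell_injective j fwd⟩

/-- The admissible changes of the layout: a started run is forwarded if and only if its key comes
from run `j` and the flag `F` is set. -/
def moves (F : Bool) (j : ℕ) (a : Ledger) : Set (Cell ↪ Cell) :=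
  {ρ | ∃ fwd, ρ = move j fwd ∧ ∀ i r, a.look i = some r → r.started = true →
    fwd i = (F && r.own == j)}

theorem moves_nonempty (F : Bool) (j : ℕ) (a : Ledger) : (moves F j a).Nonempty :=
  ⟨_, fun i => (a.look i).any fun r => F && r.own == j, rfl, fun i r hr hs => by simp [hr]⟩

theorem moves_congr {F : Bool} {j : ℕ} {a a' : Ledger} (h : ∀ i, a.look i = a'.look i) :
    moves F j a = moves F j a' := by
  simp only [moves, h]

theorem moves_inner {F : Bool} {j : ℕ} {a : Ledger} :
    ∀ ρ ∈ moves F j a, ∀ s x, ρ (cellAt (Cell.priv 0) s x) = cellAt inner s x := by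
  rintro _ ⟨fwd, rfl, -⟩ s x
  cases s <;> rfl

/-- The reduction does not know the key and the states of the bank in forwarded runs. -/
def _root_.Entry.hide (F : Bool) (j : ℕ) (r : Entry) : Entry :=
  if F && r.started && r.own == j then { r with key := [], party := ⟨[], r.party.out⟩ } else r

def hideKey (F : Bool) (j : ℕ) (i : ℕ) (k : Str) : Str := if F && i == j then [] else k

def hide (F : Bool) (j : ℕ) (a : Ledger) : Ledger :=
  { a with
    log := a.log.map fun x => (x.1, x.2.hide F j)
    tbl := a.tbl.map fun x => (x.1, x.2.1, hideKey F j x.2.1 x.2.2) }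

theorem look_hide (F : Bool) (j : ℕ) (a : Ledger) (i : ℕ) :
    (a.hide F j).look i = (a.look i).map (Entry.hide F j) := by
  simp only [look, hide, List.find?_map, Option.map_map]
  rfl

theorem find_hide (F : Bool) (j : ℕ) (a : Ledger) (c : Str) :
    (a.hide F j).find c = (a.find c).map fun y => (y.1, hideKey F j y.1 y.2) := by
  simp only [find, hide, List.find?_map, Option.map_map]
  rfl

theorem hide_of_not_started {F : Bool} {j : ℕ} {r : Entry} (h : r.started = false) :
    r.hide F j = r := by simp [Entry.hide, h]

@[simp] theorem hide_ver (F : Bool) (j : ℕ) (r : Entry) : (r.hide F j).ver = r.ver := by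
  unfold Entry.hide; split_ifs <;> rfl

@[simp] theorem hide_started (F : Bool) (j : ℕ) (r : Entry) : (r.hide F j).started = r.started := by
  unfold Entry.hide; split_ifs <;> rfl

@[simp] theorem hide_own (F : Bool) (j : ℕ) (r : Entry) : (r.hide F j).own = r.own := by
  unfold Entry.hide; split_ifs <;> rfl

@[simp] theorem hide_ct (F : Bool) (j : ℕ) (r : Entry) : (r.hide F j).ct = r.ct := by
  unfold Entry.hide; split_ifs <;> rfl

@[simp] theorem hide_out (F : Bool) (j : ℕ) (r : Entry) :
    (r.hide F j).party.out = r.party.out := by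
  unfold Entry.hide; split_ifs <;> rfl

theorem hide_push (F : Bool) (j : ℕ) (a : Ledger) (v : Bool) :
    (a.push v).hide F j = (a.hide F j).push v := by
  simp [hide, push, Entry.hide]

theorem hide_set (F : Bool) (j : ℕ) (a : Ledger) (i : ℕ) (r : Entry) :
    (a.set i r).hide F j = (a.hide F j).set i (r.hide F j) := rfl

theorem hide_reject (F : Bool) (j : ℕ) (a : Ledger) (i : ℕ) {r : Entry} (h : r.started = false) :
    reject (a.hide F j) i r = ((reject a i r).1, (reject a i r).2.hide F j) := by
  have h1 : ({ r with party := ⟨[], some false⟩ } : Entry).hide F j =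
    { r with party := ⟨[], some false⟩ } := hide_of_not_started h
  simp only [reject, hide_set, h1]

theorem hide_accept (F : Bool) (j : ℕ) (a : Ledger) (i : ℕ) (r : Entry) (y : ℕ × Str) :
    accept (a.hide F j) i r (y.1, hideKey F j y.1 y.2) =
      ((accept a i r y).1, (accept a i r y).2.hide F j) := by
  simp only [accept, hide_set]
  congr 2
  simp only [Entry.hide, hideKey, Bool.and_true, Party.init]
  split_ifs <;> rfl

theorem hide_minted (F : Bool) (j : ℕ) (a : Ledger) (i : ℕ) (r : Entry) (k c t x : Str) :
    minted (a.hide F j) i r (hideKey F j i k) c t x =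
      ((minted a i r k c t x).1.hide F j, i, (minted a i r k c t x).2.2.1.hide F j, x) := by
  simp only [minted]
  congr 2
  simp only [Entry.hide, hideKey, Bool.and_true, Party.init]
  split_ifs <;> rfl

/-- The output of the bank of the mini-scheme as the reduction sees it. -/
def hideOut (F : Bool) (j : ℕ) (r : Entry) (v : Str) : Str :=
  if F && r.own == j then Str.pair (partyNext v).out.toList (Str.pair [] (partyReply v)) else v

/-- For a forwarded run the reduction sees only the output bit and the reply of the outer bank. The
ledger uses nothing else of the output except the new state, which is hidden. -/
theorem hide_bankDone (F : Bool) (j : ℕ) (a : Ledger) (i : ℕ) {r : Entry} (h : r.started = true)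
    (v : Str) :
    bankDone (a.hide F j) i (r.hide F j) (hideOut F j r v) =
      ((bankDone a i r v).1, (bankDone a i r v).2.hide F j) := by
  by_cases hF : (F && r.own == j) = true
  · have h1 : (partyNext (hideOut F j r v)).out = (partyNext v).out := by
      rw [hideOut, if_pos hF]
      rcases hv : (partyNext v).out with _ | b <;> simp [partyNext, Str.fst_pair]
    have h2 : partyReply (hideOut F j r v) = partyReply v := by
      rw [hideOut, if_pos hF]
      simp [partyReply, Str.snd_pair]
    -- Whether the status is empty survives although the status is cut to one bit; this decides
    -- whether a run of `mint` now sends the ciphertext and the tag.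
    have h3 : ((hideOut F j r v).fst = []) = (v.fst = []) := by
      rw [hideOut, if_pos hF, Str.fst_pair]
      rcases hv : v.fst with _ | ⟨b, l⟩ <;> simp [partyNext, hv]
    have h4 : (partyNext (hideOut F j r v)).st = [] := by
      rw [hideOut, if_pos hF]
      simp [partyNext, Str.snd_pair, Str.fst_pair]
    have h5 : ({ r.hide F j with party := partyNext (hideOut F j r v) } : Entry) =
        ({ r with party := partyNext v } : Entry).hide F j := by
      have h6 : (F && r.started && r.own == j) = true := by simpa [h] using hF
      have h7 : partyNext (hideOut F j r v) = ⟨[], (partyNext v).out⟩ := by rw [← h1, ← h4]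
      rw [h7, Entry.hide, if_pos h6, Entry.hide, if_pos h6]
    simp only [bankDone]
    rw [h5, h1, h2, hide_ver, hide_own, hide_ct]
    simp only [h3]
    rfl
  · have h1 : hideOut F j r v = v := by rw [hideOut, if_neg hF]
    have h6 : ¬ (F && r.started && r.own == j) = true := by simpa [h] using hF
    have h7 : r.hide F j = r := by rw [Entry.hide, if_neg h6]
    have h8 : ({ r with party := partyNext v } : Entry).hide F j = { r with party := partyNext v } := by
      rw [Entry.hide, if_neg h6]
    rw [h1, h7]
    simp only [bankDone]
    congr 1
    simp only [hide, set, List.map_cons, h8]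

theorem look_bankDone (a : Ledger) (i : ℕ) (r : Entry) (v : Str) (i' : ℕ) :
    (bankDone a i r v).2.look i' = if i = i' then some { r with party := partyNext v } else a.look i' :=
  look_set a i i' _

theorem verStart_fresh (o : Ops) {a : Ledger} {i : ℕ} {r : Entry} {c t : Str}
    (h : a.find c = none) (hi : Str.unary i ≠ o.target) :
    verStart o a i r c t = (o.vtag c t).bind fun v =>
      .ret (.inl (reject { a with fresh := a.fresh ++ [(i, decide (Accepts v))] } i r)) := by
  unfold verStart
  rw [h]
  exact if_neg hi

theorem verStart_dead (o : Ops) {a : Ledger} {i : ℕ} {r : Entry} {c t : Str}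
    (h : a.find c = none) (hi : Str.unary i = o.target) :
    verStart o a i r c t = .ret (.inl ([], { a with dead := Str.pair c t })) := by
  unfold verStart
  rw [h]
  exact if_pos hi

variable {σ' : Type}

/-- States of the game and of the reduction. -/
def LinkRel (F : Bool) (j : ℕ) (Out : ℕ → Ledger → σ' → Prop) (w : (Ledger × Unit) × QState)
    (ν : PMF ((Ledger × σ') × QState)) : Prop :=
  ∃ s ψ, ν = PMF.pure ((w.1.1.hide F j, s), ψ) ∧ QState.Renamed (moves F j w.1.1) w.2 ψ ∧
    Out w.1.1.fuel w.1.1 s ∧ w.1.1.dead = []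

/-- The requirements on a reduction that replaces the operations of the game by `o`, with the outer
oracle `O`. The predicate `Out` (with a bound for the total length of the messages) describes the
state of the outer oracle. -/
structure Link (S : MoneyScheme) (M : MACScheme) (E : EncScheme) (n : ℕ) (km ke : Str) (j : ℕ)
    (b : Bool) (kst : Option Str) (F : Bool) (o : Ops) (O : Oracle σ') (B : ℕ)
    (Out : ℕ → Ledger → σ' → Prop) (U : Ledger → ℝ≥0∞) (V : Ledger × σ' → ℝ≥0∞) : Prop where
  mono : ∀ {f f' a s}, f ≤ f' → Out f a s → Out f' a s
  congr : ∀ {f a a' s}, (∀ i, a.look i = a'.look i) → a.N = a'.N → a.tbl = a'.tbl →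
    a.wins = a'.wins → a.fresh = a'.fresh → Out f a s → Out f a' s
  next : ∀ {f a s}, Out f a s → a.look a.N = none
  opn : ∀ {f a s} (v : Bool) (ψ : QState), Out f a s → ∃ r s',
    o.opn.run O (Cell.priv 0) (s, ψ) = PMF.pure (r, s', ψ) ∧ Out f (a.push v) s'
  mint : ∀ {f a s} (i : ℕ) (r : Entry) (ψ : QState), Out f a s → a.look i = some r →
    r.ver = false → r.started = false → r.party.out = none → ∃ upd : Str → Str → Str → σ',
      ((o.gen i).bind fun k => (o.enc i k).bind fun c => (o.sign c).bind fun t =>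
        Eff.ret (k, c, t)).run O (Cell.priv 0) (s, ψ) =
      ((keyDist S n j kst i).bind fun k => (encDist E ke j b i k).bind fun c =>
        (M.mac.run (Str.pair km c)).map fun t => ((hideKey F j i k, c, t), upd k c t, ψ)) ∧
      ∀ k ∈ (keyDist S n j kst i).support, ∀ c t x,
        Out f ((minted a i r k c t x).1.set i (minted a i r k c t x).2.2.1) (upd k c t)
  vtag : ∀ {f a s} (c t : Str) (ψ : QState), Out f a s →
    ((o.vtag c t).run O (Cell.priv 0) (s, ψ)).map (fun x => (decide (Accepts x.1), x.2)) =
      (M.verify.run (Str.pair km (Str.pair c t))).map fun v => (decide (Accepts v), s, ψ)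
  reject : ∀ {f a s} (i : ℕ) (r : Entry), Out f a s → a.look i = some r → r.started = false →
    r.party.out = none → Out f (reject a i r).2 s
  accept : ∀ {f a s} (i : ℕ) (r : Entry) (c : Str) (y : ℕ × Str), Out f a s → a.look i = some r →
    r.ver = true → r.started = false → r.party.out = none → a.find c = some y →
    Out f (accept a i r y).2 s
  fresh : ∀ {f a s} (i : ℕ) (r : Entry) (c t : Str) (ψ ψ' : QState), f ≤ a.fuel → Out f a s →
    QState.Renamed (moves F j a) ψ ψ' → a.look i = some r → r.ver = true → r.started = false →
    r.party.out = none → a.dead = [] → a.find c = none →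
    ∀ (g : Str → (Ledger × Unit) × QState → ℝ≥0∞) (h : Str → (Ledger × σ') × QState → ℝ≥0∞),
      Eff.Tests (LinkRel F j Out) (fun s => U s.1) V g h →
      ((M.verify.run (Str.pair km (Str.pair c t))).ev fun v => g (Str.pair [false] [])
        (((Ledger.reject { a with fresh := a.fresh ++ [(i, decide (Accepts v))] } i r).2, ()), ψ)) ≤
      ((verStart o (a.hide F j) i r c t).run O (Cell.priv 0) (s, ψ')).ev fun x =>
        ((finish o x.1).run O (Cell.priv 0) x.2).ev fun y => h y.1.1 ((y.1.2, y.2.1), y.2.2)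
  bank : ∀ {f a s} (i : ℕ) (r : Entry) (x : Str) (ψ ψ' : QState), Out f a s →
    a.look i = some r → r.started = true → r.party.out = none → f + (x.length + 1) ≤ B →
    QState.Renamed (moves F j a) ψ ψ' →
    ∀ (g : Str → QState → ℝ≥0∞) (h : Str → σ' → QState → ℝ≥0∞),
      (∀ v φ φ' s', QState.Renamed (moves F j a) φ φ' →
        Out (f + (x.length + 1)) (bankDone a i r v).2 s' → g v φ ≤ h (hideOut F j r v) s' φ') →
      ((partyRun (bankProg S r.ver) (Cell.priv (i + 1)) n r.key r.party.st x ψ).ev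
          fun v => g v.1 v.2) ≤
        ((o.bank r.ver i r.own (r.hide F j).key (r.hide F j).party.st x).run O (Cell.priv 0)
          (s, ψ')).ev fun y => h y.1 y.2.1 y.2.2
  monoU : ∀ p m s ψ, ∀ x ∈ (oracle (gameOps S M E n km ke j b kst) noOracle spread p m s ψ).support,
    U x.2.1.1 ≤ U s.1
  monoV : ∀ p m s ψ, ∀ x ∈ (oracle o O (Cell.priv 0) p m s ψ).support, V s ≤ V x.2.1
  bound : ∀ a, B < a.fuel → U a = 0

variable {S : MoneyScheme} {M : MACScheme} {E : EncScheme} {n : ℕ} {km ke : Str} {j : ℕ} {b : Bool}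
  {kst : Option Str} {F : Bool} {o : Ops} {O : Oracle σ'} {B : ℕ} {Out : ℕ → Ledger → σ' → Prop}
  {U : Ledger → ℝ≥0∞} {V : Ledger × σ' → ℝ≥0∞}

/-- The destination of the memory of a run is fixed only when the run has started. Before, the state
has the same image under all choices of destination, which stands for the memory of that run being
untouched. Starting a run merely discards some of the choices, so nothing has to be proved about the
state. -/
theorem moves_mono {F : Bool} {j : ℕ} {a a' : Ledger}
    (h : ∀ i r, a.look i = some r → r.started = true →
      ∃ r', a'.look i = some r' ∧ r'.started = true ∧ r'.own = r.own) :
    moves F j a' ⊆ moves F j a := by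
  rintro _ ⟨fwd, rfl, hf⟩
  refine ⟨fwd, rfl, fun i r hr hs => ?_⟩
  obtain ⟨r', h1, h2, h3⟩ := h i r hr hs
  rw [hf i r' h1 h2, h3]

theorem moves_set_subset {F : Bool} {j : ℕ} {a : Ledger} {i : ℕ} {r₀ r : Entry}
    (hr₀ : a.look i = some r₀) (h : r₀.started = true → r.started = true ∧ r.own = r₀.own) :
    moves F j (a.set i r) ⊆ moves F j a :=
  moves_mono fun i' r' hr' hs => by
    by_cases hi : i = i'
    · subst hi
      rw [hr₀] at hr'
      obtain rfl := Option.some.inj hr'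
      exact ⟨r, by rw [look_set, if_pos rfl], h hs⟩
    · exact ⟨r', by rw [look_set, if_neg hi, hr'], hs, rfl⟩

/-- The step of the bank of the mini-scheme. -/
theorem Link.bankStep_le (L : Link S M E n km ke j b kst F o O B Out U V) {f : ℕ} {a : Ledger}
    {s : σ'} {i : ℕ} {r r₀ : Entry} {x : Str} {ψ ψ' : QState} (hO : Out f (a.set i r) s)
    (hr₀ : a.look i = some r₀) (h₀ : r₀.started = true → r.started = true ∧ r.own = r₀.own)
    (hs : r.started = true) (ho : r.party.out = none) (hd : a.dead = [])
    (hf : f + (x.length + 1) ≤ a.fuel) (hB : a.fuel ≤ B) (hψ : QState.Renamed (moves F j a) ψ ψ')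
    {g : Str → (Ledger × Unit) × QState → ℝ≥0∞} {h : Str → (Ledger × σ') × QState → ℝ≥0∞}
    (hgh : Eff.Tests (LinkRel F j Out) (fun s => U s.1) V g h) :
    (((bankStep (gameOps S M E n km ke j b kst) (a, i, r, x)).run noOracle spread ((), ψ)).ev
        fun y => g y.1.1 ((y.1.2, y.2.1), y.2.2)) ≤
      ((bankStep o (a.hide F j, i, r.hide F j, x)).run O (Cell.priv 0) (s, ψ')).ev
        fun y => h y.1.1 ((y.1.2, y.2.1), y.2.2) := by
  rw [run_bankStep, PMF.ev_map]
  simp only [bankStep, Eff.run_bind, PMF.ev_bind, Eff.run, PMF.ev_pure, hide_ver, hide_own]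
  refine L.bank (a := a.set i r) (f := f) i r x ψ ψ' hO (by rw [look_set, if_pos rfl]) hs ho
    (hf.trans hB) (hψ.mono (moves_set_subset hr₀ h₀))
    (fun v φ => g (bankDone a i r v).1 (((bankDone a i r v).2, ()), φ))
    (fun v s' φ => h (bankDone (a.hide F j) i (r.hide F j) v).1
      (((bankDone (a.hide F j) i (r.hide F j) v).2, s'), φ)) fun v φ φ' s' hφ hO' => ?_
  rw [hide_bankDone F j a i hs]
  have hl : ∀ i', (bankDone (a.set i r) i r v).2.look i' = (bankDone a i r v).2.look i' := by
    intro i'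
    rw [look_bankDone, look_bankDone, look_set]
    split_ifs <;> rfl
  refine hgh.rel_pure ⟨s', φ', rfl, ?_, ?_, hd⟩
  · refine hφ.mono ?_
    refine moves_mono fun i' r' hr' hs' => ?_
    rw [look_set] at hr'
    rw [look_bankDone]
    by_cases hi : i = i'
    · rw [if_pos hi] at hr' ⊢
      obtain rfl := Option.some.inj hr'
      exact ⟨_, rfl, hs, rfl⟩
    · rw [if_neg hi] at hr' ⊢
      exact ⟨r', hr', hs', rfl⟩
  · exact L.mono hf (L.congr hl rfl rfl rfl rfl hO')

/-- A reduction is compared with the game operation by operation, and the control flow of the ledger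
is treated once for all reductions. The adversary's private cells move below the address `[]`, so
that they cannot meet the memory of the simulated banks. -/
theorem Link.sim (L : Link S M E n km ke j b kst F o O B Out U V) (hS : S.keygen.Classical)
    (hE : E.encrypt.Classical) (hM : M.mac.Classical) (hM' : M.verify.Classical) :
    Eff.Sim (LinkRel F j Out) (fun s => U s.1) V
      (oracle (gameOps S M E n km ke j b kst) noOracle spread) (Cell.priv 0)
      (oracle o O (Cell.priv 0)) inner := by
  refine ⟨?_, ?_, ?_, L.monoU, L.monoV⟩
  · rintro g w ν ⟨s, ψ, rfl, hψ, hO⟩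
    exact ⟨s, _, PMF.pure_map _ _, hψ.gate moves_inner g, hO⟩
  · rintro s c w ν ⟨s', ψ', rfl, hψ, hO⟩ g h hgh
    rw [PMF.ev_pure]
    refine hψ.ev_measure_le (moves_nonempty _ _ _) (fun ρ hρ => moves_inner ρ hρ s c)
      fun b φ φ' hφ => hgh.rel_pure ⟨s', φ', rfl, hφ, hO⟩
  · rintro p m ⟨⟨a₀, ⟨⟩⟩, ψ⟩ ν ⟨s, ψ', rfl, hψ, hO, hd⟩ g h hgh
    rw [PMF.ev_pure]
    simp only at hO hd hψ ⊢
    -- Queries beyond the budget `B` lead to ledgers where `U` is zero. This is how bounds on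
    -- message lengths enter although the tree of the adversary is arbitrary.
    by_cases hB : B < a₀.fuel + 1 + m.length
    · refine (PMF.ev_le_of_le fun x hx => (hgh.left _ _).trans ?_).trans zero_le
      rw [oracle, PMF.mem_support_map_iff] at hx
      obtain ⟨y, hy, rfl⟩ := hx
      rw [L.bound _ (hB.trans_eq (step_fuel _ _ _ _ _ _ _ _ y hy).symm)]
    have hpt : ∀ r a s ψ ψ', QState.Renamed (moves F j a) ψ ψ' → Out a.fuel a s → a.dead = [] →
        g r ((a, ()), ψ) ≤ h r ((a.hide F j, s), ψ') :=
      fun r a s ψ ψ' h1 h2 h3 => hgh.rel_pure ⟨s, ψ', rfl, h1, h2, h3⟩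
    have hspend : (a₀.hide F j).spend m = (a₀.spend m).hide F j := rfl
    rw [oracle, oracle, PMF.ev_map, PMF.ev_map, run_step, run_step, prep, prep, if_pos hd,
      if_pos (show (a₀.hide F j).dead = [] from hd), PMF.ev_bind, PMF.ev_bind, hspend]
    have hO' : Out a₀.fuel (a₀.spend m) s :=
      L.congr (a := a₀) (a' := a₀.spend m) (fun _ => rfl) rfl rfl rfl rfl hO
    have hψ' : QState.Renamed (moves F j (a₀.spend m)) ψ ψ' := hψ
    have hd' : (a₀.spend m).dead = [] := hd
    have hfuel : (a₀.spend m).fuel = a₀.fuel + 1 + m.length := rfl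
    clear hO hψ hd hspend
    generalize a₀.spend m = a at hO' hψ' hd' hfuel
    generalize a₀.fuel = f at hO' hfuel hB
    have hBa : a.fuel ≤ B := by omega
    have hO1 : Out a.fuel a s := L.mono (by omega) hO'
    simp only
    have hpush : ∀ v, (((o.opn.bind fun _ => Eff.ret (Sum.inl ([], (a.hide F j).push v))).run O
        (Cell.priv 0) (s, ψ')).ev fun y => ((finish o y.1).run O (Cell.priv 0) y.2).ev
          fun x => h x.1.1 ((x.1.2, x.2.1), x.2.2)) ≥ g [] ((a.push v, ()), ψ) := by
      intro v
      obtain ⟨r, s', h1, h2⟩ := L.opn v ψ' hO1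
      simp only [Eff.run_bind, h1, PMF.pure_bind, Eff.run, PMF.ev_pure, finish]
      rw [← hide_push]
      refine hpt _ _ _ _ _ (hψ'.mono (moves_mono fun i r hr hs => ⟨r, ?_, hs, rfl⟩)) h2 hd'
      rw [look_push, if_neg, hr]
      rintro rfl
      rw [L.next hO1] at hr
      cases hr
    match p with
    | 0 =>
      refine le_trans (le_of_eq ?_) (hpush false)
      simp only [live, gameOps, Eff.bind, Eff.run, PMF.ev_pure, finish]
    | 1 =>
      refine le_trans (le_of_eq ?_) (hpush true)
      simp only [live, gameOps, Eff.bind, Eff.run, PMF.ev_pure, finish]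
    | p + 3 =>
      simp only [live, Eff.run, PMF.ev_pure, finish]
      exact hpt _ _ _ _ _ hψ' hO1 hd'
    | 2 =>
      simp only [live, message, look_hide]
      set i := m.fst.length with hi
      rcases hl : a.look i with _ | r
      · simp only [Option.map_none, PMF.ev_pure, Eff.run, finish]
        exact hpt _ _ _ _ _ hψ' hO1 hd'
      · simp only [Option.map_some, hide_out, hide_started, hide_ver]
        rcases hout : r.party.out with _ | bo
        swap
        · simp only [Option.isSome_some, if_true, PMF.ev_pure, Eff.run, finish]
          exact hpt _ _ _ _ _ hψ' hO1 hd'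
        simp only [Option.isSome_none, Bool.false_eq_true, if_false]
        have hx : f + (m.snd.length + 1) ≤ a.fuel := by
          have := m.length_snd_le
          omega
        by_cases hst : r.started = true
        · simp only [hst, if_true, Eff.run, PMF.ev_pure, finish]
          refine L.bankStep_le (f := f) (L.congr (a := a) (a' := a.set i r) (fun i' => ?_)
            rfl rfl rfl rfl hO') hl (fun h => ⟨h, rfl⟩) hst hout hd' hx (by omega) hψ' hgh
          rw [look_set]
          split_ifs with h1
          · rw [← h1, hl]
          · rfl
        have hst' : r.started = false := by simpa using hst
        simp only [hst, if_false, hide_of_not_started hst', Bool.false_eq_true]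
        by_cases hv : r.ver = true
        · simp only [hv, if_true]
          rcases hfind : a.find m.snd.fst with _ | y
          · refine le_trans (le_of_eq ?_) (L.fresh i r m.snd.fst m.snd.snd ψ ψ' (by omega) hO' hψ'
              hl hv hst' hout hd' hfind g h hgh)
            rw [verStart_fresh (gameOps S M E n km ke j b kst) hfind (unary_ne_false i)]
            simp only [Eff.run_bind, run_vtag hM', PMF.bind_map, PMF.ev_bind, Function.comp_def,
              Eff.run, PMF.ev_pure, finish]
            rfl
          · have hfh : (a.hide F j).find m.snd.fst = some (y.1, hideKey F j y.1 y.2) := by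
              rw [find_hide, hfind]; rfl
            simp only [verStart, hfind, hfh, Eff.run_bind, run_vtag hM', PMF.bind_map, PMF.ev_bind,
              Function.comp_def, Eff.run, PMF.ev_pure, finish]
            have hv2 := congrArg (fun q => q.ev fun z : Bool × σ' × QState =>
              if z.1 = true then h (a.accept i r y).1 (((a.accept i r y).2.hide F j, z.2.1), z.2.2)
              else h (a.reject i r).1 (((a.reject i r).2.hide F j, z.2.1), z.2.2))
              (L.vtag m.snd.fst m.snd.snd ψ' hO1)
            simp only [PMF.ev_map, decide_eq_true_eq] at hv2
            refine le_trans (b := _) ?_ (le_of_eq (hv2.symm.trans (PMF.ev_congr fun z _ => ?_)))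
            · refine PMF.ev_mono fun v _ => ?_
              split_ifs
              · exact hpt _ _ _ _ _ (hψ'.mono (moves_set_subset hl fun h => by simp [hst'] at h))
                  (L.accept i r _ y hO1 hl hv hst' hout hfind) hd'
              · exact hpt _ _ _ _ _ (hψ'.mono (moves_set_subset hl fun h => by simp [hst'] at h))
                  (L.reject i r hO1 hl hst' hout) hd'
            · rw [hide_accept, hide_reject F j a i hst']
              split_ifs <;> rfl
        · have hv' : r.ver = false := by simpa using hv
          simp only [hv', Bool.false_eq_true, if_false]
          obtain ⟨upd, hmint, hOut⟩ := L.mint i r ψ' hO' hl hv' hst' hout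
          -- The requirement `Link.mint` treats key, ciphertext and tag as one block, because a
          -- reduction may know the key only in hidden form.
          have hright : (mintStart o (a.hide F j) i r m.snd).run O (Cell.priv 0) (s, ψ') =
              (((o.gen i).bind fun k => (o.enc i k).bind fun c => (o.sign c).bind fun t =>
                Eff.ret (k, c, t)).run O (Cell.priv 0) (s, ψ')).bind fun y =>
                  PMF.pure (.inr (minted (a.hide F j) i r y.1.1 y.1.2.1 y.1.2.2 m.snd), y.2) := by
            simp only [mintStart, Eff.run_bind, PMF.bind_bind, Eff.run, PMF.pure_bind]
          rw [run_mintStart hS hE hM, hright, hmint]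
          simp only [PMF.ev_bind, PMF.ev_map, PMF.ev_pure, finish, hide_minted]
          refine PMF.ev_mono fun k hk => PMF.ev_mono fun c _ => PMF.ev_mono fun t _ => ?_
          exact L.bankStep_le (f := f) (a := (minted a i r k c t m.snd).1)
            (hOut k hk c t m.snd) hl (fun h => by simp [hst'] at h) rfl rfl hd' hx hBa hψ' hgh

end Ledger

end


noncomputable section

theorem PMF.bind_congr_support {α β : Type} {p : PMF α} {f g : α → PMF β}
    (h : ∀ a ∈ p.support, f a = g a) : p.bind f = p.bind g := by
  ext b
  rw [PMF.bind_apply, PMF.bind_apply]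
  refine tsum_congr fun a => ?_
  by_cases ha : a ∈ p.support
  · rw [h a ha]
  · rw [PMF.mem_support_iff, not_not] at ha
    rw [ha, zero_mul, zero_mul]

theorem accepts_decide (p : Prop) [Decidable p] : Accepts [decide p] ↔ p := by simp [Accepts]

/-! ## Programs for the operations of the ledger -/

/-- Parameters of a reduction: security parameter, bound for the length of replies (both unary), the
special run, the run in which a forgery is expected, the owner of forwarded runs, the keys, and the
replacement for the key of the special run. -/
structure Conf where
  sec : Str
  T : Str
  J : Str
  g : Str
  Fw : Str
  km : Str
  ke : Str
  L : Str

def Conf.str (K : Conf) : Str :=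
  Str.pair K.sec (Str.pair K.T (Str.pair K.J (Str.pair K.g (Str.pair K.Fw (Str.pair K.km
    (Str.pair K.ke K.L))))))

namespace Prog

def cSec (p : Prog) : Prog := .fst p
def cT (p : Prog) : Prog := .fst (.snd p)
def cJ (p : Prog) : Prog := .fst (.snd (.snd p))
def cG (p : Prog) : Prog := .fst (.snd (.snd (.snd p)))
def cFw (p : Prog) : Prog := .fst (.snd (.snd (.snd (.snd p))))
def cKm (p : Prog) : Prog := .fst (.snd (.snd (.snd (.snd (.snd p)))))
def cKe (p : Prog) : Prog := .fst (.snd (.snd (.snd (.snd (.snd (.snd p))))))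
def cL (p : Prog) : Prog := .snd (.snd (.snd (.snd (.snd (.snd (.snd p))))))

variable {p : Prog} {env : List Str}

/-- The unary string of the same length. -/
def norm (p : Prog) : Prog := .loop p (.lit []) (.append (.lit [true]) (.arg 0))

@[simp] theorem val_norm (p : Prog) (env : List Str) :
    (norm p).val env = Str.unary (p.val env).length := by
  simp only [norm, val]
  generalize (p.val env).length = k
  induction k with
  | zero => rfl
  | succ k ih => rw [Function.iterate_succ_apply', ih]; rfl

attribute [simp] Prog.val Prog.Pure cSec cT cJ cG cFw cKm cKe cL isNil Str.fst_pair Str.snd_pair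
  Str.pair_ne_nil

@[simp] theorem pure_norm (p : Prog) : (norm p).Pure ↔ p.Pure := by simp [norm]

variable {σ : Type} {O : Oracle σ} {loc : Str → Cell} {w : σ × QState} {q : Prog} {u v : Str}

theorem run_base (hp : p.Pure := by simp) (hv : p.val env = v := by simp) :
    ((base p q).tree env).run O loc w = (q.tree env).run O (fun a => loc (Str.pair v a)) w := by
  simp only [tree, Eff.run_bind, hp.run, PMF.pure_bind, Eff.run, Eff.run_relocate, hv]

theorem run_oracle {port : ℕ} (hp : p.Pure := by simp) (hq : q.Pure := by simp)
    (hu : p.val env = u := by simp) (hv : q.val env = v := by simp) :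
    ((oracle port p q).tree env).run O loc w =
      (O port u w.1 w.2).map fun o => (o.1.take v.length, o.2) := by
  simp only [tree, Eff.run_bind, hp.run, hq.run, PMF.pure_bind, Eff.run, hu, hv]
  rfl

theorem run_sandbox_of_val {P : Prog} (hP : P.Classical) (hp : p.Pure := by simp)
    (hv : p.val env = v := by simp) :
    ((sandbox P p).tree env).run O loc w = (P.run v).map fun r => (r, w) :=
  hv ▸ run_sandbox_classical hP hp O loc env w

end Prog

open Prog

/-- Programs for the operations of the ledger. -/
structure Kit where
  opn : Prog
  gen : Prog
  enc : Prog
  sign : Prog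
  vtag : Prog
  bank : Prog

def bankArg (ver : Bool) (i own : ℕ) (key st x : Str) : Str :=
  Str.pair [ver] (Str.pair (Str.unary i) (Str.pair (Str.unary own) (Str.pair key (Str.pair st x))))

def Kit.ops (P : Kit) (K : Conf) : Ledger.Ops where
  opn := P.opn.tree [K.str]
  gen i := P.gen.tree [Str.pair K.str (Str.unary i)]
  enc i k := P.enc.tree [Str.pair K.str (Str.pair (Str.unary i) k)]
  sign c := P.sign.tree [Str.pair K.str c]
  vtag c t := P.vtag.tree [Str.pair K.str (Str.pair c t)]
  bank ver i own key st x := P.bank.tree [Str.pair K.str (bankArg ver i own key st x)]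
  target := K.g

namespace Kit

/-- The configuration in the argument of an operation. -/
def conf : Prog := .fst (.arg 0)

/-- The message for the bank of the mini-scheme in the argument of `bank`. -/
def bankIn : Prog := .partyIn (cSec conf) (.fst (.snd (.snd (.snd (.snd (.arg 0))))))
    (.fst (.snd (.snd (.snd (.snd (.snd (.arg 0)))))))
    (.snd (.snd (.snd (.snd (.snd (.snd (.arg 0)))))))

def bankForward : Prog := .letIn (.oracle 2 (.pair (.ite (.fst (.snd (.arg 0)))
      (.append (.lit [true]) (.fst (.snd (.snd (.arg 0))))) (.lit []))
      (.snd (.snd (.snd (.snd (.snd (.snd (.arg 0)))))))) (cT conf))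
    (.partyOut (.fst (.arg 0)) (.lit []) (.snd (.arg 0)))

def bankLocal (S : MoneyScheme) : Prog :=
  .base (.append (.lit [true]) (.fst (.snd (.snd (.arg 0)))))
    (.ite (.fst (.snd (.arg 0))) (sandbox S.verifyBank bankIn) (sandbox S.mintBank bankIn))

def bankP (S : MoneyScheme) : Prog :=
  .ite (.eq (.fst (.snd (.snd (.snd (.arg 0))))) (cFw conf)) bankForward (bankLocal S)

def genLocal (S : MoneyScheme) : Prog := sandbox S.keygen (cSec conf)

/-- The operations of a forger against the MAC. -/
def forger (S : MoneyScheme) (E : EncScheme) : Kit where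
  opn := .lit []
  gen := genLocal S
  enc := sandbox E.encrypt (.pair (cKe conf) (.snd (.snd (.arg 0))))
  sign := .oracle 0 (.snd (.arg 0)) (cT conf)
  vtag := .oracle 1 (.snd (.arg 0)) (cT conf)
  bank := bankP S

def signLocal (M : MACScheme) : Prog := sandbox M.mac (.pair (cKm conf) (.snd (.arg 0)))

def vtagLocal (M : MACScheme) : Prog := sandbox M.verify (.pair (cKm conf) (.snd (.arg 0)))

/-- The operations of a distinguisher against the encryption scheme. -/
def distinguisher (S : MoneyScheme) (M : MACScheme) : Kit where
  opn := .lit []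
  gen := genLocal S
  enc := .ite (.eq (.fst (.snd (.arg 0))) (cJ conf))
    (.oracle 1 (.pair (norm (.snd (.snd (.arg 0)))) (.snd (.snd (.arg 0)))) (cT conf))
    (.oracle 0 (.snd (.snd (.arg 0))) (cT conf))
  sign := signLocal M
  vtag := vtagLocal M
  bank := bankP S

/-- The operations of a counterfeiter against the mini-scheme. -/
def counterfeiter (S : MoneyScheme) (M : MACScheme) (E : EncScheme) : Kit where
  opn := .oracle 1 (.lit []) (.lit [])
  gen := .ite (.eq (.snd (.arg 0)) (cJ conf)) (.lit []) (genLocal S)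
  enc := sandbox E.encrypt (.pair (cKe conf)
    (.ite (.eq (.fst (.snd (.arg 0))) (cJ conf)) (cL conf) (.snd (.snd (.arg 0)))))
  sign := signLocal M
  vtag := vtagLocal M
  bank := bankP S

variable {S : MoneyScheme} {M : MACScheme} {E : EncScheme} {K : Conf} {n : ℕ} {σ : Type}
  {O : Oracle σ} {loc : Str → Cell}

attribute [local simp] Conf.str conf bankArg accepts_decide

theorem run_genLocal (hS : S.keygen.Classical) (hK : K.sec = Str.unary n) (x : Str)
    (w : σ × QState) :
    ((genLocal S).tree [Str.pair K.str x]).run O loc w =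
      (S.keygen.run (Str.unary n)).map fun k => (k, w) :=
  run_sandbox_of_val hS (hv := by simp [hK])

theorem run_signLocal (hM : M.mac.Classical) (c : Str) (w : σ × QState) :
    ((signLocal M).tree [Str.pair K.str c]).run O loc w =
      (M.mac.run (Str.pair K.km c)).map fun t => (t, w) := run_sandbox_of_val hM

theorem run_vtagLocal (hM : M.verify.Classical) (x : Str) (w : σ × QState) :
    ((vtagLocal M).tree [Str.pair K.str x]).run O loc w =
      (M.verify.run (Str.pair K.km x)).map fun t => (t, w) := run_sandbox_of_val hM

theorem val_bankIn (hK : K.sec = Str.unary n) (ver : Bool) (i own : ℕ) (key st x : Str) :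
    bankIn.val [Str.pair K.str (bankArg ver i own key st x)] = partyInput n key st x := by
  simp [bankIn, partyIn, hK, partyInput]

theorem pure_bankIn : bankIn.Pure := by simp [bankIn, partyIn]

theorem run_bankP_local (hK : K.sec = Str.unary n) (ver : Bool) (i own : ℕ) (key st x : Str)
    (hown : Str.unary own ≠ K.Fw) (w : σ × QState) :
    ((bankP S).tree [Str.pair K.str (bankArg ver i own key st x)]).run O loc w =
      (partyRun (Ledger.bankProg S ver) (fun a => loc (Str.pair (Str.unary (i + 1)) a)) n key st x
        w.2).map fun v => (v.1, w.1, v.2) := by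
  rw [bankP, run_ite_neg (h := by simpa using hown), bankLocal, run_base (v := Str.unary (i + 1))
    (hv := by simp [Str.unary, List.replicate_succ]), partyRun, PMF.map_comp]
  cases ver
  · rw [run_ite_neg (h := by simp [Accepts]), run_sandbox _ pure_bankIn, val_bankIn hK]; rfl
  · rw [run_ite_pos (h := by simp [Accepts]), run_sandbox _ pure_bankIn, val_bankIn hK]; rfl

theorem run_bankP_forward (ver : Bool) (i own : ℕ) (key st x : Str)
    (hown : Str.unary own = K.Fw) (w : σ × QState) :
    ((bankP S).tree [Str.pair K.str (bankArg ver i own key st x)]).run O loc w =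
      (O 2 (Str.pair (if ver then Str.unary (i + 1) else []) x) w.1 w.2).map fun o =>
        (Str.pair (Str.fst (o.1.take K.T.length)) (Str.pair [] (Str.snd (o.1.take K.T.length))), o.2) := by
  rw [bankP, run_ite_pos (h := by simpa using hown), bankForward, run_letIn, run_oracle (v := K.T)
    (u := Str.pair (if ver then Str.unary (i + 1) else []) x)
    (hu := by cases ver <;> simp [Str.unary, List.replicate_succ]), PMF.bind_map]
  refine congrArg _ (funext fun o => ?_)
  rw [Function.comp_apply, Prog.Pure.run (by simp [partyOut])]
  rfl

end Kit

namespace Ledger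

variable {S : MoneyScheme} {M : MACScheme} {E : EncScheme} {n : ℕ} {km ke : Str} {j : ℕ} {b : Bool}
  {kst : Option Str} {F : Bool} {σ' : Type} {O : Oracle σ'}

/-- The numbers of the runs are below `N`. -/
def Fits (a : Ledger) : Prop := ∀ i, a.N ≤ i → a.look i = none

theorem fits_init : init.Fits := fun _ _ => rfl

theorem Fits.lt {a : Ledger} (h : a.Fits) {i : ℕ} {r : Entry} (hr : a.look i = some r) : i < a.N := by
  by_contra hi
  rw [h i (not_lt.1 hi)] at hr
  cases hr

theorem Fits.congr {a a' : Ledger} (h : a.Fits) (hl : ∀ i, a.look i = a'.look i) (hN : a.N = a'.N) :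
    a'.Fits := fun i hi => (hl i).symm.trans (h i (hN ▸ hi))

theorem Fits.push {a : Ledger} (h : a.Fits) (v : Bool) : (a.push v).Fits := fun i hi => by
  have hi' : a.N + 1 ≤ i := hi
  rw [look_push, if_neg (by omega)]
  exact h i (by omega)

theorem Fits.look_push {a : Ledger} (h : a.Fits) (v : Bool) {i : ℕ} {r : Entry}
    (hr : a.look i = some r) : (a.push v).look i = some r := by
  rw [Ledger.look_push, if_neg (h.lt hr).ne', hr]

theorem Fits.set {a : Ledger} (h : a.Fits) {i : ℕ} {r₀ : Entry} (hi : a.look i = some r₀)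
    (r : Entry) : (a.set i r).Fits := fun i' hi' => by
  have hi2 : a.N ≤ i' := hi'
  have := h.lt hi
  rw [look_set, if_neg (by omega)]
  exact h i' hi2

/-- A run that is not forwarded is executed by the reduction itself, with memory below the address
`unary (i + 1)`; this is where every admissible renaming puts the cells of the bank of run `i`. -/
theorem bank_le_local {K : Conf} (hK : K.sec = Str.unary n) {a : Ledger} {i : ℕ} {r : Entry}
    (hr : a.look i = some r) (hs : r.started = true) (hF : (F && r.own == j) = false)
    (hown : Str.unary r.own ≠ K.Fw) (x : Str) {ψ ψ' : QState} (s : σ')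
    (hψ : QState.Renamed (moves F j a) ψ ψ') {g : Str → QState → ℝ≥0∞}
    {h : Str → σ' → QState → ℝ≥0∞}
    (hgh : ∀ v φ φ', QState.Renamed (moves F j a) φ φ' → g v φ ≤ h v s φ') :
    ((partyRun (bankProg S r.ver) (Cell.priv (i + 1)) n r.key r.party.st x ψ).ev
        fun v => g v.1 v.2) ≤
      (((Kit.bankP S).tree [Str.pair K.str
        (bankArg r.ver i r.own (r.hide F j).key (r.hide F j).party.st x)]).run O (Cell.priv 0)
          (s, ψ')).ev fun y => h y.1 y.2.1 y.2.2 := by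
  have hh : r.hide F j = r := by
    rw [Entry.hide, if_neg]
    simp only [hs, Bool.and_true, hF]
    simp
  rw [hh, Kit.run_bankP_local hK _ _ _ _ _ _ hown, PMF.ev_map, partyRun, partyRun, PMF.ev_map,
    PMF.ev_map]
  refine Eff.ev_run_le_of_renamed (moves_nonempty F j a) ?_ _ hψ hgh
  rintro _ ⟨fwd, rfl, hf⟩ sh y
  have hfi : fwd i = false := by rw [hf i r hr hs, hF]
  cases sh
  · simp only [cellAt, Bool.false_eq_true, if_false]
    change moveCell j fwd (Cell.priv (i + 1) y) = _
    simp only [moveCell, hfi, Bool.false_eq_true, if_false]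
  · rfl

/-- An accepted or rejected first message that is treated as in the game. -/
theorem fresh_le {o : Ops} {Out : ℕ → Ledger → σ' → Prop} {U : Ledger → ℝ≥0∞}
    {V : Ledger × σ' → ℝ≥0∞} {a : Ledger} {s : σ'} {i : ℕ} {r : Entry} {c t : Str} {ψ ψ' : QState}
    (hvtag : ((o.vtag c t).run O (Cell.priv 0) (s, ψ')).map (fun x => (decide (Accepts x.1), x.2)) =
      (M.verify.run (Str.pair km (Str.pair c t))).map fun v => (decide (Accepts v), s, ψ'))
    (hO : ∀ b, Out a.fuel (Ledger.reject { a with fresh := a.fresh ++ [(i, b)] } i r).2 s)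
    (hψ : QState.Renamed (moves F j a) ψ ψ') (hr : a.look i = some r) (hs : r.started = false)
    (hd : a.dead = []) (hc : a.find c = none) (hi : Str.unary i ≠ o.target)
    {g : Str → (Ledger × Unit) × QState → ℝ≥0∞} {h : Str → (Ledger × σ') × QState → ℝ≥0∞}
    (hgh : Eff.Tests (LinkRel F j Out) (fun s => U s.1) V g h) :
    ((M.verify.run (Str.pair km (Str.pair c t))).ev fun v => g (Str.pair [false] [])
        (((Ledger.reject { a with fresh := a.fresh ++ [(i, decide (Accepts v))] } i r).2, ()), ψ)) ≤
      ((verStart o (a.hide F j) i r c t).run O (Cell.priv 0) (s, ψ')).ev fun x =>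
        ((finish o x.1).run O (Cell.priv 0) x.2).ev fun y => h y.1.1 ((y.1.2, y.2.1), y.2.2) := by
  rw [verStart_fresh o (by rw [find_hide, hc]; rfl) hi]
  have hv2 := congrArg (fun q => q.ev fun z : Bool × σ' × QState => h (Str.pair [false] [])
    ((((Ledger.reject { a with fresh := a.fresh ++ [(i, z.1)] } i r).2.hide F j, z.2.1)), z.2.2)) hvtag
  simp only [PMF.ev_map] at hv2
  simp only [Eff.run_bind, PMF.ev_bind, Eff.run, PMF.ev_pure, finish]
  refine le_trans ?_ (le_of_eq (hv2.symm.trans (PMF.ev_congr fun z _ => ?_)))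
  · refine PMF.ev_mono fun v _ => ?_
    refine hgh.rel_pure (w := ((_, _), _)) ⟨s, ψ', rfl, ?_, hO (decide (Accepts v)), hd⟩
    exact hψ.mono (moves_set_subset (a := { a with fresh := _ }) hr fun h => by simp [hs] at h)
  · exact congrArg (fun y : Str × Ledger => h y.1 ((y.2, z.2.1), z.2.2))
      (hide_reject F j { a with fresh := a.fresh ++ [(i, decide (Accepts z.1))] } i hs).symm

end Ledger

end


noncomputable section

open Prog

/-! ### The forger and the distinguisher satisfy the requirements of a reduction. -/

theorem EncScheme.cpaOracle_encrypt (E : EncScheme) (k m : Str) (b used : Bool) (ψ : QState) :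
    E.cpaOracle k b 0 m used ψ = (E.encrypt.run (Str.pair k m)).map fun c => (c, used, ψ) := rfl

theorem EncScheme.cpaOracle_challenge (E : EncScheme) (k m : Str) (b : Bool) (ψ : QState)
    (h : m.fst.length = m.snd.length) :
    E.cpaOracle k b 1 m false ψ =
      (E.encrypt.run (Str.pair k (if b then m.snd else m.fst))).map fun c => (c, true, ψ) :=
  if_pos ⟨rfl, h⟩

namespace Ledger

variable {S : MoneyScheme} {M : MACScheme} {E : EncScheme} {n : ℕ} {km ke : Str} {j : ℕ} {b : Bool}
  {kst : Option Str} {F : Bool} {σ' : Type} {O : Oracle σ'} {K : Conf}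

theorem find_minted (a : Ledger) (i : ℕ) (r : Entry) (k c t x : Str) (c' : Str) :
    ((minted a i r k c t x).1.set i (minted a i r k c t x).2.2.1).find c' =
      if c = c' then some (i, k) else a.find c' := find_cons a c (i, k) c'

attribute [local simp] Conf.str Kit.conf Str.length_unary

theorem oracle_dead (o : Ops) (O : Oracle σ') (loc : Str → Cell) (p : ℕ) (m : Str)
    {s : Ledger × σ'} (ψ : QState) (h : s.1.dead ≠ []) :
    oracle o O loc p m s ψ = PMF.pure ([], (s.1.spend m, s.2), ψ) := by
  rw [oracle, run_step, prep, if_neg h]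
  simp only [Eff.run, PMF.pure_bind, finish, PMF.pure_map]

theorem oracle_mono (o : Ops) (O : Oracle σ') (loc : Str → Cell) (p : ℕ) (m : Str)
    (s : Ledger × σ') (ψ : QState) : ∀ x ∈ (oracle o O loc p m s ψ).support,
      s.1.fuel ≤ x.2.1.1.fuel ∧ s.1.fresh <+: x.2.1.1.fresh := by
  intro x hx
  rw [oracle, PMF.mem_support_map_iff] at hx
  obtain ⟨y, hy, rfl⟩ := hx
  have h1 := step_fuel _ _ _ _ _ _ _ _ y hy
  have h2 := step_fresh _ _ _ _ _ _ _ _ y hy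
  exact ⟨by simp only; omega, h2⟩

/-- The bound for test functions that do not look at ledgers with long messages. -/
def cutoff (B : ℕ) (a : Ledger) : ℝ≥0∞ := if B < a.fuel then 0 else ⊤

/-- The bound for test functions that are at most the indicator function of a forgery in run `g`. -/
def forged (B g : ℕ) (a : Ledger) : ℝ≥0∞ :=
  if B < a.fuel then 0
  else match a.fresh.find? fun x => x.1 == g with
    | none => ⊤
    | some x => if x.2 then 1 else 0

theorem cutoff_mono (B : ℕ) {a a' : Ledger} (h : a.fuel ≤ a'.fuel) : cutoff B a' ≤ cutoff B a := by
  unfold cutoff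
  split_ifs with h1 h2 <;> first | exact le_top | exact le_refl _ | omega

theorem forged_mono (B g : ℕ) {a a' : Ledger} (h : a.fuel ≤ a'.fuel) (h' : a.fresh <+: a'.fresh) :
    forged B g a' ≤ forged B g a := by
  unfold forged
  by_cases h1 : B < a'.fuel
  · rw [if_pos h1]; exact zero_le
  · rw [if_neg h1, if_neg (by omega)]
    rcases hf : a.fresh.find? (fun x => x.1 == g) with _ | x
    · simp only [hf]; exact le_top
    · rw [find?_prefix h' hf]
      simp only [hf]; exact le_rfl

/-- The probability that the recorded forgery is successful. -/
def forgeProb (M : MACScheme) (km : Str) (s : Ledger × List Str) : ℝ≥0∞ :=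
  if s.1.dead = [] then 0
  else (M.verify.run (Str.pair km (Str.pair s.1.dead.fst s.1.dead.snd))).ev fun r =>
    if Accepts r ∧ s.1.dead.fst ∉ s.2 then 1 else 0

/-- Tags come from the signing oracle, and every signed message is a ciphertext in the table; a
ciphertext that is not found has therefore never been signed. Nothing is hidden and nothing is
forwarded (`F = false`). The length hypotheses ensure that reading only `K.T.length` bits of a reply
loses nothing. -/
theorem link_forger (hS : S.keygen.Classical) (hE : E.encrypt.Classical)
    (hK : K.sec = Str.unary n) (hg : K.g = Str.unary g) (hFw : K.Fw = [false]) (hke : K.ke = ke)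
    (hT : ∀ k ∈ (S.keygen.run (Str.unary n)).support, ∀ c ∈ (E.encrypt.run (Str.pair ke k)).support,
      ∀ t ∈ (M.mac.run (Str.pair km c)).support, t.length ≤ K.T.length) (hT' : 1 ≤ K.T.length)
    (B : ℕ) :
    Link S M E n km ke j true none false ((Kit.forger S E).ops K) (M.cmaOracle km) B
      (fun _ a Q => a.Fits ∧ (∀ c, a.find c = none → c ∉ Q) ∧
        a.fresh.find? (fun x => x.1 == g) = none) (forged B g) (forgeProb M km) := by
  have hvtag : ∀ c t (s : List Str) ψ, ((((Kit.forger S E).ops K).vtag c t).run (M.cmaOracle km)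
      (Cell.priv 0) (s, ψ)).map (fun x => (decide (Accepts x.1), x.2)) =
      (M.verify.run (Str.pair km (Str.pair c t))).map fun v => (decide (Accepts v), s, ψ) := by
    intro c t s ψ
    simp only [Kit.ops, Kit.forger]
    rw [run_oracle (u := Str.pair c t) (v := K.T)]
    simp only [MACScheme.cmaOracle, Str.fst_pair, Str.snd_pair]
    refine (PMF.map_comp _ _ _).trans ((PMF.map_comp _ _ _).trans ?_)
    congr 1
    funext v
    simp only [Function.comp_apply]
    rw [List.take_of_length_le (by simpa using hT')]
    simp [Accepts]
  refine ⟨fun _ h => h, ?_, fun h => h.1 _ le_rfl, ?_, ?_, fun c t ψ _ => hvtag c t _ ψ, ?_, ?_, ?_,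
    ?_, ?_, ?_, ?_⟩
  · intro f a a' s hl hN ht hw hf h
    exact ⟨h.1.congr hl hN, by simpa only [find, ht] using h.2.1, hf ▸ h.2.2⟩
  · intro f a s v ψ h
    exact ⟨[], s, rfl, h.1.push v, h.2⟩
  · intro f a s i r ψ h hr hv hs ho
    refine ⟨fun _ c _ => c :: s, ?_, fun k _ c t x => ⟨h.1.set hr _, fun c' hc' => ?_, h.2.2⟩⟩
    · simp only [Eff.run_bind, keyDist, encDist, hideKey, Option.isSome_none, and_false,
        Bool.false_eq_true, Bool.true_eq_false, if_false, Bool.false_and]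
      simp only [Kit.ops, Kit.forger]
      rw [Kit.run_genLocal hS hK, PMF.bind_map]
      refine PMF.bind_congr_support fun k hk => ?_
      rw [Function.comp_apply, run_sandbox_of_val hE (v := Str.pair ke k) (hv := by simp [hke]),
        PMF.bind_map]
      refine PMF.bind_congr_support fun c hc => ?_
      rw [Function.comp_apply, run_oracle (u := c) (v := K.T), PMF.bind_map]
      refine (PMF.bind_map _ _ _).trans (PMF.bind_congr_support fun t ht => ?_)
      simp only [Function.comp_apply, Eff.run]
      rw [List.take_of_length_le (hT k hk c hc t ht)]
    · rw [find_minted] at hc'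
      split_ifs at hc' with h1
      exact List.not_mem_cons_of_ne_of_not_mem (Ne.symm h1) (h.2.1 c' hc')
  · intro f a s i r h hr hs ho
    exact ⟨h.1.set hr _, h.2⟩
  · intro f a s i r c y h hr hv hs ho hc
    exact ⟨h.1.set hr _, h.2⟩
  · intro f a s i r c t ψ ψ' hf h hψ hr hv hs ho hd hc G H hGH
    -- In run `g` the reduction stops and records the pair instead of verifying its tag. The game's
    -- test is at most the indicator of a valid tag, the reduction's is at least the probability
    -- that the recorded pair is a valid forgery, and these agree because `c` was not signed.
    by_cases hi : i = g
    · subst hi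
      rw [verStart_dead _ (by rw [find_hide, hc]; rfl) hg.symm]
      simp only [Eff.run, PMF.ev_pure, finish]
      refine le_trans (PMF.ev_mono (g := fun v => if Accepts v ∧ c ∉ s then 1 else 0)
        fun v _ => (hGH.left _ _).trans ?_) (le_trans ?_ (hGH.right [] (({ a.hide false j with
          dead := Str.pair c t }, s), ψ')))
      · have h1 : forged B i (Ledger.reject { a with fresh := a.fresh ++ [(i, decide (Accepts v))] }
            i r).2 ≤ if Accepts v then 1 else 0 := by
          have h2 : (a.fresh ++ [(i, decide (Accepts v))]).find? (fun x => x.1 == i) =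
              some (i, decide (Accepts v)) := by
            rw [List.find?_append, h.2.2]; simp
          simp only [forged, Ledger.reject, set, h2, decide_eq_true_eq]
          split_ifs <;> simp
        refine h1.trans (le_of_eq ?_)
        simp [h.2.1 c hc]
      · rw [forgeProb, if_neg (Str.pair_ne_nil _ _)]
        simp only [Str.fst_pair, Str.snd_pair]
        exact le_rfl
    · have hf : ∀ b : Bool, (a.fresh ++ [(i, b)]).find? (fun x => x.1 == g) = none := by
        intro b
        rw [List.find?_append, h.2.2]
        simp [hi]
      refine fresh_le (hvtag c t s ψ') (fun b => ⟨h.1.set hr _, h.2.1, hf b⟩) hψ hr hs hd hc ?_ hGH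
      show Str.unary i ≠ K.g
      rw [hg]
      exact fun h => hi (Str.unary_injective h)
  · intro f a s i r x ψ ψ' h hr hs ho hB hψ G H hGH
    refine bank_le_local hK hr hs rfl (by rw [hFw]; exact unary_ne_false _) x s hψ
      fun v φ φ' hφ => ?_
    have := hGH v φ φ' s hφ ⟨h.1.set hr _, h.2⟩
    rwa [hideOut] at this
  · intro p m s ψ x hx
    exact forged_mono B g (oracle_mono _ _ _ p m s ψ x hx).1 (oracle_mono _ _ _ p m s ψ x hx).2
  · intro p m s ψ x hx
    -- After a forgery has been recorded all queries are ignored, so the pair stays and no further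
    -- message gets signed.
    by_cases hd : s.1.dead = []
    · rw [forgeProb, if_pos hd]; exact zero_le
    · rw [oracle_dead _ _ _ _ _ _ hd, PMF.support_pure, Set.mem_singleton_iff] at hx
      subst hx
      exact le_rfl
  · intro a ha
    rw [forged, if_pos ha]

/-- The encryption challenge is used at most once. -/
def Unused (j : ℕ) (a : Ledger) (used : Bool) : Prop :=
  a.Fits ∧ (used = true → ∃ r, a.look j = some r ∧ r.started = true)

theorem Unused.set {a : Ledger} {used : Bool} (h : Unused j a used) {i : ℕ} {r₀ r : Entry}
    (hr₀ : a.look i = some r₀) (hr : r₀.started = true → r.started = true) :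
    Unused j (a.set i r) used :=
  ⟨h.1.set hr₀ _, fun hu => exists_look_set hr₀ hr (h.2 hu)⟩

/-- The challenge consists of the string of ones and the key, of equal length, and is submitted in
run `j`. The hidden bit of the challenge oracle is the parameter `b` of the game, so both games are
simulated exactly by one program. -/
theorem link_distinguisher (hS : S.keygen.Classical) (hM : M.mac.Classical)
    (hM' : M.verify.Classical) (hK : K.sec = Str.unary n) (hg : K.g = [false])
    (hFw : K.Fw = [false]) (hJ : K.J = Str.unary j) (hkm : K.km = km)
    (hT : ∀ k ∈ (S.keygen.run (Str.unary n)).support, ∀ i,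
      ∀ c ∈ (encDist E ke j b i k).support, c.length ≤ K.T.length) (B : ℕ) :
    Link S M E n km ke j b none false ((Kit.distinguisher S M).ops K) (E.cpaOracle ke b) B
      (fun _ => Unused j) (cutoff B) (fun _ => 0) := by
  have hvtag : ∀ c t (s : Bool) ψ, ((((Kit.distinguisher S M).ops K).vtag c t).run (E.cpaOracle ke b)
      (Cell.priv 0) (s, ψ)).map (fun x => (decide (Accepts x.1), x.2)) =
      (M.verify.run (Str.pair km (Str.pair c t))).map fun v => (decide (Accepts v), s, ψ) := by
    intro c t s ψ
    simp only [Kit.ops, Kit.distinguisher]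
    rw [Kit.run_vtagLocal hM', PMF.map_comp, hkm]
    rfl
  refine ⟨fun _ h => h, ?_, fun h => h.1 _ le_rfl, ?_, ?_, fun c t ψ _ => hvtag c t _ ψ, ?_, ?_, ?_,
    ?_, ?_, fun _ _ _ _ _ _ => le_rfl, fun a ha => if_pos ha⟩
  · intro f a a' s hl hN ht hw hf h
    exact ⟨h.1.congr hl hN, by simpa only [hl] using h.2⟩
  · intro f a s v ψ h
    exact ⟨[], s, rfl, h.1.push v, fun hu => let ⟨r, hr, hs⟩ := h.2 hu; ⟨r, h.1.look_push v hr, hs⟩⟩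
  · intro f a s i r ψ h hr hv hs ho
    refine ⟨fun _ c _ => if i = j then true else s, ?_, fun k _ c t x => ?_⟩
    · simp only [Eff.run_bind, keyDist, hideKey, Option.isSome_none, and_false, Bool.false_eq_true,
        if_false, Bool.false_and]
      simp only [Kit.ops, Kit.distinguisher]
      rw [Kit.run_genLocal hS hK, PMF.bind_map]
      refine PMF.bind_congr_support fun k hk => ?_
      simp only [Function.comp_apply]
      have h1 : ((Kit.distinguisher S M).enc.tree [Str.pair K.str (Str.pair (Str.unary i) k)]).run
          (E.cpaOracle ke b) (Cell.priv 0) (s, ψ) = (encDist E ke j b i k).map fun c =>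
            (c, if i = j then true else s, ψ) := by
        simp only [Kit.distinguisher]
        by_cases hi : i = j
        · subst hi
          -- The challenge is used only when run `j` starts. If it had been used before, run `j`
          -- would have started already.
          have hu : s = false := by
            by_contra hu
            obtain ⟨r', hr', hs'⟩ := h.2 (by simpa using hu)
            rw [hr] at hr'
            obtain rfl := Option.some.inj hr'
            rw [hs] at hs'; cases hs'
          subst hu
          rw [run_ite_pos (h := by simp [Accepts, hJ]), if_pos rfl,
            run_oracle (u := Str.pair (Str.unary k.length) k) (v := K.T),
            EncScheme.cpaOracle_challenge _ _ _ _ _ (by simp), PMF.map_comp, Str.fst_pair,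
            Str.snd_pair, encDist, show (if b = true then k else Str.unary k.length) =
              if i = i ∧ b = false then Str.unary k.length else k by cases b <;> simp]
          refine PMF.bind_congr_support fun c hc => ?_
          simp only [Function.comp_apply]
          rw [List.take_of_length_le (hT k hk i c hc)]
        · have h5 : encDist E ke j b i k = E.encrypt.run (Str.pair ke k) := by
            rw [encDist, if_neg (by simp [hi])]
          rw [run_ite_neg (h := by simpa [Accepts, hJ, Str.unary_injective.eq_iff] using hi), if_neg hi,
            run_oracle (u := k) (v := K.T), EncScheme.cpaOracle_encrypt, PMF.map_comp, h5]
          refine PMF.bind_congr_support fun c hc => ?_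
          simp only [Function.comp_apply]
          rw [List.take_of_length_le (hT k hk i c (h5 ▸ hc))]
      simp only [Kit.distinguisher] at h1
      rw [h1, PMF.bind_map]
      refine congrArg _ (funext fun c => ?_)
      rw [Function.comp_apply, Kit.run_signLocal hM, PMF.bind_map, hkm]
      rfl
    · have h6 : Unused j (a.set i (minted a i r k c t x).2.2.1) s := h.set hr fun _ => rfl
      refine ⟨h6.1, fun hu => ?_⟩
      by_cases hi : i = j
      · subst hi
        exact ⟨(minted a i r k c t x).2.2.1, by rw [look_set, if_pos rfl], rfl⟩
      · exact h6.2 (by simpa [hi] using hu)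
  · intro f a s i r h hr hs ho
    exact h.set hr fun h => h
  · intro f a s i r c y h hr hv hs ho hc
    exact h.set hr fun _ => rfl
  · intro f a s i r c t ψ ψ' hf h hψ hr hv hs ho hd hc G H hGH
    exact fresh_le (hvtag c t s ψ') (fun b => by exact h.set hr fun h => h) hψ hr hs hd hc
      (by show _ ≠ K.g; rw [hg]; exact unary_ne_false _) hGH
  · intro f a s i r x ψ ψ' h hr hs ho hB hψ G H hGH
    refine bank_le_local hK hr hs rfl (by rw [hFw]; exact unary_ne_false _) x s hψ
      fun v φ φ' hφ => ?_
    have := hGH v φ φ' s hφ (h.set hr fun h => h)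
    rwa [hideOut] at this
  · intro p m s ψ x hx
    exact cutoff_mono B (oracle_mono _ _ _ p m s ψ x hx).1

end Ledger

end


noncomputable section

namespace Ledger

/-! ### The counterfeiter of the mini-scheme satisfies the requirements of a reduction. -/

open Prog

attribute [local simp] Conf.str Kit.conf Accepts

variable {S : MoneyScheme} {M : MACScheme} {E : EncScheme} {n : ℕ} {km ke : Str} {j : ℕ} {b : Bool}
  {σ' : Type} {K : Conf} {k : Str}

/-- The situation of the bank of the outer game in the run of `mint` (`v = false`) or in the run of
`verify` (`v = true`) that belongs to an entry. -/
def outerParty (j : ℕ) (v : Bool) : Option Entry → Party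
  | none => Party.init
  | some r => if r.started && r.ver == v && r.own == j then r.party else Party.init

/-- The number of the run of the outer game. -/
def outerRun (v : Bool) (i : ℕ) : ℕ := if v then i + 1 else 0

/-- The correspondence of the ledger and the runs of a single banknote in the outer game. -/
structure MiniRel (S : MoneyScheme) (n j : ℕ) (k : Str) (f : ℕ) (a : Ledger)
    (runs : List Session) : Prop where
  fits : a.Fits
  len : runs.length = a.N + 1
  mint : runs[0]? = some ⟨false, outerParty j false (a.look j)⟩
  ver : ∀ i, i < a.N → runs[i + 1]? = some ⟨true, outerParty j true (a.look i)⟩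
  own : ∀ i r, a.look i = some r → r.started = true → (r.ver = false → r.own = i) ∧
    ∃ r', a.look r.own = some r' ∧ r'.ver = false
  key : ∀ i r, a.look i = some r → r.started = true → r.own = j → r.key = k ∧
    ∃ len ≤ f, ∃ c, Reachable (bankProg S r.ver) (Cell.priv (outerRun r.ver i + 1)) n k r.party len c
  tbl : ∀ c j' k', a.find c = some (j', k') →
    (∃ r, a.look j' = some r ∧ r.ver = false) ∧ (j' = j → k' = k)
  count : a.wins.count j ≤ runs.countP success

variable {f : ℕ} {a : Ledger} {runs : List Session}

theorem miniRel_init : MiniRel S n j k 0 init [⟨false, Party.init⟩] :=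
  ⟨fits_init, rfl, rfl, fun _ h => absurd h (Nat.not_lt_zero _), fun _ _ h => absurd h (by simp [look, init]),
    fun _ _ h => absurd h (by simp [look, init]), fun _ _ _ h => absurd h (by simp [find, init]), Nat.zero_le _⟩

theorem MiniRel.mono (h : MiniRel S n j k f a runs) {f' : ℕ} (hf : f ≤ f') :
    MiniRel S n j k f' a runs :=
  ⟨h.fits, h.len, h.mint, h.ver, h.own, fun i r h1 h2 h3 =>
    let ⟨h4, len, h5, h6⟩ := h.key i r h1 h2 h3; ⟨h4, len, h5.trans hf, h6⟩, h.tbl, h.count⟩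

theorem MiniRel.congr (h : MiniRel S n j k f a runs) {a' : Ledger}
    (hl : ∀ i, a.look i = a'.look i) (hN : a.N = a'.N) (ht : a.tbl = a'.tbl)
    (hw : a.wins = a'.wins) : MiniRel S n j k f a' runs := by
  obtain ⟨h1, h2, h3, h4, h5, h6, h7, h8⟩ := h
  have hf : ∀ c, a.find c = a'.find c := fun c => by simp only [find, ht]
  exact ⟨h1.congr hl hN, hN ▸ h2, hl j ▸ h3, by simpa only [← hN, ← hl] using h4,
    by simpa only [← hl] using h5, by simpa only [← hl] using h6,
    by simpa only [← hl, ← hf] using h7, hw ▸ h8⟩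

/-- Whatever its kind, a new run opens a verification in the outer game. This keeps the numbering
aligned: outer run 0 is the only run of `mint`, and outer run `i + 1` is reserved for run `i`, even
if it is never used. -/
theorem MiniRel.push (h : MiniRel S n j k f a runs) (v : Bool) :
    MiniRel S n j k f (a.push v) (runs ++ [⟨true, Party.init⟩]) := by
  have hl : ∀ {q : Entry → Prop} {i}, (∃ r, a.look i = some r ∧ q r) →
      ∃ r, (a.push v).look i = some r ∧ q r := fun ⟨r, hr, hq⟩ => ⟨r, h.fits.look_push v hr, hq⟩
  have hp : ∀ w i, outerParty j w ((a.push v).look i) = outerParty j w (a.look i) := by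
    intro w i
    rw [look_push]
    split_ifs with hi
    · rw [h.fits i hi.le]; simp [outerParty]
    · rfl
  refine ⟨h.fits.push v, by simp [h.len, Ledger.push], ?_, fun i hi => ?_, fun i r hr hs => ?_,
    fun i r hr hs => h.key i r (look_of_look_push hr hs) hs, fun c j' k' hc => ?_, ?_⟩
  · rw [List.getElem?_append_left (by rw [h.len]; omega), h.mint, hp]
  · have hi' : i < a.N + 1 := hi
    rw [hp]
    rcases Nat.lt_succ_iff_lt_or_eq.1 hi' with hi | rfl
    · rw [List.getElem?_append_left (by rw [h.len]; omega), h.ver i hi]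
    · rw [List.getElem?_append_right (by rw [h.len]), h.fits _ le_rfl, h.len]
      simp [outerParty]
  · obtain ⟨h1, h2⟩ := h.own i r (look_of_look_push hr hs) hs
    exact ⟨h1, hl h2⟩
  · obtain ⟨h1, h2⟩ := h.tbl c j' k' hc
    exact ⟨hl h1, h2⟩
  · rw [List.countP_append]
    exact h.count.trans (Nat.le_add_right _ _)

theorem MiniRel.set (h : MiniRel S n j k f a runs) {i : ℕ} {r₀ r : Entry}
    (hr₀ : a.look i = some r₀) (hv : r.ver = r₀.ver)
    (hp : ∀ v, outerParty j v (some r) = outerParty j v (some r₀))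
    (hown : r.started = true → (r.ver = false → r.own = i) ∧
      ∃ r', a.look r.own = some r' ∧ r'.ver = false)
    (hkey : r.started = true → r.own = j → r.key = k ∧ ∃ len ≤ f, ∃ c,
      Reachable (bankProg S r.ver) (Cell.priv (outerRun r.ver i + 1)) n k r.party len c) :
    MiniRel S n j k f (a.set i r) runs := by
  have hl : ∀ {i'}, (∃ r, a.look i' = some r ∧ r.ver = false) →
      ∃ r', (a.set i r).look i' = some r' ∧ r'.ver = false := exists_look_set hr₀ hv.trans
  have hp' : ∀ w i', outerParty j w ((a.set i r).look i') = outerParty j w (a.look i') := by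
    intro w i'
    rw [look_set]
    split_ifs with hi
    exacts [by rw [hp, ← hi, hr₀], rfl]
  refine ⟨h.fits.set hr₀ r, h.len, ?_, fun i' hi' => ?_, fun i' r' hr' hs => ?_,
    fun i' r' hr' hs => ?_, fun c j' k' hc => ?_, h.count⟩
  · rw [hp', h.mint]
  · rw [hp', h.ver i' hi']
  · rcases look_set_cases hr' with ⟨rfl, rfl⟩ | hr'
    exacts [⟨(hown hs).1, hl (hown hs).2⟩, ⟨(h.own i' r' hr' hs).1, hl (h.own i' r' hr' hs).2⟩]
  · rcases look_set_cases hr' with ⟨rfl, rfl⟩ | hr'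
    exacts [hkey hs, h.key i' r' hr' hs]
  · obtain ⟨h1, h2⟩ := h.tbl c j' k' hc
    exact ⟨hl h1, h2⟩

theorem MiniRel.insert (h : MiniRel S n j k f a runs) {i : ℕ} {r : Entry} {c k' : Str}
    (hr : a.look i = some r) (hv : r.ver = false) (hk : i = j → k' = k) :
    MiniRel S n j k f { a with tbl := (c, i, k') :: a.tbl } runs := by
  refine ⟨h.fits, h.len, h.mint, h.ver, h.own, h.key, fun c' j' k'' hc' => ?_, h.count⟩
  rw [find_cons] at hc'
  split_ifs at hc' with hcc
  · subst hcc
    obtain ⟨rfl, rfl⟩ := Prod.mk.inj (Option.some.inj hc')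
    exact ⟨⟨r, hr, hv⟩, hk⟩
  · exact h.tbl c' j' k'' hc'

/-- Runs of the outer game belong to entries. -/
theorem MiniRel.get (h : MiniRel S n j k f a runs) {i : ℕ} {r : Entry} (hr : a.look i = some r)
    (hs : r.started = true) (ho : r.own = j) :
    runs[outerRun r.ver i]? = some ⟨r.ver, r.party⟩ ∧ (r.ver = false ↔ i = j) := by
  obtain ⟨h1, r', h2, h3⟩ := h.own i r hr hs
  rcases hv : r.ver with _ | _
  · obtain rfl := (h1 hv).symm.trans ho
    refine ⟨?_, by simp⟩
    have h4 := h.mint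
    rw [hr] at h4
    simpa [outerParty, hs, hv, ho, outerRun] using h4
  · refine ⟨?_, ?_⟩
    · have h4 := h.ver i (h.fits.lt hr)
      rw [hr] at h4
      simpa [outerParty, hs, hv, ho, outerRun] using h4
    · refine ⟨fun h => absurd h (by simp), ?_⟩
      rintro rfl
      rw [ho, hr] at h2
      obtain rfl := Option.some.inj h2
      rw [hv] at h3; cases h3

/-- A step of a forwarded run. -/
theorem MiniRel.forward (h : MiniRel S n j k f a runs) {i : ℕ} {r : Entry} (hr : a.look i = some r)
    (hs : r.started = true) (ho : r.own = j) (hout : r.party.out = none) (v : Str) {len c : ℕ}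
    (hreach : Reachable (bankProg S r.ver) (Cell.priv (outerRun r.ver i + 1)) n k (partyNext v) len c)
    (hlen : len ≤ f) :
    MiniRel S n j k f (bankDone a i r v).2
      (runs.set (outerRun r.ver i) ⟨r.ver, partyNext v⟩) := by
  have hl : ∀ {i'}, (∃ r, a.look i' = some r ∧ r.ver = false) →
      ∃ r', (bankDone a i r v).2.look i' = some r' ∧ r'.ver = false :=
    exists_look_set (r := { r with party := partyNext v }) hr fun h => h
  obtain ⟨hget, hij⟩ := h.get hr hs ho
  have hlt : outerRun r.ver i < runs.length := by
    by_contra hc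
    rw [List.getElem?_eq_none (not_lt.1 hc)] at hget
    cases hget
  refine ⟨(h.fits.set hr { r with party := partyNext v }).congr (fun i' => ?_) rfl, by rw [List.length_set]; exact h.len, ?_,
    fun i' hi' => ?_, fun i' r' hr' hs' => ?_, fun i' r' hr' hs' => ?_, fun c j' k' hc => ?_, ?_⟩
  · rw [look_bankDone, look_set]
  · rw [look_bankDone]
    rcases hv : r.ver with _ | _
    · rw [if_pos (hij.1 hv)]
      simp only [outerRun, Bool.false_eq_true, if_false]
      rw [List.getElem?_set_self (by rw [h.len]; omega)]
      simp [outerParty, hs, ho]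
    · rw [if_neg (fun hi => by rw [hij.2 hi] at hv; cases hv)]
      simp only [outerRun, if_true]
      rw [List.getElem?_set_ne (by omega), h.mint]
  · rw [look_bankDone]
    rcases hv : r.ver with _ | _
    · simp only [outerRun, Bool.false_eq_true, if_false]
      rw [List.getElem?_set_ne (by omega), h.ver i' hi']
      split_ifs with hi
      · subst hi; rw [hr]; simp [outerParty, hv]
      · rfl
    · simp only [outerRun, if_true]
      split_ifs with hi
      · subst hi
        rw [List.getElem?_set_self (by simpa [outerRun, hv] using hlt)]
        simp [outerParty, hs, ho]
      · rw [List.getElem?_set_ne (by omega), h.ver i' hi']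
  · rcases look_set_cases hr' with ⟨rfl, rfl⟩ | hr'
    · exact ⟨(h.own _ r hr hs).1, hl (h.own _ r hr hs).2⟩
    · exact ⟨(h.own i' r' hr' hs').1, hl (h.own i' r' hr' hs').2⟩
  · rcases look_set_cases hr' with ⟨rfl, rfl⟩ | hr'
    · exact fun _ => ⟨(h.key _ r hr hs ho).1, len, hlen, c, hreach⟩
    · exact h.key i' r' hr' hs'
  · obtain ⟨h1, h2⟩ := h.tbl c j' k' hc
    exact ⟨hl h1, h2⟩
  · have hg : runs[outerRun r.ver i] = ⟨r.ver, r.party⟩ := by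
      rw [List.getElem?_eq_getElem hlt] at hget
      exact Option.some.inj hget
    rw [List.countP_set hlt, hg]
    have := h.count
    simp only [bankDone, success, hout, ho]
    by_cases hw : r.ver = true ∧ (partyNext v).out = some true
    · simp [hw.1, hw.2]; omega
    · rw [if_neg hw]
      have hw' : (r.ver && (partyNext v).out == some true) = false := by
        rw [Bool.eq_false_iff]
        simpa using hw
      simp [hw']; omega

/-- The outer bank holds the key `k` of run `j`. Since a string of ones is encrypted in that run (`b
= false`), the reduction needs only the length of `k`. Run `j` and the verifications owned by it are
forwarded, and all other runs have keys that the reduction knows. -/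
theorem link_counterfeiter (hS : S.keygen.Classical) (hE : E.encrypt.Classical)
    (hM : M.mac.Classical)
    (hM' : M.verify.Classical) (hK : K.sec = Str.unary n) (hg : K.g = [false])
    (hFw : K.Fw = Str.unary j) (hJ : K.J = Str.unary j) (hkm : K.km = km) (hke : K.ke = ke)
    (hL : K.L = Str.unary k.length) (B : ℕ)
    (hT : ∀ ver i s len c, Reachable (bankProg S ver) (Cell.priv (i + 1)) n k s len c → len ≤ B →
      2 * c + 4 ≤ K.T.length) :
    Link S M E n km ke j false (some k) true ((Kit.counterfeiter S M E).ops K) (S.bankOracle n k) B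
      (MiniRel S n j k) (cutoff B) (fun _ => 0) := by
  have hvtag : ∀ c t (s : List Session) ψ, ((((Kit.counterfeiter S M E).ops K).vtag c t).run
      (S.bankOracle n k) (Cell.priv 0) (s, ψ)).map (fun x => (decide (Accepts x.1), x.2)) =
      (M.verify.run (Str.pair km (Str.pair c t))).map fun v => (decide (Accepts v), s, ψ) := by
    intro c t s ψ
    simp only [Kit.ops, Kit.counterfeiter]
    rw [Kit.run_vtagLocal hM', PMF.map_comp, hkm]
    rfl
  refine ⟨fun h h' => h'.mono h, fun hl hN ht hw _ h => h.congr hl hN ht hw,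
    fun h => h.fits _ le_rfl, ?_, ?_, fun c t ψ _ => hvtag c t _ ψ, ?_, ?_, ?_,
    ?_, ?_, fun _ _ _ _ _ _ => le_rfl, fun a ha => if_pos ha⟩
  · intro f a s v ψ h
    exact ⟨[], _, PMF.pure_map _ _, h.push v⟩
  · intro f a s i r ψ h hr hv hs ho
    -- In the game the key of run `j` is prescribed to be `k`, so the table and the entry of this
    -- run agree with the key of the outer bank.
    have hk1 : ∀ k' ∈ (keyDist S n j (some k) i).support, i = j → k' = k := by
      rintro k' hk' rfl
      rwa [keyDist, if_pos (by simp), PMF.support_pure, Set.mem_singleton_iff] at hk'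
    refine ⟨fun _ c _ => s, ?_, fun k' hk' c t x => ?_⟩
    · simp only [Eff.run_bind]
      have h1 : (((Kit.counterfeiter S M E).ops K).gen i).run (S.bankOracle n k) (Cell.priv 0)
          (s, ψ) = (keyDist S n j (some k) i).map fun k' => (hideKey true j i k', s, ψ) := by
        simp only [Kit.ops, Kit.counterfeiter]
        by_cases hi : i = j
        · rw [run_ite_pos (h := by simp [hJ, hi]), keyDist, if_pos (by simp [hi]), PMF.pure_map]
          simp [hideKey, run_lit, hi]
        · rw [run_ite_neg (h := by simpa [hJ, Str.unary_injective.eq_iff] using hi), keyDist,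
            if_neg (by simp [hi]), Kit.run_genLocal hS hK]
          simp [hideKey, hi]
      rw [h1, PMF.bind_map]
      refine PMF.bind_congr_support fun k' hk' => ?_
      simp only [Function.comp_apply, Kit.ops, Kit.counterfeiter]
      rw [run_sandbox_of_val hE (v := Str.pair ke (if i = j then Str.unary k.length else k'))
        (hv := by by_cases hi : i = j <;>
          simp [hi, hJ, hke, hL, hideKey, Str.unary_injective.eq_iff]), PMF.bind_map,
        show encDist E ke j false i k' = E.encrypt.run (Str.pair ke
          (if i = j then Str.unary k.length else k')) by
          by_cases hi : i = j <;> simp [encDist, hi]; rw [hk1 k' hk' hi]]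
      refine congrArg _ (funext fun c => ?_)
      rw [Function.comp_apply, Kit.run_signLocal hM, PMF.bind_map, hkm]
      rfl
    · replace hk1 := hk1 k' hk'
      refine (h.insert (c := c) hr hv hk1).set hr rfl (fun v => ?_) (fun _ => ⟨fun _ => rfl, r, hr, hv⟩)
        fun _ hi => ⟨hk1 hi, 0, Nat.zero_le _, 0, Reachable.init⟩
      simp [outerParty, minted, hs]
  · intro f a s i r h hr hs ho
    exact h.set hr rfl (fun v => by simp [outerParty, hs]) (fun hs' => by simp [hs] at hs')
      fun hs' => by simp [hs] at hs'
  · intro f a s i r c y h hr hv hs ho hc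
    obtain ⟨h1, h2⟩ := h.tbl c y.1 y.2 hc
    exact h.set hr rfl (fun v => by simp [outerParty, hs])
      (fun _ => ⟨fun h => by simp [hv] at h, h1⟩)
      fun _ hi => ⟨h2 hi, 0, Nat.zero_le _, 0, Reachable.init⟩
  · intro f a s i r c t ψ ψ' hf h hψ hr hv hs ho hd hc G H hGH
    refine fresh_le (hvtag c t s ψ') (fun b => ?_) hψ hr hs hd hc
      (by show _ ≠ K.g; rw [hg]; exact unary_ne_false _) hGH
    exact ((h.mono hf).congr (a' := { a with fresh := a.fresh ++ [(i, b)] }) (fun _ => rfl) rfl rfl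
      rfl).set hr rfl (fun v => by simp [outerParty, hs]) (fun hs' => by simp [hs] at hs')
      fun hs' => by simp [hs] at hs'
  · intro f a s i r x ψ ψ' h hr hs ho hB hψ G H hGH
    by_cases hown : r.own = j
    · obtain ⟨hget, hij⟩ := h.get hr hs hown
      obtain ⟨hkey, len, hlen, c, hreach⟩ := h.key i r hr hs hown
      simp only [Kit.ops, Kit.counterfeiter]
      rw [Kit.run_bankP_forward _ _ _ _ _ _ (by rw [hFw, hown])]
      have hidx : List.length (if r.ver = true then Str.unary (i + 1) else ([] : Str)) = outerRun r.ver i := by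
        rcases r.ver with _ | _ <;> simp [outerRun, Str.length_unary]
      have hst : r.party = ⟨r.party.st, none⟩ := by rw [← ho]
      rw [MoneyScheme.bankOracle_some S n k _ _ (s := ⟨r.ver, r.party⟩)
        (by rw [Str.fst_pair]; exact hidx ▸ hget), Str.fst_pair, Str.snd_pair]
      simp only
      rw [hidx, hst, activate_none, PMF.map_comp, PMF.map_comp, PMF.ev_map]
      simp only [Function.comp_def]
      set loc' := Cell.priv (outerRun r.ver i + 1) with hloc'
      -- The comparison of the two placements quantifies over all values, not only over possible
      -- ones. `P` collects what is known of the possible ones; on the others the test function is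
      -- set to `⊤`, which does not change the expectation.
      let P : Str → Prop := fun v => (∃ c', Reachable (bankProg S r.ver) loc' n k (partyNext v)
        (len + (x.length + 1)) c') ∧ v.length + 4 ≤ K.T.length
      have hP : ∀ o ∈ (partyRun (bankProg S r.ver) loc' n k r.party.st x ψ').support, P o.1 := by
        intro o ho'
        rw [partyRun, PMF.mem_support_map_iff] at ho'
        obtain ⟨y, hy, rfl⟩ := ho'
        obtain ⟨o', ho', rfl⟩ := Eff.exists_interp_of_run hy 0
        obtain ⟨d, hd, hd'⟩ := ensures_length (bankProg S r.ver) noOracle loc' _ _ _ _ _ ho'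
        have h1 := Reachable.step hreach ho x ψ' o' (by rw [eval_run]; exact ho')
        have h2 := hT r.ver _ _ _ _ h1 (by omega)
        exact ⟨⟨_, h1⟩, by simp only; omega⟩
      -- The reply is not truncated: the status has at most one bit, so pairing adds at most 4 to
      -- the length of the message.
      have hreply : ∀ v, P v → List.take K.T.length
          (Str.pair (partyNext v).out.toList (partyReply v)) =
            Str.pair (partyNext v).out.toList (partyReply v) := by
        intro v hv
        refine List.take_of_length_le ?_
        rw [Str.length_pair]
        have h1 : (partyReply v).length ≤ v.length :=
          (Str.length_snd_le _).trans (Str.length_snd_le _)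
        have h2 : (partyNext v).out.toList.length ≤ 1 := by
          rcases (partyNext v).out with _ | _ <;> simp
        have := hv.2
        omega
      classical
      calc _ ≤ (partyRun (bankProg S r.ver) loc' n k r.party.st x ψ').ev fun o => if P o.1 then
            H (hideOut true j r o.1) (s.set (outerRun r.ver i) ⟨r.ver, partyNext o.1⟩) o.2 else ⊤ := by
            rw [hkey, partyRun, partyRun, PMF.ev_map, PMF.ev_map]
            refine Eff.ev_run_le_of_renamed (moves_nonempty true j a) ?_ _ hψ
              (g := fun v φ => if P v then H (hideOut true j r v)
                (s.set (outerRun r.ver i) ⟨r.ver, partyNext v⟩) φ else ⊤) ?_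
            -- The outer bank of `mint` is party 1 and that of the outer verification `i + 1` is
            -- party `i + 2`, as in `moveCell`.
            · rintro _ ⟨fwd, rfl, hf⟩ sh y
              have hfi : fwd i = true := by rw [hf i r hr hs, hown]; simp
              cases sh
              · simp only [cellAt, Bool.false_eq_true, if_false]
                change moveCell j fwd (Cell.priv (i + 1) y) = _
                simp only [moveCell, hfi, if_true, hloc']
                rcases hv : r.ver with _ | _
                · rw [if_pos (hij.1 hv)]; rfl
                · rw [if_neg fun hi => by rw [hij.2 hi] at hv; cases hv]; rfl
              · rfl
            · intro v φ φ' hφ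
              split_ifs with hPv
              · obtain ⟨⟨c', hc'⟩, -⟩ := hPv
                exact hGH v φ φ' _ hφ ((h.mono (by omega)).forward hr hs hown ho v hc' (by omega))
              · exact le_top
        _ = _ := PMF.ev_congr fun o ho' => by
            have h1 := hP o ho'
            rw [if_pos h1, hreply _ h1, Str.fst_pair, Str.snd_pair, hideOut, if_pos (by simp [hown])]
    · have hF : (true && r.own == j) = false := by simpa using hown
      refine bank_le_local hK hr hs hF (by rw [hFw]; exact fun h => hown (Str.unary_injective h)) x s
        hψ fun v φ φ' hφ => ?_
      have := hGH v φ φ' s hφ ?_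
      · rwa [hideOut, if_neg (by rw [hF]; simp)] at this
      · have h1 := (h.mono (f' := f + (x.length + 1)) (by omega)).set (r := { r with party := partyNext v })
          hr rfl (fun w => by simp [outerParty, hown]) (fun _ => h.own i r hr hs)
          fun _ hi => absurd hi hown
        refine ⟨h1.fits, h1.len, h1.mint, h1.ver, h1.own, h1.key, h1.tbl, ?_⟩
        refine le_trans (le_of_eq ?_) h.count
        simp only [bankDone]
        split_ifs
        · rw [List.count_cons_of_ne hown]
        · rfl
  · intro p m s ψ x hx
    exact cutoff_mono B (oracle_mono _ _ _ p m s ψ x hx).1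

end Ledger

end


noncomputable section

open Prog

/-! ## The ledger as a program -/

/-- Association lists as strings. -/
def assoc : List (Str × Str) → Str
  | [] => []
  | x :: l => Str.pair x.1 (Str.pair x.2 (assoc l))

namespace Prog

/-- The suffix of an association list that begins with a key; the argument is the pair of the key
and the list. -/
def lookP : Prog := .loop (.snd (.arg 0)) (.snd (.arg 0)) (.ite (isNil (.arg 0)) (.arg 0)
    (.ite (.eq (.fst (.arg 0)) (.fst (.arg 1))) (.arg 0) (.snd (.snd (.arg 0)))))

theorem pure_lookP : lookP.Pure := by simp [lookP, Prog.Pure, isNil]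

/-- The loop makes as many passes as the encoded list has bits, which is at least its number of
entries. A suffix beginning with the key, and the empty string, are fixed points, so surplus passes
are harmless. -/
theorem val_lookP (key : Str) (l : List (Str × Str)) :
    lookP.val [Str.pair key (assoc l)] = assoc (l.dropWhile fun x => !(x.1 == key)) := by
  have hlen : ∀ l, l.length ≤ (assoc l).length := by
    intro l
    induction l with
    | nil => exact le_rfl
    | cons x l ih => simp only [assoc, Str.length_pair, List.length_cons]; omega
  simp only [lookP, val, List.getD_cons_zero, List.getD_cons_succ, Str.snd_pair, Str.fst_pair,
    val_isNil]
  generalize hN : (assoc l).length = N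
  have hN' := hN ▸ hlen l
  clear hN
  induction N generalizing l with
  | zero =>
    obtain rfl := List.length_eq_zero_iff.1 (Nat.le_zero.1 hN')
    rfl
  | succ N ih =>
    rw [Function.iterate_succ_apply]
    rcases l with _ | ⟨x, l⟩
    · simpa [assoc] using ih [] (Nat.zero_le _)
    · by_cases hx : x.1 = key
      · have h1 : (x :: l).dropWhile (fun x => !(x.1 == key)) = x :: l := by simp [hx]
        have h2 : ∀ N, (fun u : Str => if ([decide (u = [])] : Str).head? = some true then u else
            if ([decide (u.fst = key)] : Str).head? = some true then u else u.snd.snd)^[N]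
              (assoc (x :: l)) = assoc (x :: l) := by
          intro N
          refine Function.iterate_fixed ?_ N
          simp [assoc, Str.fst_pair, hx]
        rw [← Function.iterate_succ_apply, h2, h1]
      · have h1 : (x :: l).dropWhile (fun x => !(x.1 == key)) =
            l.dropWhile (fun x => !(x.1 == key)) := by simp [hx]
        rw [h1, ← ih l (by simpa using hN')]
        congr 1
        simp [assoc, Str.fst_pair, Str.snd_pair, hx, Str.pair_ne_nil]

theorem val_lookP_none {key : Str} {l : List (Str × Str)}
    (h : l.find? (fun x => x.1 == key) = none) : lookP.val [Str.pair key (assoc l)] = [] := by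
  rw [val_lookP, List.dropWhile_eq_nil_iff.2, assoc]
  intro x hx
  simpa using List.find?_eq_none.1 h x hx

theorem val_lookP_some {key v : Str} {l : List (Str × Str)} {x : Str × Str}
    (h : l.find? (fun x => x.1 == key) = some x) (hv : x.2 = v) :
    ∃ t, lookP.val [Str.pair key (assoc l)] = Str.pair key (Str.pair v t) := by
  induction l with
  | nil => cases h
  | cons y l ih =>
    rw [List.find?_cons] at h
    rw [val_lookP] at *
    by_cases hy : y.1 = key
    · rw [beq_iff_eq.2 hy] at h
      obtain rfl := Option.some.inj h
      rw [List.dropWhile_cons_of_neg (by simp [hy]), assoc, hy, hv]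
      exact ⟨_, rfl⟩
    · rw [beq_eq_false_iff_ne.2 hy] at h
      rw [List.dropWhile_cons_of_pos (by simp [hy])]
      exact val_lookP key l ▸ ih h

end Prog

def Entry.str (r : Entry) : Str :=
  Str.pair [r.ver] (Str.pair [r.started] (Str.pair (Str.unary r.own) (Str.pair r.key
    (Str.pair r.ct (Str.pair r.party.st r.party.out.toList)))))

namespace Ledger

/-- The ledger as a string; of the list of owners only the number of occurrences of `j` is kept. -/
def encode (K : Conf) (j : ℕ) (a : Ledger) : Str := Str.pair K.str (Str.pair (Str.unary a.N)
    (Str.pair (assoc (a.log.map fun x => (Str.unary x.1, x.2.str)))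
    (Str.pair (assoc (a.tbl.map fun x => (x.1, Str.pair (Str.unary x.2.1) x.2.2)))
    (Str.pair (Str.unary (a.wins.count j)) a.dead))))

def encodePrep (K : Conf) (j : ℕ) : Prep → Str
  | .inl x => Str.pair [false] (Str.pair (x.2.encode K j) x.1)
  | .inr y => Str.pair [true] (Str.pair (y.1.encode K j)
      (Str.pair (Str.unary y.2.1) (Str.pair y.2.2.1.str y.2.2.2)))

end Ledger

namespace Prog

def sConf (s : Prog) : Prog := .fst s
def sN (s : Prog) : Prog := .fst (.snd s)
def sLog (s : Prog) : Prog := .fst (.snd (.snd s))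
def sTbl (s : Prog) : Prog := .fst (.snd (.snd (.snd s)))
def sCnt (s : Prog) : Prog := .fst (.snd (.snd (.snd (.snd s))))
def sDead (s : Prog) : Prog := .snd (.snd (.snd (.snd (.snd s))))

def eVer (e : Prog) : Prog := .fst e
def eStarted (e : Prog) : Prog := .fst (.snd e)
def eOwn (e : Prog) : Prog := .fst (.snd (.snd e))
def eKey (e : Prog) : Prog := .fst (.snd (.snd (.snd e)))
def eCt (e : Prog) : Prog := .fst (.snd (.snd (.snd (.snd e))))
def eSt (e : Prog) : Prog := .fst (.snd (.snd (.snd (.snd (.snd e)))))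
def eOut (e : Prog) : Prog := .snd (.snd (.snd (.snd (.snd (.snd e)))))

def mkState (K N log tbl cnt dead : Prog) : Prog :=
  .pair K (.pair N (.pair log (.pair tbl (.pair cnt dead))))

def mkEntry (ver started own key ct st out : Prog) : Prog :=
  .pair ver (.pair started (.pair own (.pair key (.pair ct (.pair st out)))))

/-- The state `s` with the entry `e` for run `i`. -/
def setLog (s i e : Prog) : Prog :=
  mkState (sConf s) (sN s) (.pair i (.pair e (sLog s))) (sTbl s) (sCnt s) (sDead s)

def answer (s r : Prog) : Prog := .pair (.lit [false]) (.pair s r)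

def goOn (s i e x : Prog) : Prog := .pair (.lit [true]) (.pair s (.pair i (.pair e x)))

end Prog

namespace Kit

variable (P : Kit)

def opnP (s : Prog) (ver : Bool) : Prog :=
  .letIn (.call P.opn (sConf s)) (answer (mkState (sConf (.fst (.arg 1)))
    (.append (.lit [true]) (sN (.fst (.arg 1)))) (.pair (sN (.fst (.arg 1)))
      (.pair (mkEntry (.lit [ver]) (.lit [false]) (.lit []) (.lit []) (.lit []) (.lit []) (.lit []))
        (sLog (.fst (.arg 1))))) (sTbl (.fst (.arg 1))) (sCnt (.fst (.arg 1)))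
      (sDead (.fst (.arg 1)))) (.lit []))

def rejectP (s i e : Prog) : Prog :=
  answer (setLog s i (mkEntry (eVer e) (eStarted e) (eOwn e) (eKey e) (eCt e) (.lit [])
    (.lit [false]))) (.lit (Str.pair [false] []))

/-- The environment holds the result of the search for the run, its number, and the input. -/
def verStartP : Prog :=
  .letIn (.call lookP (.pair (.fst (.snd (.snd (.snd (.arg 2))))) (sTbl (.fst (.arg 2)))))
    (.ite (isNil (.arg 0)) (.ite (.eq (.arg 2) (cG (sConf (.fst (.arg 3)))))
        (answer (mkState (sConf (.fst (.arg 3))) (sN (.fst (.arg 3))) (sLog (.fst (.arg 3)))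
          (sTbl (.fst (.arg 3))) (sCnt (.fst (.arg 3))) (.pair (.fst (.snd (.snd (.snd (.arg 3)))))
            (.snd (.snd (.snd (.snd (.arg 3))))))) (.lit []))
        (.letIn (.call P.vtag (.pair (sConf (.fst (.arg 3))) (.pair
            (.fst (.snd (.snd (.snd (.arg 3))))) (.snd (.snd (.snd (.snd (.arg 3))))))))
          (rejectP (.fst (.arg 4)) (.arg 3) (.fst (.snd (.arg 2))))))
      (.letIn (.call P.vtag (.pair (sConf (.fst (.arg 3))) (.pair
            (.fst (.snd (.snd (.snd (.arg 3))))) (.snd (.snd (.snd (.snd (.arg 3))))))))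
        (.ite (.arg 0)
          (answer (setLog (.fst (.arg 4)) (.arg 3) (mkEntry (eVer (.fst (.snd (.arg 2))))
            (.lit [true]) (.fst (.fst (.snd (.arg 1)))) (.snd (.fst (.snd (.arg 1))))
            (eCt (.fst (.snd (.arg 2)))) (.lit []) (.lit []))) (.lit (Str.pair [] [])))
          (rejectP (.fst (.arg 4)) (.arg 3) (.fst (.snd (.arg 2)))))))

def mintStartP : Prog := .letIn (.call P.gen (.pair (sConf (.fst (.arg 2))) (.arg 1)))
    (.letIn (.call P.enc (.pair (sConf (.fst (.arg 3))) (.pair (.arg 2) (.arg 0))))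
      (.letIn (.call P.sign (.pair (sConf (.fst (.arg 4))) (.arg 0)))
        (goOn (mkState (sConf (.fst (.arg 5))) (sN (.fst (.arg 5))) (sLog (.fst (.arg 5)))
          (.pair (.arg 1) (.pair (.pair (.arg 4) (.arg 2)) (sTbl (.fst (.arg 5)))))
          (sCnt (.fst (.arg 5))) (sDead (.fst (.arg 5)))) (.arg 4)
          (mkEntry (eVer (.fst (.snd (.arg 3)))) (.lit [true]) (.arg 4) (.arg 2)
            (.pair (.arg 1) (.arg 0)) (.lit []) (.lit []))
          (.snd (.snd (.snd (.arg 5)))))))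

def messageP : Prog := .letIn (norm (.fst (.snd (.snd (.arg 0)))))
    (.letIn (.call lookP (.pair (.arg 0) (sLog (.fst (.arg 1)))))
      (.ite (isNil (.arg 0)) (answer (.fst (.arg 2)) (.lit []))
        (.ite (isNil (eOut (.fst (.snd (.arg 0))))) (.ite (eStarted (.fst (.snd (.arg 0))))
            (goOn (.fst (.arg 2)) (.arg 1) (.fst (.snd (.arg 0))) (.snd (.snd (.snd (.arg 2)))))
            (.ite (eVer (.fst (.snd (.arg 0)))) (verStartP P) (mintStartP P)))
          (answer (.fst (.arg 2)) (.pair (eOut (.fst (.snd (.arg 0)))) (.lit []))))))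

def prepP : Prog := .ite (isNil (sDead (.fst (.arg 0))))
    (.ite (isNil (.fst (.snd (.arg 0)))) (opnP P (.fst (.arg 0)) false)
      (.ite (.eq (.fst (.snd (.arg 0))) (.lit [true])) (opnP P (.fst (.arg 0)) true)
        (.ite (.eq (.fst (.snd (.arg 0))) (.lit [true, true])) (messageP P)
          (answer (.fst (.arg 0)) (.lit [])))))
    (answer (.fst (.arg 0)) (.lit []))

/-- The output bit in the status `v`, if any. -/
def outP (v : Prog) : Prog := .ite (isNil v) (.lit []) (.ite v (.lit [true]) (.lit [false]))

/-- The environment holds the state of the ledger, the number of the run, its entry, and the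
message. -/
def bankDoneP (s i e v : Prog) : Prog :=
  .pair (mkState (sConf s) (sN s) (.pair i (.pair (mkEntry (eVer e) (eStarted e) (eOwn e) (eKey e)
      (eCt e) (.fst (.snd v)) (outP (.fst v))) (sLog s))) (sTbl s)
      (.ite (eVer e) (.ite (.fst v) (.ite (.eq (eOwn e) (cJ (sConf s)))
        (.append (.lit [true]) (sCnt s)) (sCnt s)) (sCnt s)) (sCnt s)) (sDead s))
    (.pair (outP (.fst v)) (.ite (eVer e) (.snd (.snd v))
      (.pair (.snd (.snd v)) (.ite (isNil (.fst v)) (.lit []) (eCt e)))))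

def bankCallArg : Prog :=
  .pair (sConf (.fst (.arg 0))) (.pair (eVer (.fst (.snd (.snd (.arg 0))))) (.pair
    (.fst (.snd (.arg 0))) (.pair (eOwn (.fst (.snd (.snd (.arg 0))))) (.pair
      (eKey (.fst (.snd (.snd (.arg 0))))) (.pair (eSt (.fst (.snd (.snd (.arg 0)))))
        (.snd (.snd (.snd (.arg 0)))))))))

def bankStepP : Prog := .letIn (.call P.bank bankCallArg)
    (bankDoneP (.fst (.arg 1)) (.fst (.snd (.arg 1))) (.fst (.snd (.snd (.arg 1)))) (.arg 0))

def handlerP : Prog :=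
  .letIn (prepP P) (.ite (.fst (.arg 0)) (.call (bankStepP P) (.snd (.arg 0))) (.snd (.arg 0)))

variable {P} {K : Conf} {j : ℕ} {σ : Type} {O : Oracle σ} {loc : Str → Cell}

open Ledger

theorem val_outP (v : Prog) (env : List Str) :
    (outP v).val env = (v.val env).head?.toList := by
  obtain ⟨s, hs⟩ : ∃ s, s = v.val env := ⟨_, rfl⟩
  simp only [outP, val, val_isNil, ← hs]
  rcases s with _ | ⟨_ | _, l⟩ <;> rfl

theorem find_log {a : Ledger} (i : ℕ) :
    (a.log.map fun x => (Str.unary x.1, x.2.str)).find? (fun x => x.1 == Str.unary i) =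
      (a.look i).map fun r => (Str.unary i, r.str) := by
  have h : ∀ x : ℕ × Entry, ((Str.unary x.1 == Str.unary i) = (x.1 == i)) := fun x => by
    rw [Bool.eq_iff_iff, beq_iff_eq, beq_iff_eq, Str.unary_injective.eq_iff]
  rw [List.find?_map, look]
  simp only [Function.comp_def, h]
  rcases hf : a.log.find? (fun x => x.1 == i) with _ | x
  · simp only [hf]; rfl
  · have := List.find?_some hf
    simp only [beq_iff_eq] at this
    simp only [hf, Option.map_some, this]

theorem find_tbl {a : Ledger} (c : Str) :
    (a.tbl.map fun x => (x.1, Str.pair (Str.unary x.2.1) x.2.2)).find? (fun x => x.1 == c) =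
      (a.find c).map fun y => (c, Str.pair (Str.unary y.1) y.2) := by
  rw [List.find?_map, find]
  simp only [Function.comp_def]
  rcases hf : a.tbl.find? (fun x => x.1 == c) with _ | x
  · simp only [hf]; rfl
  · have := List.find?_some hf
    simp only [beq_iff_eq] at this
    simp only [hf, Option.map_some, this]

attribute [simp] Prog.val Prog.Pure sConf sN sLog sTbl sCnt sDead eVer eStarted eOwn eKey eCt eSt eOut
  mkState mkEntry setLog answer goOn Str.fst_pair Str.snd_pair val_isNil cSec cT cJ cG cFw cKm cKe cL
  isNil Str.pair_ne_nil

attribute [local simp] Accepts encode encodePrep Entry.str Conf.str Eff.handlerInput Ledger.set assoc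
  Party.init

/-- The argument of `bankStepP`. -/
def stepArg (K : Conf) (j : ℕ) (y : Ledger × ℕ × Entry × Str) : Str :=
  Str.pair (y.1.encode K j) (Str.pair (Str.unary y.2.1) (Str.pair y.2.2.1.str y.2.2.2))

/-- The encoding keeps only the number of occurrences of `j` among the owners, and whether it
increases can be decided from the owner of the entry and the special run in the configuration. -/
theorem val_bankDoneP (hJ : K.J = Str.unary j) (y : Ledger × ℕ × Entry × Str) (v : Str) :
    (bankDoneP (.fst (.arg 1)) (.fst (.snd (.arg 1))) (.fst (.snd (.snd (.arg 1)))) (.arg 0)).val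
      [v, stepArg K j y] = Str.pair ((bankDone y.1 y.2.1 y.2.2.1 v).2.encode K j)
        (bankDone y.1 y.2.1 y.2.2.1 v).1 := by
  obtain ⟨a, i, r, x⟩ := y
  obtain ⟨s, hs⟩ : ∃ s, s = v.fst := ⟨_, rfl⟩
  simp only [bankDoneP, stepArg, val_outP, val, sConf, sN, sLog, sTbl, sCnt, sDead, eVer, eStarted,
    eOwn, eKey, eCt, mkState, mkEntry, val_isNil, cJ, Conf.str, hJ, List.getD_cons_zero,
    List.getD_cons_succ, Str.fst_pair, Str.snd_pair, encode, Entry.str, bankDone, Ledger.set,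
    List.map_cons, assoc, partyNext, partyReply, Str.unary_injective.eq_iff, ← hs]
  rcases hv : r.ver with _ | _ <;> rcases s with _ | ⟨_ | _, l⟩ <;>
    by_cases ho : r.own = j <;> simp [ho, Str.unary, List.replicate_succ]

theorem pure_bankDoneP : (bankDoneP (.fst (.arg 1)) (.fst (.snd (.arg 1)))
    (.fst (.snd (.snd (.arg 1)))) (.arg 0)).Pure := by simp [bankDoneP, outP]

theorem val_bankCallArg (y : Ledger × ℕ × Entry × Str) : bankCallArg.val [stepArg K j y] =
    Str.pair K.str (bankArg y.2.2.1.ver y.2.1 y.2.2.1.own y.2.2.1.key y.2.2.1.party.st y.2.2.2) := by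
  simp [bankCallArg, stepArg, encode, Entry.str, bankArg]

theorem run_bankStepP (hJ : K.J = Str.unary j) (y : Ledger × ℕ × Entry × Str) (w : σ × QState) :
    ((bankStepP P).tree [stepArg K j y]).run O loc w =
      ((bankStep (P.ops K) y).run O loc w).map fun x =>
        (Str.pair (x.1.2.encode K j) x.1.1, x.2) := by
  rw [bankStepP, run_letIn, run_call_of_val (by simp [bankCallArg]) (val_bankCallArg y), bankStep,
    Eff.run_bind, PMF.map_bind]
  refine congrArg _ (funext fun o => ?_)
  simp only [Eff.run, PMF.pure_map]
  exact run_of_val pure_bankDoneP (val_bankDoneP hJ y _)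

theorem run_opnP (a : Ledger) (ver : Bool) (x : Str) (w : σ × QState) :
    ((opnP P (.fst (.arg 0)) ver).tree [Str.pair (a.encode K j) x]).run O loc w =
      (((P.ops K).opn.bind fun _ => .ret (.inl ([], a.push ver))).run O loc w).map fun x =>
        (encodePrep K j x.1, x.2) := by
  rw [opnP, run_letIn, run_call_of_val (v := K.str), Eff.run_bind, PMF.map_bind]
  refine congrArg _ (funext fun o => ?_)
  simp only [Eff.run, PMF.pure_map]
  exact run_of_val (hv := by simp [push, Str.unary, List.replicate_succ])

theorem run_rejectP {s i e : Prog} {a a' : Ledger} {r : Entry} {i' : ℕ} {env : List Str}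
    {w : σ × QState} (hs : s.Pure := by simp) (hi : i.Pure := by simp) (he : e.Pure := by simp)
    (vs : s.val env = a.encode K j := by simp) (vi : i.val env = Str.unary i' := by simp)
    (ve : e.val env = r.str := by simp)
    (hr : (reject a' i' r).2.encode K j = (reject a i' r).2.encode K j) :
    ((rejectP s i e).tree env).run O loc w =
      PMF.pure (encodePrep K j (.inl (reject a' i' r)), w) := by
  refine run_of_val (by simp [rejectP, hs, hi, he]) ?_
  rw [encodePrep, hr]
  simp [rejectP, reject, vs, vi, ve]

theorem run_verStartP {a : Ledger} {i : ℕ} {r : Entry} {q m x t : Str} (w : σ × QState) :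
    ((verStartP P).tree [Str.pair q (Str.pair r.str t), Str.unary i,
        Str.pair (a.encode K j) (Str.pair x m)]).run O loc w =
      ((verStart (P.ops K) a i r m.snd.fst m.snd.snd).run O loc w).map fun x =>
        (encodePrep K j x.1, x.2) := by
  rw [verStartP, run_letIn, run_call_of_val (v := Str.pair m.snd.fst
    (assoc (a.tbl.map fun x => (x.1, Str.pair (Str.unary x.2.1) x.2.2)))), run_of_val pure_lookP rfl, PMF.pure_bind]
  have hf := find_tbl (a := a) m.snd.fst
  rcases h : a.find m.snd.fst with _ | y
  · rw [h] at hf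
    rw [val_lookP_none hf, run_ite_pos]
    by_cases hg : Str.unary i = K.g
    · rw [run_ite_pos (h := by simp [hg]), verStart_dead _ h hg]
      simp only [Eff.run, PMF.pure_map]
      exact run_of_val
    · rw [run_ite_neg (h := by simp [hg]), verStart_fresh _ h hg, run_letIn,
        run_call_of_val (v := Str.pair K.str (Str.pair m.snd.fst m.snd.snd)),
        Eff.run_bind, PMF.map_bind]
      refine congrArg _ (funext fun o => ?_)
      simp only [Eff.run, PMF.pure_map]
      exact run_rejectP (a := a) (hr := rfl)
  · rw [h] at hf
    obtain ⟨t', ht⟩ := val_lookP_some hf rfl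
    rw [ht, run_ite_neg, run_letIn,
      run_call_of_val (v := Str.pair K.str (Str.pair m.snd.fst m.snd.snd)), verStart, h]
    simp only [Eff.run_bind, PMF.map_bind]
    refine congrArg _ (funext fun o => ?_)
    simp only [Eff.run, PMF.pure_map]
    by_cases ho : Accepts o.1
    · rw [if_pos ho, run_ite_pos (h := by simpa using ho)]
      exact run_of_val (hv := by simp [accept])
    · rw [if_neg ho, run_ite_neg (h := by simpa using ho)]
      exact run_rejectP (a := a) (hr := rfl)

theorem run_mintStartP {a : Ledger} {i : ℕ} {r : Entry} {q m x t : Str} (w : σ × QState) :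
    ((mintStartP P).tree [Str.pair q (Str.pair r.str t), Str.unary i,
        Str.pair (a.encode K j) (Str.pair x m)]).run O loc w =
      ((mintStart (P.ops K) a i r m.snd).run O loc w).map fun x => (encodePrep K j x.1, x.2) := by
  rw [mintStartP, run_letIn, run_call_of_val (v := Str.pair K.str (Str.unary i)), mintStart]
  simp only [Eff.run_bind, PMF.map_bind]
  refine congrArg _ (funext fun o => ?_)
  rw [run_letIn, run_call_of_val (v := Str.pair K.str (Str.pair (Str.unary i) o.1))]
  refine congrArg _ (funext fun o' => ?_)
  rw [run_letIn, run_call_of_val (v := Str.pair K.str o'.1)]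
  refine congrArg _ (funext fun o'' => ?_)
  simp only [Eff.run, PMF.pure_map]
  exact run_of_val (hv := by simp [minted])

theorem run_messageP {a : Ledger} {m x : Str} (w : σ × QState) :
    ((messageP P).tree [Str.pair (a.encode K j) (Str.pair x m)]).run O loc w =
      ((message (P.ops K) a m.fst.length m.snd).run O loc w).map fun x => (encodePrep K j x.1, x.2) := by
  rw [messageP, run_letIn, run_of_val (v := Str.unary m.fst.length), PMF.pure_bind, run_letIn, run_call_of_val
    (v := Str.pair (Str.unary m.fst.length) (assoc (a.log.map fun x => (Str.unary x.1, x.2.str)))), run_of_val pure_lookP rfl, PMF.pure_bind, message]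
  have hf := find_log (a := a) m.fst.length
  rcases h : a.look m.fst.length with _ | r
  · rw [h] at hf
    rw [val_lookP_none hf, run_ite_pos]
    simp only [Eff.run, PMF.pure_map]
    exact run_of_val
  · rw [h] at hf
    obtain ⟨t, ht⟩ := val_lookP_some (v := r.str) hf rfl
    replace ht : _ = Str.pair (Str.unary m.fst.length) (Str.pair r.str t) := ht
    rw [ht, run_ite_neg]
    simp only
    by_cases ho : r.party.out.isSome
    · obtain ⟨b, hb⟩ := Option.isSome_iff_exists.1 ho
      rw [run_ite_neg (h := by simp [hb]), if_pos ho]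
      simp only [Eff.run, PMF.pure_map]
      exact run_of_val
    · have hb : r.party.out = none := by simpa using ho
      rw [run_ite_pos (h := by simp [hb]), if_neg ho]
      by_cases hs : r.started
      · rw [run_ite_pos (h := by simp [hs]), if_pos hs]
        simp only [Eff.run, PMF.pure_map]
        exact run_of_val
      · rw [run_ite_neg (h := by simp [hs]), if_neg hs]
        by_cases hv : r.ver
        · rw [run_ite_pos (h := by simp [hv]), if_pos hv]
          exact run_verStartP w
        · rw [run_ite_neg (h := by simp [hv]), if_neg hv]
          exact run_mintStartP w

theorem run_prepP (a : Ledger) (p : ℕ) (m : Str) (w : σ × QState) :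
    ((prepP P).tree [Eff.handlerInput (a.encode K j) p m]).run O loc w =
      ((prep (P.ops K) a p m).run O loc w).map fun x => (encodePrep K j x.1, x.2) := by
  have h0 : ∀ p, Str.unary p = [] ↔ p = 0 := fun _ => Str.unary_injective.eq_iff (b := 0)
  have h1 : ∀ p, Str.unary p = [true] ↔ p = 1 := fun _ => Str.unary_injective.eq_iff (b := 1)
  have h2 : ∀ p, Str.unary p = [true, true] ↔ p = 2 := fun _ => Str.unary_injective.eq_iff (b := 2)
  rw [prepP, prep]
  by_cases hd : a.dead = []
  · rw [run_ite_pos (h := by simp [hd]), if_pos hd]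
    -- The total length of queries and the results for unknown ciphertexts serve the analysis only
    -- and are not part of the encoding.
    have e : a.encode K j = (a.spend m).encode K j := rfl
    rw [e]
    rcases p with _ | _ | _ | p
    · rw [run_ite_pos (h := by simp [h0])]
      exact run_opnP _ _ _ w
    · rw [run_ite_neg (h := by simp [h0]), run_ite_pos (h := by simp [h1])]
      exact run_opnP _ _ _ w
    · rw [run_ite_neg (h := by simp [h0]), run_ite_neg (h := by simp [h1]), run_ite_pos (h := by simp [h2])]
      exact run_messageP w
    · rw [run_ite_neg (h := by simp [h0]), run_ite_neg (h := by simp [h1]), run_ite_neg (h := by simp [h2])]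
      change _ = PMF.map _ (PMF.pure _)
      rw [PMF.pure_map]
      exact run_of_val
  · rw [run_ite_neg (h := by simp [hd]), if_neg hd]
    simp only [Eff.run, PMF.pure_map]
    exact run_of_val (hv := by simp [spend])

/-- The ledger of the analysis is implemented by an actual program, whatever the elementary
operations are. This one statement serves all three reductions. -/
theorem run_handlerP (hJ : K.J = Str.unary j) (a : Ledger) (p : ℕ) (m : Str) (w : σ × QState) :
    ((handlerP P).tree [Eff.handlerInput (a.encode K j) p m]).run O loc w =
      ((step (P.ops K) a p m).run O loc w).map fun x =>
        (Str.pair (x.1.2.encode K j) x.1.1, x.2) := by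
  rw [handlerP, run_letIn, run_prepP, PMF.bind_map, step, Eff.run_bind, PMF.map_bind]
  refine congrArg _ (funext fun o => ?_)
  obtain ⟨x | y, w'⟩ := o
  · simp only [Function.comp_apply, encodePrep, finish, Eff.run, PMF.pure_map]
    rw [run_ite_neg]
    exact run_of_val
  · simp only [Function.comp_apply, encodePrep, finish]
    rw [run_ite_pos, ← run_bankStepP hJ]
    exact run_call_of_val (hv := by simp [stepArg])

end Kit

end


noncomputable section

open Prog Polynomial

/-! ## The running time of the handler -/

attribute [simp] Prog.Simple Kit.conf

namespace Prog

variable {C : ∀ σ : Type, Oracle σ → Prop}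

theorem polyTime_lookP : PolyTime C lookP := by
  refine PolyTime.loop (Simple.polyTime (by simp)) (Simple.polyTime (by simp))
    (Simple.polyTime (by simp)) (fun env u => u.length ≤ envSize env) Polynomial.X
    (fun σ O loc env => ?_) (fun σ O loc env u hu => ?_) (fun env u hu => by simpa using hu)
  · refine ((Simple.pure (P := .snd (.arg 0)) trivial).ensures O loc env).mono fun v _ hv => ?_
    rw [hv]
    exact (Str.length_snd_le _).trans (length_getD_le env 0)
  · refine ((Simple.pure (by simp)).ensures O loc _).mono fun v _ hv => ?_
    rw [hv]
    have h : u.snd.snd.length ≤ envSize env := by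
      have := u.snd.length_snd_le
      have := u.length_snd_le
      omega
    simp only [val, List.getD_cons_zero, List.getD_cons_succ]
    split_ifs <;> assumption

/-- Here the carried string grows in each pass, but by an amount that does not depend on it. So its
length is linear in the number of passes, which the indexed invariant of `ensures_iterate`
expresses. -/
theorem PolyTime.accumulate {n f g : Prog} (hn : PolyTime C n) (hg : PolyTime C g)
    (h : ∀ u env, f.tree (u :: env) = g.tree env) :
    PolyTime C (.loop n (.lit []) (.append f (.arg 0))) := by
  obtain ⟨p, hp⟩ := hn.exists_bound
  obtain ⟨q, hq⟩ := hg.exists_bound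
  refine ⟨3 * p + 2 + 2 * p * (3 * q + 2 + 2 * (2 * p * (2 * q))), fun σ O hO loc hl env =>
    (hp σ O hO loc hl env).bind fun k d hk =>
    Eff.ensures_tick (Eff.ensures_tick (n := 1 + k.length) ?_)⟩
  set a := p.eval (envSize env) with ha
  set b := q.eval (envSize env) with hb
  obtain ⟨B, hB⟩ : ∃ B, B = 2 * b := ⟨_, rfl⟩
  refine (Eff.ensures_iterate (Inv := fun i u => u.length ≤ i * B)
    (D := 3 * b + 2 + 2 * (2 * a * (2 * b))) (fun i u hi hu => ?_) (Nat.zero_le _)).mono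
    fun w e hw => ?_
  · rw [tree, h]
    refine (hq σ O hO loc hl env).bind fun v e hv => Eff.ensures_tick (Eff.ensures_tick
      (Eff.ensures_ret ⟨?_, ?_⟩))
    · simp only [List.length_append, List.getD_cons_zero, Nat.succ_mul]
      omega
    · have : i * B ≤ 2 * a * (2 * b) := hB ▸ Nat.mul_le_mul_right _ (by omega)
      simp only [List.getD_cons_zero]
      omega
  · have := Nat.mul_le_mul_right (3 * b + 2 + 2 * (2 * a * (2 * b))) hk.2
    simp only [eval_add, eval_mul, eval_ofNat, List.length_nil, ← ha, ← hb]
    omega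

theorem PolyTime.norm {p : Prog} (h : PolyTime C p) : PolyTime C (norm p) :=
  h.accumulate (polyTime_lit [true]) fun _ _ => rfl

end Prog

/-- The operations, except for the bank, run in polynomial time. -/
structure Kit.Efficient (P : Kit) : Prop where
  opn : PolyTime AnyOracle P.opn
  gen : PolyTime AnyOracle P.gen
  enc : PolyTime AnyOracle P.enc
  sign : PolyTime AnyOracle P.sign
  vtag : PolyTime AnyOracle P.vtag

namespace Kit

variable {S : MoneyScheme} {M : MACScheme} {E : EncScheme} {P : Kit}

theorem efficient_forger (hS : S.keygen.PPT) (hE : E.encrypt.PPT) : (forger S E).Efficient :=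
  ⟨polyTime_lit _, hS.polyTime_sandbox trivial (Simple.polyTime (by simp)),
    hE.polyTime_sandbox (by simp) (Simple.polyTime (by simp)),
    .oracle _ (Simple.polyTime (by simp)) (Simple.polyTime (by simp)),
    .oracle _ (Simple.polyTime (by simp)) (Simple.polyTime (by simp))⟩

theorem efficient_distinguisher (hS : S.keygen.PPT) (hM : M.mac.PPT) (hM' : M.verify.PPT) :
    (distinguisher S M).Efficient :=
  ⟨polyTime_lit _, hS.polyTime_sandbox trivial (Simple.polyTime (by simp)),
    .ite (Simple.polyTime (by simp))
      (.oracle _ (.pair (PolyTime.norm (Simple.polyTime (by simp))) (Simple.polyTime (by simp)))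
        (Simple.polyTime (by simp)))
      (.oracle _ (Simple.polyTime (by simp)) (Simple.polyTime (by simp))),
    hM.polyTime_sandbox (by simp) (Simple.polyTime (by simp)),
    hM'.polyTime_sandbox (by simp) (Simple.polyTime (by simp))⟩

theorem efficient_counterfeiter (hS : S.keygen.PPT) (hE : E.encrypt.PPT) (hM : M.mac.PPT)
    (hM' : M.verify.PPT) : (counterfeiter S M E).Efficient :=
  ⟨.oracle _ (polyTime_lit _) (polyTime_lit _),
    .ite (Simple.polyTime (by simp)) (polyTime_lit _)
      (hS.polyTime_sandbox trivial (Simple.polyTime (by simp))),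
    hE.polyTime_sandbox (by simp) (Simple.polyTime (by simp)),
    hM.polyTime_sandbox (by simp) (Simple.polyTime (by simp)),
    hM'.polyTime_sandbox (by simp) (Simple.polyTime (by simp))⟩

theorem polyTime_prepP (h : P.Efficient) : PolyTime AnyOracle (prepP P) := by
  have simple : ∀ {p : Prog}, p.Simple → PolyTime AnyOracle p := fun h => h.polyTime
  have h1 : ∀ ver, PolyTime AnyOracle (opnP P (.fst (.arg 0)) ver) := fun ver =>
    .letIn (.call h.opn (simple (by simp))) (simple (by simp))
  have h2 : PolyTime AnyOracle (verStartP P) :=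
    .letIn (.call polyTime_lookP (simple (by simp)))
      (.ite (simple (by simp))
        (.ite (simple (by simp)) (simple (by simp))
          (.letIn (.call h.vtag (simple (by simp))) (simple (by simp [rejectP]))))
        (.letIn (.call h.vtag (simple (by simp))) (simple (by simp [rejectP]))))
  have h3 : PolyTime AnyOracle (mintStartP P) :=
    .letIn (.call h.gen (simple (by simp)))
      (.letIn (.call h.enc (simple (by simp)))
        (.letIn (.call h.sign (simple (by simp))) (simple (by simp))))
  have h4 : PolyTime AnyOracle (messageP P) :=
    .letIn (PolyTime.norm (simple (by simp)))
      (.letIn (.call polyTime_lookP (simple (by simp)))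
        (.ite (simple (by simp)) (simple (by simp))
          (.ite (simple (by simp)) (.ite (simple (by simp))
            (simple (by simp)) (.ite (simple (by simp)) h2 h3))
            (simple (by simp)))))
  exact .ite (simple (by simp)) (.ite (simple (by simp)) (h1 false)
    (.ite (simple (by simp)) (h1 true)
      (.ite (simple (by simp)) h4 (simple (by simp)))))
    (simple (by simp))

/-- Running time and result of one step of the bank of the mini-scheme. -/
theorem exists_bank_bound (hS : S.IsScheme) : ∃ s q : Polynomial ℕ,
    ∀ {n X Y j : ℕ} {K : Conf} {σ : Type} {O : Oracle σ} {loc : Str → Cell} (_ : IsPlacement loc)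
      (_ : K.sec = Str.unary n) {i len : ℕ} {r : Entry} {x : Str} (_ : r.party.out = none)
      (_ : Str.unary r.own ≠ K.Fw → ∃ c, Reachable (Ledger.bankProg S r.ver)
        (fun a => loc (Str.pair (Str.unary (i + 1)) a)) n r.key r.party len c)
      (_ : n + r.key.length + (len + (x.length + 1)) ≤ X)
      (_ : X ≤ Y)
      (_ : (Str.pair K.str (bankArg r.ver i r.own r.key r.party.st x)).length ≤ Y),
      Eff.Ensures O loc
        ((bankP S).tree [Str.pair K.str (bankArg r.ver i r.own r.key r.party.st x)]) fun v d =>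
        ((Str.unary r.own ≠ K.Fw → ∃ c, Reachable (Ledger.bankProg S r.ver)
          (fun a => loc (Str.pair (Str.unary (i + 1)) a)) n r.key (partyNext v)
          (len + (x.length + 1)) c) ∧ v.snd.fst.length ≤ s.eval X) ∧ d ≤ q.eval Y := by
  obtain ⟨p₁, -, hp₁⟩ := hS.verifyBank_qpt.exists_bound
  obtain ⟨p₂, -, hp₂⟩ := hS.mintBank_qpt.exists_bound
  obtain ⟨k₁, hk₁⟩ := ensures_sandbox S.verifyBank pure_bankIn
  obtain ⟨k₂, hk₂⟩ := ensures_sandbox S.mintBank pure_bankIn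
  obtain ⟨q₀, hq₀⟩ : PolyTime AnyOracle (Prog.eq (.fst (.snd (.snd (.snd (.arg 0))))) (cFw conf)) :=
    Simple.polyTime (by simp)
  obtain ⟨q₁, hq₁⟩ : PolyTime AnyOracle bankForward :=
    .letIn (.oracle _ (Simple.polyTime (by simp))
      (Simple.polyTime (by simp))) (Simple.polyTime (by simp [partyOut]))
  obtain ⟨q₂, hq₂⟩ := PolyTime.exists_bound (C := AnyOracle)
    (P := .append (.lit [true]) (.fst (.snd (.snd (.arg 0))))) (Simple.polyTime (by simp))
  obtain ⟨q₃, hq₃⟩ : PolyTime AnyOracle (Prog.fst (.snd (.arg 0))) := Simple.polyTime (by simp)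
  obtain ⟨q₄, hq₄⟩ : PolyTime AnyOracle bankIn :=
    Simple.polyTime (by simp [bankIn, partyIn])
  refine ⟨2 * p₁ + 2 * p₂, (q₀ + 3 * q₁ + 3 * q₂ + q₃ + 4).comp (Polynomial.X + 1) +
    Polynomial.C k₁ * (p₁ + q₄.comp (Polynomial.X + 1) + 1) +
    Polynomial.C k₂ * (p₂ + q₄.comp (Polynomial.X + 1) + 1) + 3 * p₁ + 3 * p₂, ?_⟩
  intro n X Y j K σ O loc hl hK i len r x ho hR hX hXY hX'
  have e₁ := p₁.eval_mono_nat hXY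
  have e₂ := p₂.eval_mono_nat hXY
  set y := Str.pair K.str (bankArg r.ver i r.own r.key r.party.st x) with hy
  have hs : ∀ q : Polynomial ℕ, q.eval (envSize [y]) ≤ q.eval (Y + 1) := fun q =>
    q.eval_mono_nat (by simp [envSize]; omega)
  have hcond : (Prog.eq (.fst (.snd (.snd (.snd (.arg 0))))) (cFw conf)).val [y] =
      [decide (Str.unary r.own = K.Fw)] := by
    simp [hy, bankArg, Conf.str, conf]
  have hver : (Prog.fst (.snd (.arg 0))).val [y] = [r.ver] := by simp [hy, bankArg]
  have hloc : (Prog.append (.lit [true]) (.fst (.snd (.snd (.arg 0))))).val [y] =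
      Str.unary (i + 1) := by
    simp [hy, bankArg, Str.unary, List.replicate_succ]
  have hin := val_bankIn hK r.ver i r.own r.key r.party.st x
  rw [← hy] at hin
  refine (ensures_ite (Simple.pure (by simp)) (hq₀ σ O trivial loc hl [y]) (b := (3 * q₁ + 3 * q₂ + q₃ + 3).eval (Y + 1) +
    k₁ * (p₁.eval Y + q₄.eval (Y + 1) + 1) + k₂ * (p₂.eval Y + q₄.eval (Y + 1) + 1) +
    3 * p₁.eval Y + 3 * p₂.eval Y) (Q := fun v => (Str.unary r.own ≠ K.Fw → ∃ c, Reachable (Ledger.bankProg S r.ver)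
          (fun a => loc (Str.pair (Str.unary (i + 1)) a)) n r.key (partyNext v)
          (len + (x.length + 1)) c) ∧ v.snd.fst.length ≤ 2 * p₁.eval X + 2 * p₂.eval X) ?_).mono fun v d hv => ⟨⟨hv.1.1, ?_⟩, ?_⟩
  · rw [hcond]
    by_cases hown : Str.unary r.own = K.Fw
    -- A forwarded run keeps no local state, so its running time is that of a query alone.
    · rw [if_pos (by simp [hown])]
      refine ((hq₁ σ O trivial loc hl [y]).and (Eff.ensures_of_run (Q := fun v => v.snd.fst = [])
        fun s ψ o ho => ?_)).mono fun v d hv => ⟨⟨fun h => absurd hown h, by simp [hv.2]⟩, ?_⟩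
      · rw [bankForward, run_letIn, PMF.mem_support_bind_iff] at ho
        obtain ⟨z, -, ho⟩ := ho
        rw [Prog.Pure.run (by simp [partyOut]), PMF.support_pure, Set.mem_singleton_iff] at ho
        rw [ho]
        simp [partyOut]
      · have := hs q₁
        simp only [eval_add, eval_mul, eval_ofNat]
        omega
    · rw [if_neg (by simp [hown])]
      -- In a local run the new state is bounded through reachability, by `X`, that is, by key and
      -- received messages. A bound through the size `Y` of the whole argument would compound from
      -- query to query.
      have hlp := isPlacement_pair hl (Str.unary (i + 1))
      obtain ⟨c, hc⟩ := hR hown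
      refine ((hq₂ σ O trivial loc hl [y]).and (Prog.Pure.ensures (by simp) _ _ _)).bind
        fun v d hv => Eff.ensures_tick (Eff.ensures_relocate ?_)
      have hv1 := hv.1.2
      rw [hv.2, hloc] at hv1 ⊢
      refine (ensures_ite (by simp) (hq₃ σ O trivial _ hlp [y]) (b :=
        k₁ * (p₁.eval Y + q₄.eval (Y + 1) + 1) + k₂ * (p₂.eval Y + q₄.eval (Y + 1) + 1))
        (Q := fun v => (∃ c, Reachable (Ledger.bankProg S r.ver)
          (fun a => loc (Str.pair (Str.unary (i + 1)) a)) n r.key (partyNext v)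
          (len + (x.length + 1)) c) ∧ v.length ≤ 2 * p₁.eval X + 2 * p₂.eval X) ?_).mono
          fun w e hw => ⟨⟨fun _ => hw.1.1, ?_⟩, ?_⟩
      · rw [hver]
        rcases hv : r.ver with _ | _
        · rw [if_neg (by simp)]
          rw [hv] at hc
          refine (hk₂ σ O _ _ _ (q₄.eval (Y + 1)) ((hq₄ _ _ trivial _ hlp [y]).mono fun v d hd => hd.trans (hs q₄))
            (hin ▸ hp₂ n r.key _ hlp _ len c hc ho x X hX)).mono fun v d hd => ?_
          obtain ⟨e, he, hd⟩ := hd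
          refine ⟨⟨he.1.1, by omega⟩, ?_⟩
          have := Nat.mul_le_mul_left k₂ (show e + q₄.eval (Y + 1) + 1 ≤ p₂.eval Y + q₄.eval (Y + 1) + 1 by omega)
          omega
        · rw [if_pos (by simp)]
          rw [hv] at hc
          refine (hk₁ σ O _ _ _ (q₄.eval (Y + 1)) ((hq₄ _ _ trivial _ hlp [y]).mono fun v d hd => hd.trans (hs q₄))
            (hin ▸ hp₁ n r.key _ hlp _ len c hc ho x X hX)).mono fun v d hd => ?_
          obtain ⟨e, he, hd⟩ := hd
          refine ⟨⟨he.1.1, by omega⟩, ?_⟩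
          have := Nat.mul_le_mul_left k₁ (show e + q₄.eval (Y + 1) + 1 ≤ p₁.eval Y + q₄.eval (Y + 1) + 1 by omega)
          omega
      · have := w.snd.length_fst_le
        have := w.length_snd_le
        omega
      · have := hs q₂
        have := hs q₃
        simp only [eval_add, eval_mul, eval_ofNat]
        omega
  · simp only [eval_add, eval_mul, eval_ofNat]
    omega
  · have := hs q₀
    have h3 := hv.2
    simp only [eval_add, eval_mul, eval_ofNat, eval_C, eval_comp, eval_X, eval_one] at h3 ⊢
    omega

end Kit

end


noncomputable section

open Prog Polynomial

/-! ## The size of the ledger -/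

/-- Bounds for an entry for run `i`, for keys, and for other strings. -/
structure Entry.Small (S : MoneyScheme) (n : ℕ) (loc : Str → Cell) (Fw : Str) (R₀ R c i : ℕ)
    (r : Entry) : Prop where
  idx : i ≤ c
  own : r.own ≤ c
  key : r.key.length ≤ R₀
  ct : r.ct.length ≤ R
  st : r.party.st.length ≤ R
  reach : r.started = true → Str.unary r.own ≠ Fw → ∃ len ≤ c, ∃ c',
    Reachable (Ledger.bankProg S r.ver) (fun a => loc (Str.pair (Str.unary (i + 1)) a)) n r.key
      r.party len c'

namespace Ledger

/-- The bounds `R₀` and `R` on the lengths of strings are fixed for the whole execution. Only `c`,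
the steps spent by the adversary, and `e`, the number of answered queries, grow; they bound the
numbers of entries. So the encoded ledger stays polynomial after any polynomial number of queries.
-/
structure Small (S : MoneyScheme) (n : ℕ) (loc : Str → Cell) (Fw : Str) (R₀ R c e : ℕ)
    (a : Ledger) : Prop where
  N : a.N ≤ c
  log : a.log.length ≤ e
  mem : ∀ x ∈ a.log, x.2.Small S n loc Fw R₀ R c x.1
  tbl : a.tbl.length ≤ c
  tmem : ∀ x ∈ a.tbl, x.1.length ≤ R ∧ x.2.1 ≤ c ∧ x.2.2.length ≤ R₀
  wins : a.wins.length ≤ e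
  dead : a.dead.length ≤ 3 * c + 2

variable {S : MoneyScheme} {n : ℕ} {loc : Str → Cell} {Fw : Str} {R₀ R c e c' e' i : ℕ}
  {a : Ledger} {r : Entry}

theorem _root_.Entry.Small.mono (h : r.Small S n loc Fw R₀ R c i) (hc : c ≤ c') :
    r.Small S n loc Fw R₀ R c' i :=
  ⟨h.idx.trans hc, h.own.trans hc, h.key, h.ct, h.st, fun hs ho =>
    let ⟨len, hl, hr⟩ := h.reach hs ho; ⟨len, hl.trans hc, hr⟩⟩

theorem Small.mono (h : a.Small S n loc Fw R₀ R c e) (hc : c ≤ c') (he : e ≤ e') :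
    a.Small S n loc Fw R₀ R c' e' :=
  ⟨h.N.trans hc, h.log.trans he, fun x hx => (h.mem x hx).mono hc, h.tbl.trans hc,
    fun x hx => ⟨(h.tmem x hx).1, (h.tmem x hx).2.1.trans hc, (h.tmem x hx).2.2⟩,
    h.wins.trans he, h.dead.trans (by omega)⟩

theorem small_init : init.Small S n loc Fw R₀ R 0 0 := by
  refine ⟨?_, ?_, ?_, ?_, ?_, ?_, ?_⟩ <;> simp [init]

theorem Small.set (h : a.Small S n loc Fw R₀ R c e) (hr : r.Small S n loc Fw R₀ R c i) :
    (a.set i r).Small S n loc Fw R₀ R c (e + 1) :=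
  ⟨h.N, Nat.succ_le_succ h.log, fun x hx => (List.mem_cons.1 hx).elim (fun h => h ▸ hr) (h.mem x),
    h.tbl, h.tmem, h.wins.trans (Nat.le_succ _), h.dead⟩

theorem Small.push (h : a.Small S n loc Fw R₀ R c e) (v : Bool) :
    (a.push v).Small S n loc Fw R₀ R (c + 1) (e + 1) :=
  ⟨Nat.succ_le_succ h.N, Nat.succ_le_succ h.log, fun x hx => (List.mem_cons.1 hx).elim (fun hx =>
    hx ▸ ⟨h.N.trans (Nat.le_succ c), Nat.zero_le _, Nat.zero_le _, Nat.zero_le _, Nat.zero_le _,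
      fun hs => by cases hs⟩) fun hx => (h.mem x hx).mono (Nat.le_succ _),
    h.tbl.trans (Nat.le_succ _), fun x hx => ⟨(h.tmem x hx).1, (h.tmem x hx).2.1.trans
    (Nat.le_succ _), (h.tmem x hx).2.2⟩, h.wins.trans (Nat.le_succ _), h.dead.trans (by omega)⟩

theorem mem_of_look (h : a.look i = some r) : (i, r) ∈ a.log := by
  rw [look, Option.map_eq_some_iff] at h
  obtain ⟨x, hx, rfl⟩ := h
  have := List.find?_some hx
  rw [beq_iff_eq] at this
  exact this ▸ List.mem_of_find?_eq_some hx

theorem mem_of_find {x : Str} {y : ℕ × Str} (h : a.find x = some y) : (x, y) ∈ a.tbl := by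
  rw [find, Option.map_eq_some_iff] at h
  obtain ⟨z, hz, rfl⟩ := h
  have := List.find?_some hz
  rw [beq_iff_eq] at this
  exact this ▸ List.mem_of_find?_eq_some hz

/-- What holds after the preparation of the answer to a query of length `l`. -/
def PrepSmall (S : MoneyScheme) (n : ℕ) (loc : Str → Cell) (Fw : Str) (R₀ R c l : ℕ) : Prep → Prop
  | .inl x => x.2.Small S n loc Fw R₀ R (c + 1 + l) (c + 1)
  | .inr y => y.1.Small S n loc Fw R₀ R (c + 1 + l) c ∧ y.2.2.1.Small S n loc Fw R₀ R c y.2.1 ∧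
      y.2.2.1.party.out = none ∧ y.2.2.1.started = true ∧ y.2.2.2.length ≤ l

variable {o : Ops} {σ : Type} {O : Oracle σ} {X : ℕ}

/-- New strings enter the ledger only through the operations `gen`, `enc` and `sign`, or through the
query itself. A ciphertext is made from a key, and a tag from a ciphertext, whence the chain of
bounds `R₀`, `R₁`, `R`. -/
theorem ensures_prep {R₁ : ℕ} (hgen : ∀ i ≤ X, Eff.Ensures O loc (o.gen i) fun v _ => v.length ≤ R₀)
    (henc : ∀ i ≤ X, ∀ k : Str, k.length ≤ R₀ →
      Eff.Ensures O loc (o.enc i k) fun v _ => v.length ≤ R₁)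
    (hsign : ∀ m : Str, m.length ≤ R₁ →
      Eff.Ensures O loc (o.sign m) fun v _ => 2 * m.length + 2 + v.length ≤ R)
    (h : a.Small S n loc Fw R₀ R c c) (hc : c ≤ X) (p : ℕ) (m : Str) :
    Eff.Ensures O loc (prep o a p m) fun y _ => PrepSmall S n loc Fw R₀ R c m.length y := by
  have h' : a.Small S n loc Fw R₀ R (c + 1 + m.length) (c + 1) := h.mono (by omega) (by omega)
  have hs : (a.spend m).Small S n loc Fw R₀ R (c + 1 + m.length) (c + 1) :=
    ⟨h'.N, h'.log, h'.mem, h'.tbl, h'.tmem, h'.wins, h'.dead⟩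
  have hp : ∀ v, ((a.spend m).push v).Small S n loc Fw R₀ R (c + 1 + m.length) (c + 1) := fun v =>
    have := (h.push v).mono (c' := c + 1 + m.length) (by omega) le_rfl
    ⟨this.N, this.log, this.mem, this.tbl, this.tmem, this.wins, this.dead⟩
  unfold prep
  split_ifs
  swap
  · exact Eff.ensures_ret hs
  rcases p with _ | _ | _ | p
  · exact (Eff.ensures_true _).bind fun _ _ _ => Eff.ensures_ret (hp false)
  · exact (Eff.ensures_true _).bind fun _ _ _ => Eff.ensures_ret (hp true)
  · simp only [live, message, look_spend]
    rcases hl : a.look m.fst.length with _ | r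
    · exact Eff.ensures_ret hs
    have hm := h.mem _ (mem_of_look hl)
    have hm' := hm.mono (c' := c + 1 + m.length) (by omega)
    simp only
    have hset : ∀ {a' : Ledger} {r' : Entry}, a'.log = a.log → a'.N = a.N → a'.tbl = a.tbl →
        a'.wins = a.wins → a'.dead = a.dead →
        r'.Small S n loc Fw R₀ R (c + 1 + m.length) m.fst.length →
        (a'.set m.fst.length r').Small S n loc Fw R₀ R (c + 1 + m.length) (c + 1) := by
      intro a' r' h1 h2 h3 h4 h5 hr'
      refine Small.set (e := c) ⟨?_, ?_, ?_, ?_, ?_, ?_, ?_⟩ hr'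
      · exact h2 ▸ h'.N
      · exact h1 ▸ h.log
      · exact h1 ▸ h'.mem
      · exact h3 ▸ h'.tbl
      · exact h3 ▸ h'.tmem
      · exact h4 ▸ h.wins
      · exact h5 ▸ h'.dead
    by_cases ho : r.party.out.isSome
    · rw [if_pos ho]
      exact Eff.ensures_ret hs
    rw [if_neg ho]
    have hmr := m.length_snd_le
    by_cases hst : r.started
    · rw [if_pos hst]
      exact Eff.ensures_ret ⟨⟨h'.N, h.log, h'.mem, h'.tbl, h'.tmem, h.wins, h'.dead⟩, hm,
        by simpa using ho, hst, hmr⟩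
    rw [if_neg hst]
    have hrej : Entry.Small S n loc Fw R₀ R (c + 1 + m.length) m.fst.length
        { r with party := ⟨[], some false⟩ } :=
      ⟨hm'.idx, hm'.own, hm'.key, hm'.ct, Nat.zero_le _, fun hs => absurd hs hst⟩
    by_cases hv : r.ver
    · rw [if_pos hv]
      rcases hf : (a.spend m).find m.snd.fst with _ | y
      · by_cases ht : Str.unary m.fst.length = o.target
        · rw [verStart_dead _ hf ht]
          refine Eff.ensures_ret ⟨h'.N, h'.log, h'.mem, h'.tbl, h'.tmem, h'.wins, ?_⟩
          have := m.snd.length_fst_le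
          have := m.snd.length_snd_le
          simp only [Str.length_pair]
          omega
        · rw [verStart_fresh _ hf ht]
          exact (Eff.ensures_true _).bind fun v _ _ =>
            Eff.ensures_ret (hset rfl rfl rfl rfl rfl hrej)
      · have hy := h'.tmem _ (mem_of_find hf)
        rw [verStart, hf]
        refine (Eff.ensures_true _).bind fun v _ _ => Eff.ensures_ret ?_
        split_ifs
        · exact hset rfl rfl rfl rfl rfl ⟨hm'.idx, hy.2.1, hy.2.2, hm'.ct, Nat.zero_le _,
            fun _ _ => ⟨0, Nat.zero_le _, 0, .init⟩⟩
        · exact hset rfl rfl rfl rfl rfl hrej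
    · rw [if_neg hv]
      have hi := hm.idx
      refine (hgen _ (hi.trans hc)).bind fun k _ hk => (henc _ (hi.trans hc) k hk).bind fun x _ hx =>
        (hsign x hx).bind fun t _ ht => Eff.ensures_ret ⟨⟨h'.N, h.log, h'.mem,
          Nat.succ_le_of_lt (Nat.lt_of_le_of_lt h.tbl (by omega)), fun y hy => ?_, h.wins, h'.dead⟩,
          ⟨hi, hi, hk, (Str.length_pair x t).trans_le ht, Nat.zero_le _,
            fun _ _ => ⟨0, Nat.zero_le _, 0, .init⟩⟩, rfl, rfl, hmr⟩
      rcases List.mem_cons.1 hy with rfl | hy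
      · exact ⟨by simp only; omega, hm'.idx, hk⟩
      · exact h'.tmem y hy
  · exact Eff.ensures_ret hs

theorem Small.bankDone {l : ℕ} (h : a.Small S n loc Fw R₀ R (c + 1 + l) c)
    (hr : r.Small S n loc Fw R₀ R (c + 1 + l) i) {v : Str} (hv : v.snd.fst.length ≤ R)
    (hR : Str.unary r.own ≠ Fw → ∃ len ≤ c + 1 + l, ∃ c', Reachable (bankProg S r.ver)
      (fun a => loc (Str.pair (Str.unary (i + 1)) a)) n r.key (partyNext v) len c') :
    (Ledger.bankDone a i r v).2.Small S n loc Fw R₀ R (c + 1 + l) (c + 1) := by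
  have := h.set (i := i) (r := { r with party := partyNext v })
    ⟨hr.idx, hr.own, hr.key, hr.ct, hv, fun _ => hR⟩
  refine ⟨this.N, this.log, this.mem, this.tbl, this.tmem, ?_, this.dead⟩
  have hw := h.wins
  simp only [Ledger.bankDone]
  split_ifs
  · exact Nat.succ_le_succ hw
  · exact hw.trans (Nat.le_succ _)

theorem length_assoc_le {B : ℕ} {l : List (Str × Str)}
    (h : ∀ x ∈ l, 2 * x.1.length + 2 * x.2.length + 4 ≤ B) : (assoc l).length ≤ l.length * B := by
  induction l with
  | nil => simp [assoc]
  | cons x l ih =>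
    have h1 := h x (List.mem_cons_self ..)
    have h2 := ih fun y hy => h y (List.mem_cons_of_mem _ hy)
    simp only [assoc, Str.length_pair, List.length_cons, Nat.succ_mul]
    omega

theorem Small.length_encode (h : a.Small S n loc Fw R₀ R c e) (he : e ≤ c) (K : Conf) (j : ℕ) :
    (a.encode K j).length ≤ 2 * K.str.length + 9 * c + 14 +
      2 * (c * (6 * c + 4 * R₀ + 8 * R + 60)) + 2 * (c * (4 * R + 4 * c + 2 * R₀ + 10)) := by
  have h1 : (assoc (a.log.map fun x => (Str.unary x.1, x.2.str))).length ≤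
      c * (6 * c + 4 * R₀ + 8 * R + 60) := by
    refine (length_assoc_le (B := 6 * c + 4 * R₀ + 8 * R + 60) fun x hx => ?_).trans
      (Nat.mul_le_mul_right _ (by rw [List.length_map]; exact h.log.trans he))
    obtain ⟨y, hy, rfl⟩ := List.mem_map.1 hx
    have := h.mem y hy
    have h1 := this.idx
    have h2 := this.own
    have h3 := this.key
    have h4 := this.ct
    have h5 := this.st
    have h6 : y.2.party.out.toList.length ≤ 1 := by cases y.2.party.out <;> simp
    simp only [Entry.str, Str.length_pair, Str.length_unary, List.length_singleton]
    omega
  have h2 : (assoc (a.tbl.map fun x => (x.1, Str.pair (Str.unary x.2.1) x.2.2))).length ≤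
      c * (4 * R + 4 * c + 2 * R₀ + 10) := by
    refine (length_assoc_le (B := 4 * R + 4 * c + 2 * R₀ + 10) fun x hx => ?_).trans
      (Nat.mul_le_mul_right _ (by rw [List.length_map]; exact h.tbl))
    obtain ⟨y, hy, rfl⟩ := List.mem_map.1 hx
    have := h.tmem y hy
    simp only [Str.length_pair, Str.length_unary]
    omega
  have h3 := h.N
  have h4 := (List.count_le_length (a := j) (l := a.wins)).trans h.wins
  have h5 := h.dead
  simp only [encode, Str.length_pair, Str.length_unary]
  omega

end Ledger

namespace Kit

open Ledger

/-- One answer of the handler. -/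
theorem exists_handler_bound {S : MoneyScheme} (hS : S.IsScheme) {P : Kit} (hP : P.Efficient)
    (hb : P.bank = bankP S) : ∃ r₀ r t : Polynomial ℕ, ∀ {n X j c p : ℕ} {K : Conf} {σ : Type}
      {O : Oracle σ} {loc : Str → Cell} {a : Ledger} {m : Str} (_ : IsPlacement loc)
      (_ : K.sec = Str.unary n) (_ : K.J = Str.unary j) (_ : K.str.length ≤ X)
      (_ : c + 1 + m.length ≤ X) (_ : p ≤ X)
      (_ : a.Small S n loc K.Fw (r₀.eval X) (r.eval X) c c),
      Eff.Ensures O loc ((handlerP P).tree [Eff.handlerInput (a.encode K j) p m]) fun v d =>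
        (∃ a' : Ledger, v.fst = a'.encode K j ∧ a'.Small S n loc K.Fw (r₀.eval X) (r.eval X)
          (c + 1 + m.length) (c + 1)) ∧
        d + (Eff.handlerInput (a.encode K j) p m).length + v.length ≤ t.eval X := by
  obtain ⟨pg, hg⟩ := hP.gen.exists_bound
  obtain ⟨pe, he⟩ := hP.enc.exists_bound
  obtain ⟨ps, hs⟩ := hP.sign.exists_bound
  obtain ⟨pp, hp⟩ := polyTime_prepP hP
  obtain ⟨s, q, hq⟩ := exists_bank_bound hS
  obtain ⟨pa, hpa⟩ : PolyTime AnyOracle bankCallArg := Simple.polyTime (by simp [bankCallArg])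
  obtain ⟨pd, hpd⟩ : PolyTime AnyOracle (bankDoneP (.fst (.arg 1)) (.fst (.snd (.arg 1)))
    (.fst (.snd (.snd (.arg 1)))) (.arg 0)) := Simple.polyTime (by simp [bankDoneP, outP])
  obtain ⟨pf, hpf⟩ : PolyTime AnyOracle (Prog.fst (.arg 0)) := Simple.polyTime (by simp)
  obtain ⟨pn, hpn⟩ : PolyTime AnyOracle (Prog.snd (.arg 0)) := Simple.polyTime (by simp)
  -- `r₀`, `r₁` and `r` bound keys, ciphertexts and the other strings in the ledger. `L` bounds the
  -- input of the handler and `Y` the argument of the bank operation. `cp`, `cb`, `cd` bound the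
  -- times of preparation, bank call and update, and `ct` the total. None of the bounds on strings
  -- refers to the size of the ledger.
  let x : Polynomial ℕ := Polynomial.X
  let r₀ := 2 * pg.comp (3 * x + 3)
  let r₁ := 2 * pe.comp (4 * x + 5 + r₀)
  let r := 2 * r₁ + 2 + 2 * ps.comp (2 * x + 3 + r₁) + s.comp (3 * x + r₀ + 1)
  let L := 2 * (11 * x + 14 + 2 * (x * (6 * x + 4 * r₀ + 8 * r + 60)) +
    2 * (x * (4 * r + 4 * x + 2 * r₀ + 10))) + 3 * x + 4
  let cp := pp.comp (L + 1)
  let Y := 8 * x + 3 * r₀ + 2 * r + 20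
  let cb := pa.comp (2 * cp + 1) + 1 + q.comp Y
  let cd := pd.comp (2 * cp + 2 * cb + 2)
  let ct := cp + 1 + (pf.comp (2 * cp + L + 4) + 1 + (pn.comp (2 * cp + L + 4) + 1 + (cb + 1 + cd)))
  refine ⟨r₀, r, L + 3 * ct, ?_⟩
  intro n X j c p K σ O loc a m hl hK hJ hκ hc hpX hsm
  have hlen : (Eff.handlerInput (a.encode K j) p m).length ≤ L.eval X := by
    have h1 := (hsm.mono (c' := X) (e' := X) (by omega) (by omega)).length_encode le_rfl K j
    simp only [Eff.handlerInput, Str.length_pair, Str.length_unary]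
    simp only [L, x, eval_add, eval_mul, eval_ofNat, eval_X]
    omega
  have hn : n ≤ X := by
    have : K.sec.length ≤ K.str.length := by simp only [Conf.str, Str.length_pair]; omega
    rw [hK, Str.length_unary] at this
    omega
  have hprep := ensures_prep (o := P.ops K) (O := O) (X := X) (R₁ := r₁.eval X)
    (fun i hi => (hg σ O trivial loc hl _).mono fun v d hv => hv.2.trans ?_)
    (fun i hi k hk => (he σ O trivial loc hl _).mono fun v d hv => hv.2.trans ?_)
    (fun y hy => (hs σ O trivial loc hl _).mono fun v d hv => ?_) hsm (by omega) p m
  rotate_left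
  · simp only [r₀, eval_mul, eval_comp, eval_ofNat]
    refine Nat.mul_le_mul_left _ (eval_mono_nat _ ?_)
    simp [envSize, Str.length_pair, Str.length_unary, x]
    omega
  · simp only [r₁, eval_mul, eval_comp, eval_ofNat]
    refine Nat.mul_le_mul_left _ (eval_mono_nat _ ?_)
    simp [envSize, Str.length_pair, Str.length_unary, x]
    omega
  · have h1 : ps.eval (envSize [Str.pair K.str y]) ≤ ps.eval (2 * X + 3 + r₁.eval X) :=
      ps.eval_mono_nat (by simp [envSize, Str.length_pair]; omega)
    simp only [r, x, eval_add, eval_mul, eval_comp, eval_ofNat, eval_X]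
    omega
  have hval : Eff.Ensures O loc ((prepP P).tree [Eff.handlerInput (a.encode K j) p m]) fun v d =>
      (∃ y, v = encodePrep K j y ∧ PrepSmall S n loc K.Fw (r₀.eval X) (r.eval X) c m.length y) ∧
        d ≤ cp.eval X := by
    refine ((hp σ O trivial loc hl _).and (Eff.ensures_of_run fun s ψ o ho => ?_)).mono
      fun v d hv => ⟨hv.2, hv.1.trans ?_⟩
    · rw [run_prepP, PMF.mem_support_map_iff] at ho
      obtain ⟨z, hz, rfl⟩ := ho
      exact ⟨z.1, rfl, (hprep.of_run hz).elim fun _ h => h⟩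
    · rw [eval_comp]
      exact pp.eval_mono_nat (by simp [envSize]; omega)
  refine ((ensures_letIn hval (b := (pf.comp (2 * cp + L + 4) + 1 +
    (pn.comp (2 * cp + L + 4) + 1 + (cb + 1 + cd))).eval X) (B := fun v => ∃ a' : Ledger,
      v.fst = a'.encode K j ∧ a'.Small S n loc K.Fw (r₀.eval X) (r.eval X)
          (c + 1 + m.length) (c + 1)) ?_).and (ensures_length (handlerP P) O loc _)).mono
    fun v d hv => ⟨hv.1.1, ?_⟩
  swap
  · have h1 := hv.1.2
    simp only [ct, eval_add, eval_mul, eval_ofNat, eval_one] at h1 ⊢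
    omega
  rintro v ⟨y, rfl, hy⟩ hvl
  have hsz : envSize [encodePrep K j y, Eff.handlerInput (a.encode K j) p m] ≤
      (2 * cp + L + 4).eval X := by
    simp only [envSize, eval_add, eval_mul, eval_ofNat,
      List.map_cons, List.sum_cons, List.map_nil, List.sum_nil]
    omega
  have hfst := (hpf σ O trivial loc hl _).mono fun v d hd => hd.trans (pf.eval_mono_nat hsz)
  have hsnd := (hpn σ O trivial loc hl _).mono fun v d hd => hd.trans (pn.eval_mono_nat hsz)
  refine (ensures_ite (by simp) hfst (b := (pn.comp (2 * cp + L + 4) + 1 + (cb + 1 + cd)).eval X)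
    ?_).mono fun v d hv => ⟨hv.1, hv.2.trans (by simp)⟩
  rcases y with y | ⟨a', i, e, msg⟩
  · rw [if_neg (by simp [encodePrep])]
    refine (hsnd.and (Prog.Pure.ensures (by simp) _ _ _)).mono fun v d hv =>
      ⟨⟨y.2, by simp [hv.2, encodePrep], hy⟩, hv.1.trans (by simp; omega)⟩
  rw [if_pos (by simp [encodePrep])]
  obtain ⟨hy1, hy2, hy3, hy4, hy5⟩ := hy
  simp only at hy1 hy2 hy3 hy4 hy5
  refine (ensures_call (by simp) hsnd (b := (cb + 1 + cd).eval X) ?_).mono fun v d hv =>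
    ⟨hv.1, hv.2.trans (by simp)⟩
  set I := stepArg K j (a', i, e, msg) with hI
  have hIv : (Prog.snd (.arg 0)).val [encodePrep K j (.inr (a', i, e, msg)),
      Eff.handlerInput (a.encode K j) p m] = I := by simp [encodePrep, hI, stepArg]
  have hIl : I.length ≤ 2 * cp.eval X := by
    refine le_trans ?_ hvl
    rw [← hIv]
    simpa using Str.length_snd_le _
  rw [hIv]
  have harg : bankCallArg.val [I] = Str.pair K.str (bankArg e.ver i e.own e.key e.party.st msg) := by
    exact val_bankCallArg (a', i, e, msg)
  have hsnd' := (hpa σ O trivial loc hl [I]).mono fun v d hd => hd.trans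
    (pa.eval_mono_nat (n := (2 * cp + 1).eval X) (by simp [envSize]; omega))
  -- For a forwarded run nothing is known about reachability and nothing is needed; the length 0 is
  -- a dummy.
  have hlen' : ∃ len ≤ c, (Str.unary e.own ≠ K.Fw → ∃ c', Reachable (bankProg S e.ver)
      (fun a => loc (Str.pair (Str.unary (i + 1)) a)) n e.key e.party len c') := by
    by_cases h : Str.unary e.own = K.Fw
    · exact ⟨0, Nat.zero_le _, fun h' => absurd h h'⟩
    · obtain ⟨len, h1, h2⟩ := hy2.reach hy4 h
      exact ⟨len, h1, fun _ => h2⟩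
  obtain ⟨len, hlc, hR⟩ := hlen'
  have i1 := hy2.key
  have i2 := hy2.st
  have i3 := hy2.idx
  have i4 := hy2.own
  have hbank := hq (X := (3 * x + r₀ + 1).eval X) (Y := Y.eval X) (O := O) (j := j) hl hK (x := msg) hy3 hR
    (by simp [x]; omega) (by simp [x, Y]; omega)
    (by simp [bankArg, Str.length_pair, Str.length_unary, x, Y]; omega)
  have hcall := (ensures_call (f := P.bank) (by simp [bankCallArg]) hsnd' (b := q.eval (Y.eval X))
    (B := fun v => (Str.unary e.own ≠ K.Fw → ∃ c', Reachable (bankProg S e.ver)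
      (fun a => loc (Str.pair (Str.unary (i + 1)) a)) n e.key (partyNext v)
      (len + (msg.length + 1)) c') ∧ v.snd.fst.length ≤ r.eval X) (by
    rw [harg, hb]
    exact hbank.mono fun v d hv => ⟨⟨hv.1.1, hv.1.2.trans (by simp [r])⟩, hv.2⟩)).mono
    (Q' := fun v d => _ ∧ d ≤ cb.eval X) fun v d hv => ⟨hv.1, hv.2.trans (by simp [cb])⟩
  refine (ensures_letIn hcall (b := cd.eval X) fun v hv hvl' => ?_).mono fun v d hv =>
    ⟨hv.1, hv.2.trans (by simp)⟩
  refine ((hpd σ O trivial loc hl _).and (pure_bankDoneP.ensures _ _ _)).mono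
    fun w d hw => ⟨?_, hw.1.trans ?_⟩
  · rw [hw.2, val_bankDoneP hJ, Str.fst_pair]
    refine ⟨_, rfl, hy1.bankDone (hy2.mono (by omega)) hv.2 fun h => ?_⟩
    obtain ⟨c', hc'⟩ := hv.1 h
    exact ⟨_, by omega, c', hc'⟩
  · simp only [cd, eval_comp]
    refine pd.eval_mono_nat ?_
    simp [envSize]
    omega

end Kit

end


noncomputable section

open Prog Polynomial

/-! ## Polynomials and random numbers in unary -/

namespace Prog

/-- The value of a polynomial in unary. -/
theorem exists_unary (p : Polynomial ℕ) : ∃ P : Prog, P.Pure ∧ PolyTime AnyOracle P ∧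
    ∀ n, P.val [Str.unary n] = Str.unary (p.eval n) := by
  -- Multiplication in unary: the value of `Q` is appended once for each bit of the value of `P`.
  have hmul : ∀ {p q : Polynomial ℕ} {P Q : Prog}, P.Pure → PolyTime AnyOracle P →
      (∀ n, P.val [Str.unary n] = Str.unary (p.eval n)) → Q.Pure → PolyTime AnyOracle Q →
      (∀ n, Q.val [Str.unary n] = Str.unary (q.eval n)) → ∃ P : Prog, P.Pure ∧
        PolyTime AnyOracle P ∧ ∀ n, P.val [Str.unary n] = Str.unary ((p * q).eval n) := by
    intro p q P Q h1 h2 h3 h4 h5 h6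
    refine ⟨.loop P (.lit []) (.append (.call Q (.arg 1)) (.arg 0)), by simp [h1, h4],
      h2.accumulate (h5.call (polyTime_arg 0)) fun _ _ => rfl, fun n => ?_⟩
    simp only [val, h3, h6, Str.length_unary, eval_mul, List.getD_cons_zero, List.getD_cons_succ]
    induction p.eval n with
    | zero => simp [Str.unary]
    | succ k ih => rw [Function.iterate_succ_apply', ih]; simp [Str.unary, Nat.succ_mul, Nat.add_comm]
  induction p using Polynomial.induction_on with
  | C a => exact ⟨.lit (Str.unary a), trivial, polyTime_lit _, fun n => by simp⟩
  | add p q hp hq =>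
    obtain ⟨P, h1, h2, h3⟩ := hp
    obtain ⟨Q, h4, h5, h6⟩ := hq
    exact ⟨.append P Q, ⟨h1, h4⟩, h2.append h5, fun n => by
      rw [val, h3, h6, eval_add]; simp [Str.unary]⟩
  | monomial n a ih =>
    obtain ⟨P, h1, h2, h3⟩ := ih
    have := hmul h1 h2 h3 (Q := .arg 0) trivial (polyTime_arg 0) (q := Polynomial.X)
      fun n => by simp
    rwa [pow_succ, ← mul_assoc]

/-- The state is a pair of a unary number `x`, which is halved, and a unary number `v`, which
becomes `2v` plus a coin. Thus `v` receives one random binary digit for each digit of `x`. -/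
def guessStep : Prog :=
  .ite (isNil (.fst (.arg 0))) (.arg 0) (.pair (.fst (.fst (.arg 0))) (.append (.snd (.arg 0))
    (.append (.snd (.arg 0)) (.ite .flip (.lit [true]) (.lit [])))))

/-- A uniform number below the least power of two above `s`, where the argument is `s` in unary, and
the result too. -/
def guess : Prog := .snd (.loop (.arg 0) (.pair (.arg 0) (.lit [])) guessStep)

theorem unary_add (m n : ℕ) : Str.unary (m + n) = Str.unary m ++ Str.unary n :=
  List.replicate_add ..

/-- Adjacent bits of a string of ones agree, so the decoding takes them for doubled bits; `fst` is
therefore division by two. -/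
theorem fst_unary (s : ℕ) : (Str.unary s).fst = Str.unary (s / 2) := by
  induction s using Nat.twoStepInduction with
  | zero => rfl
  | one => rfl
  | more s ih _ =>
    have : Str.unary (s + 2) = true :: true :: Str.unary s := rfl
    rw [this, Str.fst, Str.unpair, if_pos rfl]
    change true :: (Str.unary s).fst = _
    rw [ih]
    have : (s + 2) / 2 = s / 2 + 1 := by omega
    rw [this]
    rfl

section

variable {σ : Type} {O : Oracle σ} {loc : Str → Cell}

theorem run_guessStep (x v : Str) (env : List Str) (w : σ × QState) :
    (guessStep.tree (Str.pair x v :: env)).run O loc w = if x = [] then PMF.pure (Str.pair x v, w)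
      else (PMF.uniformOfFintype Bool).map fun b =>
        (Str.pair x.fst (v ++ (v ++ if b then [true] else [])), w) := by
  rw [guessStep, run_ite_pure (by simp)]
  by_cases hx : x = []
  · rw [if_pos (by simp [Accepts, hx]), if_pos hx]
    exact run_of_val
  · rw [if_neg (by simp [Accepts, hx]), if_neg hx]
    simp only [tree, Eff.run_bind, Eff.run, PMF.pure_bind, PMF.bind_bind, List.getD_cons_zero,
      Str.fst_pair, Str.snd_pair]
    refine congrArg _ (funext fun b => ?_)
    cases b <;> simp [Eff.run]

theorem polyTime_guess : PolyTime AnyOracle guess := by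
  refine .snd (PolyTime.loop (polyTime_arg 0) (Simple.polyTime (by simp))
    (.ite (Simple.polyTime (by simp)) (polyTime_arg 0) (.pair (Simple.polyTime (by simp))
      (.append (Simple.polyTime (by simp)) (.append (Simple.polyTime (by simp))
        (.ite polyTime_flip (polyTime_lit _) (polyTime_lit _))))))
    -- The doubling of `v` is compensated by the halving of `x`: as long as `x` is nonempty, the
    -- product of `x.length` and `v.length + 1` stays bounded.
    (fun env u => ∃ x v, u = Str.pair x v ∧ x.length ≤ envSize env ∧
      (x ≠ [] → (v.length + 1) * x.length ≤ envSize env + 1) ∧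
      v.length + 1 ≤ 2 * (envSize env + 1))
    (4 * Polynomial.X + 4) (fun σ O loc env => ?_) (fun σ O loc env u hu => ?_) ?_)
  · refine (Prog.Pure.ensures (by simp) O loc env).mono fun v _ hv => ?_
    have := length_getD_le env 0
    exact ⟨env.getD 0 [], [], hv, this, fun _ => by simp only [List.length_nil]; omega,
      by simp only [List.length_nil]; omega⟩
  · obtain ⟨x, v, rfl, h1, h2, h3⟩ := hu
    refine Eff.ensures_of_run fun s ψ o ho => ?_
    change o ∈ ((guessStep.tree _).run O loc _).support at ho
    rw [run_guessStep] at ho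
    split_ifs at ho with hx
    · rw [PMF.support_pure, Set.mem_singleton_iff] at ho
      exact ⟨x, v, by rw [ho], h1, h2, h3⟩
    · rw [PMF.mem_support_map_iff] at ho
      obtain ⟨b, -, rfl⟩ := ho
      have hx' : 1 ≤ x.length := List.length_pos_of_ne_nil hx
      have h4 : 2 * x.fst.length ≤ x.length := by have := Str.length_fst_add_snd x; omega
      have h5 := h2 hx
      have h6 : (if b then [true] else [] : Str).length ≤ 1 := by cases b <;> simp
      have h7 : (v ++ (v ++ if b then [true] else [])).length + 1 ≤ 2 * (v.length + 1) := by
        simp only [List.length_append]; omega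
      refine ⟨_, _, rfl, by omega, fun _ => ?_, ?_⟩ <;> nlinarith
  · rintro env _ ⟨x, v, rfl, h1, h2, h3⟩
    simp [Str.length_pair]
    omega

theorem guess_ppt : guess.PPT := by
  obtain ⟨p, hp⟩ := polyTime_guess
  exact ppt_of_polyTime (by simp [guess, guessStep, Classical, isNil])
    ⟨p, fun σ O _ => hp σ O trivial⟩

theorem guess_run (s : ℕ) : guess.run (Str.unary s) =
    ((Eff.iterate (fun u => guessStep.tree [u, Str.unary s]) s (Str.pair (Str.unary s) [])).run
      noOracle (Cell.priv 0) ((), QState.zero)).map fun o => o.1.snd := by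
  rw [run_eq_tree]
  simp only [guess, tree, Eff.run_bind, Eff.run, PMF.pure_bind, List.getD_cons_zero,
    Str.length_unary, PMF.map_bind, PMF.pure_map]
  rfl

theorem exists_of_mem_guess {s : ℕ} {v : Str} (h : v ∈ (guess.run (Str.unary s)).support) :
    ∃ j, v = Str.unary j := by
  rw [guess_run, PMF.mem_support_map_iff] at h
  obtain ⟨o, ho, rfl⟩ := h
  have key : ∀ N x m, ∀ o ∈ ((Eff.iterate (fun u => guessStep.tree [u, Str.unary s]) N
      (Str.pair x (Str.unary m))).run noOracle (Cell.priv 0) ((), QState.zero)).support,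
      ∃ j, o.1.snd = Str.unary j := by
    intro N
    induction N with
    | zero =>
      intro x m o ho
      rw [Eff.iterate, Eff.run, PMF.support_pure, Set.mem_singleton_iff] at ho
      exact ⟨m, by rw [ho, Str.snd_pair]⟩
    | succ N ih =>
      intro x m o ho
      rw [Eff.iterate, Eff.run_bind, run_guessStep] at ho
      split_ifs at ho
      · rw [PMF.pure_bind] at ho
        exact ih _ _ o ho
      · rw [PMF.bind_map, PMF.mem_support_bind_iff] at ho
        obtain ⟨b, -, ho⟩ := ho
        cases b
        · exact ih _ (m + (m + 0)) o (by rwa [unary_add, unary_add])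
        · exact ih _ (m + (m + 1)) o (by rwa [unary_add, unary_add])
  exact key _ _ 0 o ho

/-- The exponent `e` is the number of binary digits of `s`. The inductive claim concerns an
intermediate state: if `m` consists of the leading digits of `j` and `e` digits are missing, these
are hit with probability at least `2⁻¹ ^ e`. -/
theorem le_guess {e s j : ℕ} (h1 : s < 2 ^ e) (h2 : e = 0 ∨ 2 ^ (e - 1) ≤ s) (hj : j < 2 ^ e)
    (F : Str → ℝ≥0∞) : 2⁻¹ ^ e * F (Str.unary j) ≤ (guess.run (Str.unary s)).ev F := by
  have key : ∀ N e s' m j, s' ≤ N → s' < 2 ^ e → (e = 0 ∨ 2 ^ (e - 1) ≤ s') → m * 2 ^ e ≤ j →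
      j < (m + 1) * 2 ^ e → 2⁻¹ ^ e * F (Str.unary j) ≤
      ((Eff.iterate (fun u => guessStep.tree [u, Str.unary s]) N
        (Str.pair (Str.unary s') (Str.unary m))).run noOracle (Cell.priv 0) ((), QState.zero)).ev
        fun o => F o.1.snd := by
    intro N
    induction N with
    | zero =>
      intro e s' m j hs h1 h2 h3 h4
      obtain rfl := Nat.le_zero.1 hs
      rcases h2 with rfl | h2
      · obtain rfl : j = m := by omega
        rw [Eff.iterate, Eff.run, PMF.ev_pure, Str.snd_pair, pow_zero, one_mul]
      · exact absurd h2 (by simp)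
    | succ N ih =>
      intro e s' m j hs h1 h2 h3 h4
      rw [Eff.iterate, Eff.run_bind, run_guessStep]
      split_ifs with hx
      · rw [PMF.pure_bind]
        obtain rfl : s' = 0 := Str.unary_injective (a₂ := 0) hx
        exact ih e 0 m j (Nat.zero_le _) h1 h2 h3 h4
      · have hs0 : s' ≠ 0 := fun h => hx (by rw [h]; rfl)
        obtain ⟨e, rfl⟩ : ∃ e', e = e' + 1 := ⟨e - 1, by
          rcases e with _ | e
          · simp at h1; omega
          · rfl⟩
        rw [PMF.bind_map, PMF.ev_bind, pow_succ', mul_assoc]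
        have hrec : ∀ b : Bool, (m + (m + if b then 1 else 0)) * 2 ^ e ≤ j →
            j < (m + (m + if b then 1 else 0) + 1) * 2 ^ e →
            2⁻¹ ^ e * F (Str.unary j) ≤ _ := fun b hb hb' =>
          ih e (s' / 2) (m + (m + if b then 1 else 0)) j (by omega) (by rw [pow_succ] at h1; omega)
            (by
              rcases e with _ | e
              · exact Or.inl rfl
              · have := h2.resolve_left (by omega)
                simp only [Nat.add_sub_cancel, pow_succ] at this ⊢
                exact Or.inr (by omega)) hb hb'
        have hb : ∃ b : Bool, (m + (m + if b then 1 else 0)) * 2 ^ e ≤ j ∧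
            j < (m + (m + if b then 1 else 0) + 1) * 2 ^ e := by
          rw [pow_succ] at h3 h4
          by_cases h : (m + (m + 1)) * 2 ^ e ≤ j
          · exact ⟨true, by simpa using h, by simp only [if_true]; nlinarith⟩
          · exact ⟨false, by simp; nlinarith, by simp; nlinarith⟩
        obtain ⟨b, hb, hb'⟩ := hb
        refine le_trans ?_ (PMF.mul_le_ev _ _ b)
        rw [PMF.uniformOfFintype_apply, Fintype.card_bool, Nat.cast_ofNat]
        refine mul_le_mul_right (α := ℝ≥0∞) ((hrec b hb hb').trans (le_of_eq ?_)) 2⁻¹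
        have : Str.unary (m + (m + if b then 1 else 0)) =
            Str.unary m ++ (Str.unary m ++ if b then [true] else []) := by
          rw [unary_add, unary_add]
          cases b <;> rfl
        rw [this, Function.comp_apply, fst_unary]
  rw [guess_run, PMF.ev_map]
  exact key s e s 0 j le_rfl h1 h2 (by simp) (by simpa using hj)

end

end Prog

theorem Prog.qptAdversary_iff {A : Prog} : A.QPTAdversary ↔ ∃ p : Polynomial ℕ, ∀ (n : ℕ)
    (loc : Str → Cell), IsPlacement loc → ∀ (σ : Type) (O : Oracle σ),
      Eff.Ensures O loc (A.tree [Str.unary n]) fun _ d => d ≤ p.eval n := by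
  refine exists_congr fun p => forall₃_congr fun n loc hl => forall₂_congr fun σ O => ?_
  refine ⟨fun h s ψ c o ho => ?_, fun h s ψ o ho => ?_⟩
  · have e := Eff.interp_shift O loc (A.tree [Str.unary n]) s ψ 0 c
    rw [Nat.zero_add] at e
    rw [e, PMF.mem_support_map_iff] at ho
    obtain ⟨o, ho, rfl⟩ := ho
    exact ⟨o.2.cost, Nat.add_comm _ _, h s ψ o (by rw [eval_run]; exact ho)⟩
  · rw [eval_run] at ho
    obtain ⟨d, hd, hd'⟩ := h s ψ 0 o ho
    omega

namespace Kit

open Ledger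

variable {σ : Type} {O : Oracle σ} {loc : Str → Cell} {K : Conf} {j n : ℕ}

/-- Run an adversary against the ledger; the environment holds the configuration. -/
def play (A : Prog) (P : Kit) (final : Prog) : Prog :=
  .letIn (.simulate (.base (.lit []) (.call A (cSec (.arg 0)))) (handlerP P)
    (mkState (.arg 0) (.lit []) (.lit []) (.lit []) (.lit []) (.lit []))) final

/-- The handler acts on encoded ledgers in the same way as the ledger oracle acts on ledgers, so the
two executions correspond under `encode`. The address `[]` of `base` is the one in `inner`. -/
theorem run_play (A : Prog) (P : Kit) {final : Prog} (hf : final.Pure) (hJ : K.J = Str.unary j)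
    (w : σ × QState) :
    ((play A P final).tree [K.str]).run O (Cell.priv 0) w =
      ((A.tree [K.sec]).run (Ledger.oracle (P.ops K) O (Cell.priv 0)) inner ((init, w.1), w.2)).map fun o =>
        (final.val [Str.pair o.1 (o.2.1.1.encode K j), K.str], o.2.1.2, o.2.2) := by
  have h1 : (mkState (.arg 0) (.lit []) (.lit []) (.lit []) (.lit []) (.lit [])).val [K.str] =
      init.encode K j := by simp [encode, init, assoc, Str.unary]
  have h2 : ((Prog.base (.lit []) (.call A (cSec (.arg 0)))).tree [K.str]).run
      (Eff.handlerOracle (fun x => (handlerP P).tree [x]) O (Cell.priv 0)) (Cell.priv 0)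
      ((init.encode K j, w.1), w.2) = ((A.tree [K.sec]).run (Ledger.oracle (P.ops K) O (Cell.priv 0)) inner
        ((init, w.1), w.2)).map fun o => (o.1, (o.2.1.1.encode K j, o.2.1.2), o.2.2) := by
    rw [run_base (v := []), run_call_of_val (v := K.sec) (by simp) (by simp [Conf.str])]
    refine Eff.run_map_state (fun s : Ledger × σ => (s.1.encode K j, s.2)) ?_ _ (A.tree [K.sec])
      ((init, w.1), w.2)
    intro p m s ψ
    simp only [Eff.handlerOracle, Ledger.oracle, run_handlerP hJ, PMF.map_comp]
    refine congrFun (congrArg _ (funext fun x => ?_)) _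
    simp
  rw [play, run_letIn, tree, Eff.run_bind, Prog.Pure.run (by simp), PMF.pure_bind, h1, Eff.run_bind,
    Eff.run_handle, h2]
  simp only [PMF.map_comp, PMF.bind_map, PMF.bind_bind, Eff.run, PMF.pure_bind, Function.comp_def,
    hf.run]
  rfl

/-- The adversary makes at most polynomially many steps against every oracle, hence also against the
handler. It remains to bound each answer uniformly, which is `exists_handler_bound`. -/
theorem exists_play_bound {S : MoneyScheme} (hS : S.IsScheme) {P : Kit} (hP : P.Efficient)
    (hb : P.bank = bankP S) {A : Prog} (hA : A.QPTAdversary) {final : Prog}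
    (hf : PolyTime AnyOracle final) : ∃ t : Polynomial ℕ, ∀ {n X j : ℕ} {K : Conf} {σ : Type}
      {O : Oracle σ} {loc : Str → Cell} (_ : IsPlacement loc) (_ : K.sec = Str.unary n)
      (_ : K.J = Str.unary j) (_ : K.str.length ≤ X),
      Eff.Ensures O loc ((play A P final).tree [K.str]) fun _ d => d ≤ t.eval X := by
  obtain ⟨p, hp⟩ := qptAdversary_iff.1 hA
  obtain ⟨κ, hκ⟩ := exists_fits (Prog.base (.lit []) (.call A (cSec (.arg 0))))
  obtain ⟨r₀, r, t, ht⟩ := exists_handler_bound hS hP hb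
  obtain ⟨pc, hpc⟩ : PolyTime AnyOracle (cSec (.arg 0)) := Simple.polyTime (by simp)
  obtain ⟨pm, hpm⟩ := PolyTime.exists_bound (C := AnyOracle) (P := mkState (.arg 0) (.lit [])
    (.lit []) (.lit []) (.lit []) (.lit [])) (Simple.polyTime (by simp))
  obtain ⟨pf, hpf⟩ := hf
  let ca := 2 + (pc.comp (Polynomial.X + 1) + 1 + p)
  -- One number that bounds the steps of the simulated adversary, the length of the configuration
  -- and the ports in use; all bounds of the handler are taken at this value.
  let Z := ca + Polynomial.X + Polynomial.C κ
  let cs := 3 * pm.comp (Polynomial.X + 1) + 3 * Z + Z * (t.comp Z + 2) + t.comp Z + 1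
  refine ⟨3 * cs + 1 + 1 + pf.comp (6 * cs + Polynomial.X + 10), ?_⟩
  intro n X j K σ O loc hl hK hJ hX
  have hn : n ≤ X := by
    have : K.sec.length ≤ K.str.length := by simp only [Conf.str, Str.length_pair]; omega
    rw [hK, Str.length_unary] at this
    omega
  have hsz : envSize [K.str] ≤ X + 1 := by simp [envSize]; omega
  set Y := Z.eval X with hY
  have hY' : Y = ca.eval X + X + κ := by simp [hY, Z]
  have htree : ∀ (σ : Type) (O : Oracle σ),
      Eff.Ensures O loc ((Prog.base (.lit []) (.call A (cSec (.arg 0)))).tree [K.str])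
        fun _ d => d ≤ Y := by
    intro σ O
    have hl' := isPlacement_pair hl []
    have hc := ensures_call (p := cSec (.arg 0)) (by simp) (B := fun _ => True)
      (hpc σ O trivial _ hl' [K.str])
      (by
        have : (cSec (.arg 0)).val [K.str] = Str.unary n := by simp [Conf.str, hK]
        rw [this]
        exact (hp n _ hl' σ O).mono fun _ _ h => ⟨trivial, h⟩)
    have hq : Eff.Ensures O loc ((Prog.lit []).tree [K.str]) fun v d => v = [] ∧ d = 1 :=
      Eff.ensures_tick (Eff.ensures_ret ⟨rfl, rfl⟩)
    refine hq.bind fun v d hv => ?_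
    obtain ⟨rfl, rfl⟩ := hv
    refine Eff.ensures_tick (Eff.ensures_relocate (hc.mono fun _ d hd => ?_))
    have h1 := pc.eval_mono_nat hsz
    have h2 := p.eval_mono_nat hn
    simp [ca] at hY'
    simp only [List.length_nil]
    omega
  have hI : Eff.Ensures O loc ((Prog.simulate (.base (.lit []) (.call A (cSec (.arg 0))))
      (handlerP P) (mkState (.arg 0) (.lit []) (.lit []) (.lit []) (.lit []) (.lit []))).tree
      [K.str]) fun _ d => d ≤ cs.eval X := by
    refine ((hpm σ O trivial loc hl [K.str]).and (Prog.Pure.ensures (by simp) O loc [K.str])).bind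
      fun v d hv => ?_
    obtain ⟨⟨hd, hv⟩, rfl⟩ := hv
    have h1 : (mkState (.arg 0) (.lit []) (.lit []) (.lit []) (.lit []) (.lit [])).val [K.str] =
        init.encode K j := by simp [encode, init, assoc, Str.unary]
    rw [h1] at hv
    rw [h1]
    have htree' := fun σ O => (htree σ O).and (ensures_length _ O loc _)
    have hκ' := hκ True (Or.inl trivial) [K.str]
    clear htree
    revert htree' hκ'
    generalize (Prog.base (.lit []) (.call A (cSec (.arg 0)))).tree [K.str] = T
    intro htree hκ
    intro s ψ c o ho
    obtain ⟨H, hH⟩ : ∃ H : Str → Comp σ Str, ∀ x w,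
        (H x).run w = ((handlerP P).tree [x]).interp O loc w :=
      ⟨fun x => (handlerP P).eval O loc [x], fun x w => eval_run _ O loc [x] w⟩
    obtain ⟨d', hd', -⟩ := Eff.ensures_true _ _ _ _ _ ho
    rw [Eff.interp_bind, show c = 0 + c from (Nat.zero_add _).symm,
      Eff.interp_handle O loc _ H hH, PMF.mem_support_bind_iff] at ho
    obtain ⟨o₁, ho₁, ho⟩ := ho
    rw [PMF.mem_support_map_iff] at ho₁
    obtain ⟨o₂, ho₂, rfl⟩ := ho₁
    obtain ⟨e, he, hde, hle⟩ := htree _ _ _ _ _ _ ho₂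
    rw [Nat.zero_add] at he
    -- After `e` steps of the simulated adversary the ledger is small with both parameters `e`, and
    -- the handler has spent at most `t + 2` for each of these steps. The condition `e ≤ Y` keeps
    -- the length bounds fixed during the whole execution.
    have hI := Eff.interp_invariant (K := κ) (I := fun e (s : Str × σ × ℕ) => e ≤ Y →
        (∃ a : Ledger, s.1 = a.encode K j ∧ a.Small S n loc K.Fw (r₀.eval Y) (r.eval Y) e e) ∧
        s.1.length ≤ 2 * pm.eval (envSize [K.str]) + t.eval Y ∧
        s.2.2 ≤ c + e * (t.eval Y + 2)) (O := Oracle.ofHandler H)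
      (fun e e' s he h he' => by
        obtain ⟨⟨a, h1, h2⟩, h3, h4⟩ := h (he.trans he')
        exact ⟨⟨a, h1, h2.mono he he⟩, h3, h4.trans (by gcongr)⟩)
      (fun e s p m ψ hp h o ho he => by
        obtain ⟨⟨a, h1, h2⟩, h3, h4⟩ := h (by omega)
        obtain ⟨s, so, hc⟩ := s
        change s = _ at h1
        subst h1
        simp only [Oracle.ofHandler] at ho
        erw [PMF.mem_support_bind_iff] at ho
        obtain ⟨v, hv, ho⟩ := ho
        rw [hH] at hv
        erw [PMF.mem_support_pure_iff] at ho
        subst ho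
        obtain ⟨d', h5, ⟨a', h6, h7⟩, h8⟩ := ht hl hK hJ (hX.trans (by omega)) he (by omega) h2
          _ _ _ _ hv
        have := Str.length_fst_add_snd v.1
        refine ⟨⟨a', h6, h7.mono le_rfl (by omega)⟩, ?_, ?_⟩
        · change v.1.fst.length ≤ _
          omega
        · change v.2.cost + 1 + v.1.length ≤ _
          rw [h5]
          simp only [Eff.handlerInput] at h8 ⊢
          change hc ≤ _ at h4
          have : (e + 1) * (t.eval Y + 2) ≤ (e + 1 + m.length) * (t.eval Y + 2) :=
            Nat.mul_le_mul_right _ (by omega)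
          rw [Nat.succ_mul] at this
          omega)
      hκ _ (fun _ => ⟨⟨init, rfl, small_init⟩, by dsimp only; omega, by simp⟩) o₂ ho₂ (by omega)
    obtain ⟨-, h2, h3⟩ := hI
    rw [Eff.interp, Eff.interp, PMF.mem_support_pure_iff] at ho
    subst ho
    have h4 := pm.eval_mono_nat hsz
    have h5 : o₂.2.cost * (t.eval Y + 2) ≤ Y * (t.eval Y + 2) := by gcongr; omega
    refine ⟨d', hd', ?_⟩
    simp [cs, ← hY] at h2 h3 hd' ⊢
    omega
  exact (ensures_letIn (A := fun _ => True) (B := fun _ => True) (hI.mono fun _ _ h => ⟨trivial, h⟩)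
    fun v _ hv => (hpf σ O trivial loc hl _).mono fun _ d hd => ⟨trivial, hd.trans
      (pf.eval_mono_nat (show _ ≤ (6 * cs + Polynomial.X + 10).eval X by
        simp [envSize] at hv ⊢; omega))⟩).mono fun _ d hd => by
    have := hd.2
    simp only [eval_add, eval_mul, eval_comp, eval_one, eval_ofNat] at this ⊢
    omega

end Kit

end


noncomputable section

open Prog

/-! ## Reductions -/

namespace Prog

def unaryProg (p : Polynomial ℕ) : Prog := (exists_unary p).choose

theorem pure_unaryProg (p : Polynomial ℕ) : (unaryProg p).Pure := (exists_unary p).choose_spec.1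

theorem polyTime_unaryProg (p : Polynomial ℕ) : PolyTime AnyOracle (unaryProg p) :=
  (exists_unary p).choose_spec.2.1

theorem val_unaryProg (p : Polynomial ℕ) (n : ℕ) :
    (unaryProg p).val [Str.unary n] = Str.unary (p.eval n) := (exists_unary p).choose_spec.2.2 n

theorem PolyTime.mono {C C' : ∀ σ : Type, Oracle σ → Prop} {P : Prog} (h : PolyTime C P)
    (hC : ∀ σ O, C' σ O → C σ O) : PolyTime C' P :=
  let ⟨p, hp⟩ := h
  ⟨p, fun σ O hO => hp σ O (hC σ O hO)⟩

end Prog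

/-- A reduction runs the adversary `A` against the ledger. It guesses the special run, and the length
of its key; `km` and `ke` generate the keys. -/
structure Reduction where
  A : Prog
  kit : Kit
  final : Prog
  T : Polynomial ℕ
  s : Polynomial ℕ
  l : Polynomial ℕ
  g : Prog
  Fw : Prog
  km : Prog
  ke : Prog

namespace Reduction

open Ledger

variable (R : Reduction)

def setup : Prog := .letIn (sandbox guess (.call (unaryProg R.s) (.arg 0)))
    (.pair (.arg 1) (.pair (.call (unaryProg R.T) (.arg 1)) (.pair (.arg 0) (.pair R.g
      (.pair R.Fw (.pair (sandbox R.km (.arg 1)) (.pair (sandbox R.ke (.arg 1))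
        (sandbox guess (.call (unaryProg R.l) (.arg 1))))))))))

def prog : Prog := .call (Kit.play R.A R.kit R.final) R.setup

def conf (n : ℕ) (J m e L : Str) : Conf :=
  ⟨Str.unary n, Str.unary (R.T.eval n), J, R.g.val [J, Str.unary n], R.Fw.val [J, Str.unary n],
    m, e, L⟩

/-- The programs of the reduction are of the admissible kinds. -/
structure Valid : Prop where
  efficient : R.kit.Efficient
  final : R.final.Simple
  g : R.g.Simple
  Fw : R.Fw.Simple
  km : R.km.PPT
  ke : R.ke.PPT

variable {R} {S : MoneyScheme} {n : ℕ} {σ : Type} {O : Oracle σ}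

theorem Valid.run_setup (h : R.Valid) (loc : Str → Cell) (w : σ × QState) :
    (R.setup.tree [Str.unary n]).run O loc w =
      (guess.run (Str.unary (R.s.eval n))).bind fun J => (R.km.run (Str.unary n)).bind fun m =>
        (R.ke.run (Str.unary n)).bind fun e => (guess.run (Str.unary (R.l.eval n))).map fun L =>
          ((R.conf n J m e L).str, w) := by
  have hs : ∀ p : Polynomial ℕ, (unaryProg p).Pure := pure_unaryProg
  rw [setup, run_letIn, run_sandbox_classical guess_ppt.1 (p := .call (unaryProg R.s) (.arg 0)) ⟨hs _, trivial⟩,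
    PMF.bind_map]
  simp only [val, List.getD_cons_zero, val_unaryProg]
  refine congrArg _ (funext fun J => ?_)
  have hT : ((Prog.call (unaryProg R.T) (.arg 1)).tree [J, Str.unary n]).run O loc w =
      PMF.pure (Str.unary (R.T.eval n), w) := run_of_val (by exact ⟨hs _, trivial⟩) (by
        simp [val_unaryProg])
  simp only [Function.comp_apply, run_pair, hT, h.g.pure.run, h.Fw.pure.run,
    run_sandbox_classical h.km.1 (p := .arg 1) trivial,
    run_sandbox_classical h.ke.1 (p := .arg 1) trivial,
    run_sandbox_classical guess_ppt.1 (p := .call (unaryProg R.l) (.arg 1)) ⟨hs _, trivial⟩,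
    Prog.Pure.run (P := .arg _) trivial, PMF.pure_bind, PMF.bind_map, PMF.bind_bind]
  simp [Function.comp_def, conf, Conf.str, val, val_unaryProg, PMF.map]

theorem Valid.ev_run (h : R.Valid) (w : σ × QState) (F : Str × σ × QState → ℝ≥0∞) :
    ((R.prog.tree [Str.unary n]).run O (Cell.priv 0) w).ev F =
      (guess.run (Str.unary (R.s.eval n))).ev fun J => (R.km.run (Str.unary n)).ev fun m =>
        (R.ke.run (Str.unary n)).ev fun e => (guess.run (Str.unary (R.l.eval n))).ev fun L =>
          ((R.A.tree [Str.unary n]).run (Ledger.oracle (R.kit.ops (R.conf n J m e L)) O (Cell.priv 0)) inner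
            ((init, w.1), w.2)).ev fun o => F (R.final.val
              [Str.pair o.1 (o.2.1.1.encode (R.conf n J m e L) J.length), (R.conf n J m e L).str],
              o.2.1.2, o.2.2) := by
  rw [prog, tree, Eff.run_bind, h.run_setup]
  simp only [PMF.ev_bind, PMF.ev_map, Eff.run]
  refine PMF.ev_congr fun J hJ => ?_
  obtain ⟨j, rfl⟩ := exists_of_mem_guess hJ
  refine PMF.ev_congr fun m _ => PMF.ev_congr fun e _ => PMF.ev_congr fun L _ => ?_
  rw [Kit.run_play (j := j) _ _ h.final.pure rfl, PMF.ev_map, Str.length_unary]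
  rfl

/-- The setup produces a configuration of polynomial length, in which the guessed run is a unary
string as `exists_play_bound` requires. -/
theorem Valid.qptAdversary (h : R.Valid) (hS : S.IsScheme) (hb : R.kit.bank = Kit.bankP S)
    (hA : R.A.QPTAdversary) : R.prog.QPTAdversary := by
  obtain ⟨t, ht⟩ := Kit.exists_play_bound hS h.efficient hb hA (h.final.polyTime (C := AnyOracle))
  have hu : ∀ (p : Polynomial ℕ) i, PolyTime AnyOracle (Prog.call (unaryProg p) (.arg i)) :=
    fun p i => (polyTime_unaryProg p).call (polyTime_arg i)
  have hg : ∀ (p : Polynomial ℕ) i, PolyTime AnyOracle (sandbox guess (.call (unaryProg p) (.arg i))) :=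
    fun p i => guess_ppt.polyTime_sandbox ⟨pure_unaryProg p, trivial⟩
      ((hu p i).mono fun _ _ _ => trivial)
  obtain ⟨q, hq⟩ : PolyTime AnyOracle R.setup := (hg _ _).letIn (.pair (polyTime_arg _) (.pair (hu _ _)
    (.pair (polyTime_arg _) (.pair h.g.polyTime (.pair h.Fw.polyTime (.pair
      (h.km.polyTime_sandbox trivial (polyTime_arg _)) (.pair
        (h.ke.polyTime_sandbox trivial (polyTime_arg _)) (hg _ _))))))))
  refine qptAdversary_iff.2 ⟨q.comp (Polynomial.X + 1) + 1 + t.comp (2 * q.comp (Polynomial.X + 1)),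
    fun n loc hl σ O => ?_⟩
  have h1 : Eff.Ensures O loc (R.setup.tree [Str.unary n]) fun v _ =>
      ∃ j m e L, v = (R.conf n (Str.unary j) m e L).str := by
    refine Eff.ensures_of_run fun s ψ o ho => ?_
    rw [h.run_setup] at ho
    simp only [PMF.mem_support_bind_iff, PMF.mem_support_map_iff] at ho
    obtain ⟨J, hJ, m, -, e, -, L, -, rfl⟩ := ho
    obtain ⟨j, rfl⟩ := exists_of_mem_guess hJ
    exact ⟨j, m, e, L, rfl⟩
  refine ((h1.and (ensures_length _ O loc _)).and (hq σ O trivial loc hl _)).bind fun v d hv => ?_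
  obtain ⟨⟨⟨j, m, e, L, rfl⟩, hv⟩, hd⟩ := hv
  have he : envSize [Str.unary n] = n + 1 := by simp [envSize, Str.length_unary]
  rw [he] at hd
  refine Eff.ensures_tick ((ht hl rfl rfl (hv.trans (Nat.mul_le_mul_left 2 hd))).mono fun _ e he => ?_)
  simp
  omega

end Reduction

end


noncomputable section

open Prog

/-! ## Choosing the key of the special run at the beginning -/

namespace Ledger

variable {S : MoneyScheme} {M : MACScheme} {E : EncScheme} {n : ℕ} {km ke : Str} {j : ℕ} {b : Bool}
  {σ : Type}

/-- The next query makes the bank choose the key of the run `j`. -/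
def Mints (j : ℕ) (a : Ledger) (p : ℕ) (m : Str) : Prop :=
  a.dead = [] ∧ p = 2 ∧ m.fst.length = j ∧ ∃ r, a.look j = some r ∧ r.party.out = none ∧
    r.started = false ∧ r.ver = false

def Started (j : ℕ) (a : Ledger) : Prop := ∃ r, a.look j = some r ∧ r.started = true

theorem step_fits (o : Ops) (O : Oracle σ) (loc : Str → Cell) (a : Ledger) (p : ℕ) (m : Str)
    (s : σ) (ψ : QState) (ha : a.Fits) : ∀ x ∈ ((step o a p m).run O loc (s, ψ)).support,
      x.1.2.Fits ∧ (Started j a → Started j x.1.2) := by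
  refine step_invariant o O loc (J := fun b => b.Fits ∧ (Started j a → Started j b))
    (fun b v h => ⟨h.1.push v, fun hs => ?_⟩) (fun b i r r₀ hr hs h => ⟨h.1.set hr r, fun ha => ?_⟩)
    (fun _ _ h => h) (fun _ _ h => h) (fun _ _ h => h) (fun _ _ h => h) a p m ⟨ha, id⟩ s ψ
  · obtain ⟨r, hr, h'⟩ := h.2 hs
    exact ⟨r, h.1.look_push v hr, h'⟩
  · exact exists_look_set hr hs (h.2 ha)

theorem step_gameOps_congr {a : Ledger} {p : ℕ} {m : Str} (h : ¬ Mints j a p m) (k : Str) :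
    step (gameOps S M E n km ke j b (some k)) a p m =
      step (gameOps S M E n km ke j b none) a p m := by
  have : prep (gameOps S M E n km ke j b (some k)) a p m =
      prep (gameOps S M E n km ke j b none) a p m := by
    unfold prep
    split_ifs with hd
    · unfold live
      split
      · rfl
      · rfl
      · unfold message
        split
        · rfl
        · rename_i r hr
          split_ifs with ho hs hv
          · rfl
          · rfl
          · rfl
          · have hij : m.fst.length ≠ j := fun hij => h ⟨hd, rfl, hij, r, hij ▸ hr, by simpa using ho,
              by simpa using hs, by simpa using hv⟩
            simp only [mintStart, gameOps, hij, false_and, if_false]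
      · rfl
    · rfl
  rw [step, this]
  rfl

/-- At the query that starts run `j` in `mint`, drawing the key at that moment or having it drawn
before makes no difference, and afterwards the run counts as started. -/
theorem run_step_of_mints (hS : S.keygen.Classical) (hE : E.encrypt.Classical)
    (hM : M.mac.Classical) {a : Ledger} {p : ℕ} {m : Str} (h : Mints j a p m) (ψ : QState) :
    (step (gameOps S M E n km ke j b none) a p m).run noOracle spread ((), ψ) =
      ((S.keygen.run (Str.unary n)).bind fun k =>
        (step (gameOps S M E n km ke j b (some k)) a p m).run noOracle spread ((), ψ)) ∧
    ∀ k, ∀ x ∈ ((step (gameOps S M E n km ke j b (some k)) a p m).run noOracle spread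
      ((), ψ)).support, Started j x.1.2 := by
  obtain ⟨hd, rfl, rfl, r, hr, ho, hs, hv⟩ := h
  have hp : ∀ o : Ops, prep o a 2 m = mintStart o (a.spend m) m.fst.length r m.snd := fun o => by
    simp only [prep, if_pos hd, live, message, look_spend, hr, ho, hs, hv, Option.isSome_none,
      Bool.false_eq_true, if_false]
  simp only [run_step, hp, run_mintStart hS hE hM, PMF.bind_bind]
  refine ⟨?_, fun k x hx => ?_⟩
  · simp only [keyDist, Option.isSome_none, Bool.false_eq_true, and_false, if_false,
      Option.isSome_some, and_self, if_true, Option.getD_some, PMF.pure_bind]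
    rfl
  · simp only [PMF.mem_support_bind_iff, PMF.mem_support_map_iff, finish] at hx
    obtain ⟨_, -, _, -, _, ⟨_, -, rfl⟩, hx⟩ := hx
    simp only [minted, run_bankStep, PMF.mem_support_map_iff] at hx
    obtain ⟨v, -, rfl⟩ := hx
    exact ⟨_, by rw [bankDone]; exact (look_set _ _ _ _).trans (if_pos rfl), rfl⟩

/-- The game with the key of the run `j` in the state of the oracle. -/
def eagerOracle (S : MoneyScheme) (M : MACScheme) (E : EncScheme) (n : ℕ) (km ke : Str) (j : ℕ)
    (b : Bool) : Oracle (Str × Ledger × Unit) := fun p m s ψ =>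
  (oracle (gameOps S M E n km ke j b (some s.1)) noOracle spread p m s.2 ψ).map fun o =>
    (o.1, (s.1, o.2.1), o.2.2)

/-- Here the right side of the simulation is a proper distribution: the key of run `j` is already
drawn but has not influenced anything. As long as run `j` has not started, this key has the
distribution of `keygen`; afterwards it is never looked at again, so any distribution `D` is
allowed. -/
theorem eager_sim (hS : S.keygen.Classical) (hE : E.encrypt.Classical) (hM : M.mac.Classical) :
    Eff.Sim (fun w ν => w.1.1.Fits ∧ ∃ D : PMF Str, ν = D.map (fun k => ((k, w.1), w.2)) ∧
        (D = S.keygen.run (Str.unary n) ∨ Started j w.1.1)) (fun _ => ⊤) (fun _ => 0)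
      (oracle (gameOps S M E n km ke j b none) noOracle spread) (Cell.priv 0)
      (eagerOracle S M E n km ke j b) (Cell.priv 0) := by
  refine ⟨?_, ?_, ?_, fun _ _ _ _ _ _ => le_rfl, fun _ _ _ _ _ _ => le_rfl⟩
  · rintro g w _ ⟨h, D, rfl, hD⟩
    exact ⟨h, D, PMF.map_comp _ _ _, hD⟩
  · rintro s c w _ ⟨h, D, rfl, hD⟩ f g hfg
    rw [PMF.ev_map]
    dsimp only
    -- The measurement does not depend on the key that has been drawn, so the two draws commute.
    rw [PMF.ev_comm]
    refine PMF.ev_mono fun x _ => (hfg.rel x.1 (w.1, x.2) _ ⟨h, D, rfl, hD⟩).trans ?_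
    rw [PMF.ev_map]
  · rintro p m ⟨⟨a, ⟨⟩⟩, ψ⟩ _ ⟨h, D, rfl, hD⟩ f g hfg
    simp only [PMF.ev_map, eagerOracle, oracle]
    dsimp only at h hD
    by_cases hm : Mints j a p m
    -- Run `j` has not started, so the key on the right still has the distribution from which the
    -- left side draws now. Both use the same key `k`, and the right distribution becomes
    -- concentrated at it.
    · have hD' := hD.resolve_right fun ⟨r, hr, hs⟩ => by
        obtain ⟨-, -, -, r', hr', -, hs', -⟩ := hm
        rw [hr] at hr'
        rw [Option.some.inj hr', hs'] at hs
        cases hs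
      obtain ⟨h1, h2⟩ := run_step_of_mints (S := S) (M := M) (E := E) (n := n) (km := km) (ke := ke)
        (b := b) hS hE hM hm ψ
      rw [h1, PMF.ev_bind, hD']
      refine PMF.ev_mono fun k _ => PMF.ev_mono fun x hx => ?_
      refine (hfg.rel x.1.1 ((x.1.2, x.2.1), x.2.2) (PMF.pure ((k, x.1.2, x.2.1), x.2.2))
        ⟨(step_fits (j := j) _ _ _ _ _ _ _ _ h x hx).1, PMF.pure k, by rw [PMF.pure_map],
          Or.inr (h2 k x hx)⟩).trans ?_
      rw [PMF.ev_pure]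
    · simp only [step_gameOps_congr hm]
      rw [PMF.ev_comm]
      refine PMF.ev_mono fun x hx => ?_
      have h2 := step_fits (j := j) _ _ _ _ _ _ _ _ h x hx
      refine (hfg.rel x.1.1 ((x.1.2, x.2.1), x.2.2) _ ⟨h2.1, D, rfl, hD.imp_right h2.2⟩).trans ?_
      rw [PMF.ev_map]

/-- The expectation of a function of the final ledger in the game against `A`. -/
def gameEv (S : MoneyScheme) (M : MACScheme) (E : EncScheme) (A : Prog) (n : ℕ) (km ke : Str) (j : ℕ)
    (b : Bool) (kst : Option Str) (f : Ledger → ℝ≥0∞) : ℝ≥0∞ :=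
  ((A.tree [Str.unary n]).run (oracle (gameOps S M E n km ke j b kst) noOracle spread) (Cell.priv 0)
    ((init, ()), QState.zero)).ev fun o => f o.2.1.1

/-- In the game of the mini-scheme the key exists from the beginning, whereas the ledger chooses the
key of run `j` on demand; this lemma moves the choice to the beginning. -/
theorem gameEv_none_le (hS : S.keygen.Classical) (hE : E.encrypt.Classical) (hM : M.mac.Classical)
    (A : Prog) (f : Ledger → ℝ≥0∞) : gameEv S M E A n km ke j b none f ≤
      (S.keygen.run (Str.unary n)).ev fun k => gameEv S M E A n km ke j b (some k) f := by
  refine ((eager_sim (j := j) (b := b) (km := km) (ke := ke) hS hE hM).ev_run_le (A.tree [Str.unary n])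
    (w := ((init, ()), QState.zero)) ⟨fits_init, _, rfl, Or.inl rfl⟩ (f := fun _ w => f w.1.1)
    (g := fun _ w => f w.1.2.1) ⟨?_, fun _ _ => le_top, fun _ _ => zero_le⟩).trans (le_of_eq ?_)
  · rintro _ w _ ⟨h, D, rfl, -⟩
    rw [PMF.ev_map]
    exact (PMF.ev_const D _).ge
  · rw [PMF.ev_map]
    refine PMF.ev_congr fun k _ => ?_
    have := Eff.run_map_state (fun s : Ledger × Unit => (k, s))
      (O := oracle (gameOps S M E n km ke j b (some k)) noOracle spread)
      (O' := eagerOracle S M E n km ke j b) (fun p m s ψ => rfl) (Cell.priv 0)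
      (A.tree [Str.unary n]) ((init, ()), QState.zero)
    rw [this, PMF.ev_map]
    rfl

end Ledger

end


noncomputable section

open Prog

/-! ## The probabilities in the games and in the reductions -/

theorem Prog.ev_runWith {σ : Type} (A : Prog) (n : ℕ) (O : Oracle σ) (s : σ)
    (F : Str × σ → ℝ≥0∞) : (A.runWith n O s).ev F =
      ((A.tree [Str.unary n]).run O (Cell.priv 0) (s, QState.zero)).ev fun o => F (o.1, o.2.1) := by
  have h : A.runWith n O s =
      PMF.map (fun o => (o.1, o.2.ora)) ((A.tree [Str.unary n]).interp O (Cell.priv 0) ⟨s, QState.zero, 0⟩) := by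
    rw [← eval_run]; rfl
  have h2 := Eff.run_eq_map_interp O (Cell.priv 0) (A.tree [Str.unary n]) ⟨s, QState.zero, 0⟩
  rw [h, PMF.ev_map, h2, PMF.ev_map]

/-- The numbers are drawn below a power of two of at most `2s + 1`, so the value at one number is at
most this factor times the average. -/
theorem Prog.mul_le_guess {s j : ℕ} (hj : j ≤ s) (F : Str → ℝ≥0∞) :
    F (Str.unary j) ≤ (2 * s + 1 : ℕ) * (guess.run (Str.unary s)).ev F := by
  obtain ⟨e, h1, h2, h3⟩ : ∃ e, s < 2 ^ e ∧ (e = 0 ∨ 2 ^ (e - 1) ≤ s) ∧ 2 ^ e ≤ 2 * s + 1 := by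
    rcases Nat.eq_zero_or_pos s with rfl | hs
    · exact ⟨0, by simp⟩
    · have := Nat.pow_log_le_self 2 hs.ne'
      exact ⟨Nat.log 2 s + 1, Nat.lt_pow_succ_log_self one_lt_two s, Or.inr this, by
        rw [pow_succ]; omega⟩
  calc F (Str.unary j) = (2 : ℝ≥0∞) ^ e * (2⁻¹ ^ e * F (Str.unary j)) := by
        rw [← mul_assoc, ← mul_pow, ENNReal.mul_inv_cancel (by simp) (by simp), one_pow, one_mul]
    _ ≤ (2 * s + 1 : ℕ) * _ := mul_le_mul' (by exact_mod_cast h3) (le_guess h1 h2 (hj.trans_lt h1) F)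

namespace Ledger

variable {S : MoneyScheme} {M : MACScheme} {E : EncScheme} {n : ℕ} {km ke : Str} {j : ℕ} {b : Bool}
  {kst : Option Str} {A : Prog} {B : ℕ}

/-- A bound for the number of steps of an adversary. -/
def StepsLE (A : Prog) (n B : ℕ) : Prop := ∀ (σ : Type) (O : Oracle σ) (s : σ) (ψ : QState),
  ∀ o ∈ ((A.eval O (Cell.priv 0) [Str.unary n]).run ⟨s, ψ, 0⟩).support, o.2.cost ≤ B

/-- The steps of the adversary bound the total length of its queries, so only ledgers within the
budget `B` matter. -/
theorem gameEv_mono (hA : StepsLE A n B) {f f' : Ledger → ℝ≥0∞}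
    (h : ∀ a, a.fuel ≤ B → f a ≤ f' a) :
    gameEv S M E A n km ke j b kst f ≤ gameEv S M E A n km ke j b kst f' := by
  set O := oracle (gameOps S M E n km ke j b kst) noOracle spread with hO
  have e := Eff.run_eq_map_interp O (Cell.priv 0) (A.tree [Str.unary n])
    ⟨(init, ()), QState.zero, 0⟩
  obtain ⟨K, hK⟩ := exists_fits A
  rw [gameEv, gameEv, e, PMF.ev_map, PMF.ev_map]
  refine PMF.ev_mono fun o ho => h _ ?_
  have h1 := Eff.interp_invariant (O := O) (loc := Cell.priv 0) (I := fun c s => s.1.fuel ≤ c) (K := K)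
    (fun c c' s hc h => h.trans hc) (fun c s p m ψ _ h o ho => by
      rw [hO, oracle, PMF.mem_support_map_iff] at ho
      obtain ⟨x, hx, rfl⟩ := ho
      have := step_fuel _ _ _ _ _ _ _ _ x hx
      dsimp only
      omega) (hK True (Or.inl trivial) [Str.unary n]) ⟨(init, ()), QState.zero, 0⟩ le_rfl o ho
  exact h1.trans (hA _ O _ _ o (by rw [eval_run]; exact ho))

theorem gameEv_add (f f' : Ledger → ℝ≥0∞) : (gameEv S M E A n km ke j b kst fun a => f a + f' a) =
    gameEv S M E A n km ke j b kst f + gameEv S M E A n km ke j b kst f' := PMF.ev_add _ _ _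

theorem gameOps_true_none (j j' : ℕ) :
    gameOps S M E n km ke j true none = gameOps S M E n km ke j' true none := by
  simp [gameOps]

/-- If nothing is replaced and no key is prescribed, the special run plays no role. So one ledger
game can be regarded as the game for each `j` in a sum over `j`. -/
theorem gameEv_true_none (j j' : ℕ) (f : Ledger → ℝ≥0∞) :
    gameEv S M E A n km ke j true none f = gameEv S M E A n km ke j' true none f := by
  rw [gameEv, gameOps_true_none j j']; rfl

/-- The owner `j` has two accepted banknotes. -/
def Twice (j : ℕ) (a : Ledger) : ℝ≥0∞ := if decide (2 ≤ a.wins.count j) then 1 else 0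

open Classical in
def badFun (g : ℕ) (a : Ledger) : ℝ≥0∞ := if a.Bad g then 1 else 0

-- A union bound. Run numbers of bad verifications and of owners are below `fuel`, hence below the
-- number `B` of steps of the adversary.
open Classical in
theorem full_le (hS : S.keygen.PPT) (hM : M.IsScheme) (hE : E.IsScheme) (hA : StepsLE A n B)
    (hke : ke ∈ (E.keygen.run (Str.unary n)).support) :
    (A.runWith n ((fullScheme S M E).bankOracle n (Str.pair km ke)) []).ev (fun o =>
        if o.2.countP (fun s => !s.isVerify) < o.2.countP success then 1 else 0) ≤
      ∑ j ∈ Finset.range B, (gameEv S M E A n km ke j true none (badFun j) +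
        gameEv S M E A n km ke j true none (Twice j)) := by
  have h := (full_sim hS hM hE hke 0 (km := km)).ev_run_le (A.tree [Str.unary n])
    (w := ([], QState.zero)) ⟨init, rfl, fullRel_init⟩
    (f := fun _ w => if w.1.countP (fun s => !s.isVerify) < w.1.countP success then 1 else 0)
    (g := fun _ w => if SomeBad w.1.1 ∨ ∃ j < w.1.1.fuel, 2 ≤ w.1.1.wins.count j then 1 else 0)
    ⟨?_, ?_, ?_⟩
  · rw [ev_runWith]
    refine h.trans ?_
    rw [PMF.ev_pure]
    refine (gameEv_mono (b := true) (kst := none) (j := 0) hA (f := fun a => if SomeBad a ∨ ∃ j < a.fuel,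
      2 ≤ a.wins.count j then 1 else 0)
      (f' := fun a => ∑ j ∈ Finset.range B, (badFun j a + Twice j a)) fun a ha => ?_).trans ?_
    · split_ifs with hc
      · rcases hc with ⟨i, hi, hc⟩ | ⟨i, hi, hc⟩ <;>
        refine le_trans ?_ (Finset.single_le_sum (f := fun j => badFun j a + Twice j a)
          (fun _ _ => zero_le) (Finset.mem_range.2 (hi.trans_le ha)))
        · simp [badFun, hc]
        · simp [Twice, hc]
      · exact zero_le
    · rw [gameEv, PMF.ev_sum]
      refine Finset.sum_le_sum fun j _ => le_of_eq ?_
      rw [gameEv_true_none j 0, gameEv_true_none j 0 (Twice j), ← gameEv_add]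
      rfl
  · rintro _ w _ ⟨a, rfl, h⟩
    rw [PMF.ev_pure]
    split_ifs with h1 h2
    · exact le_rfl
    · exact absurd (Or.inr (h.exists_count h1)) h2
    · exact zero_le
    · exact zero_le
  · intro _ w
    split_ifs
    · exact le_rfl
    · exact zero_le
  · intro _ w
    split_ifs with h1 h2 h2
    · exact le_rfl
    · exact absurd (Or.inl h1) h2
    · exact zero_le
    · exact le_rfl

variable {σ' : Type} {F : Bool} {o : Ops} {O : Oracle σ'} {Out : ℕ → Ledger → σ' → Prop}
  {U : Ledger → ℝ≥0∞} {V : Ledger × σ' → ℝ≥0∞} {s₀ : σ'}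

/-- At the beginning all qubits are zero, so the state is its own image under every renaming and the
simulation can start. -/
theorem Link.gameEv_le (L : Link S M E n km ke j b kst F o O B Out U V) (hS : S.keygen.Classical)
    (hE : E.encrypt.Classical) (hM : M.mac.Classical) (hM' : M.verify.Classical) (h0 : Out 0 init s₀)
    {f : Ledger → ℝ≥0∞} {g : Ledger × σ' → ℝ≥0∞} (hf : ∀ a, f a ≤ U a) (hg : ∀ s, V s ≤ g s)
    (hfg : ∀ a s, Out a.fuel a s → a.dead = [] → f a ≤ g (a.hide F j, s)) :
    gameEv S M E A n km ke j b kst f ≤ ((A.tree [Str.unary n]).run (oracle o O (Cell.priv 0)) inner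
      ((init, s₀), QState.zero)).ev fun x => g x.2.1 := by
  refine ((L.sim hS hE hM hM').ev_run_le (A.tree [Str.unary n]) (f := fun _ w => f w.1.1)
    (g := fun _ w => g w.1) (w := ((init, ()), QState.zero))
    ⟨s₀, QState.zero, rfl, fun ρ _ => (QState.rename_zero ρ).symm, h0, rfl⟩ ⟨?_, fun _ w => hf _,
      fun _ w => hg _⟩).trans (PMF.ev_pure _ _).le
  rintro _ w _ ⟨s, ψ, rfl, -, hO, hd⟩
  rw [PMF.ev_pure]
  exact hfg _ _ hO hd

end Ledger

end


noncomputable section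

open Prog

/-! ### The three reductions as polynomial-time adversaries and their success probabilities. -/

theorem Prog.PPT.exists_length {P : Prog} (h : P.PPT) (q : Polynomial ℕ) : ∃ p : Polynomial ℕ,
    ∀ n x, x.length ≤ q.eval n → ∀ y ∈ (P.run x).support, y.length ≤ p.eval n := by
  obtain ⟨p, hp⟩ := h.exists_bound
  refine ⟨2 * p.comp q, fun n x hx y hy => ?_⟩
  have e : P.run x = ((P.tree [x]).interp noOracle (Cell.priv 0) ⟨(), QState.zero, 0⟩).map Prod.fst := by
    rw [← eval_run]; rfl
  rw [e, PMF.mem_support_map_iff] at hy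
  obtain ⟨o, ho, rfl⟩ := hy
  obtain ⟨d, -, h1, h2⟩ := ((hp x (Cell.priv 0) ⟨fun a b h => (Cell.priv.inj h).2,
    fun a b h => by cases h⟩).and (ensures_length P _ _ _)) _ _ _ o ho
  have := p.eval_mono_nat hx
  simp
  omega

theorem Prog.ppt_lit (w : Str) : (Prog.lit w).PPT := ppt_of_polyTime trivial (polyTime_lit w)

theorem Prog.run_lit_nil (x : Str) : (Prog.lit []).run x = PMF.pure [] := by
  rw [run_eq_tree]
  simp [tree, Eff.run, PMF.pure_map]

namespace Ledger

variable {S : MoneyScheme} {M : MACScheme} {E : EncScheme} {n : ℕ} {km ke : Str} {j : ℕ} {b : Bool}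
  {kst : Option Str} {A : Prog}

/-- A bound for the lengths of keys, ciphertexts and tags. -/
theorem exists_lengths (hS : S.IsScheme) (hM : M.IsScheme) (hE : E.IsScheme) : ∃ T : Polynomial ℕ,
    ∀ n, 1 ≤ T.eval n ∧ ∀ k ∈ (S.keygen.run (Str.unary n)).support, k.length ≤ T.eval n ∧
      ∀ ke ∈ (E.keygen.run (Str.unary n)).support, ∀ x : Str, x.length ≤ k.length →
      ∀ c ∈ (E.encrypt.run (Str.pair ke x)).support, c.length ≤ T.eval n ∧
      ∀ km ∈ (M.keygen.run (Str.unary n)).support, ∀ t ∈ (M.mac.run (Str.pair km c)).support,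
        t.length ≤ T.eval n := by
  obtain ⟨pS, hpS⟩ := hS.keygen_ppt.exists_length Polynomial.X
  obtain ⟨pE, hpE⟩ := hE.keygen_ppt.exists_length Polynomial.X
  obtain ⟨pM, hpM⟩ := hM.keygen_ppt.exists_length Polynomial.X
  obtain ⟨pc, hpc⟩ := hE.encrypt_ppt.exists_length (2 * pE + 2 + pS)
  obtain ⟨pt, hpt⟩ := hM.mac_ppt.exists_length (2 * pM + 2 + pc)
  have hlen : ∀ n, (Str.unary n).length = n := Str.length_unary
  refine ⟨pS + pc + pt + 1, fun n => ⟨by simp, fun k hk => ?_⟩⟩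
  have h1 := hpS n _ (by simp [hlen]) k hk
  refine ⟨by simp; omega, fun ke hke x hx c hc => ?_⟩
  have h2 := hpc n (Str.pair ke x) (by
    have := hpE n _ (by simp [hlen]) ke hke
    simp [Str.length_pair]; omega) c hc
  refine ⟨by simp; omega, fun km hkm t ht => ?_⟩
  have h3 := hpt n (Str.pair km c) (by
    have := hpM n _ (by simp [hlen]) km hkm
    simp [Str.length_pair]; omega) t ht
  simp
  omega

theorem ev_forgeGame (F : Prog) (n : ℕ) : M.forgeGame F n true =
    (M.keygen.run (Str.unary n)).ev fun km => ((F.tree [Str.unary n]).run (M.cmaOracle km)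
      (Cell.priv 0) ([], QState.zero)).ev fun o =>
        (M.verify.run (Str.pair km (Str.pair o.1.fst o.1.snd))).ev fun r =>
          if Accepts r ∧ o.1.fst ∉ o.2.1 then 1 else 0 := by
  rw [PMF.apply_true_eq_ev, MACScheme.forgeGame]
  simp only [PMF.do_bind_eq, PMF.ev_bind, ev_runWith]
  refine PMF.ev_congr fun km _ => PMF.ev_congr fun o _ => PMF.ev_congr fun r _ => ?_
  exact (PMF.ev_pure _ _).trans (by simp)

/-- A forger whose success bounds the probability that a verification of an unknown ciphertext
succeeds. -/
theorem exists_forger (hS : S.IsScheme) (hM : M.IsScheme) (hE : E.IsScheme) (hA : A.QPTAdversary)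
    {B : Polynomial ℕ} (hB : ∀ n, StepsLE A n (B.eval n)) : ∃ F : Prog, F.QPTAdversary ∧
      ∀ n, ∀ g ≤ B.eval n, ((M.keygen.run (Str.unary n)).ev fun km => (E.keygen.run (Str.unary n)).ev
        fun ke => gameEv S M E A n km ke g true none (badFun g)) ≤
          (2 * B.eval n + 1 : ℕ) * M.forgeGame F n true := by
  obtain ⟨T, hT⟩ := exists_lengths hS hM hE
  let R : Reduction := ⟨A, Kit.forger S E, sDead (.snd (.arg 0)), T, B, 0, .arg 0, .lit [false],
    .lit [], E.keygen⟩
  have hR : R.Valid := ⟨Kit.efficient_forger hS.keygen_ppt hE.encrypt_ppt, by simp [R], trivial,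
    trivial, ppt_lit _, hE.keygen_ppt⟩
  refine ⟨R.prog, hR.qptAdversary hS rfl hA, fun n g hg => ?_⟩
  rw [ev_forgeGame, ← PMF.ev_mul_left]
  refine PMF.ev_mono fun km hkm => ?_
  rw [hR.ev_run]
  -- The reduction does not know in which run a forgery will occur; the guess `g` is right with
  -- probability at least `1 / (2B + 1)`.
  refine le_trans ?_ (mul_le_guess hg _)
  simp only [R, run_lit_nil, PMF.ev_pure]
  refine PMF.ev_mono fun ke hke => PMF.le_ev_of_le fun L hL => ?_
  have hlen : ∀ n, (Str.unary n).length = n := Str.length_unary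
  refine (gameEv_mono (hB n) (f' := fun a => if B.eval n < a.fuel then 0 else badFun g a)
    fun a ha => by rw [if_neg (by omega)]).trans ?_
  refine (Link.gameEv_le (link_forger (n := n) (km := km) (ke := ke) (j := g) (g := g)
    (K := R.conf n (Str.unary g) [] ke L) hS.keygen_ppt.1 hE.encrypt_ppt.1 rfl rfl rfl rfl ?_ ?_
    (B.eval n)) hS.keygen_ppt.1 hE.encrypt_ppt.1 hM.mac_ppt.1 hM.verify_ppt.1 (s₀ := [])
    ⟨fits_init, fun _ _ => by simp, rfl⟩ (g := fun s => (M.verify.run (Str.pair km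
      (Str.pair s.1.dead.fst s.1.dead.snd))).ev fun r => if Accepts r ∧ s.1.dead.fst ∉ s.2 then 1 else 0)
      (fun a => ?_) (fun s => ?_) fun a Q h hd => ?_).trans
    (le_of_eq (PMF.ev_congr fun o _ => ?_))
  · intro k hk c hc t ht
    simpa [R, Reduction.conf, hlen] using
      (((hT n).2 k hk).2 ke hke k le_rfl c hc).2 km hkm t ht
  · simpa [R, Reduction.conf, hlen] using (hT n).1
  · unfold forged badFun
    split_ifs with h1 h2
    · exact le_rfl
    · rw [h2]; simp
    · exact zero_le
  · unfold forgeProb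
    split_ifs
    · exact zero_le
    · exact le_rfl
  -- In related final states no result for run `g` is recorded, so the left side vanishes; the event
  -- itself is accounted for by the bounds `forged` and `forgeProb`.
  · have : ¬ a.Bad g := fun h' => by rw [Bad, h.2.2] at h'; cases h'
    simp [badFun, this]
  · simp [encode]

/-- Twice the success probability is the probability of output 1 in the one game plus the
probability of another output in the other game. This form avoids subtraction in `ℝ≥0∞`. -/
theorem ev_cpaGame (D : Prog) (n : ℕ) : 2 * E.cpaGame D n true =
    (E.keygen.run (Str.unary n)).ev fun ke =>
      (((D.tree [Str.unary n]).run (E.cpaOracle ke true) (Cell.priv 0) (false, QState.zero)).ev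
        fun o => if Accepts o.1 then 1 else 0) +
      ((D.tree [Str.unary n]).run (E.cpaOracle ke false) (Cell.priv 0) (false, QState.zero)).ev
        fun o => if Accepts o.1 then 0 else 1 := by
  have hu : ∀ f : Bool → ℝ≥0∞, 2 * (PMF.uniformOfFintype Bool).ev f = f true + f false := fun f => by
    rw [PMF.ev, tsum_bool, PMF.uniformOfFintype_apply, PMF.uniformOfFintype_apply, ← mul_add,
      Fintype.card_bool, ← mul_assoc, Nat.cast_ofNat, ENNReal.mul_inv_cancel (by simp) (by simp),
      one_mul, add_comm]
  rw [PMF.apply_true_eq_ev, EncScheme.cpaGame]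
  simp only [PMF.do_bind_eq, PMF.ev_bind, ev_runWith]
  rw [← PMF.ev_mul_left]
  refine PMF.ev_congr fun ke _ => ?_
  rw [hu]
  congr 1 <;> refine PMF.ev_congr fun o _ => (PMF.ev_pure _ _).trans ?_ <;> simp

/-- A distinguisher whose success bounds the difference between the game and the game in which the key
of the special run is not encrypted. -/
theorem exists_distinguisher (hS : S.IsScheme) (hM : M.IsScheme) (hE : E.IsScheme)
    (hA : A.QPTAdversary) {B : Polynomial ℕ} (hB : ∀ n, StepsLE A n (B.eval n)) :
    ∃ D : Prog, D.QPTAdversary ∧ ∀ n,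
      (let u b := (E.keygen.run (Str.unary n)).ev fun ke => (guess.run (Str.unary (B.eval n))).ev
        fun J => (M.keygen.run (Str.unary n)).ev fun km =>
          gameEv S M E A n km ke J.length b none (Twice J.length)
      u true + 1 ≤ u false + 2 * E.cpaGame D n true) := by
  obtain ⟨T, hT⟩ := exists_lengths hS hM hE
  let R : Reduction := ⟨A, Kit.distinguisher S M, .tail (sCnt (.snd (.arg 0))), T, B, 0, .lit [false],
    .lit [false], M.keygen, .lit []⟩
  have hR : R.Valid := ⟨Kit.efficient_distinguisher hS.keygen_ppt hM.mac_ppt hM.verify_ppt, by simp [R],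
    trivial, trivial, hM.keygen_ppt, ppt_lit _⟩
  refine ⟨R.prog, hR.qptAdversary hS rfl hA, fun n => ?_⟩
  have hlen : ∀ n, (Str.unary n).length = n := Str.length_unary
  have key : ∀ b (f : Bool → ℝ≥0∞), ∀ ke ∈ (E.keygen.run (Str.unary n)).support,
      ((guess.run (Str.unary (B.eval n))).ev fun J => (M.keygen.run (Str.unary n)).ev fun km =>
        gameEv S M E A n km ke J.length b none fun a => f (decide (2 ≤ a.wins.count J.length))) ≤
      ((R.prog.tree [Str.unary n]).run (E.cpaOracle ke b) (Cell.priv 0) (false, QState.zero)).ev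
        fun o => f (decide (Accepts o.1)) := by
    intro b f ke hke
    rw [hR.ev_run]
    refine PMF.ev_mono fun J hJ => ?_
    obtain ⟨j, rfl⟩ := exists_of_mem_guess hJ
    refine PMF.ev_mono fun km _ => ?_
    simp only [R, run_lit_nil, PMF.ev_pure, hlen]
    refine PMF.le_ev_of_le fun L _ => ?_
    refine (gameEv_mono (hB n) (f' := fun a => if B.eval n < a.fuel then 0 else
      f (decide (2 ≤ a.wins.count j))) fun a ha => by rw [if_neg (by omega)]).trans ?_
    refine (Link.gameEv_le (link_distinguisher (n := n) (km := km) (ke := ke) (j := j) (b := b)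
      (K := R.conf n (Str.unary j) km [] L) hS.keygen_ppt.1 hM.mac_ppt.1 hM.verify_ppt.1 rfl rfl rfl
      rfl rfl ?_ (B.eval n)) hS.keygen_ppt.1 hE.encrypt_ppt.1 hM.mac_ppt.1 hM.verify_ppt.1
      (s₀ := false) ⟨fits_init, fun h => by cases h⟩
      (g := fun s => f (decide (2 ≤ s.1.wins.count j))) (fun a => ?_) (fun s => zero_le)
      fun a Q h hd => ?_).trans (le_of_eq (PMF.ev_congr fun o _ => ?_))
    · intro k hk i c hc
      rw [encDist] at hc
      simpa [R, Reduction.conf, hlen] using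
        (((hT n).2 k hk).2 ke hke _ (by split_ifs <;> simp [hlen]) c hc).1
    · unfold cutoff
      split_ifs <;> simp
    · dsimp only
      split_ifs
      · exact zero_le
      · exact le_rfl
    -- The distinguisher outputs the number of acceptances with owner `j` in unary without its first
    -- bit; it begins with `1` exactly when the number is at least two.
    · have : ∀ i, Accepts (Str.unary i).tail ↔ 2 ≤ i := fun i => by
        rcases i with _ | _ | i <;> simp [Accepts, Str.unary, List.replicate_succ]
      simp [encode, this]
  intro u
  have h1 : u true ≤ _ := PMF.ev_mono fun ke hke => key true (fun b => if b then 1 else 0) ke hke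
  have h2 := PMF.ev_mono (p := E.keygen.run (Str.unary n)) fun ke hke =>
    key false (fun b => if b then 0 else 1) ke hke
  -- In the game with the replaced key, the probability of two acceptances and that of the
  -- complement add up to 1; this produces the summand 1 in the claim.
  have h3 : u false + _ = _ := (PMF.ev_add _ _ fun ke => (guess.run (Str.unary (B.eval n))).ev
    fun J => (M.keygen.run (Str.unary n)).ev fun km => gameEv S M E A n km ke J.length false none
      fun a => if decide (2 ≤ a.wins.count J.length) then 0 else 1).symm
  simp only [← PMF.ev_add, ← gameEv_add] at h3
  have h4 : ∀ i (a : Ledger), Twice i a + (if decide (2 ≤ a.wins.count i) then 0 else 1) = 1 :=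
    fun i a => by by_cases h : 2 ≤ a.wins.count i <;> simp [Twice, h]
  simp only [h4, gameEv, PMF.ev_const] at h3
  rw [ev_cpaGame, PMF.ev_add]
  refine (congrArg (u true + ·) h3.symm).le.trans ?_
  simp only [decide_eq_true_eq] at h1 h2 ⊢
  rw [add_left_comm]
  exact add_le_add le_rfl (add_le_add h1 h2)

end Ledger

end


noncomputable section

open Prog

theorem PMF.ev_rotate {α β γ δ : Type} (p : PMF α) (q : PMF β) (r : PMF γ) (s : PMF δ)
    (f : α → β → γ → δ → ℝ≥0∞) :
    (p.ev fun a => q.ev fun b => r.ev fun c => s.ev fun d => f a b c d) =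
      s.ev fun d => q.ev fun b => r.ev fun c => p.ev fun a => f a b c d := by
  simp_rw [PMF.ev_comm r s, PMF.ev_comm q s, PMF.ev_comm p s, PMF.ev_comm p q, PMF.ev_comm p r]

namespace Ledger

variable {S : MoneyScheme} {M : MACScheme} {E : EncScheme} {A : Prog}

/-- Only outer run 0 is a run of `mint`, so the winning condition `ℓ = 1` holds automatically. -/
theorem MiniRel.countP {n j f : ℕ} {k : Str} {a : Ledger} {runs : List Session}
    (h : MiniRel S n j k f a runs) : runs.countP (fun s => !s.isVerify) = 1 := by
  rcases runs with _ | ⟨r, runs⟩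
  · cases h.len
  · have h0 := h.mint
    rw [List.getElem?_cons_zero] at h0
    rw [Option.some.inj h0, List.countP_cons, List.countP_eq_zero.2 fun s hs => ?_]
    · rfl
    · obtain ⟨i, hi, rfl⟩ := List.getElem_of_mem hs
      have h1 := h.ver i (by have := h.len; simp at this; omega)
      rw [List.getElem?_cons_succ, List.getElem?_eq_getElem hi] at h1
      rw [Option.some.inj h1]
      simp

theorem ev_counterfeit (S : MoneyScheme) (A : Prog) (n : ℕ) (s : Set (ℕ × ℕ × ℕ)) :
    (S.counterfeit A n).toOuterMeasure s = (S.keygen.run (Str.unary n)).ev fun k =>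
      (A.runWith n (S.bankOracle n k) []).ev fun o => s.indicator 1
        (o.2.countP success, o.2.countP fun s => !s.isVerify, o.2.countP fun s => s.isVerify) := by
  rw [PMF.toOuterMeasure_eq_ev, MoneyScheme.counterfeit]
  simp only [PMF.do_bind_eq, PMF.ev_bind]
  exact PMF.ev_congr fun k _ => PMF.ev_congr fun o _ => PMF.ev_pure _ _

/-- A counterfeiter of the mini-scheme whose success bounds the probability that a banknote is
accepted twice, if its key is not encrypted. -/
theorem exists_counterfeiter (hS : S.IsScheme) (hM : M.IsScheme) (hE : E.IsScheme)
    (hA : A.QPTAdversary) {B : Polynomial ℕ} (hB : ∀ n, StepsLE A n (B.eval n)) :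
    ∃ (C : Prog) (q : Polynomial ℕ), C.QPTAdversary ∧ ∀ n,
      ((E.keygen.run (Str.unary n)).ev fun ke => (guess.run (Str.unary (B.eval n))).ev
        fun J => (M.keygen.run (Str.unary n)).ev fun km =>
          gameEv S M E A n km ke J.length false none (Twice J.length)) ≤
        (q.eval n : ℕ) * (S.counterfeit C n).toOuterMeasure {g | g.1 > g.2.1 ∧ g.2.1 = 1} := by
  obtain ⟨T, hT⟩ := exists_lengths hS hM hE
  obtain ⟨pv, hpv⟩ := hS.verifyBank_qpt
  obtain ⟨pm, hpm⟩ := hS.mintBank_qpt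
  -- The reply bound is the one demanded by `link_counterfeiter`: twice the steps of a bank of the
  -- mini-scheme, whose key has length at most `T` and whose messages have total length at most `B`,
  -- plus 4. The length of the key is guessed up to `T`.
  let R : Reduction := ⟨A, Kit.counterfeiter S M E, .lit [],
    2 * (pv + pm).comp (Polynomial.X + T + B) + 4, B, T, .lit [false], .arg 0, M.keygen, E.keygen⟩
  have hR : R.Valid := ⟨Kit.efficient_counterfeiter hS.keygen_ppt hE.encrypt_ppt hM.mac_ppt
    hM.verify_ppt, by simp [R], trivial, trivial, hM.keygen_ppt, hE.keygen_ppt⟩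
  obtain ⟨p, hp⟩ := qptAdversary_iff.1 (hR.qptAdversary hS rfl hA)
  have hlen : ∀ n, (Str.unary n).length = n := Str.length_unary
  -- The counterfeiter opens the single run of `mint` before anything else, which gives it the
  -- number 0.
  refine ⟨.letIn (.oracle 0 (.lit []) (.lit [])) (.call R.prog (.arg 1)), 2 * T + 1,
    qptAdversary_iff.2 ⟨p + Polynomial.X + 6, fun n loc hl σ O => ?_⟩, fun n => ?_⟩
  · have h0 : Eff.Ensures O loc ((Prog.oracle 0 (.lit []) (.lit [])).tree [Str.unary n])
        fun _ d => d ≤ 3 :=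
      Eff.ensures_tick (Eff.ensures_tick (Eff.ensures_query fun r hr => Eff.ensures_ret (by simp)))
    refine h0.bind fun v d hd => Eff.ensures_tick (Eff.ensures_tick (Eff.ensures_tick
      ((hp n loc hl σ O).mono fun _ e he => ?_)))
    simp [hlen]
    omega
  · have h1 : ∀ k ψ, S.bankOracle n k 0 [] [] ψ = PMF.pure ([], [⟨false, Party.init⟩], ψ) :=
      fun _ _ => rfl
    -- The key of the special run is chosen in advance, so that it can be identified with the key of
    -- the outer bank.
    refine (PMF.ev_mono fun ke _ => PMF.ev_mono fun J _ => PMF.ev_mono fun km _ =>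
      gameEv_none_le hS.keygen_ppt.1 hE.encrypt_ppt.1 hM.mac_ppt.1 A _).trans ?_
    rw [PMF.ev_rotate, ev_counterfeit, ← PMF.ev_mul_left]
    refine PMF.ev_mono fun k hk => ?_
    simp only [ev_runWith, run_letIn, h1,
      run_oracle (p := .lit []) (q := .lit []) (u := []) (v := []) trivial trivial rfl rfl,
      PMF.pure_map, PMF.pure_bind]
    rw [run_call_of_val (v := Str.unary n), hR.ev_run, ← PMF.ev_mul_left]
    refine PMF.ev_mono fun J hJ => ?_
    obtain ⟨j, rfl⟩ := exists_of_mem_guess hJ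
    rw [← PMF.ev_mul_left]
    refine PMF.ev_mono fun km _ => ?_
    rw [← PMF.ev_mul_left]
    refine PMF.ev_mono fun ke _ => ?_
    have hq : (2 * T + 1).eval n = 2 * T.eval n + 1 := by simp
    rw [hq]
    -- The length of the unknown key is guessed, since a string of ones of exactly this length has
    -- to be encrypted.
    refine le_trans ?_ (mul_le_guess ((hT n).2 k hk).1 _)
    refine (gameEv_mono (hB n) (f' := fun a => if B.eval n < a.fuel then 0 else Twice j a)
      fun a ha => by rw [if_neg (by omega), hlen]).trans ?_
    rw [hlen]
    refine Link.gameEv_le (link_counterfeiter (n := n) (km := km) (ke := ke) (j := j) (k := k)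
      (K := R.conf n (Str.unary j) km ke (Str.unary k.length)) hS.keygen_ppt.1 hE.encrypt_ppt.1
      hM.mac_ppt.1 hM.verify_ppt.1 rfl rfl rfl rfl rfl rfl rfl (B.eval n) ?_) hS.keygen_ppt.1
      hE.encrypt_ppt.1 hM.mac_ppt.1 hM.verify_ppt.1 miniRel_init
      (g := fun s => {g : ℕ × ℕ × ℕ | g.1 > g.2.1 ∧ g.2.1 = 1}.indicator 1 (s.2.countP success,
        s.2.countP fun s => !s.isVerify, s.2.countP fun s => s.isVerify))
      (fun a => ?_) (fun s => zero_le) fun a runs h hd => ?_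
    · intro ver i s len c hc hl
      have hk' := ((hT n).2 k hk).1
      have h2 : c ≤ pv.eval (n + k.length + len) + pm.eval (n + k.length + len) := by
        cases ver
        · exact (hpm n k _ ⟨fun a b h => (Cell.priv.inj h).2, fun a b h => by cases h⟩ s len c hc).trans
            (Nat.le_add_left _ _)
        · exact (hpv n k _ ⟨fun a b h => (Cell.priv.inj h).2, fun a b h => by cases h⟩ s len c hc).trans
            (Nat.le_add_right _ _)
      have h3 := pv.eval_mono_nat (show n + k.length + len ≤ n + T.eval n + B.eval n by omega)
      have h4 := pm.eval_mono_nat (show n + k.length + len ≤ n + T.eval n + B.eval n by omega)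
      simp [R, Reduction.conf, hlen]
      omega
    · unfold cutoff
      split_ifs <;> simp
    · unfold Twice
      split_ifs with h1 h2
      · exact zero_le
      · rw [Set.indicator_of_mem]
        · simp
        · have := h.count
          rw [decide_eq_true_eq] at h2
          exact ⟨by rw [gt_iff_lt, h.countP]; dsimp only; omega, h.countP⟩
      · exact zero_le

end Ledger

end


noncomputable section

open Prog

/-! ## Security of the full scheme -/

theorem Negligible.add {ν μ : ℕ → ℝ} (h : Negligible ν) (h' : Negligible μ) :
    Negligible fun n => ν n + μ n := Asymptotics.SuperpolynomialDecay.add h h'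

theorem Negligible.eval_mul {ν : ℕ → ℝ} (h : Negligible ν) (p : Polynomial ℕ) :
    Negligible fun n => ((p.eval n : ℕ) : ℝ) * ν n := by
  have := Asymptotics.SuperpolynomialDecay.polynomial_mul h (p.map (Nat.castRingHom ℝ))
  refine this.congr fun n => ?_
  rw [Polynomial.eval_natCast_map]
  rfl

theorem isPlacement_priv (i : ℕ) : IsPlacement (Cell.priv i) :=
  ⟨fun _ _ h => (Cell.priv.inj h).2, fun _ _ h => by cases h⟩

variable {S : MoneyScheme} {M : MACScheme} {E : EncScheme}

theorem ev_fullScheme_keygen (hM : M.keygen.Classical) (hE : E.keygen.Classical) (n : ℕ)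
    (F : Str → ℝ≥0∞) : ((fullScheme S M E).keygen.run (Str.unary n)).ev F =
      (M.keygen.run (Str.unary n)).ev fun km => (E.keygen.run (Str.unary n)).ev fun ke =>
        F (Str.pair km ke) := by
  rw [run_eq_tree]
  simp only [fullScheme, FullScheme.keygen, run_pair, run_call _ (p := .arg 0) trivial, val,
    List.getD_cons_zero, hM.run_eq, hE.run_eq, PMF.ev_map, PMF.ev_bind, PMF.ev_pure]

/-- What remains is arithmetic. Write `u` and `v` for the probabilities, averaged over the guessed
run, of two acceptances with that owner before and after the replacement of the key. Then `u + 1 ≤ v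
+ 2 * cpaGame`, and `v` is a polynomial times the success of the mini-scheme counterfeiter. The
summand 1 cancels against twice the `1 / 2` in the definition of `PQIndCPA`. -/
theorem fullScheme_fullSecure (hS : S.IsScheme) (hmini : S.MiniSecure) (hM : M.IsScheme)
    (hM' : M.PQEUCMA) (hE : E.IsScheme) (hE' : E.PQIndCPA) : (fullScheme S M E).FullSecure := by
  intro A hA
  obtain ⟨B, hB⟩ := id hA
  have hB : ∀ n, Ledger.StepsLE A n (B.eval n) := fun n => hB n _ (isPlacement_priv 0)
  obtain ⟨F, hF, hF'⟩ := Ledger.exists_forger hS hM hE hA hB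
  obtain ⟨D, hD, hD'⟩ := Ledger.exists_distinguisher hS hM hE hA hB
  obtain ⟨C, q, hC, hC'⟩ := Ledger.exists_counterfeiter hS hM hE hA hB
  obtain ⟨νF, hνF, hF''⟩ := hM' F hF
  obtain ⟨νD, hνD, hD''⟩ := hE' D hD
  obtain ⟨νC, hνC, hC''⟩ := hmini C hC
  -- The factor `B` is the number of runs in the union bound, and `2 * B + 1` is the loss from
  -- guessing a run; the factor `q` comes from guessing the length of the key.
  refine ⟨_, (hνF.add ((hνC.eval_mul q).add (hνD.eval_mul 2))).eval_mul (B * (2 * B + 1)),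
    fun n => ?_⟩
  have hD1 := hD' n
  have hC1 := hC' n
  dsimp only at hD1
  set u := (E.keygen.run (Str.unary n)).ev fun ke => (guess.run (Str.unary (B.eval n))).ev
    fun J => (M.keygen.run (Str.unary n)).ev fun km =>
      Ledger.gameEv S M E A n km ke J.length true none (Ledger.Twice J.length) with hu
  set v := (E.keygen.run (Str.unary n)).ev fun ke => (guess.run (Str.unary (B.eval n))).ev
    fun J => (M.keygen.run (Str.unary n)).ev fun km =>
      Ledger.gameEv S M E A n km ke J.length false none (Ledger.Twice J.length)
  set m := (S.counterfeit C n).toOuterMeasure {g | g.1 > g.2.1 ∧ g.2.1 = 1} with hm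
  -- A fixed owner is compared with the average over the guessed owner.
  have hy : ∀ j ≤ B.eval n, ((M.keygen.run (Str.unary n)).ev fun km =>
      (E.keygen.run (Str.unary n)).ev fun ke => Ledger.gameEv S M E A n km ke j true none
        (Ledger.Twice j)) ≤ (2 * B.eval n + 1 : ℕ) * u := fun j hj => by
    rw [PMF.ev_comm, hu, ← PMF.ev_mul_left]
    refine PMF.ev_mono fun ke _ => le_trans (le_of_eq ?_) (mul_le_guess hj _)
    rw [Str.length_unary]
  have hfull : ((fullScheme S M E).counterfeit A n).toOuterMeasure {g | g.1 > g.2.1} ≤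
      (B.eval n : ℕ) * ((2 * B.eval n + 1 : ℕ) * (M.forgeGame F n true + u)) := by
    rw [Ledger.ev_counterfeit, ev_fullScheme_keygen hM.keygen_ppt.1 hE.keygen_ppt.1]
    refine (PMF.ev_mono fun km _ => PMF.ev_mono fun ke hke => (le_of_eq (PMF.ev_congr fun o _ => ?_)).trans
      (Ledger.full_le hS.keygen_ppt hM hE (hB n) hke)).trans ?_
    · exact Set.indicator_apply _ _ _
    · simp only [PMF.ev_sum, PMF.ev_add]
      refine (Finset.sum_le_card_nsmul _ _ _ fun j hj => ?_).trans_eq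
        (by rw [Finset.card_range, nsmul_eq_mul])
      have hj' := (Finset.mem_range.1 hj).le
      rw [mul_add]
      exact add_le_add (hF' n j hj') (hy j hj')
  have hc1 : E.cpaGame D n true ≠ ⊤ := PMF.apply_ne_top _ _
  have hf1 : M.forgeGame F n true ≠ ⊤ := PMF.apply_ne_top _ _
  have hm1 : m ≠ ⊤ := by
    rw [hm, PMF.toOuterMeasure_eq_ev]
    refine ((PMF.ev_le_of_le (c := 1) fun a _ => ?_).trans_lt ENNReal.one_lt_top).ne
    exact Set.indicator_le_self' (fun _ _ => zero_le) a
  -- Finiteness is needed to pass to real numbers, where the summand 1 can be subtracted.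
  have hv1 : v ≠ ⊤ := (hC1.trans_lt (ENNReal.mul_lt_top (ENNReal.natCast_lt_top _) hm1.lt_top)).ne
  have hu0 : v + 2 * E.cpaGame D n true ≠ ⊤ :=
    ENNReal.add_ne_top.2 ⟨hv1, ENNReal.mul_ne_top (by simp) hc1⟩
  have hu1 : u ≠ ⊤ := (ENNReal.add_ne_top.1 (hD1.trans_lt hu0.lt_top).ne).1
  have r1 := ENNReal.toReal_mono hu0 hD1
  rw [ENNReal.toReal_add hu1 (by simp), ENNReal.toReal_add hv1 (ENNReal.mul_ne_top (by simp) hc1),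
    ENNReal.toReal_mul, ENNReal.toReal_one, ENNReal.toReal_ofNat] at r1
  have r2 := ENNReal.toReal_mono (ENNReal.mul_ne_top (ENNReal.natCast_ne_top _) hm1) hC1
  rw [ENNReal.toReal_mul, ENNReal.toReal_natCast] at r2
  have r3 := ENNReal.toReal_mono (ENNReal.mul_ne_top (ENNReal.natCast_ne_top _)
    (ENNReal.mul_ne_top (ENNReal.natCast_ne_top _) (ENNReal.add_ne_top.2 ⟨hf1, hu1⟩))) hfull
  rw [ENNReal.toReal_mul, ENNReal.toReal_natCast, ENNReal.toReal_mul, ENNReal.toReal_natCast,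
    ENNReal.toReal_add hf1 hu1, ← mul_assoc] at r3
  have e1 : (((B * (2 * B + 1)).eval n : ℕ) : ℝ) = ((B.eval n : ℕ) : ℝ) * ((2 * B.eval n + 1 : ℕ) : ℝ) := by simp
  have e2 : (((2 : Polynomial ℕ).eval n : ℕ) : ℝ) = 2 := by simp
  rw [e1, e2]
  refine r3.trans (mul_le_mul_of_nonneg_left ?_ (by positivity))
  have r4 := mul_le_mul_of_nonneg_left (hC'' n) (Nat.cast_nonneg (α := ℝ) (q.eval n))
  linarith [hF'' n, hD'' n]

end


noncomputable section

open Prog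

/-! ## Correctness -/

theorem ev_interact_succ (A B : Prog) (o n : ℕ) (x y : Str) (r : ℕ) (u b : Party) (m : Str)
    (ψ : QState) (f : Party × Party × QState → ℝ≥0∞) :
    (interact A B o n x y (r + 1) u b m ψ).ev f = (activate A (Cell.priv 0) n x u m ψ).ev fun a =>
        (activate B (Cell.priv o) n y b a.1 a.2.2).ev fun c =>
          (interact A B o n x y r a.2.1 c.2.1 c.1 c.2.2).ev f := by
  simp only [interact, PMF.do_bind_eq, PMF.ev_bind]

theorem MoneyScheme.ev_honestRun (S : MoneyScheme) (n r : ℕ) : S.honestRun n r true =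
    (S.keygen.run (Str.unary n)).ev fun k =>
      (interact S.mintUser S.mintBank 1 n [] k r Party.init Party.init [] QState.zero).ev fun a =>
        (interact S.verifyUser S.verifyBank 2 n a.1.st k r Party.init Party.init [] a.2.2).ev
          fun c => if a.1.out.isSome ∧ a.2.1.out.isSome ∧ c.2.1.out = some true then 1 else 0 := by
  rw [PMF.apply_true_eq_ev, honestRun]
  simp only [PMF.do_bind_eq, PMF.ev_bind]
  refine PMF.ev_congr fun k _ => PMF.ev_congr fun a _ => PMF.ev_congr fun c _ =>
    (PMF.ev_pure _ _).trans ?_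
  simp [and_assoc]

namespace FullScheme

attribute [local simp] Accepts stOf inpOf msgOf secOf partyIn partyOut partyInput partyNext partyReply

variable {S : MoneyScheme} {M : MACScheme} {E : EncScheme} {loc : Str → Cell} {n : ℕ}
  {km ke : Str} {ψ : QState}

/-- What the user in `mint` makes of the output `v` of the user of the mini-scheme, when `a` is the
part `(c, t)` of the banknote received so far. -/
def userWrap (a v : Str) : Str :=
  Str.pair (if a = [] then [] else v.fst) (Str.pair (Str.pair (Str.pair v.fst a) v.snd.fst) v.snd.snd)

theorem partyRun_mintUser (x st m : Str) : partyRun (mintUser S) loc n x st m ψ =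
      (if st.fst.fst = [] then partyRun S.mintUser loc n x st.snd m.fst ψ
        else PMF.pure (Str.pair st.fst.fst (Str.pair st.snd []), ψ)).map fun o =>
          (userWrap (if m.snd = [] then st.fst.snd else m.snd) o.1, o.2) := by
  rw [partyRun, mintUser, run_letIn, run_ite_pure (by simp)]
  have h1 : Accepts ((isNil (.fst (.fst (stOf (.arg 0))))).val [partyInput n x st m]) ↔
      st.fst.fst = [] := by simp
  have h2 : ((call S.mintUser (partyIn (secOf (.arg 0)) (inpOf (.arg 0)) (.snd (stOf (.arg 0)))
      (.fst (msgOf (.arg 0))))).tree [partyInput n x st m]).run noOracle loc ((), ψ) =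
      (partyRun S.mintUser loc n x st.snd m.fst ψ).map fun o => (o.1, (), o.2) := by
    rw [← run_tree_eq_partyRun, run_call_of_val (v := partyInput n x st.snd m.fst)]
  have h3 : ((partyOut (.fst (.fst (stOf (.arg 0)))) (.snd (stOf (.arg 0))) (.lit [])).tree
      [partyInput n x st m]).run noOracle loc ((), ψ) =
      (PMF.pure (Str.pair st.fst.fst (Str.pair st.snd []), ψ)).map fun o => (o.1, (), o.2) := by
    rw [Prog.Pure.run (by simp), PMF.pure_map]
    simp
  simp only [h1, h2, h3]
  rw [← apply_ite (PMF.map fun o : Str × QState => (o.1, (), o.2)), PMF.bind_map, PMF.map_bind]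
  refine congrArg _ (funext fun o => ?_)
  rw [Function.comp_apply, Prog.Pure.run (by simp), PMF.pure_map]
  simp [userWrap]

theorem partyRun_verifyUser_start (x m : Str) : partyRun (verifyUser S) loc n x [] m ψ =
    PMF.pure (Str.pair [] (Str.pair (Str.pair [] []) x.fst.snd), ψ) := by
  rw [partyRun, verifyUser, run_ite_pos, Prog.Pure.run (by simp), PMF.pure_map]
  simp

theorem partyRun_verifyUser (x st m : Str) : partyRun (verifyUser S) loc n x (Str.pair [] st) m ψ =
      (partyRun S.verifyUser loc n x.snd st m ψ).map fun o =>
        (Str.pair o.1.fst (Str.pair (Str.pair [] o.1.snd.fst) o.1.snd.snd), o.2) := by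
  rw [partyRun, verifyUser, run_ite_neg, run_letIn,
    run_call_of_val (v := partyInput n x.snd st m), run_tree_eq_partyRun, PMF.bind_map, PMF.map_bind]
  refine congrArg _ (funext fun o => ?_)
  rw [Function.comp_apply, Prog.Pure.run (by simp), PMF.pure_map]
  simp

/-- The bank holding the keys `(k_m, k_e)` does the same as the bank of the mini-scheme. -/
theorem ev_verify (k x : Str) (o r : ℕ) (g : Party × Party × QState → ℝ≥0∞) (u b : Party) (m : Str)
    (ψ : QState) :
    (interact (verifyUser S) (verifyBank S M E) o n x (Str.pair km ke) r
      ⟨Str.pair [] u.st, u.out⟩ ⟨Str.pair k b.st, b.out⟩ m ψ).ev g =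
    (interact S.verifyUser S.verifyBank o n x.snd k r u b m ψ).ev fun a =>
      g (⟨Str.pair [] a.1.st, a.1.out⟩, ⟨Str.pair k a.2.1.st, a.2.1.out⟩, a.2.2) := by
  induction r generalizing u b m ψ with
  | zero =>
    rw [interact, interact]
    refine (PMF.ev_pure _ _).trans (Eq.symm ?_)
    exact PMF.ev_pure _ _
  | succ r ih =>
    have hb : ∀ (b : Party) (m : Str) (ψ : QState) (f : Str × Party × QState → ℝ≥0∞),
        (activate (verifyBank S M E) (Cell.priv o) n (Str.pair km ke) ⟨Str.pair k b.st, b.out⟩ m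
          ψ).ev f = (activate S.verifyBank (Cell.priv o) n k b m ψ).ev fun a =>
            f (a.1, ⟨Str.pair k a.2.1.st, a.2.1.out⟩, a.2.2) := by
      rintro ⟨st, _ | out⟩ m ψ f
      · simp [activate_none, partyRun_verifyBank, PMF.ev_map]
      · simp only [activate_some, PMF.ev_pure]
    have hu : ∀ (u : Party) (m : Str) (ψ : QState) (f : Str × Party × QState → ℝ≥0∞),
        (activate (verifyUser S) (Cell.priv 0) n x ⟨Str.pair [] u.st, u.out⟩ m ψ).ev f =
          (activate S.verifyUser (Cell.priv 0) n x.snd u m ψ).ev fun a =>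
            f (a.1, ⟨Str.pair [] a.2.1.st, a.2.1.out⟩, a.2.2) := by
      rintro ⟨st, _ | out⟩ m ψ f
      · simp [activate_none, partyRun_verifyUser, PMF.ev_map]
      · simp only [activate_some, PMF.ev_pure]
    simp only [ev_interact_succ, hu, hb, ih]

/-- In the additional first round the user delivers the ciphertext and the tag. By completeness of
the MAC and of the encryption the bank certainly obtains the key `k`, and its empty reply is the
empty message with which the inner protocol begins. -/
theorem ev_verify_start (hM : M.IsScheme) (hE : E.IsScheme)
    (hkm : km ∈ (M.keygen.run (Str.unary n)).support)
    (hke : ke ∈ (E.keygen.run (Str.unary n)).support) {k c t x : Str}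
    (hc : c ∈ (E.encrypt.run (Str.pair ke k)).support)
    (ht : t ∈ (M.mac.run (Str.pair km c)).support) (hx : x.fst.snd = Str.pair c t) (o r : ℕ)
    (g : Option Bool → ℝ≥0∞) :
    (interact (verifyUser S) (verifyBank S M E) o n x (Str.pair km ke) (r + 1) Party.init Party.init
      [] ψ).ev (fun a => g a.2.1.out) =
    (interact S.verifyUser S.verifyBank o n x.snd k r Party.init Party.init [] ψ).ev fun a =>
      g a.2.1.out := by
  have h := ev_verify (S := S) (M := M) (E := E) (km := km) (ke := ke) (n := n) k x o r
    (fun a => g a.2.1.out) Party.init Party.init [] ψ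
  rw [ev_interact_succ, ← h]
  simp only [Party.init, activate_none, partyRun_verifyUser_start, PMF.ev_map, PMF.ev_pure,
    partyReply, partyNext, Str.fst_pair, Str.snd_pair, hx,
    partyRun_verifyBank_start hM.verify_ppt.1 hE.decrypt_ppt.1, PMF.ev_bind]
  refine (PMF.ev_congr fun v hv => ?_).trans (PMF.ev_const _ _)
  rw [if_pos (hM.complete n km hkm c t ht v hv), hE.complete n ke hke k c hc, PMF.pure_map,
    PMF.ev_pure]
  simp

/-- The relation between the user in `mint` of the mini-scheme and that of the full scheme. -/
structure UserRel (ct : Str) (u u' : Party) : Prop where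
  status : u'.st.fst.fst = [] ↔ u.out = none
  st : u'.st.snd = u.st
  part : u'.st.fst.snd = [] ∨ u'.st.fst.snd = ct
  out : u'.out.isSome ↔ u.out.isSome ∧ u'.st.fst.snd ≠ []

theorem userRel_userWrap {ct a : Str} (ha : a = [] ∨ a = ct) (v : Str) :
    UserRel ct (partyNext v) (partyNext (userWrap a v)) := by
  refine ⟨?_, ?_, ?_, ?_⟩ <;> simp only [partyNext, userWrap, Str.fst_pair, Str.snd_pair]
  · cases v.fst <;> simp
  · exact ha
  · cases v.fst <;> cases a <;> simp

/-- The two users move together. The user of the full scheme lags behind only by waiting for the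
ciphertext and the tag after the inner user has halted; meanwhile it repeats the stored status and
does not touch the quantum memory. -/
theorem mintUser_le {ct m : Str} {u u' : Party} (h : UserRel ct u u') (hct : ct ≠ [])
    (hm : m.snd = [] ∨ m.snd = ct) {f g : Str × Party × QState → ℝ≥0∞}
    (hfg : ∀ m₁ u₁ u₁' ψ₁, UserRel ct u₁ u₁' →
      (u'.st.fst.snd = ct ∨ m.snd = ct → u₁'.st.fst.snd = ct) → (u.out.isSome → u₁.out.isSome) →
      f (m₁, u₁, ψ₁) ≤ g (m₁, u₁', ψ₁)) :
    (activate S.mintUser loc n [] u m.fst ψ).ev f ≤ (activate (mintUser S) loc n [] u' m ψ).ev g := by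
  obtain ⟨st, out⟩ := u
  obtain ⟨st', out'⟩ := u'
  obtain ⟨h1, h2, h3, h4⟩ := h
  dsimp only at h1 h2 h3 h4 hfg
  subst h2
  have ha : (if m.snd = [] then st'.fst.snd else m.snd) = [] ∨
      (if m.snd = [] then st'.fst.snd else m.snd) = ct := by
    split_ifs with h
    exacts [h3, hm]
  have hb : st'.fst.snd = ct ∨ m.snd = ct → (if m.snd = [] then st'.fst.snd else m.snd) = ct := by
    split_ifs with h
    · rintro (h' | h')
      exacts [h', absurd (h'.symm.trans h) hct]
    · exact fun _ => hm.resolve_left h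
  cases out with
  | none =>
    obtain rfl : out' = none := by simpa using h4
    rw [activate_none, activate_none, partyRun_mintUser, if_pos (h1.2 rfl), PMF.map_comp, PMF.ev_map,
      PMF.ev_map]
    refine PMF.ev_mono fun o _ => ?_
    have := hfg (partyReply o.1) (partyNext o.1) _ o.2 (userRel_userWrap ha o.1) (fun h => by
      simpa [userWrap] using hb h) (by simp)
    simpa [userWrap] using this
  | some d =>
    rw [activate_some, PMF.ev_pure]
    cases out' with
    | none =>
      have h5 : st'.fst.fst ≠ [] := fun h => by simpa using h1.1 h
      rw [activate_none, partyRun_mintUser, if_neg h5, PMF.pure_map, PMF.pure_map, PMF.ev_pure]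
      have h6 := userRel_userWrap ha (Str.pair st'.fst.fst (Str.pair st'.snd []))
      simp only [partyNext, partyReply, userWrap, Str.fst_pair, Str.snd_pair] at h6 ⊢
      refine hfg _ _ _ _ ⟨?_, ?_, ?_, ?_⟩ (fun h => ?_) (by simp)
      · simpa using h5
      · simp
      · simpa using ha
      · have h7 := h6.out
        have h8 : st'.fst.fst.head?.isSome := by
          cases h : st'.fst.fst
          · exact absurd h h5
          · rfl
        simpa [h8] using h7
      · simpa using hb h
    | some d' =>
      rw [activate_some, PMF.ev_pure]
      refine hfg _ _ _ _ ⟨h1, rfl, h3, h4⟩ (fun _ => h3.resolve_left (h4.1 rfl).2) (by simp)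

/-- The proposition `d` leaves room for a weaker conclusion about the attached part; what matters is
that the message in which the bank halts carries `ct`. -/
theorem mintBank_le {k ct m : Str} {st : Str} {d : Prop} {f g : Str × Party × QState → ℝ≥0∞}
    (hfg : ∀ m₁ m₁' b ψ₁, m₁'.fst = m₁ → (m₁'.snd = [] ∨ m₁'.snd = ct) →
      (b.out.isSome → d ∨ m₁'.snd = ct) →
      f (m₁, b, ψ₁) ≤ g (m₁', ⟨Str.pair (Str.pair k ct) b.st, b.out⟩, ψ₁)) :
    ((partyRun S.mintBank loc n k st m ψ).map fun o => (partyReply o.1, partyNext o.1, o.2)).ev f ≤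
      (((partyRun S.mintBank loc n k st m ψ).map fun o => (mintWrap k ct o.1, o.2)).map fun o =>
        (partyReply o.1, partyNext o.1, o.2)).ev g := by
  simp only [PMF.ev_map, Ledger.partyNext_mintWrap]
  refine PMF.ev_mono fun o _ => hfg _ _ _ _ ?_ ?_ ?_ <;>
    simp only [partyReply, partyNext, mintWrap, Str.fst_pair, Str.snd_pair]
  · split_ifs <;> simp
  · cases o.1.fst <;> simp

/-- The full protocol gets one round more than the inner one, because the ciphertext and the tag
come with the last message of the bank, which the inner user need not wait for. The hypothesis `hb`
says that once the bank has halted, this part has been stored or is under way. -/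
theorem mint_le {k ct : Str} (hct : ct ≠ []) {f g : Party × Party × QState → ℝ≥0∞}
    (hf : ∀ a, ¬ (a.1.out.isSome ∧ a.2.1.out.isSome) → f a = 0)
    (hfg : ∀ u u' b ψ, UserRel ct u u' → u'.st.fst.snd = ct → u.out.isSome → b.out.isSome →
      f (u, b, ψ) ≤ g (u', ⟨Str.pair (Str.pair k ct) b.st, b.out⟩, ψ)) (o r : ℕ) {u u' b : Party}
    {m : Str} (h : UserRel ct u u') (hm : m.snd = [] ∨ m.snd = ct)
    (hb : b.out.isSome → u'.st.fst.snd = ct ∨ m.snd = ct) (ψ : QState) :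
    (interact S.mintUser S.mintBank o n [] k r u b m.fst ψ).ev f ≤
      (interact (mintUser S) (mintBank S M E) o n [] (Str.pair km ke) (r + 1) u'
        ⟨Str.pair (Str.pair k ct) b.st, b.out⟩ m ψ).ev g := by
  induction r generalizing u u' b m ψ with
  | zero =>
    rw [interact, ev_interact_succ]
    refine (PMF.ev_pure _ _).trans_le ?_
    -- If the inner run is not finished, the test function vanishes. Otherwise the one remaining
    -- activation of the full user takes in the pending message, and the halted bank does nothing.
    by_cases hd : u.out.isSome ∧ b.out.isSome
    swap
    · rw [hf _ hd]
      exact zero_le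
    obtain ⟨st, out⟩ := u
    obtain ⟨hu, hd⟩ := hd
    obtain ⟨d, rfl⟩ := Option.isSome_iff_exists.1 hu
    have h0 := mintUser_le (S := S) (loc := Cell.priv 0) (n := n) (ψ := ψ) h hct hm
      (f := fun a => f (a.2.1, b, a.2.2)) (g := fun a => g (a.2.1, ⟨Str.pair (Str.pair k ct) b.st,
        b.out⟩, a.2.2)) fun m₁ u₁ u₁' ψ₁ h₁ h₂ h₃ => hfg _ _ _ _ h₁ (h₂ (hb hd)) (h₃ hu) hd
    rw [activate_some, PMF.ev_pure] at h0
    refine h0.trans_eq (PMF.ev_congr fun a _ => ?_)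
    obtain ⟨e, he⟩ := Option.isSome_iff_exists.1 hd
    rw [he, activate_some, PMF.ev_pure]
    exact (PMF.ev_pure _ _).symm
  | succ r ih =>
    rw [ev_interact_succ, ev_interact_succ]
    refine mintUser_le h hct hm fun m₁ u₁ u₁' ψ₁ h₁ h₂ _ => ?_
    obtain ⟨st, _ | d⟩ := b
    · dsimp only
      rw [activate_none, activate_none, partyRun_mintBank]
      refine mintBank_le (d := False) fun m₂ m₂' b ψ₂ h₃ h₄ h₅ => ?_
      subst h₃
      exact ih h₁ h₄ (fun hh => Or.inr ((h₅ hh).resolve_left id)) ψ₂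
    · dsimp only
      rw [activate_some, activate_some, PMF.ev_pure, PMF.ev_pure]
      have := ih (b := ⟨st, some d⟩) (m := []) h₁ (Or.inl Str.snd_nil) (fun hh => Or.inl (h₂ (hb hh))) ψ₁
      rwa [Str.fst_nil] at this

theorem mint_start_le (hS : S.keygen.Classical) (hE : E.encrypt.Classical) (hM : M.mac.Classical)
    {f : Str → Party × Party × QState → ℝ≥0∞} {g : Party × Party × QState → ℝ≥0∞}
    (hf : ∀ k a, ¬ (a.1.out.isSome ∧ a.2.1.out.isSome) → f k a = 0)
    (hfg : ∀ k, ∀ c ∈ (E.encrypt.run (Str.pair ke k)).support,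
      ∀ t ∈ (M.mac.run (Str.pair km c)).support, ∀ u u' b ψ, UserRel (Str.pair c t) u u' →
        u'.st.fst.snd = Str.pair c t → u.out.isSome → b.out.isSome →
        f k (u, b, ψ) ≤ g (u', ⟨Str.pair (Str.pair k (Str.pair c t)) b.st, b.out⟩, ψ)) (o r : ℕ) :
    ((S.keygen.run (Str.unary n)).ev fun k =>
        (interact S.mintUser S.mintBank o n [] k (r + 1) Party.init Party.init [] ψ).ev (f k)) ≤
      (interact (mintUser S) (mintBank S M E) o n [] (Str.pair km ke) (r + 2) Party.init Party.init
        [] ψ).ev g := by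
  simp only [ev_interact_succ (r := r) (A := S.mintUser)]
  -- The first message of the inner user does not depend on the key. So the choice of the key is
  -- exchanged with it and takes place where the bank of the full scheme makes it.
  rw [PMF.ev_comm, ev_interact_succ]
  simp only [Party.init, activate_none]
  rw [partyRun_mintUser, if_pos (by rfl), PMF.map_comp, PMF.ev_map,
    PMF.ev_map]
  simp only [Str.fst_nil, Str.snd_nil, if_true, Function.comp_apply]
  refine PMF.ev_mono fun v _ => ?_
  rw [partyRun_mintBank_start hS hE hM]
  simp only [PMF.map_bind, PMF.ev_bind]
  refine PMF.ev_mono fun k _ => PMF.le_ev_of_le fun c hc => PMF.le_ev_of_le fun t ht => ?_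
  have h1 : partyReply (userWrap [] v.1) = partyReply v.1 := by simp [userWrap]
  rw [h1]
  refine mintBank_le (d := False) fun m m' b ψ₂ h₃ h₄ h₅ => ?_
  subst h₃
  exact mint_le (Str.pair_ne_nil _ _) (hf k) (hfg k c hc t ht) o r
    (userRel_userWrap (Or.inl rfl) _) h₄ (fun hh => Or.inr ((h₅ hh).resolve_left id)) ψ₂

/-- One additional round suffices in both protocols: in `mint` for the user to receive the
ciphertext and the tag, in `verify` to send them. With no round at all nothing has halted and the
left side is zero. -/
theorem honestRun_le (hS : S.IsScheme) (hM : M.IsScheme) (hE : E.IsScheme) (n r : ℕ) :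
    S.honestRun n r true ≤ (fullScheme S M E).honestRun n (r + 1) true := by
  rw [MoneyScheme.ev_honestRun, MoneyScheme.ev_honestRun]
  cases r with
  | zero =>
    refine le_trans (PMF.ev_le_of_le fun k _ => ?_) zero_le
    rw [interact]
    refine ((PMF.ev_pure _ _).trans ?_).le
    simp only [Party.init, Option.isSome_none, Bool.false_eq_true, false_and, if_false]
    exact PMF.ev_const _ _
  | succ r =>
    rw [ev_fullScheme_keygen hM.keygen_ppt.1 hE.keygen_ppt.1]
    refine PMF.le_ev_of_le fun km hkm => PMF.le_ev_of_le fun ke hke => ?_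
    refine mint_start_le hS.keygen_ppt.1 hE.encrypt_ppt.1 hM.mac_ppt.1 (fun k a ha => ?_)
      (fun k c hc t ht u u' b ψ h hct hu hb => ?_) 1 r
    · refine (PMF.ev_congr fun d _ => if_neg fun h => ha ⟨h.1, h.2.1⟩).trans (PMF.ev_const _ _)
    · have hu' : u'.out.isSome := h.out.2 ⟨hu, hct ▸ Str.pair_ne_nil _ _⟩
      simp only [hu, hb, hu', true_and]
      rw [← h.st]
      exact (ev_verify_start hM hE hkm hke hc ht hct 2 (r + 1)
        fun b => if b = some true then 1 else 0).ge

theorem correct (hS : S.IsScheme) (hM : M.IsScheme) (hE : E.IsScheme) (h : S.Correct) :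
    (fullScheme S M E).Correct := by
  obtain ⟨p, ν, hν, h⟩ := h
  refine ⟨p + 1, ν, hν, fun n => (h n).trans ?_⟩
  rw [Polynomial.eval_add, Polynomial.eval_one]
  exact ENNReal.toReal_mono (PMF.apply_ne_top _ _) (honestRun_le hS hM hE n _)

end FullScheme

theorem mainTheorem6 (S : MoneyScheme) (M : MACScheme) (E : EncScheme)
    (hS : S.IsScheme) (hmini : S.MiniSecure)
    (hM : M.IsScheme) (hM_sec : M.PQEUCMA)
    (hE : E.IsScheme) (hE_sec : E.PQIndCPA) :
    (fullScheme S M E).IsScheme ∧ (fullScheme S M E).FullSecure ∧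
      (S.Correct → (fullScheme S M E).Correct) ∧
      (S.SemiQuantum → (fullScheme S M E).SemiQuantum) :=
  ⟨fullScheme_isScheme hS hM hE, fullScheme_fullSecure hS hmini hM hM_sec hE hE_sec,
    FullScheme.correct hS hM hE, fullScheme_semiQuantum hS hM hE⟩

end
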